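/- \textbf{Setting.} For $m\ge 0$ let $L^2(m)$ be the Hilbert space of real functions $f$ on $\mathbf R^2$ with $\|f\|_m=\big(\int_{\mathbf R^2}(1+|\xi|^2)^m|f(\xi)|^2\,d\xi\big)^{1/2}<\infty$. Let $e^{\tau\mathcal L}$, $\tau\ge 0$, be the semigroup on $L^2(m)$ generated by $\mathcal L=\Delta+\tfrac12\,\xi\cdot\nabla+1$, that is, $e^{0\mathcal L}=1$ and $$(e^{\tau\mathcal L}f)(\xi)=\frac{e^{\tau}}{4\pi a(\tau)}\int_{\mathbf R^2}e^{-|\xi-\xi'|^2/(4a(\tau))}f(\xi' e^{\tau/2})\,d\xi',\qquad a(\tau)=1-e^{-\tau},\ \tau>0 .$$ For $w\in L^2(m)$, $m>1$, let $\mathbf v(\xi)=\frac1{2\pi}\int_{\mathbf R^2}\frac{(\xi-\eta)^\perp}{|\xi-\eta|^2}\,w(\eta)\,d\eta$, with $x^\perp=(-x_2,x_1)$, be the velocity field of $w$. Let $\chi:L^2(m)\to\mathbf R$ be a $C^\infty$ function, bounded together with its first derivative, with $\chi(w)=1$ if $\|w\|_m\le 1$ and $\chi(w)=0$ if $\|w\|_m\ge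 2$, and for $r_0>0$ put $\chi_{r_0}(w)=\chi(w/r_0)$. A solution of the cut-off vorticity equation $$\partial_\tau w=\mathcal Lw-(\mathbf v\cdot\nabla)(\chi_{r_0}(w)w)\qquad(\ast)$$ with initial value $w_0$ is a function $w\in C^0([0,\infty),L^2(m))$ such that, for all $\tau\ge 0$, $$w(\tau)=e^{\tau\mathcal L}w_0-\int_0^\tau e^{-\frac12(\tau-s)}\,\nabla\cdot e^{(\tau-s)\mathcal L}\big(\mathbf v(s)\chi_{r_0}(w(s))w(s)\big)\,ds .$$ A negative semi-orbit of a semiflow $\Phi_\tau$ is a family $\{w(\tau)\}_{\tau\le 0}$ with $\Phi_t(w(s))=w(s+t)$ whenever $t\ge 0$ and $s+t\le 0$. We use the convention $\ln 0=-\infty$. \textbf{Theorem.} Fix an integer $k\ge 0$, a real number $m\ge k+2$, real numbers $\mu_1,\mu_2$ with $\frac k2<\mu_1<\mu_2<\frac{k+1}2$, and $\chi$ as above. Then $\Lambda=e^{\mathcal L}$ is a bounded operator on $L^2(m)$; it has a spectral projection $P$ onto the span $E_c$ of its eigenvectors for the eigenvalues $e^{-j/2}$, $0\le j\le k$ (i.e.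 $P$ is a bounded projection with range $E_c$ that commutes with $\Lambda$, and on $\ker P$ the operators $\Lambda-e^{-j/2}$, $0\le j\le k$, are invertible), and $E_c$ is finite-dimensional. Let $Q=1-P$ and $E_s=QL^2(m)$. For all sufficiently small $r_0>0$, equation $(\ast)$ has for each $w_0\in L^2(m)$ exactly one solution $\tau\mapsto\Phi_\tau(w_0)$, $\Phi$ is a continuous semiflow on $L^2(m)$, and there is a $C^1$ and globally Lipschitz map $g:E_c\to E_s$ with $g(0)=0$, $Dg(0)=0$, such that $W_c=\{w_c+g(w_c)\mid w_c\in E_c\}$ has the following properties. 1. (Invariance) The restriction of $\Phi_\tau$ to $W_c$ extends to a continuous flow on $W_c$ whose time-$\tau$ maps, $\tau\in\mathbf R$, are Lipschitz, uniformly for $\tau$ in bounded intervals. In particular $\Phi_\tau(W_c)=W_c$ for all $\tau\ge 0$, and for every $w_0\in W_c$ there is a unique negative semi-orbit $\{w(\tau)\}_{\tau\le 0}$ of $\Phi$ in $W_c$ with $w(0)=w_0$. Every negative semi-orbit contained in $W_c$ satisfies $\limsup_{\tau\to-\infty}\frac1{|\tau|}\ln\|w(\tau)\|_m\le\mu_1$.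 Conversely, every negative semi-orbit of $\Phi$ with $\limsup_{\tau\to-\infty}\frac1{|\tau|}\ln\|w(\tau)\|_m\le\mu_2$ lies in $W_c$. 2. (Invariant foliation) There is a continuous map $h:L^2(m)\times E_s\to E_c$, which is $C^1$ in the $E_s$ direction (for each fixed first argument), such that for each $w\in L^2(m)$ one has $h(w,Qw)=Pw$, and the manifold $M_w=\{h(w,w_s)+w_s\mid w_s\in E_s\}$ satisfies $\Phi_\tau(M_w)\subset M_{\Phi_\tau(w)}$ for all $\tau\ge 0$ and $$M_w=\Big\{\tilde w\in L^2(m)\ \Big|\ \limsup_{\tau\to+\infty}\frac1\tau\ln\|\Phi_\tau(\tilde w)-\Phi_\tau(w)\|_m\le-\mu_2\Big\}.$$ 3. (Completeness) For every $w\in L^2(m)$, $M_w\cap W_c$ is exactly a single point. In particular, every point of $L^2(m)$ lies in $M_w$ for exactly one $w\in W_c$. -/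

import Mathlib

open Filter Topology MeasureTheory Set
open scoped ContDiff NNReal ENNReal

namespace Vorticity

noncomputable section

/-- The Euclidean plane. -/
abbrev Plane : Type := EuclideanSpace ℝ (Fin 2)

/-- The measure `(1 + |ξ|²)^m dξ` on the plane. -/
def weightedMeasure (m : ℝ) : Measure Plane :=
  volume.withDensity fun ξ => ENNReal.ofReal ((1 + ‖ξ‖ ^ 2) ^ m)

/-- The weighted Hilbert space `L²(m)` of real-valued functions on the plane, with norm
`‖f‖_m = (∫ (1 + |ξ|²)^m |f(ξ)|² dξ)^{1/2}`. -/
abbrev L2m (m : ℝ) : Type := Lp ℝ 2 (weightedMeasure m)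

/-- `x^⊥ = (-x₂, x₁)`. -/
def perp (x : Plane) : Plane := !₂[-x 1, x 0]

/-- The Biot-Savart velocity field `v(ξ) = (2π)⁻¹ ∫ (ξ - η)^⊥ / |ξ - η|² w(η) dη`. -/
def biotSavart (w : Plane → ℝ) (ξ : Plane) : Plane :=
  (2 * Real.pi)⁻¹ • ∫ η : Plane, (w η / ‖ξ - η‖ ^ 2) • perp (ξ - η)

/-- The semigroup `S(τ) = e^{τL}`, `τ ≥ 0`, generated by `L = Δ + ½ ξ·∇ + 1` in the plane, through
its integral kernel: with `a(τ) = 1 - e^{-τ}`, for `τ > 0`,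
`(S(τ)f)(ξ) = e^τ / (4π a(τ)) ∫ exp(-|ξ - ξ'|² / (4 a(τ))) f(ξ' e^{τ/2}) dξ'`, and `S(0) = 1`. -/
def semigroup (τ : ℝ) (f : Plane → ℝ) (ξ : Plane) : ℝ :=
  if τ = 0 then f ξ
  else Real.exp τ / (4 * Real.pi * (1 - Real.exp (-τ))) *
    ∫ ξ' : Plane, Real.exp (-‖ξ - ξ'‖ ^ 2 / (4 * (1 - Real.exp (-τ)))) *
      f (Real.exp (τ / 2) • ξ')

/-- `∇ · (S(τ) F)` for a vector field `F`, the semigroup acting on each component of `F`. -/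
def divSemigroup (τ : ℝ) (F : Plane → Plane) (ξ : Plane) : ℝ :=
  ∑ i : Fin 2, fderiv ℝ (semigroup τ fun η => F η i) ξ (EuclideanSpace.single i 1)

/-- The cut-off flux `χ(w / r₀) w v`, where `v` is the velocity field of `w`. -/
def cutoffFlux {m : ℝ} (χ : L2m m → ℝ) (r₀ : ℝ) (w : L2m m) (ξ : Plane) : Plane :=
  (χ (r₀⁻¹ • w) * w ξ) • biotSavart w ξ

/-- `w` restricted to `[0, ∞)` is a (mild) solution in `C⁰([0, ∞), L²(m))`, with initial value `w₀`,
of `∂_τ w = L w - (v · ∇)(χ(w / r₀) w)`: for all `τ ≥ 0`,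
`w(τ) = S(τ) w₀ - ∫₀^τ e^{-(τ - s)/2} ∇ · S(τ - s) (χ(w(s) / r₀) w(s) v(s)) ds`.
The integrand is required to be an integrable function `G` of `s` with values in `L²(m)`. -/
def IsMildSolution {m : ℝ} (χ : L2m m → ℝ) (r₀ : ℝ) (w₀ : L2m m) (w : ℝ → L2m m) : Prop :=
  ContinuousOn w (Ici 0) ∧
  ∀ τ : ℝ, 0 ≤ τ → ∃ G : ℝ → L2m m,
    (∀ s ∈ Ico 0 τ, ∀ᵐ ξ : Plane,
      G s ξ = Real.exp (-(τ - s) / 2) * divSemigroup (τ - s) (cutoffFlux χ r₀ (w s)) ξ) ∧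
    IntervalIntegrable G volume 0 τ ∧
    ∀ᵐ ξ : Plane, (w τ + ∫ s in 0..τ, G s : L2m m) ξ = semigroup τ w₀ ξ

/-- `Φ` is, for nonnegative times, the continuous semiflow on `L²(m)` defined by
`∂_τ w = L w - (v · ∇)(χ(w / r₀) w)`: the solution starting at `w₀` exists globally, is unique,
and equals `τ ↦ Φ τ w₀`. -/
structure IsSolutionSemiflow {m : ℝ} (χ : L2m m → ℝ) (r₀ : ℝ) (Φ : ℝ → L2m m → L2m m) :
    Prop where
  solution : ∀ w₀, IsMildSolution χ r₀ w₀ fun τ => Φ τ w₀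
  unique : ∀ w₀ w, IsMildSolution χ r₀ w₀ w → EqOn w (fun τ => Φ τ w₀) (Ici 0)
  zero : ∀ w₀, Φ 0 w₀ = w₀
  add : ∀ s t, 0 ≤ s → 0 ≤ t → ∀ w₀, Φ (s + t) w₀ = Φ s (Φ t w₀)
  continuousOn : ContinuousOn (fun p : ℝ × L2m m => Φ p.1 p.2) (Ici 0 ×ˢ univ)

section Abstract

variable {X : Type*} [NormedAddCommGroup X] [NormedSpace ℝ X]

/-- `P` is the spectral projection of the bounded operator `Λ` onto the space spanned by the
eigenvectors of `Λ` for the eigenvalues in the finite set `σ`: it is a bounded projection that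
commutes with `Λ`, its range is the span of these eigenvectors, and on the complementary invariant
subspace `ker P` no `λ ∈ σ` belongs to the spectrum of `Λ` (that is, `Λ - λ` is a bijection of
`ker P`; its inverse is then automatically bounded if `X` is complete). These conditions determine
`P` uniquely. -/
structure IsSpectralProjection (Λ : X →L[ℝ] X) (σ : Finset ℝ) (P : X →L[ℝ] X) : Prop where
  idem : ∀ x, P (P x) = P x
  comm : ∀ x, P (Λ x) = Λ (P x)
  range_eq : LinearMap.range P.toLinearMap =
    ⨆ l ∈ σ, Module.End.eigenspace (Λ.toLinearMap : Module.End ℝ X) l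
  bijOn_ker : ∀ l ∈ σ, BijOn (fun x => Λ x - l • x)
    (LinearMap.ker P.toLinearMap : Set X) (LinearMap.ker P.toLinearMap : Set X)

/-- `{w(τ)}_{τ ≤ 0}` is a negative semi-orbit of the semiflow `Φ` (only the values of `w` on
`(-∞, 0]` matter). -/
def IsNegSemiorbit (Φ : ℝ → X → X) (w : ℝ → X) : Prop :=
  ∀ s t, 0 ≤ t → s + t ≤ 0 → w (s + t) = Φ t (w s)

/-- The upper exponential growth rate `limsup |τ|⁻¹ ln ‖u(τ)‖` along the filter `l`, with values in
`[-∞, ∞]` and with `ln 0 = -∞`. -/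
def expRate (u : ℝ → X) (l : Filter ℝ) : EReal :=
  limsup (fun τ => ENNReal.log ‖u τ‖ₑ / ((|τ| : ℝ) : EReal)) l

/-- The graph `{w_c + g(w_c) | w_c ∈ E_c}`. -/
def graphManifold {Ec Es : Submodule ℝ X} (g : Ec → Es) : Set X :=
  {x | ∃ wc : Ec, x = (wc : X) + (g wc : X)}

/-- The leaf `M_w = {h(w, w_s) + w_s | w_s ∈ E_s}`. -/
def leaf {Ec Es : Submodule ℝ X} (h : X × Es → Ec) (w : X) : Set X :=
  {x | ∃ ws : Es, x = (h (w, ws) : X) + (ws : X)}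

end Abstract

end

end Vorticity

/-! The linear semigroup is explicit. After a change of variables `e^{τL}` has the kernel `G_a(ξ - c
η)`, where `G_a` is the heat kernel at time `a = 1 - e^{-τ}` and `c = e^{-τ/2}`.

Spectral gap. If all moments of `f` of degree at most `k` vanish, the Taylor polynomial of order `k`
of the kernel in `c η` may be subtracted. What remains is of size `c^{k+θ}` for any `θ < 1`, so
`e^{τL} f` decays like `e^{-ντ}` for any `ν < (k+1)/2` (`exists_decay`); the region `|c η| > 1` is
controlled by the weight, since `m ≥ k + 2`. The moments themselves transform triangularly, with
diagonal entries `e^{-j/2}`. Hence the product of the `Λ - e^{-j/2}`, `j ≤ k`, maps `L²(m)` into the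
space `V` of functions with vanishing moments. It is invertible on `V`, and this yields the
projection onto `V` along the sum of the eigenspaces (`exists_spectralProjection`).

Nonlinearity. In the integral equation the gradient of the heat kernel costs `a^{-1/2}` and the
product of `w` with its velocity `a^{-1/4}`, which together give an integrable singularity
`t^{-3/4}` (`exists_bilinearOperator`). The cut-off quadratic term has Lipschitz constant of order
`r₀`. On `C([0, 1])` the integral equation is therefore a small `C¹` perturbation of the identity.
Its solutions form a semiflow whose time-one map is `Λ + R`, where `R` is `C¹`, vanishes to second
order at `0` in the sense `R(0) = 0`, `DR(0) = 0`, and has a Lipschitz constant as small as desired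
(`exists_cutoff_semiflow`).

Dynamics. The Lyapunov–Perron method is applied to `Λ + R`. A backward orbit whose growth lies
strictly inside the gap is determined by its component in the range of `P`, as the fixed point of a
contraction on sequences weighted by `ρ ^ n`; its endpoints form the graph of `g`
(`exists_backward`). A difference of two forward orbits that decays at a rate inside the gap is
likewise determined by its component in `ker P`, which gives the leaves (`exists_forward`). Working
with two weights at once gives uniqueness in the larger space and differentiability with a loss of
weight. The time-`t` maps are Lipschitz and commute with the time-one map, so these descriptions by
growth rates carry over to the semiflow. Manifold and leaves are graphs of slope at most `1/2` over
complementary subspaces and so meet in exactly one point (`exists_graph_and_foliation`). -/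

namespace Vorticity

noncomputable section

/-! ### Fixed points in weighted sequence spaces -/

section WeightedSequences

variable {X : Type*} [NormedAddCommGroup X] [NormedSpace ℝ X]

/-- The operator matrix `T` maps sequences of growth `ρ ^ e j` to sequences of growth `ρ ^ n`,
with bound `M`. -/
structure WeightBound (T : ℕ → ℕ → X →L[ℝ] X) (e : ℕ → ℕ) (ρ M : ℝ) : Prop where
  pos : 0 < ρ
  summable : ∀ n, Summable fun j => ‖T n j‖ * ρ ^ e j
  tsum_le : ∀ n, ∑' j, ‖T n j‖ * ρ ^ e j ≤ M * ρ ^ n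

variable {T : ℕ → ℕ → X →L[ℝ] X} {e : ℕ → ℕ} {ρ M : ℝ}

lemma WeightBound.nonneg (hT : WeightBound T e ρ M) : 0 ≤ M := by
  have h := hT.tsum_le 0
  have h0 : 0 ≤ ∑' j, ‖T 0 j‖ * ρ ^ e j :=
    tsum_nonneg fun j => mul_nonneg (norm_nonneg _) (pow_nonneg hT.pos.le _)
  simpa using h0.trans h

lemma WeightBound.norm_apply_le {r : ℕ → X} {B : ℝ}
    (hr : ∀ j, ‖r j‖ ≤ B * ρ ^ e j) (n j : ℕ) :
    ‖T n j (r j)‖ ≤ B * (‖T n j‖ * ρ ^ e j) := by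
  calc ‖T n j (r j)‖ ≤ ‖T n j‖ * ‖r j‖ := (T n j).le_opNorm _
    _ ≤ ‖T n j‖ * (B * ρ ^ e j) := by gcongr; exact hr j
    _ = _ := by ring

lemma WeightBound.summable_apply [CompleteSpace X] (hT : WeightBound T e ρ M) {r : ℕ → X} {B : ℝ}
    (hr : ∀ j, ‖r j‖ ≤ B * ρ ^ e j) (n : ℕ) : Summable fun j => T n j (r j) :=
  Summable.of_norm_bounded ((hT.summable n).mul_left B) fun j =>
    WeightBound.norm_apply_le hr n j

lemma WeightBound.norm_tsum_le (hT : WeightBound T e ρ M) {r : ℕ → X} {B : ℝ}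
    (hr : ∀ j, ‖r j‖ ≤ B * ρ ^ e j) (n : ℕ) : ‖∑' j, T n j (r j)‖ ≤ B * M * ρ ^ n := by
  have hB : 0 ≤ B := by
    have h := (norm_nonneg _).trans (hr 0)
    exact nonneg_of_mul_nonneg_left h (pow_pos hT.pos _)
  calc ‖∑' j, T n j (r j)‖ ≤ ∑' j, B * (‖T n j‖ * ρ ^ e j) :=
        tsum_of_norm_bounded ((hT.summable n).mul_left B).hasSum fun j =>
          WeightBound.norm_apply_le hr n j
    _ = B * ∑' j, (‖T n j‖ * ρ ^ e j) := tsum_mul_left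
    _ ≤ B * (M * ρ ^ n) := by gcongr; exact hT.tsum_le n
    _ = _ := by ring

/-- The bound improves from `B` to `E + B / 2`, and iteration from `B₀` converges to the fixed value
`2 * E`. Some finite a priori bound is indispensable, but its size disappears. -/
lemma norm_le_of_halving {Y : Type*} [NormedAddCommGroup Y] {d : ℕ → Y} {E B₀ : ℝ} (hB₀ : ∀ n, ‖d n‖ ≤ B₀ * ρ ^ n)
    (h : ∀ B, (∀ n, ‖d n‖ ≤ B * ρ ^ n) → ∀ n, ‖d n‖ ≤ (E + B / 2) * ρ ^ n) (n : ℕ) :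
    ‖d n‖ ≤ 2 * E * ρ ^ n := by
  have key : ∀ i : ℕ, ∀ n, ‖d n‖ ≤ (2 * E + (B₀ - 2 * E) * (1 / 2) ^ i) * ρ ^ n := by
    intro i
    induction i with
    | zero => intro n; simpa using hB₀ n
    | succ i ih =>
      intro n
      refine (h _ ih n).trans (le_of_eq ?_)
      rw [pow_succ]; ring
  have hlim : Tendsto (fun i : ℕ => (2 * E + (B₀ - 2 * E) * (1 / 2) ^ i) * ρ ^ n) atTop
      (𝓝 ((2 * E + (B₀ - 2 * E) * 0) * ρ ^ n)) :=
    ((((tendsto_pow_atTop_nhds_zero_of_lt_one (by norm_num) (by norm_num)).const_mul _).const_add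
      _).mul_const _)
  simpa using ge_of_tendsto' hlim fun i => key i n

/-- The common a priori estimate: `E = O = 0` gives uniqueness, `O = 0` Lipschitz dependence on
data, and a small `O` continuity and differentiability. The Lipschitz part is absorbed because `δ *
M ≤ 1 / 2`. -/
lemma WeightBound.norm_le_of_eq (hT : WeightBound T e ρ M) {δ : ℝ} (hδ : δ * M ≤ 1 / 2)
    {d s b : ℕ → X} {O E B₀ : ℝ} (hδ0 : 0 ≤ δ)
    (hd : ∀ n, d n = b n + ∑' j, T n j (s j)) (hs : ∀ j, ‖s j‖ ≤ δ * ‖d (e j)‖ + O * ρ ^ e j)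
    (hb : ∀ n, ‖b n‖ ≤ E * ρ ^ n) (hB₀ : ∀ n, ‖d n‖ ≤ B₀ * ρ ^ n) (n : ℕ) :
    ‖d n‖ ≤ 2 * (E + O * M) * ρ ^ n := by
  refine norm_le_of_halving hB₀ (fun B hB n => ?_) n
  have hB0 : 0 ≤ B := by simpa using (norm_nonneg _).trans (hB 0)
  have h1 : ∀ j, ‖s j‖ ≤ (δ * B + O) * ρ ^ e j := fun j => by
    calc ‖s j‖ ≤ δ * ‖d (e j)‖ + O * ρ ^ e j := hs j
      _ ≤ δ * (B * ρ ^ e j) + O * ρ ^ e j := by gcongr; exact hB _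
      _ = _ := by ring
  have hp := pow_pos hT.pos n
  calc ‖d n‖ ≤ ‖b n‖ + ‖∑' j, T n j (s j)‖ := by rw [hd n]; exact norm_add_le _ _
    _ ≤ E * ρ ^ n + (δ * B + O) * M * ρ ^ n := add_le_add (hb n) (hT.norm_tsum_le h1 n)
    _ = (E + O * M + (δ * M) * B) * ρ ^ n := by ring
    _ ≤ (E + O * M + (1 / 2) * B) * ρ ^ n := by gcongr
    _ = _ := by ring

/-- Writing `u n = ρ ^ n • v n` turns the weighted space into bounded sequences, on which the
rescaled map is a contraction with constant `δ * M`. -/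
theorem WeightBound.exists_fixedPoint [CompleteSpace X] (hT : WeightBound T e ρ M) {δ : ℝ}
    (hδ0 : 0 ≤ δ) (hδ : δ * M ≤ 1 / 2) {N : ℕ → X → X}
    (hN : ∀ j x y, ‖N j x - N j y‖ ≤ δ * ‖x - y‖) (hN0 : ∀ j, N j 0 = 0)
    {a : ℕ → X} {A : ℝ} (ha : ∀ n, ‖a n‖ ≤ A * ρ ^ n) :
    ∃ u : ℕ → X, (∀ n, u n = a n + ∑' j, T n j (N j (u (e j)))) ∧
      ∀ n, ‖u n‖ ≤ 2 * A * ρ ^ n := by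
  have hρ := hT.pos
  have hρn : ∀ n, ρ ^ n ≠ 0 := fun n => (pow_pos hρ n).ne'
  have bd : ∀ v : BoundedContinuousFunction ℕ X, ∀ j,
      ‖N j (ρ ^ e j • v (e j))‖ ≤ (δ * ‖v‖) * ρ ^ e j := fun v j => by
    have := hN j (ρ ^ e j • v (e j)) 0
    rw [hN0, sub_zero, sub_zero, norm_smul, Real.norm_of_nonneg (pow_pos hρ _).le] at this
    refine this.trans ?_
    have h2 := v.norm_coe_le_norm (e j)
    have h3 := (pow_pos hρ (e j)).le
    calc δ * (ρ ^ e j * ‖v (e j)‖) ≤ δ * (ρ ^ e j * ‖v‖) := by gcongr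
      _ = _ := by ring
  let G : BoundedContinuousFunction ℕ X → BoundedContinuousFunction ℕ X := fun v =>
    BoundedContinuousFunction.ofNormedAddCommGroupDiscrete
      (fun n => (ρ ^ n)⁻¹ • (a n + ∑' j, T n j (N j (ρ ^ e j • v (e j)))))
      (A + δ * ‖v‖ * M) (fun n => by
        rw [norm_smul, norm_inv, Real.norm_of_nonneg (pow_pos hρ _).le,
          inv_mul_le_iff₀ (pow_pos hρ _)]
        calc _ ≤ A * ρ ^ n + δ * ‖v‖ * M * ρ ^ n :=
              (norm_add_le _ _).trans (add_le_add (ha n) (hT.norm_tsum_le (bd v) n))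
          _ = _ := by ring)
  have hG_apply : ∀ v n, G v n = (ρ ^ n)⁻¹ • (a n + ∑' j, T n j (N j (ρ ^ e j • v (e j)))) :=
    fun _ _ => rfl
  have hG : ContractingWith (1 / 2) G := by
    refine ⟨by rw [← NNReal.coe_lt_coe]; norm_num, LipschitzWith.of_dist_le_mul fun v w => ?_⟩
    rw [BoundedContinuousFunction.dist_le (by positivity)]
    intro n
    rw [dist_eq_norm, dist_eq_norm]
    have h1 : G v n - G w n = (ρ ^ n)⁻¹ • ∑' j, T n j (N j (ρ ^ e j • v (e j)) -
        N j (ρ ^ e j • w (e j))) := by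
      rw [hG_apply, hG_apply, ← smul_sub, add_sub_add_left_eq_sub,
        ← (hT.summable_apply (bd v) n).tsum_sub (hT.summable_apply (bd w) n)]
      simp
    rw [h1, norm_smul, norm_inv, Real.norm_of_nonneg (pow_pos hρ _).le,
      inv_mul_le_iff₀ (pow_pos hρ _)]
    have h2 : ∀ j, ‖N j (ρ ^ e j • v (e j)) - N j (ρ ^ e j • w (e j))‖
        ≤ (δ * ‖v - w‖) * ρ ^ e j := fun j => by
      refine (hN j _ _).trans ?_
      rw [← smul_sub, norm_smul, Real.norm_of_nonneg (pow_pos hρ _).le]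
      have h2 := (v - w).norm_coe_le_norm (e j)
      have h3 := (pow_pos hρ (e j)).le
      calc δ * (ρ ^ e j * ‖(v - w) (e j)‖) ≤ δ * (ρ ^ e j * ‖v - w‖) := by gcongr
        _ = _ := by ring
    refine (hT.norm_tsum_le h2 n).trans ?_
    have h3 : ((1 / 2 : ℝ≥0) : ℝ) = 1 / 2 := by norm_num
    rw [h3]
    have h4 := (pow_pos hρ n).le
    calc δ * ‖v - w‖ * M * ρ ^ n = (δ * M) * ‖v - w‖ * ρ ^ n := by ring
      _ ≤ (1 / 2) * ‖v - w‖ * ρ ^ n := by gcongr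
      _ = _ := by ring
  obtain ⟨v, hv⟩ : ∃ v, G v = v := ⟨hG.fixedPoint G, hG.fixedPoint_isFixedPt⟩
  have hu : ∀ n, ρ ^ n • v n = a n + ∑' j, T n j (N j (ρ ^ e j • v (e j))) := fun n => by
    conv_lhs => rw [← hv, hG_apply]
    rw [smul_inv_smul₀ (hρn n)]
  have hvb : ∀ n, ‖ρ ^ n • v n‖ ≤ ‖v‖ * ρ ^ n := fun n => by
    rw [norm_smul, Real.norm_of_nonneg (pow_pos hρ _).le, mul_comm]
    gcongr
    exact v.norm_coe_le_norm n
  refine ⟨fun n => ρ ^ n • v n, hu, fun n => ?_⟩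
  have := hT.norm_le_of_eq hδ (O := 0) hδ0 hu (fun j => ?_) ha hvb n
  · simpa using this
  · simpa [hN0] using hN j (ρ ^ e j • v (e j)) 0

/-- Uniform smallness in a weighted norm from pointwise smallness and a bound in a stronger
weighted norm. -/
lemma eventually_forall_le_mul_pow {ι : Type*} {l : Filter ι} {o : ℕ → ι → ℝ} {g : ι → ℝ}
    (hg : ∀ p, 0 ≤ g p) (he : Tendsto e atTop atTop) {ρ₁ ρ₂ B : ℝ} (h0 : 0 < ρ₁) (h12 : ρ₁ < ρ₂)
    (hB : ∀ᶠ p in l, ∀ j, o j p ≤ B * g p * ρ₁ ^ e j)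
    (ho : ∀ j, ∀ ε > 0, ∀ᶠ p in l, o j p ≤ ε * g p) {ε : ℝ} (hε : 0 < ε) :
    ∀ᶠ p in l, ∀ j, o j p ≤ ε * g p * ρ₂ ^ e j := by
  have h2 : 0 < ρ₂ := h0.trans h12
  -- Beyond some index the gap `ρ₁ < ρ₂` makes the crude bound small; the pointwise smallness is
  -- needed for finitely many indices only.
  have hq : Tendsto (fun j => B * (ρ₁ / ρ₂) ^ e j) atTop (𝓝 (B * 0)) :=
    ((tendsto_pow_atTop_nhds_zero_of_lt_one (by positivity)
      ((div_lt_one h2).2 h12)).comp he).const_mul B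
  rw [mul_zero] at hq
  obtain ⟨J, hJ⟩ := eventually_atTop.1 (hq.eventually (ge_mem_nhds hε))
  have hfin : ∀ᶠ p in l, ∀ j ∈ Finset.range J, o j p ≤ ε * g p * ρ₂ ^ e j := by
    rw [eventually_all_finset]
    intro j _
    filter_upwards [ho j (ε * ρ₂ ^ e j) (by positivity)] with p hp
    linarith [hp]
  filter_upwards [hB, hfin] with p hp hfin j
  by_cases hj : j < J
  · exact hfin j (Finset.mem_range.2 hj)
  · refine (hp j).trans ?_
    have h3 : B * (ρ₁ / ρ₂) ^ e j ≤ ε := hJ j (not_lt.1 hj)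
    have h4 : B * ρ₁ ^ e j ≤ ε * ρ₂ ^ e j := by
      rw [div_pow, mul_div_assoc', div_le_iff₀ (pow_pos h2 _)] at h3
      exact h3
    nlinarith [hg p]

/-- The nonlinearities are continuous in `w` index by index, not uniformly. The solution at `w₀` is
bounded in the stronger weight `ρ₁`, so its residual is uniformly small in the weight `ρ₂`, where
the a priori estimate is applied. -/
theorem WeightBound.continuous_fixedPoint [CompleteSpace X] {W : Type*} [TopologicalSpace W]
    {ρ₁ ρ₂ : ℝ}
    (hT : WeightBound T e ρ₂ M) {δ : ℝ} (hδ0 : 0 ≤ δ) (hδ : δ * M ≤ 1 / 2) (h0 : 0 < ρ₁)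
    (h12 : ρ₁ < ρ₂) (he : Tendsto e atTop atTop) {N : W → ℕ → X → X}
    (hN : ∀ w j x y, ‖N w j x - N w j y‖ ≤ δ * ‖x - y‖) (hN0 : ∀ w j, N w j 0 = 0)
    (hNc : ∀ j x, Continuous fun w => N w j x) {a u : W → ℕ → X}
    (ha : ∀ w₀, ∀ ε > 0, ∀ᶠ w in 𝓝 w₀, ∀ n, ‖a w n - a w₀ n‖ ≤ ε * ρ₂ ^ n)
    (hu : ∀ w n, u w n = a w n + ∑' j, T n j (N w j (u w (e j))))
    (hub : ∀ w, ∃ B, ∀ n, ‖u w n‖ ≤ B * ρ₁ ^ n) (n : ℕ) : Continuous fun w => u w n := by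
  have h2 : 0 < ρ₂ := h0.trans h12
  have hub₂ : ∀ w, ∃ B, 0 ≤ B ∧ (∀ n, ‖u w n‖ ≤ B * ρ₁ ^ n) ∧ ∀ n, ‖u w n‖ ≤ B * ρ₂ ^ n := by
    intro w
    obtain ⟨B, hB⟩ := hub w
    have hB0 : 0 ≤ B := by simpa using (norm_nonneg _).trans (hB 0)
    exact ⟨B, hB0, hB, fun n => (hB n).trans (by gcongr)⟩
  have hr : ∀ w, ∃ C, ∀ j, ‖N w j (u w (e j))‖ ≤ C * ρ₂ ^ e j := fun w => by
    obtain ⟨B, hB0, -, hB⟩ := hub₂ w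
    refine ⟨δ * B, fun j => ?_⟩
    have := hN w j (u w (e j)) 0
    rw [hN0, sub_zero, sub_zero] at this
    refine this.trans ?_
    rw [mul_assoc]
    gcongr
    exact hB _
  rw [continuous_iff_continuousAt]
  intro w₀
  obtain ⟨B, hB0, hB1, hB2⟩ := hub₂ w₀
  have key : ∀ ε > 0, ∀ᶠ w in 𝓝 w₀, ‖u w n - u w₀ n‖ ≤ 2 * (ε + ε * M) * ρ₂ ^ n := by
    intro ε hε
    have ho := eventually_forall_le_mul_pow (l := 𝓝 w₀) (g := fun _ => 1) (e := e)
      (o := fun j w => ‖N w j (u w₀ (e j)) - N w₀ j (u w₀ (e j))‖) (B := 2 * δ * B)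
      (fun _ => zero_le_one) he h0 h12 (Eventually.of_forall fun w j => by
        have h1 := hN w j (u w₀ (e j)) 0
        have h2 := hN w₀ j (u w₀ (e j)) 0
        rw [hN0, sub_zero, sub_zero] at h1 h2
        calc _ ≤ δ * ‖u w₀ (e j)‖ + δ * ‖u w₀ (e j)‖ :=
              (norm_sub_le _ _).trans (add_le_add h1 h2)
          _ ≤ δ * (B * ρ₁ ^ e j) + δ * (B * ρ₁ ^ e j) := by gcongr <;> exact hB1 _
          _ = _ := by ring)
      (fun j ε hε => by
        have hc := ((hNc j (u w₀ (e j))).tendsto w₀).sub_const (N w₀ j (u w₀ (e j)))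
        rw [sub_self] at hc
        simpa using hc.norm.eventually (ge_mem_nhds (by simpa using hε))) hε
    filter_upwards [ho, ha w₀ ε hε] with w how haw
    obtain ⟨B', _, _, hB'⟩ := hub₂ w
    obtain ⟨C, hC⟩ := hr w
    obtain ⟨C₀, hC₀⟩ := hr w₀
    refine hT.norm_le_of_eq (d := fun n => u w n - u w₀ n) (b := fun n => a w n - a w₀ n)
      (s := fun j => N w j (u w (e j)) - N w₀ j (u w₀ (e j))) (B₀ := B' + B) hδ hδ0
      (fun n => ?_) (fun j => ?_) haw (fun n => ?_) n
    · simp only [map_sub]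
      rw [(hT.summable_apply hC n).tsum_sub (hT.summable_apply hC₀ n), hu w n, hu w₀ n]
      abel
    · have h1 := hN w j (u w (e j)) (u w₀ (e j))
      have h2 := how j
      rw [mul_one] at h2
      calc _ = ‖(N w j (u w (e j)) - N w j (u w₀ (e j))) +
            (N w j (u w₀ (e j)) - N w₀ j (u w₀ (e j)))‖ := by abel_nf
        _ ≤ _ := (norm_add_le _ _).trans (add_le_add h1 h2)
    · rw [add_mul]
      exact (norm_sub_le _ _).trans (add_le_add (hB' n) (hB2 n))
  rw [ContinuousAt, tendsto_iff_norm_sub_tendsto_zero]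
  rw [Metric.tendsto_nhds]
  intro η hη
  have hM := hT.nonneg
  filter_upwards [key (η / (4 * (1 + M) * ρ₂ ^ n)) (by positivity)] with w hw
  rw [Real.dist_eq, sub_zero, abs_of_nonneg (norm_nonneg _)]
  refine hw.trans_lt ?_
  have : 2 * (η / (4 * (1 + M) * ρ₂ ^ n) + η / (4 * (1 + M) * ρ₂ ^ n) * M) * ρ₂ ^ n = η / 2 := by
    field_simp
    ring
  rw [this]
  linarith

/-- The fixed point depends continuously differentiably on the datum `ζ`. -/
theorem WeightBound.hasFDerivAt_fixedPoint [CompleteSpace X] {Z : Type*} [NormedAddCommGroup Z]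
    [NormedSpace ℝ Z] {ρ₁ ρ₂ : ℝ} (hT₁ : WeightBound T e ρ₁ M) (hT₂ : WeightBound T e ρ₂ M)
    {δ : ℝ} (hδ0 : 0 ≤ δ) (hδ : δ * M ≤ 1 / 2) (h12 : ρ₁ < ρ₂) (he : Tendsto e atTop atTop)
    {N : ℕ → X → X} (hNd : ∀ j, ContDiff ℝ 1 (N j))
    (hN : ∀ j x y, ‖N j x - N j y‖ ≤ δ * ‖x - y‖) (hN0 : ∀ j, N j 0 = 0)
    {A : ℕ → Z →L[ℝ] X} {C : ℝ} (hA : ∀ n, ‖A n‖ ≤ C * ρ₁ ^ n) {u : Z → ℕ → X}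
    (hu : ∀ ζ n, u ζ n = A n ζ + ∑' j, T n j (N j (u ζ (e j))))
    (hub : ∀ ζ, ∃ B, ∀ n, ‖u ζ n‖ ≤ B * ρ₁ ^ n) :
    ∃ U : Z → ℕ → Z →L[ℝ] X, (∀ ζ n, HasFDerivAt (fun ζ => u ζ n) (U ζ n) ζ) ∧
      (∀ n, Continuous fun ζ => U ζ n) ∧
      ∀ ζ, (∀ j, fderiv ℝ (N j) (u ζ (e j)) = 0) → ∀ n, U ζ n = A n := by
  have h0 := hT₁.pos
  have h2 := hT₂.pos
  have hM := hT₁.nonneg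
  have hC0 : 0 ≤ C := by simpa using (norm_nonneg _).trans (hA 0)
  have hr : ∀ ζ, ∃ B, ∀ j, ‖N j (u ζ (e j))‖ ≤ B * ρ₁ ^ e j := fun ζ => by
    obtain ⟨B, hB⟩ := hub ζ
    refine ⟨δ * B, fun j => ?_⟩
    have := hN j (u ζ (e j)) 0
    rw [hN0, sub_zero, sub_zero] at this
    refine this.trans ?_
    rw [mul_assoc]
    gcongr
    exact hB _
  have hlip : ∀ ζ ζ' n, ‖u ζ n - u ζ' n‖ ≤ 2 * C * ‖ζ - ζ'‖ * ρ₁ ^ n := by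
    intro ζ ζ' n
    obtain ⟨B, hB⟩ := hr ζ
    obtain ⟨B', hB'⟩ := hr ζ'
    obtain ⟨D, hD⟩ := hub ζ
    obtain ⟨D', hD'⟩ := hub ζ'
    have := hT₁.norm_le_of_eq (d := fun n => u ζ n - u ζ' n) (b := fun n => A n (ζ - ζ'))
      (s := fun j => N j (u ζ (e j)) - N j (u ζ' (e j))) (B₀ := D + D') (O := 0)
      (E := C * ‖ζ - ζ'‖) hδ hδ0
      (fun n => ?_) (fun j => ?_) (fun n => ?_) (fun n => ?_) n
    · simpa [mul_assoc] using this
    · simp only [map_sub]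
      rw [(hT₁.summable_apply hB n).tsum_sub (hT₁.summable_apply hB' n), hu ζ n, hu ζ' n]
      abel
    · simpa using hN j (u ζ (e j)) (u ζ' (e j))
    · calc _ ≤ ‖A n‖ * ‖ζ - ζ'‖ := (A n).le_opNorm _
        _ ≤ (C * ρ₁ ^ n) * ‖ζ - ζ'‖ := by gcongr; exact hA n
        _ = _ := by ring
    · rw [add_mul]
      exact (norm_sub_le _ _).trans (add_le_add (hD n) (hD' n))
  have hDN : ∀ j x, ‖fderiv ℝ (N j) x‖ ≤ δ := fun j x =>
    norm_fderiv_le_of_lip' ℝ hδ0 (Eventually.of_forall fun y => hN j y x)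
  -- The derivative is sought as a sequence of operators `Z →L[ℝ] X`, on which `T` acts by
  -- postcomposition with the same bounds. It solves the linearised fixed point equation.
  let T' : ℕ → ℕ → (Z →L[ℝ] X) →L[ℝ] (Z →L[ℝ] X) := fun n j =>
    ContinuousLinearMap.compL ℝ Z X X (T n j)
  have hT'n : ∀ n j, ‖T' n j‖ ≤ ‖T n j‖ := fun n j =>
    ContinuousLinearMap.opNorm_le_bound _ (norm_nonneg _) fun L => (T n j).opNorm_comp_le L
  have hT' : ∀ ρ, WeightBound T e ρ M → WeightBound T' e ρ M := fun ρ hT => by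
    have hle : ∀ n j, ‖T' n j‖ * ρ ^ e j ≤ ‖T n j‖ * ρ ^ e j := fun n j =>
      mul_le_mul_of_nonneg_right (hT'n n j) (pow_nonneg hT.pos.le _)
    have hs : ∀ n, Summable fun j => ‖T' n j‖ * ρ ^ e j := fun n =>
      Summable.of_nonneg_of_le (fun j => mul_nonneg (ContinuousLinearMap.opNorm_nonneg _)
        (pow_nonneg hT.pos.le _)) (hle n) (hT.summable n)
    exact ⟨hT.pos, hs, fun n => ((hs n).tsum_le_tsum (hle n) (hT.summable n)).trans (hT.tsum_le n)⟩
  have hT'₁ := hT' ρ₁ hT₁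
  have hT'₂ := hT' ρ₂ hT₂
  have hex : ∀ ζ, ∃ U : ℕ → Z →L[ℝ] X, (∀ n, U n = A n + ∑' j, T' n j
      ((fderiv ℝ (N j) (u ζ (e j))).comp (U (e j)))) ∧ ∀ n, ‖U n‖ ≤ 2 * C * ρ₁ ^ n := fun ζ =>
    hT'₁.exists_fixedPoint hδ0 hδ (N := fun j L => (fderiv ℝ (N j) (u ζ (e j))).comp L)
      (fun j L L' => by
        rw [← ContinuousLinearMap.comp_sub]
        exact (ContinuousLinearMap.opNorm_comp_le _ _).trans (by gcongr; exact hDN _ _))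
      (fun j => by simp) hA
  choose U hU hUb using hex
  have hUr : ∀ ζ j, ‖(fderiv ℝ (N j) (u ζ (e j))).comp (U ζ (e j))‖ ≤
      (δ * (2 * C)) * ρ₁ ^ e j := fun ζ j => by
    refine (ContinuousLinearMap.opNorm_comp_le _ _).trans ?_
    calc _ ≤ δ * (2 * C * ρ₁ ^ e j) := by gcongr; exacts [hDN _ _, hUb _ _]
      _ = _ := by ring
  have hpow : ∀ i, ρ₁ ^ i ≤ ρ₂ ^ i := fun i => pow_le_pow_left₀ h0.le h12.le i
  refine ⟨U, fun ζ n => ?_, fun n => ?_, fun ζ hζ n => ?_⟩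
  · have hUz : ∀ n z, U ζ n z = A n z + ∑' j, T n j
        (fderiv ℝ (N j) (u ζ (e j)) (U ζ (e j) z)) := fun n z => by
      have hs := hT'₁.summable_apply (hUr ζ) n
      have h := (ContinuousLinearMap.apply ℝ X z).map_tsum hs
      conv_lhs => rw [hU ζ n]
      rw [_root_.add_apply]
      congr 1
    -- The remainder solves the linearised equation with the Taylor defect of `N` as source. This
    -- defect is `o(‖z‖)` at each index but only `O(‖z‖)` in the weight `ρ₁`, so the estimate is
    -- made in the weight `ρ₂`.
    have key : ∀ ε > 0, ∀ᶠ z in 𝓝 (0 : Z),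
        ‖u (ζ + z) n - u ζ n - U ζ n z‖ ≤ 2 * (0 + ε * ‖z‖ * M) * ρ₂ ^ n := by
      intro ε hε
      have ho := eventually_forall_le_mul_pow (l := 𝓝 (0 : Z)) (g := fun z => ‖z‖) (e := e)
        (o := fun j z => ‖N j (u (ζ + z) (e j)) - N j (u ζ (e j)) -
          fderiv ℝ (N j) (u ζ (e j)) (u (ζ + z) (e j) - u ζ (e j))‖) (B := 2 * δ * (2 * C))
        (fun _ => norm_nonneg _) he h0 h12 (Eventually.of_forall fun z j => by
          have h1 := hN j (u (ζ + z) (e j)) (u ζ (e j))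
          have h2 := (fderiv ℝ (N j) (u ζ (e j))).le_of_opNorm_le (hDN _ _)
            (u (ζ + z) (e j) - u ζ (e j))
          have h3 := hlip (ζ + z) ζ (e j)
          rw [add_sub_cancel_left] at h3
          calc _ ≤ δ * ‖u (ζ + z) (e j) - u ζ (e j)‖ + δ * ‖u (ζ + z) (e j) - u ζ (e j)‖ :=
                (norm_sub_le _ _).trans (add_le_add h1 h2)
            _ ≤ δ * (2 * C * ‖z‖ * ρ₁ ^ e j) + δ * (2 * C * ‖z‖ * ρ₁ ^ e j) := by gcongr
            _ = _ := by ring)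
        (fun j ε hε => by
          have hd := ((hNd j).differentiable (by norm_num) (u ζ (e j))).hasFDerivAt.isLittleO
          have hc : Tendsto (fun z => u (ζ + z) (e j)) (𝓝 0) (𝓝 (u ζ (e j))) := by
            rw [tendsto_iff_norm_sub_tendsto_zero]
            refine squeeze_zero (fun _ => norm_nonneg _) (fun z => hlip (ζ + z) ζ (e j)) ?_
            have : Continuous fun z : Z => 2 * C * ‖ζ + z - ζ‖ * ρ₁ ^ e j := by fun_prop
            simpa using this.tendsto 0
          have hpos : 0 < 2 * C * ρ₁ ^ e j + 1 := by positivity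
          have := hc.eventually (hd.def (div_pos hε hpos))
          filter_upwards [this] with z hz
          refine hz.trans ?_
          have h3 := hlip (ζ + z) ζ (e j)
          rw [add_sub_cancel_left] at h3
          calc _ ≤ ε / (2 * C * ρ₁ ^ e j + 1) * (2 * C * ‖z‖ * ρ₁ ^ e j) := by gcongr
            _ = ε * ‖z‖ * ((2 * C * ρ₁ ^ e j) / (2 * C * ρ₁ ^ e j + 1)) := by ring
            _ ≤ ε * ‖z‖ * 1 := by
              gcongr
              rw [div_le_one hpos]; linarith
            _ = _ := mul_one _) hε
      filter_upwards [ho] with z hz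
      obtain ⟨D, hD⟩ := hr (ζ + z)
      obtain ⟨D', hD'⟩ := hr ζ
      have hUzr : ∀ j, ‖fderiv ℝ (N j) (u ζ (e j)) (U ζ (e j) z)‖ ≤
          (δ * (2 * C) * ‖z‖) * ρ₁ ^ e j := fun j => by
        have := ((fderiv ℝ (N j) (u ζ (e j))).comp (U ζ (e j))).le_of_opNorm_le (hUr ζ j) z
        refine this.trans (le_of_eq (by ring))
      refine hT₂.norm_le_of_eq (d := fun n => u (ζ + z) n - u ζ n - U ζ n z) (b := fun _ => 0)
        (s := fun j => N j (u (ζ + z) (e j)) - N j (u ζ (e j)) -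
          fderiv ℝ (N j) (u ζ (e j)) (U ζ (e j) z)) (B₀ := 2 * C * ‖z‖ + 2 * C * ‖z‖)
        hδ hδ0 (fun n => ?_) (fun j => ?_) (fun n => by simp) (fun n => ?_) n
      · simp only [map_sub]
        rw [((hT₁.summable_apply hD n).sub (hT₁.summable_apply hD' n)).tsum_sub
          (hT₁.summable_apply hUzr n),
          (hT₁.summable_apply hD n).tsum_sub (hT₁.summable_apply hD' n), hu _ n, hu ζ n, hUz n z,
          map_add]
        abel
      · have h1 : N j (u (ζ + z) (e j)) - N j (u ζ (e j)) -
            fderiv ℝ (N j) (u ζ (e j)) (U ζ (e j) z) =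
            fderiv ℝ (N j) (u ζ (e j)) (u (ζ + z) (e j) - u ζ (e j) - U ζ (e j) z) +
            (N j (u (ζ + z) (e j)) - N j (u ζ (e j)) -
            fderiv ℝ (N j) (u ζ (e j)) (u (ζ + z) (e j) - u ζ (e j))) := by
          simp only [map_sub]; abel
        rw [h1]
        exact (norm_add_le _ _).trans (add_le_add
          ((fderiv ℝ (N j) (u ζ (e j))).le_of_opNorm_le (hDN _ _) _) (hz j))
      · have h3 := hlip (ζ + z) ζ n
        rw [add_sub_cancel_left] at h3
        have h4 := (U ζ n).le_of_opNorm_le (hUb ζ n) z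
        calc _ ≤ 2 * C * ‖z‖ * ρ₁ ^ n + 2 * C * ρ₁ ^ n * ‖z‖ :=
              (norm_sub_le _ _).trans (add_le_add h3 h4)
          _ = (2 * C * ‖z‖ + 2 * C * ‖z‖) * ρ₁ ^ n := by ring
          _ ≤ _ := by gcongr
    rw [hasFDerivAt_iff_isLittleO_nhds_zero, Asymptotics.isLittleO_iff]
    intro η hη
    filter_upwards [key (η / (2 * (1 + M) * ρ₂ ^ n)) (by positivity)] with z hz
    refine hz.trans ?_
    calc 2 * (0 + η / (2 * (1 + M) * ρ₂ ^ n) * ‖z‖ * M) * ρ₂ ^ n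
        = η * ‖z‖ * (M / (1 + M)) := by field_simp; ring
      _ ≤ η * ‖z‖ * 1 := by
        gcongr
        rw [div_le_one (by positivity)]; linarith
      _ = _ := mul_one _
  · refine hT'₂.continuous_fixedPoint (W := Z) hδ0 hδ h0 h12 he
      (N := fun ζ j L => (fderiv ℝ (N j) (u ζ (e j))).comp L) (a := fun _ => A)
      (fun ζ j L L' => by
        rw [← ContinuousLinearMap.comp_sub]
        exact (ContinuousLinearMap.opNorm_comp_le _ _).trans (by gcongr; exact hDN _ _))
      (fun ζ j => by simp) (fun j L => ?_) (fun ζ ε hε => ?_) hU (fun ζ => ⟨_, hUb ζ⟩) n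
    · have hc : Continuous fun ζ => u ζ (e j) := by
        refine continuous_iff_continuousAt.2 fun ζ => ?_
        rw [ContinuousAt, tendsto_iff_norm_sub_tendsto_zero]
        refine squeeze_zero (fun _ => norm_nonneg _) (fun ζ' => hlip ζ' ζ (e j)) ?_
        have : Continuous fun ζ' : Z => 2 * C * ‖ζ' - ζ‖ * ρ₁ ^ e j := by fun_prop
        simpa using this.tendsto ζ
      exact (((hNd j).continuous_fderiv (by norm_num)).comp hc).clm_comp continuous_const
    · refine Eventually.of_forall fun _ n => ?_
      simp only [sub_self, norm_zero]
      positivity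
  · rw [hU ζ n]
    simp [hζ]

end WeightedSequences

end

end Vorticity

namespace Vorticity

noncomputable section

/-! ### Discrete Lyapunov–Perron operators -/

section Discrete

variable {X : Type*} [NormedAddCommGroup X] [NormedSpace ℝ X]

/-- The operator matrix with entries `a (n - 1 - j)` below and `b (j - n)` on and above the
diagonal. -/
def splitKernel (a b : ℕ → X →L[ℝ] X) (n j : ℕ) : X →L[ℝ] X :=
  if j < n then a (n - 1 - j) else b (j - n)

lemma splitKernel_add (a b : ℕ → X →L[ℝ] X) (n i : ℕ) : splitKernel a b n (i + n) = b i := by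
  simp [splitKernel]

/-- Two geometric series: entries below the diagonal are summable because `α < ρ`, those above
because `β * ρ < 1`. The shift `s` will be `1` for backward orbits, where the nonlinearity is
evaluated one index later, and `0` for forward ones. -/
lemma weightBound_splitKernel {a b : ℕ → X →L[ℝ] X} {C α β ρ : ℝ} (hα : 0 ≤ α) (hβ : 0 ≤ β)
    (ha : ∀ i, ‖a i‖ ≤ C * α ^ i) (hb : ∀ i, ‖b i‖ ≤ C * β ^ i) (hαρ : α < ρ) (hβρ : β * ρ < 1)
    (s : ℕ) :
    WeightBound (splitKernel a b) (fun j => j + s) ρ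
      (C * ρ ^ s * (1 / (ρ - α) + 1 / (1 - β * ρ))) := by
  have hρ : 0 < ρ := hα.trans_lt hαρ
  have hC : 0 ≤ C := by simpa using (norm_nonneg _).trans (ha 0)
  have h1 : 0 < ρ - α := sub_pos.2 hαρ
  have h2 : 0 < 1 - β * ρ := sub_pos.2 hβρ
  have hβρ0 : 0 ≤ β * ρ := mul_nonneg hβ hρ.le
  have hgeo : ∀ n : ℕ, Summable fun i : ℕ => C * ρ ^ s * ρ ^ n * (β * ρ) ^ i := fun n =>
    (summable_geometric_of_lt_one hβρ0 hβρ).mul_left _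
  have hle : ∀ n i, ‖splitKernel a b n (i + n)‖ * ρ ^ (i + n + s) ≤
      C * ρ ^ s * ρ ^ n * (β * ρ) ^ i := fun n i => by
    rw [splitKernel_add]
    calc ‖b i‖ * ρ ^ (i + n + s) ≤ (C * β ^ i) * ρ ^ (i + n + s) := by gcongr; exact hb i
      _ = _ := by rw [mul_pow]; ring
  have hsum : ∀ n, Summable fun i => ‖splitKernel a b n (i + n)‖ * ρ ^ (i + n + s) := fun n =>
    Summable.of_nonneg_of_le (fun i => by positivity) (hle n) (hgeo n)
  have hS : ∀ n, Summable fun j => ‖splitKernel a b n j‖ * ρ ^ (j + s) := fun n =>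
    (summable_nat_add_iff (f := fun j => ‖splitKernel a b n j‖ * ρ ^ (j + s)) n).1 (hsum n)
  refine ⟨hρ, hS, fun n => ?_⟩
  rw [← (hS n).sum_add_tsum_nat_add n]
  have hfin : ∑ j ∈ Finset.range n, ‖splitKernel a b n j‖ * ρ ^ (j + s) ≤
      C * ρ ^ s * (ρ ^ n * (1 / (ρ - α))) := by
    have h3 : ∑ j ∈ Finset.range n, ‖splitKernel a b n j‖ * ρ ^ (j + s) ≤
        ∑ j ∈ Finset.range n, C * ρ ^ s * (ρ ^ j * α ^ (n - 1 - j)) := by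
      refine Finset.sum_le_sum fun j hj => ?_
      rw [splitKernel, if_pos (Finset.mem_range.1 hj)]
      calc _ ≤ (C * α ^ (n - 1 - j)) * ρ ^ (j + s) := by gcongr; exact ha _
        _ = _ := by ring
    refine h3.trans ?_
    rw [← Finset.mul_sum]
    gcongr
    rw [mul_one_div, le_div_iff₀ h1, (Commute.all ρ α).geom_sum₂_mul]
    have := pow_nonneg hα n
    linarith
  have htail : ∑' i, ‖splitKernel a b n (i + n)‖ * ρ ^ (i + n + s) ≤
      C * ρ ^ s * ρ ^ n * (1 - β * ρ)⁻¹ := by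
    refine ((hsum n).tsum_le_tsum (hle n) (hgeo n)).trans ?_
    rw [tsum_mul_left, tsum_geometric_of_lt_one hβρ0 hβρ]
  calc _ ≤ _ := add_le_add hfin htail
    _ = _ := by rw [one_div, one_div]; ring

variable {a b : ℕ → X →L[ℝ] X} {r : ℕ → X}

lemma tsum_splitKernel {n : ℕ} (hs : Summable fun j => splitKernel a b n j (r j)) :
    ∑' j, splitKernel a b n j (r j) =
      ∑ j ∈ Finset.range n, a (n - 1 - j) (r j) + ∑' i, b i (r (i + n)) := by
  rw [← hs.sum_add_tsum_nat_add n]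
  congr 1
  · refine Finset.sum_congr rfl fun j hj => ?_
    rw [splitKernel, if_pos (Finset.mem_range.1 hj)]
  · simp only [splitKernel_add]

lemma summable_splitKernel_tail {n : ℕ} (hs : Summable fun j => splitKernel a b n j (r j)) :
    Summable fun i => b i (r (i + n)) := by
  simpa only [splitKernel_add] using (summable_nat_add_iff n).2 hs

/-- The kernel is a Green's function of `u (n + 1) = Λ (u n) + r n`: off the diagonal the entries
are propagated by `Λ`, and `hab` is the jump condition that produces the source. -/
lemma tsum_splitKernel_forward {Λ : X →L[ℝ] X}
    (hs : ∀ n, Summable fun j => splitKernel a b n j (r j))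
    (ha : ∀ i x, Λ (a i x) = a (i + 1) x) (hb : ∀ i x, Λ (b (i + 1) x) = b i x)
    (hab : ∀ x, a 0 x - Λ (b 0 x) = x) (n : ℕ) :
    ∑' j, splitKernel a b (n + 1) j (r j) = Λ (∑' j, splitKernel a b n j (r j)) + r n := by
  have ht := summable_splitKernel_tail (hs n)
  rw [tsum_splitKernel (hs n), tsum_splitKernel (hs (n + 1)), Finset.sum_range_succ, map_add,
    map_sum, ht.tsum_eq_zero_add, map_add, Λ.map_tsum ((summable_nat_add_iff 1).2 ht)]
  have h1 : ∑ j ∈ Finset.range n, a (n - j) (r j) =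
      ∑ j ∈ Finset.range n, Λ (a (n - 1 - j) (r j)) := by
    refine Finset.sum_congr rfl fun j hj => ?_
    rw [ha]
    congr 2
    have := Finset.mem_range.1 hj
    omega
  have h2 : ∀ i, Λ (b (i + 1) (r (i + 1 + n))) = b i (r (i + (n + 1))) := fun i => by
    rw [hb]; congr 2; omega
  simp only [add_tsub_cancel_right, h1, h2, tsub_self, zero_add]
  have h3 : a 0 (r n) = r n + Λ (b 0 (r n)) := by rw [← sub_eq_iff_eq_add, hab]
  rw [h3]
  abel

/-- The Green's function in reversed time: index `n` stands for time `-n`, so `Λ` lowers the index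
and the two families exchange roles in the jump condition. -/
lemma tsum_splitKernel_backward {Λ : X →L[ℝ] X}
    (hs : ∀ n, Summable fun j => splitKernel a b n j (r j))
    (ha : ∀ i x, Λ (a (i + 1) x) = a i x) (hb : ∀ i x, Λ (b i x) = b (i + 1) x)
    (hab : ∀ x, Λ (a 0 x) + x = b 0 x) (n : ℕ) :
    ∑' j, splitKernel a b n j (r j) = Λ (∑' j, splitKernel a b (n + 1) j (r j)) + r n := by
  have ht := summable_splitKernel_tail (hs n)
  rw [tsum_splitKernel (hs n), tsum_splitKernel (hs (n + 1)), Finset.sum_range_succ, map_add,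
    map_add, map_sum, ht.tsum_eq_zero_add, Λ.map_tsum (summable_splitKernel_tail (hs (n + 1)))]
  have h1 : ∑ j ∈ Finset.range n, Λ (a (n - j) (r j)) =
      ∑ j ∈ Finset.range n, a (n - 1 - j) (r j) := by
    refine Finset.sum_congr rfl fun j hj => ?_
    rw [← ha (n - 1 - j)]
    congr 3
    have := Finset.mem_range.1 hj
    omega
  have h2 : ∀ i, Λ (b i (r (i + (n + 1)))) = b (i + 1) (r (i + 1 + n)) := fun i => by
    rw [hb]; congr 2; omega
  simp only [add_tsub_cancel_right, h1, h2, tsub_self, zero_add]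
  rw [← hab]
  abel

/-- An exponential splitting of the iterates of `Λ`: `P` is a projection commuting with `Λ`,
`J` inverts `Λ` on the range of `P` with growth `κ` and `Λ` grows at most like `r ^ n` on the
kernel of `P`. -/
structure ExpSplitting (Λ P J : X →L[ℝ] X) (C κ r : ℝ) : Prop where
  idem : ∀ x, P (P x) = P x
  comm : ∀ x, P (Λ x) = Λ (P x)
  JP : ∀ x, J (P x) = J x
  PJ : ∀ x, P (J x) = J x
  ΛJ : ∀ x, Λ (J x) = P x
  JΛ : ∀ x, J (Λ x) = P x
  κ_nonneg : 0 ≤ κ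
  r_nonneg : 0 ≤ r
  J_pow : ∀ n x, ‖(J ^ n) x‖ ≤ C * κ ^ n * ‖x‖
  Λ_pow : ∀ n x, ‖(Λ ^ n) (x - P x)‖ ≤ C * r ^ n * ‖x‖

lemma clm_pow_succ_apply (L : X →L[ℝ] X) (n : ℕ) (x : X) : (L ^ (n + 1)) x = L ((L ^ n) x) := by
  rw [pow_succ']; rfl

lemma clm_pow_succ_apply' (L : X →L[ℝ] X) (n : ℕ) (x : X) : (L ^ (n + 1)) x = (L ^ n) (L x) := by
  rw [pow_succ]; rfl

variable {Λ P J : X →L[ℝ] X} {C κ q : ℝ}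

namespace ExpSplitting

/-- The stable family `Λ ^ i (1 - P)`. -/
def stable (Λ P : X →L[ℝ] X) (i : ℕ) : X →L[ℝ] X := Λ ^ i * (1 - P)

/-- The family `- J ^ (i + 1)`. -/
def center (J : X →L[ℝ] X) (i : ℕ) : X →L[ℝ] X := -J ^ (i + 1)

lemma stable_apply (i : ℕ) (x : X) : stable Λ P i x = (Λ ^ i) (x - P x) := rfl

lemma center_apply (i : ℕ) (x : X) : center J i x = -(J ^ (i + 1)) x := rfl

lemma norm_stable_le (h : ExpSplitting Λ P J C κ q) (hC : 0 ≤ C) (i : ℕ) :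
    ‖stable Λ P i‖ ≤ C * q ^ i :=
  ContinuousLinearMap.opNorm_le_bound _ (mul_nonneg hC (pow_nonneg h.r_nonneg _)) (h.Λ_pow i)

lemma norm_center_le (h : ExpSplitting Λ P J C κ q) (hC : 0 ≤ C) (i : ℕ) :
    ‖center J i‖ ≤ (C * κ) * κ ^ i := by
  have hκ := h.κ_nonneg
  refine ContinuousLinearMap.opNorm_le_bound _ (by positivity) fun x => ?_
  rw [center_apply, norm_neg]
  refine (h.J_pow (i + 1) x).trans (le_of_eq ?_)
  rw [pow_succ]; ring

lemma Λ_stable (i : ℕ) (x : X) : Λ (stable Λ P i x) = stable Λ P (i + 1) x := by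
  rw [stable_apply, stable_apply, clm_pow_succ_apply]

lemma P_pow (h : ExpSplitting Λ P J C κ q) (i : ℕ) (x : X) : P ((Λ ^ i) x) = (Λ ^ i) (P x) := by
  induction i with
  | zero => rfl
  | succ i ih => rw [clm_pow_succ_apply, h.comm, ih, clm_pow_succ_apply]

lemma P_stable (h : ExpSplitting Λ P J C κ q) (i : ℕ) (x : X) : P (stable Λ P i x) = 0 := by
  rw [stable_apply, h.P_pow, map_sub, h.idem, sub_self, map_zero]

lemma P_Jpow (h : ExpSplitting Λ P J C κ q) (i : ℕ) (x : X) :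
    P ((J ^ (i + 1)) x) = (J ^ (i + 1)) x := by
  rw [clm_pow_succ_apply, h.PJ]

lemma P_center (h : ExpSplitting Λ P J C κ q) (i : ℕ) (x : X) :
    P (center J i x) = center J i x := by
  rw [center_apply, map_neg, h.P_Jpow]

lemma Λ_Jpow (h : ExpSplitting Λ P J C κ q) (i : ℕ) (x : X) :
    Λ ((J ^ (i + 1)) x) = (J ^ i) (P x) := by
  induction i generalizing x with
  | zero => simpa using h.ΛJ x
  | succ i ih =>
    rw [clm_pow_succ_apply', ih, clm_pow_succ_apply', h.JP, h.PJ]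

lemma Jpow_P (h : ExpSplitting Λ P J C κ q) (i : ℕ) (x : X) :
    (J ^ (i + 1)) (P x) = (J ^ (i + 1)) x := by
  rw [clm_pow_succ_apply', h.JP, clm_pow_succ_apply']

lemma Λ_center_succ (h : ExpSplitting Λ P J C κ q) (i : ℕ) (x : X) :
    Λ (center J (i + 1) x) = center J i x := by
  rw [center_apply, center_apply, map_neg, h.Λ_Jpow, h.Jpow_P]

lemma Λ_center_zero (h : ExpSplitting Λ P J C κ q) (x : X) : Λ (center J 0 x) = -P x := by
  rw [center_apply, map_neg, h.Λ_Jpow, pow_zero]; rfl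

lemma stable_zero (x : X) : stable Λ P 0 x = x - P x := rfl

/-- A backward orbit of `Λ` of growth slower than `q⁻¹` lies in the range of `P` and is determined
by its endpoint. -/
lemma eq_zero_of_backward (h : ExpSplitting Λ P J C κ q) {d : ℕ → X} {ρ B : ℝ} (hρ : 0 < ρ)
    (hqρ : q * ρ < 1) (hd : ∀ n, d n = Λ (d (n + 1))) (hB : ∀ n, ‖d n‖ ≤ B * ρ ^ n)
    (hP : P (d 0) = 0) (hC : 0 ≤ C) (n : ℕ) : d n = 0 := by
  -- The stable component at `n` is the image under `Λ ^ i` of the one at `n + i`, hence at most a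
  -- multiple of `(q * ρ) ^ i` for every `i`.
  have h1 : ∀ n i, d n - P (d n) = (Λ ^ i) (d (n + i) - P (d (n + i))) := by
    intro n i
    induction i with
    | zero => rfl
    | succ i ih =>
      rw [ih, clm_pow_succ_apply', ← add_assoc, map_sub Λ, ← h.comm, ← hd]
  have h2 : d n - P (d n) = 0 := by
    have hlim : Tendsto (fun i : ℕ => C * B * ρ ^ n * (q * ρ) ^ i) atTop
        (𝓝 (C * B * ρ ^ n * 0)) :=
      (tendsto_pow_atTop_nhds_zero_of_lt_one (mul_nonneg h.r_nonneg hρ.le) hqρ).const_mul _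
    rw [mul_zero] at hlim
    have := ge_of_tendsto' hlim fun i => by
      have h3 : ‖d n - P (d n)‖ ≤ C * B * ρ ^ n * (q * ρ) ^ i := by
        rw [h1 n i]
        refine (h.Λ_pow i _).trans ?_
        have := pow_nonneg h.r_nonneg i
        calc C * q ^ i * ‖d (n + i)‖ ≤ C * q ^ i * (B * ρ ^ (n + i)) := by gcongr; exact hB _
          _ = _ := by rw [mul_pow, pow_add]; ring
      exact h3
    exact norm_le_zero_iff.1 this
  have h3 : P (d n) = 0 := by
    clear h2
    induction n with
    | zero => exact hP
    | succ n ih =>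
      rw [← h.idem, ← h.JΛ, ← h.comm, ← hd, ih, map_zero]
  rwa [h3, sub_zero] at h2

/-- A forward orbit of `Λ` of growth slower than `κ⁻¹` lies in the kernel of `P` and is determined
by its start. -/
lemma eq_zero_of_forward (h : ExpSplitting Λ P J C κ q) {d : ℕ → X} {ρ B : ℝ} (hρ : 0 < ρ)
    (hκρ : κ * ρ < 1) (hd : ∀ n, d (n + 1) = Λ (d n)) (hB : ∀ n, ‖d n‖ ≤ B * ρ ^ n)
    (hP : d 0 - P (d 0) = 0) (hC : 0 ≤ C) (n : ℕ) : d n = 0 := by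
  -- The component in the range of `P` is recovered from the far future by `J ^ i`, of size `κ ^ i`,
  -- against the growth `ρ ^ i`.
  have h1 : ∀ i n, P (d n) = (J ^ i) (P (d (n + i))) := by
    intro i
    induction i with
    | zero => intro n; rfl
    | succ i ih =>
      intro n
      rw [ih n, ← add_assoc, hd, clm_pow_succ_apply', h.comm, h.JΛ, h.idem]
  have h2 : P (d n) = 0 := by
    have hlim : Tendsto (fun i : ℕ => C * ‖P‖ * B * ρ ^ n * (κ * ρ) ^ i) atTop
        (𝓝 (C * ‖P‖ * B * ρ ^ n * 0)) :=
      (tendsto_pow_atTop_nhds_zero_of_lt_one (mul_nonneg h.κ_nonneg hρ.le) hκρ).const_mul _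
    rw [mul_zero] at hlim
    have := ge_of_tendsto' hlim fun i => by
      have h3 : ‖P (d n)‖ ≤ C * ‖P‖ * B * ρ ^ n * (κ * ρ) ^ i := by
        rw [h1 i n]
        refine (h.J_pow i _).trans ?_
        have := pow_nonneg h.κ_nonneg i
        calc C * κ ^ i * ‖P (d (n + i))‖ ≤ C * κ ^ i * (‖P‖ * (B * ρ ^ (n + i))) := by
              gcongr
              exact (P.le_opNorm _).trans (by gcongr; exact hB _)
          _ = _ := by rw [mul_pow, pow_add]; ring
      exact h3
    exact norm_le_zero_iff.1 this
  have h3 : ∀ n, d n - P (d n) = 0 := by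
    intro n
    induction n with
    | zero => exact hP
    | succ n ih => rw [hd, h.comm, ← map_sub, ih, map_zero]
  have h4 := h3 n
  rwa [h2, sub_zero] at h4

end ExpSplitting

end Discrete

end

end Vorticity

namespace Vorticity

noncomputable section

/-! ### Lyapunov–Perron fixed points for a perturbed linear map -/

section Discrete

variable {X : Type*} [NormedAddCommGroup X] [NormedSpace ℝ X]

lemma WeightBound.mono {T : ℕ → ℕ → X →L[ℝ] X} {e : ℕ → ℕ} {ρ M M' : ℝ}
    (hT : WeightBound T e ρ M) (h : M ≤ M') : WeightBound T e ρ M' :=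
  ⟨hT.pos, hT.summable, fun n =>
    (hT.tsum_le n).trans (mul_le_mul_of_nonneg_right h (pow_nonneg hT.pos.le n))⟩

variable [CompleteSpace X]

/-- The fixed point as a function of the datum `ζ`. The comparison with the linear part `A n ζ`
carries a factor `δ`, which later keeps the slopes of the graphs small. Uniqueness is asserted in
the larger space of weight `ρ₂`. -/
theorem WeightBound.exists_family {Z : Type*} [NormedAddCommGroup Z] [NormedSpace ℝ Z]
    {T : ℕ → ℕ → X →L[ℝ] X} {e : ℕ → ℕ} {ρ₁ ρ₂ M : ℝ} (hT₁ : WeightBound T e ρ₁ M)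
    (hT₂ : WeightBound T e ρ₂ M) {δ : ℝ} (hδ0 : 0 ≤ δ) (hδ : δ * M ≤ 1 / 2) (h12 : ρ₁ < ρ₂)
    {N : ℕ → X → X} (hN : ∀ j x y, ‖N j x - N j y‖ ≤ δ * ‖x - y‖) (hN0 : ∀ j, N j 0 = 0)
    {A : ℕ → Z →L[ℝ] X} {C : ℝ} (hA : ∀ n, ‖A n‖ ≤ C * ρ₁ ^ n) :
    ∃ u : Z → ℕ → X,
      (∀ ζ n, u ζ n = A n ζ + ∑' j, T n j (N j (u ζ (e j)))) ∧
      (∀ ζ n, ‖u ζ n‖ ≤ 2 * C * ‖ζ‖ * ρ₁ ^ n) ∧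
      (∀ ζ ζ' n, ‖u ζ n - u ζ' n‖ ≤ 2 * C * ‖ζ - ζ'‖ * ρ₁ ^ n) ∧
      (∀ ζ ζ' n, ‖(u ζ n - A n ζ) - (u ζ' n - A n ζ')‖ ≤
        δ * M * (2 * C) * ‖ζ - ζ'‖ * ρ₁ ^ n) ∧
      ∀ ζ v, (∀ n, v n = A n ζ + ∑' j, T n j (N j (v (e j)))) →
        (∃ B, ∀ n, ‖v n‖ ≤ B * ρ₂ ^ n) → v = u ζ := by
  have h0 := hT₁.pos
  have h2 := hT₂.pos
  have hC0 : 0 ≤ C := by simpa using (norm_nonneg _).trans (hA 0)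
  have hpow : ∀ i, ρ₁ ^ i ≤ ρ₂ ^ i := fun i => pow_le_pow_left₀ h0.le h12.le i
  have hAz : ∀ ζ n, ‖A n ζ‖ ≤ C * ‖ζ‖ * ρ₁ ^ n := fun ζ n => by
    calc _ ≤ (C * ρ₁ ^ n) * ‖ζ‖ := (A n).le_of_opNorm_le (hA n) ζ
      _ = _ := by ring
  have hr : ∀ {ρ B : ℝ} {v : ℕ → X}, (∀ n, ‖v n‖ ≤ B * ρ ^ n) →
      ∀ j, ‖N j (v (e j))‖ ≤ (δ * B) * ρ ^ e j := fun {ρ B v} hB j => by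
    have := hN j (v (e j)) 0
    rw [hN0, sub_zero, sub_zero] at this
    refine this.trans ?_
    rw [mul_assoc]
    gcongr
    exact hB _
  have hex : ∀ ζ, ∃ u : ℕ → X, (∀ n, u n = A n ζ + ∑' j, T n j (N j (u (e j)))) ∧
      ∀ n, ‖u n‖ ≤ 2 * (C * ‖ζ‖) * ρ₁ ^ n := fun ζ =>
    hT₁.exists_fixedPoint hδ0 hδ hN hN0 (hAz ζ)
  choose u hu hub using hex
  have hdiff : ∀ {ρ : ℝ} (_ : WeightBound T e ρ M) {v v' : ℕ → X} {ζ ζ' : Z} {B B' : ℝ},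
      (∀ n, v n = A n ζ + ∑' j, T n j (N j (v (e j)))) →
      (∀ n, v' n = A n ζ' + ∑' j, T n j (N j (v' (e j)))) → (∀ n, ‖v n‖ ≤ B * ρ ^ n) →
      (∀ n, ‖v' n‖ ≤ B' * ρ ^ n) → ∀ n, v n - v' n = A n (ζ - ζ') +
        ∑' j, T n j (N j (v (e j)) - N j (v' (e j))) :=
    fun {ρ} hT {v v' ζ ζ' B B'} hv hv' hB hB' n => by
      simp only [map_sub]
      rw [(hT.summable_apply (hr hB) n).tsum_sub (hT.summable_apply (hr hB') n), hv n, hv' n]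
      abel
  have hlip : ∀ ζ ζ' n, ‖u ζ n - u ζ' n‖ ≤ 2 * C * ‖ζ - ζ'‖ * ρ₁ ^ n := fun ζ ζ' n => by
    have := hT₁.norm_le_of_eq (d := fun n => u ζ n - u ζ' n) (O := 0)
      (B₀ := 2 * (C * ‖ζ‖) + 2 * (C * ‖ζ'‖)) hδ hδ0
      (hdiff hT₁ (hu ζ) (hu ζ') (hub ζ) (hub ζ'))
      (fun j => by simpa using hN j _ _) (hAz (ζ - ζ'))
      (fun n => by
        rw [add_mul]
        exact (norm_sub_le _ _).trans (add_le_add (hub ζ n) (hub ζ' n))) n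
    simpa [mul_assoc] using this
  refine ⟨u, hu, fun ζ n => by simpa [mul_assoc] using hub ζ n, hlip, fun ζ ζ' n => ?_,
    fun ζ v hv ⟨B, hB⟩ => ?_⟩
  · have h1 := hdiff hT₁ (hu ζ) (hu ζ') (hub ζ) (hub ζ') n
    have h2 : (u ζ n - A n ζ) - (u ζ' n - A n ζ') =
        ∑' j, T n j (N j (u ζ (e j)) - N j (u ζ' (e j))) := by
      rw [sub_sub_sub_comm, h1, map_sub]
      abel
    rw [h2]
    refine (hT₁.norm_tsum_le (B := δ * (2 * C * ‖ζ - ζ'‖)) (fun j => ?_) n).trans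
      (le_of_eq (by ring))
    refine (hN j _ _).trans ?_
    rw [mul_assoc]
    gcongr
    exact hlip _ _ _
  · funext n
    have hub₂ : ∀ n, ‖u ζ n‖ ≤ 2 * (C * ‖ζ‖) * ρ₂ ^ n := fun n =>
      (hub ζ n).trans (by gcongr)
    have := hT₂.norm_le_of_eq (d := fun n => v n - u ζ n) (O := 0) (E := 0)
      (b := fun n => A n (ζ - ζ))
      (B₀ := B + 2 * (C * ‖ζ‖)) hδ hδ0 (hdiff hT₂ hv (hu ζ) hB hub₂)
      (fun j => by simpa using hN j _ _) (fun n => by simp)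
      (fun n => by
        rw [add_mul]
        exact (norm_sub_le _ _).trans (add_le_add (hB n) (hub₂ n))) n
    rw [← sub_eq_zero, ← norm_le_zero_iff]
    simpa using this

namespace ExpSplitting

variable {Λ P J : X →L[ℝ] X} {C κ q : ℝ}

/-- Backward Lyapunov–Perron: orbits of `Λ + R` on the negative integers of growth between
`κ` and `q⁻¹` form a graph over the range of `P`. -/
theorem exists_backward (h : ExpSplitting Λ P J C κ q) (hC : 0 ≤ C) {s₁ s₂ : ℝ} (h1 : κ < s₁)
    (h12 : s₁ < s₂) (h2 : q * s₂ < 1) :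
    ∃ M, 0 < M ∧ ∀ δ, 0 ≤ δ → δ * M ≤ 1 / 2 → ∀ R : X → X, ContDiff ℝ 1 R →
      (∀ x y, ‖R x - R y‖ ≤ δ * ‖x - y‖) → R 0 = 0 →
      ∃ u : LinearMap.range P.toLinearMap → ℕ → X,
        (∀ ζ n, u ζ n = Λ (u ζ (n + 1)) + R (u ζ (n + 1))) ∧
        (∀ ζ, P (u ζ 0) = ζ) ∧
        (∀ ζ n, ‖u ζ n‖ ≤ 2 * C * ‖ζ‖ * s₁ ^ n) ∧
        (∀ ζ ζ' n, ‖u ζ n - u ζ' n‖ ≤ 2 * C * ‖ζ - ζ'‖ * s₁ ^ n) ∧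
        (∀ ζ ζ', ‖(u ζ 0 - ζ) - (u ζ' 0 - ζ')‖ ≤ δ * M * (2 * C) * ‖ζ - ζ'‖) ∧
        (∀ v : ℕ → X, (∀ n, v n = Λ (v (n + 1)) + R (v (n + 1))) →
          (∃ B, ∀ n, ‖v n‖ ≤ B * s₂ ^ n) →
            ∀ ζ : LinearMap.range P.toLinearMap, P (v 0) = ζ → v = u ζ) ∧
        ContDiff ℝ 1 (fun ζ => u ζ 0) ∧
        (fderiv ℝ R 0 = 0 →
          HasFDerivAt (fun ζ => u ζ 0) (LinearMap.range P.toLinearMap).subtypeL 0) := by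
  have hκ := h.κ_nonneg
  have hq := h.r_nonneg
  have hs1 : 0 < s₁ := hκ.trans_lt h1
  have hs2 : 0 < s₂ := hs1.trans h12
  have h2' : q * s₁ < 1 := (mul_le_mul_of_nonneg_left h12.le hq).trans_lt h2
  -- In backward time the branch `center J`, of size `κ ^ i`, lies below the diagonal and the stable
  -- branch above it; this dictates `κ < s` and `q * s < 1`. The shift is `1` because the recursion
  -- evaluates `R` at `n + 1`.
  have hK : ∀ s, κ < s → q * s < 1 → WeightBound (splitKernel (center J) (stable Λ P))
      (fun j => j + 1) s ((C * κ + C) * s ^ 1 * (1 / (s - κ) + 1 / (1 - q * s))) :=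
    fun s hs hs' => weightBound_splitKernel hκ hq
      (fun i => (h.norm_center_le hC i).trans (by gcongr; linarith))
      (fun i => (h.norm_stable_le hC i).trans (by
        gcongr; linarith [mul_nonneg hC hκ])) hs hs' 1
  obtain ⟨M, hM0, hT₁, hT₂⟩ : ∃ M, 0 < M ∧ WeightBound (splitKernel (center J) (stable Λ P))
      (fun j => j + 1) s₁ M ∧ WeightBound (splitKernel (center J) (stable Λ P))
      (fun j => j + 1) s₂ M :=
    ⟨max 1 (max _ _), by positivity, (hK s₁ h1 h2').mono ((le_max_left _ _).trans
      (le_max_right _ _)), (hK s₂ (h1.trans h12) h2).mono ((le_max_right _ _).trans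
      (le_max_right _ _))⟩
  refine ⟨M, hM0, fun δ hδ0 hδ R hRd hR hR0 => ?_⟩
  set Ec := LinearMap.range P.toLinearMap
  have hPEc : ∀ ζ : Ec, P ζ = ζ := by
    rintro ⟨_, x, rfl⟩
    exact h.idem x
  -- Backward orbits of the linear map inside the range of `P`.
  let A : ℕ → Ec →L[ℝ] X := fun n => (J ^ n).comp Ec.subtypeL
  have hA : ∀ n, ‖A n‖ ≤ C * s₁ ^ n := fun n =>
    ContinuousLinearMap.opNorm_le_bound _ (by positivity) fun ζ => by
      refine (h.J_pow n ζ).trans ?_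
      change C * κ ^ n * ‖ζ‖ ≤ _
      gcongr
  have hA_apply : ∀ n ζ, A n ζ = (J ^ n) ζ := fun _ _ => rfl
  have hAΛ : ∀ n ζ, Λ (A (n + 1) ζ) = A n ζ := fun n ζ => by
    rw [hA_apply, hA_apply, h.Λ_Jpow, hPEc]
  obtain ⟨u, hu, hub, hlip, hlip', huniq⟩ := hT₁.exists_family hT₂ hδ0 hδ h12
    (N := fun _ => R) (fun _ => hR) (fun _ => hR0) hA
  have hsum : ∀ {s B : ℝ} (_ : WeightBound (splitKernel (center J) (stable Λ P))
      (fun j => j + 1) s M) {v : ℕ → X}, (∀ n, ‖v n‖ ≤ B * s ^ n) → ∀ n, Summable fun j =>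
      splitKernel (center J) (stable Λ P) n j (R (v (j + 1))) := fun {s B} hT {v} hv n =>
    hT.summable_apply (B := δ * B) (fun j => by
      have := hR (v (j + 1)) 0
      rw [hR0, sub_zero, sub_zero] at this
      refine this.trans ?_
      rw [mul_assoc]
      gcongr
      exact hv _) n
  have hrec : ∀ {v : ℕ → X}, (∀ n, Summable fun j =>
      splitKernel (center J) (stable Λ P) n j (R (v (j + 1)))) → ∀ n,
      ∑' j, splitKernel (center J) (stable Λ P) n j (R (v (j + 1))) =
      Λ (∑' j, splitKernel (center J) (stable Λ P) (n + 1) j (R (v (j + 1)))) +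
        R (v (n + 1)) := fun hs n =>
    tsum_splitKernel_backward (r := fun j => R _) hs h.Λ_center_succ Λ_stable
      (fun x => by rw [h.Λ_center_zero, stable_zero]; abel) n
  have hPT : ∀ {v : ℕ → X}, (∀ n, Summable fun j =>
      splitKernel (center J) (stable Λ P) n j (R (v (j + 1)))) →
      P (∑' j, splitKernel (center J) (stable Λ P) 0 j (R (v (j + 1)))) = 0 := fun hs => by
    rw [tsum_splitKernel (hs 0), Finset.range_zero, Finset.sum_empty, zero_add,
      P.map_tsum (summable_splitKernel_tail (hs 0))]
    simp [h.P_stable]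
  refine ⟨u, fun ζ n => ?_, fun ζ => ?_, hub, hlip, fun ζ ζ' => ?_, fun v hv hvb ζ hζ => ?_, ?_⟩
  · have hs := hsum hT₁ (hub ζ)
    rw [hu ζ n, hrec hs n, ← hAΛ n ζ]
    conv_rhs => rw [hu ζ (n + 1)]
    rw [map_add, hu ζ (n + 1)]
    abel
  · rw [hu ζ 0, map_add, hPT (hsum hT₁ (hub ζ)), add_zero]
    exact hPEc ζ
  · have := hlip' ζ ζ' 0
    rw [pow_zero, mul_one] at this
    exact this
  · obtain ⟨B, hB⟩ := hvb
    have hs := hsum hT₂ hB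
    refine huniq ζ v (fun n => ?_) ⟨B, hB⟩
    have hr : ∀ j, ‖R (v (j + 1))‖ ≤ (δ * B) * s₂ ^ (j + 1) := fun j => by
      have := hR (v (j + 1)) 0
      rw [hR0, sub_zero, sub_zero] at this
      refine this.trans ?_
      rw [mul_assoc]
      gcongr
      exact hB _
    -- An orbit minus the right side of its Lyapunov–Perron equation is a backward orbit of `Λ` with
    -- admissible growth and no component in the range of `P`, hence zero.
    have := h.eq_zero_of_backward (d := fun n => v n - (A n ζ +
      ∑' j, splitKernel (center J) (stable Λ P) n j (R (v (j + 1)))))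
      (B := B + (C * ‖ζ‖ + δ * B * M)) hs2 h2 (fun n => ?_) (fun n => ?_) ?_ hC n
    · exact sub_eq_zero.1 this
    · rw [hrec hs n, map_sub, map_add, hAΛ]
      conv_lhs => rw [hv n]
      abel
    · rw [add_mul, add_mul]
      have hAn : ‖A n ζ‖ ≤ C * ‖ζ‖ * s₂ ^ n := by
        calc _ ≤ (C * s₁ ^ n) * ‖ζ‖ := (A n).le_of_opNorm_le (hA n) ζ
          _ = C * ‖ζ‖ * s₁ ^ n := by ring
          _ ≤ _ := by gcongr
      exact (norm_sub_le _ _).trans (add_le_add (hB n) ((norm_add_le _ _).trans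
        (add_le_add hAn (hT₂.norm_tsum_le hr n))))
    · rw [map_sub, map_add, hPT hs, add_zero, hζ]
      change (ζ : X) - P ζ = 0
      rw [hPEc, sub_self]
  · obtain ⟨U, hU, hUc, hU0⟩ := hT₁.hasFDerivAt_fixedPoint hT₂ hδ0 hδ h12
      (tendsto_add_atTop_nat 1) (N := fun _ => R) (fun _ => hRd) (fun _ => hR) (fun _ => hR0) hA
      hu (fun ζ => ⟨_, hub ζ⟩)
    refine ⟨?_, fun hR' => ?_⟩
    · rw [contDiff_one_iff_fderiv]
      refine ⟨fun ζ => (hU ζ 0).differentiableAt, ?_⟩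
      have : fderiv ℝ (fun ζ => u ζ 0) = fun ζ => U ζ 0 := funext fun ζ => (hU ζ 0).fderiv
      rw [this]
      exact hUc 0
    · have h3 : U 0 0 = Ec.subtypeL := by
        rw [hU0 0 (fun j => ?_) 0]
        · rfl
        · have : u 0 (j + 1) = 0 := by simpa using hub 0 (j + 1)
          rw [this]
          exact hR'
      rw [← h3]
      exact hU 0 0

/-- Forward Lyapunov–Perron: perturbations `y` of the orbits `x w` of `Λ + R` which decay with a
rate between `q` and `κ⁻¹` form a graph over the kernel of `P`. -/
theorem exists_forward (h : ExpSplitting Λ P J C κ q) (hC : 0 ≤ C) {t₁ t₂ : ℝ} (h1 : q < t₁)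
    (h12 : t₁ < t₂) (h2 : κ * t₂ < 1) :
    ∃ M, 0 < M ∧ ∀ δ, 0 ≤ δ → δ * M ≤ 1 / 2 → ∀ R : X → X, ContDiff ℝ 1 R →
      (∀ x y, ‖R x - R y‖ ≤ δ * ‖x - y‖) → ∀ x : X → ℕ → X, (∀ n, Continuous fun w => x w n) →
      ∃ y : X → LinearMap.ker P.toLinearMap → ℕ → X,
        (∀ w η n, y w η (n + 1) = Λ (y w η n) + (R (x w n + y w η n) - R (x w n))) ∧
        (∀ w η, y w η 0 - P (y w η 0) = η) ∧
        (∀ w η n, ‖y w η n‖ ≤ 2 * C * ‖η‖ * t₁ ^ n) ∧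
        (∀ w η η', ‖(y w η 0 - η) - (y w η' 0 - η')‖ ≤ δ * M * (2 * C) * ‖η - η'‖) ∧
        (∀ w (v : ℕ → X), (∀ n, v (n + 1) = Λ (v n) + (R (x w n + v n) - R (x w n))) →
          (∃ B, ∀ n, ‖v n‖ ≤ B * t₂ ^ n) →
            ∀ η : LinearMap.ker P.toLinearMap, v 0 - P (v 0) = η → v = y w η) ∧
        (∀ w, ContDiff ℝ 1 (fun η => y w η 0)) ∧
        Continuous fun p : X × LinearMap.ker P.toLinearMap => y p.1 p.2 0 := by
  have hκ := h.κ_nonneg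
  have hq := h.r_nonneg
  have ht1 : 0 < t₁ := hq.trans_lt h1
  have ht2 : 0 < t₂ := ht1.trans h12
  have h2' : κ * t₁ < 1 := (mul_le_mul_of_nonneg_left h12.le hκ).trans_lt h2
  -- Forward time exchanges the branches: the stable one is below the diagonal, and the weight
  -- satisfies `q < s` and `κ * s < 1`.
  have hK : ∀ s, q < s → κ * s < 1 → WeightBound (splitKernel (stable Λ P) (center J))
      (fun j => j + 0) s ((C * κ + C) * s ^ 0 * (1 / (s - q) + 1 / (1 - κ * s))) :=
    fun s hs hs' => weightBound_splitKernel hq hκ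
      (fun i => (h.norm_stable_le hC i).trans (by
        gcongr; linarith [mul_nonneg hC hκ]))
      (fun i => (h.norm_center_le hC i).trans (by gcongr; linarith)) hs hs' 0
  obtain ⟨M, hM0, hT₁, hT₂⟩ : ∃ M, 0 < M ∧ WeightBound (splitKernel (stable Λ P) (center J))
      (fun j => j) t₁ M ∧ WeightBound (splitKernel (stable Λ P) (center J))
      (fun j => j) t₂ M :=
    ⟨max 1 (max _ _), by positivity, (hK t₁ h1 h2').mono ((le_max_left _ _).trans
      (le_max_right _ _)), (hK t₂ (h1.trans h12) h2).mono ((le_max_right _ _).trans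
      (le_max_right _ _))⟩
  refine ⟨M, hM0, fun δ hδ0 hδ R hRd hR x hx => ?_⟩
  set Es := LinearMap.ker P.toLinearMap
  have hPEs : ∀ η : Es, P η = 0 := fun η => η.2
  let A : ℕ → Es →L[ℝ] X := fun n => (Λ ^ n).comp Es.subtypeL
  have hA : ∀ n, ‖A n‖ ≤ C * t₁ ^ n := fun n =>
    ContinuousLinearMap.opNorm_le_bound _ (by positivity) fun η => by
      have := h.Λ_pow n η
      rw [hPEs, sub_zero] at this
      refine this.trans ?_
      change C * q ^ n * ‖η‖ ≤ _
      gcongr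
  have hA_apply : ∀ n η, A n η = (Λ ^ n) η := fun _ _ => rfl
  have hAΛ : ∀ n η, Λ (A n η) = A (n + 1) η := fun n η => by
    rw [hA_apply, hA_apply, clm_pow_succ_apply]
  -- The increment of `R` along the reference orbit depends on the index and on `w`, but it vanishes
  -- at `0` and inherits the Lipschitz constant of `R`.
  let N : X → ℕ → X → X := fun w j z => R (x w j + z) - R (x w j)
  have hN : ∀ w j z z', ‖N w j z - N w j z'‖ ≤ δ * ‖z - z'‖ := fun w j z z' => by
    have := hR (x w j + z) (x w j + z')
    rwa [add_sub_add_left_eq_sub, ← sub_sub_sub_cancel_right _ _ (R (x w j))] at this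
  have hN0 : ∀ w j, N w j 0 = 0 := fun w j => by simp [N]
  have hfam := fun w => hT₁.exists_family hT₂ hδ0 hδ h12 (hN w) (hN0 w) hA
  choose y hy hyb hlip hlip' huniq using hfam
  have hsum : ∀ {s B : ℝ} (_ : WeightBound (splitKernel (stable Λ P) (center J))
      (fun j => j) s M) (w) {v : ℕ → X}, (∀ n, ‖v n‖ ≤ B * s ^ n) → ∀ n, Summable fun j =>
      splitKernel (stable Λ P) (center J) n j (N w j (v j)) := fun {s B} hT w {v} hv n =>
    hT.summable_apply (B := δ * B) (fun j => by
      have := hN w j (v j) 0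
      rw [hN0, sub_zero, sub_zero] at this
      refine this.trans ?_
      rw [mul_assoc]
      gcongr
      exact hv _) n
  have hrec : ∀ {w} {v : ℕ → X}, (∀ n, Summable fun j =>
      splitKernel (stable Λ P) (center J) n j (N w j (v j))) → ∀ n,
      ∑' j, splitKernel (stable Λ P) (center J) (n + 1) j (N w j (v j)) =
      Λ (∑' j, splitKernel (stable Λ P) (center J) n j (N w j (v j))) + N w n (v n) :=
    fun {w v} hs n =>
    tsum_splitKernel_forward (r := fun j => N w j (v j)) hs Λ_stable h.Λ_center_succ
      (fun x => by rw [h.Λ_center_zero, stable_zero]; abel) n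
  have hPT : ∀ {w} {v : ℕ → X}, (∀ n, Summable fun j =>
      splitKernel (stable Λ P) (center J) n j (N w j (v j))) →
      P (∑' j, splitKernel (stable Λ P) (center J) 0 j (N w j (v j))) =
        ∑' j, splitKernel (stable Λ P) (center J) 0 j (N w j (v j)) := fun hs => by
    rw [tsum_splitKernel (hs 0), Finset.range_zero, Finset.sum_empty, zero_add,
      P.map_tsum (summable_splitKernel_tail (hs 0))]
    simp [h.P_center]
  refine ⟨y, fun w η n => ?_, fun w η => ?_, hyb, fun w η η' => ?_,
    fun w v hv hvb η hη => ?_, fun w => ?_, ?_⟩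
  · have hs := hsum hT₁ w (hyb w η)
    rw [hy w η (n + 1), hrec hs n, ← hAΛ n η, ← add_assoc, ← map_add, ← hy w η n]
  · rw [hy w η 0, map_add, hPT (hsum hT₁ w (hyb w η))]
    change (η : X) + _ - (P η + _) = η
    rw [hPEs]
    abel
  · have := hlip' w η η' 0
    rw [pow_zero, mul_one] at this
    exact this
  · obtain ⟨B, hB⟩ := hvb
    have hs := hsum hT₂ w hB
    refine huniq w η v (fun n => ?_) ⟨B, hB⟩
    have hr : ∀ j, ‖N w j (v j)‖ ≤ (δ * B) * t₂ ^ j := fun j => by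
      have := hN w j (v j) 0
      rw [hN0, sub_zero, sub_zero] at this
      refine this.trans ?_
      rw [mul_assoc]
      gcongr
      exact hB _
    have := h.eq_zero_of_forward (d := fun n => v n - (A n η +
      ∑' j, splitKernel (stable Λ P) (center J) n j (N w j (v j))))
      (B := B + (C * ‖η‖ + δ * B * M)) ht2 h2 (fun n => ?_) (fun n => ?_) ?_ hC n
    · exact sub_eq_zero.1 this
    · rw [hrec hs n, map_sub, map_add, hAΛ, hv n]
      change _ + N w n (v n) - _ = _
      abel
    · rw [add_mul, add_mul]
      have hAn : ‖A n η‖ ≤ C * ‖η‖ * t₂ ^ n := by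
        calc _ ≤ (C * t₁ ^ n) * ‖η‖ := (A n).le_of_opNorm_le (hA n) η
          _ = C * ‖η‖ * t₁ ^ n := by ring
          _ ≤ _ := by gcongr
      exact (norm_sub_le _ _).trans (add_le_add (hB n) ((norm_add_le _ _).trans
        (add_le_add hAn (hT₂.norm_tsum_le hr n))))
    · rw [map_sub, map_add, hPT hs, sub_sub_sub_comm, hη]
      change (η : X) - (η + _ - (P η + _)) = 0
      rw [hPEs]
      abel
  · obtain ⟨U, hU, hUc, -⟩ := hT₁.hasFDerivAt_fixedPoint hT₂ hδ0 hδ h12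
      tendsto_id (N := N w) (fun j => (hRd.comp (contDiff_const.add contDiff_id)).sub
        contDiff_const) (hN w) (hN0 w) hA (hy w) (fun η => ⟨_, hyb w η⟩)
    rw [contDiff_one_iff_fderiv]
    refine ⟨fun η => (hU η 0).differentiableAt, ?_⟩
    have : fderiv ℝ (fun η => y w η 0) = fun η => U η 0 := funext fun η => (hU η 0).fderiv
    rw [this]
    exact hUc 0
  -- Joint continuity in the base point and the leaf coordinate. Only continuity of each `x w n` in
  -- `w` is available, which is why the version with loss of weight is needed.
  · refine hT₂.continuous_fixedPoint (W := X × Es) hδ0 hδ ht1 h12 tendsto_id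
      (N := fun p => N p.1) (fun p => hN p.1) (fun p => hN0 p.1) (fun j z => ?_)
      (a := fun p n => A n p.2) (u := fun p => y p.1 p.2) (fun p ε hε => ?_)
      (fun p => hy p.1 p.2) (fun p => ⟨_, hyb p.1 p.2⟩) 0
    · have h3 : Continuous fun p : X × Es => x p.1 j := (hx j).comp continuous_fst
      exact (hRd.continuous.comp (h3.add continuous_const)).sub (hRd.continuous.comp h3)
    · have h3 : Tendsto (fun p' : X × Es => C * ‖p'.2 - p.2‖) (𝓝 p) (𝓝 0) := by
        have : Continuous fun p' : X × Es => C * ‖p'.2 - p.2‖ := by fun_prop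
        simpa using this.tendsto p
      filter_upwards [h3.eventually (ge_mem_nhds hε)] with p' hp' n
      rw [← map_sub]
      calc _ ≤ (C * t₁ ^ n) * ‖p'.2 - p.2‖ := (A n).le_of_opNorm_le (hA n) _
        _ = (C * ‖p'.2 - p.2‖) * t₁ ^ n := by ring
        _ ≤ ε * t₂ ^ n := by gcongr

end ExpSplitting

end Discrete

end

end Vorticity

namespace Vorticity

noncomputable section

/-! ### Growth rates -/

section Rates

variable {X : Type*} [NormedAddCommGroup X]

lemma enorm_le_exp_iff {x : X} {c : ℝ} :
    ‖x‖ ≤ Real.exp c ↔ ENNReal.log ‖x‖ₑ ≤ (c : EReal) := by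
  have h1 : ENNReal.log (ENNReal.ofReal (Real.exp c)) = (c : EReal) := by
    rw [ENNReal.log_ofReal_of_pos (Real.exp_pos c), Real.log_exp]
  rw [← h1, ENNReal.log_le_log_iff, ← ofReal_norm, ENNReal.ofReal_le_ofReal_iff (Real.exp_pos c).le]

lemma norm_le_exp_iff {x : X} {c t : ℝ} (ht : 0 < t) :
    ‖x‖ ≤ Real.exp (c * t) ↔ ENNReal.log ‖x‖ₑ / (t : EReal) ≤ (c : EReal) := by
  rw [enorm_le_exp_iff, EReal.div_le_iff_le_mul (by exact_mod_cast ht) (EReal.coe_ne_top _),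
    ← EReal.coe_mul, mul_comm]

lemma exists_forall_norm_le_of_eventually {v : ℕ → X} {s B : ℝ} (hs : 0 < s)
    (h : ∀ᶠ n in atTop, ‖v n‖ ≤ B * s ^ n) : ∃ B', ∀ n, ‖v n‖ ≤ B' * s ^ n := by
  obtain ⟨n₀, hn₀⟩ := eventually_atTop.1 h
  have hnn : ∀ i, 0 ≤ ‖v i‖ / s ^ i := fun i => by positivity
  refine ⟨max B 0 + ∑ i ∈ Finset.range n₀, ‖v i‖ / s ^ i, fun n => ?_⟩
  have hsum : 0 ≤ ∑ i ∈ Finset.range n₀, ‖v i‖ / s ^ i := Finset.sum_nonneg fun i _ => hnn i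
  have hp := pow_pos hs n
  by_cases hn : n₀ ≤ n
  · refine (hn₀ n hn).trans ?_
    gcongr
    linarith [le_max_left B 0]
  · rw [← div_le_iff₀ hp]
    have := Finset.single_le_sum (f := fun i => ‖v i‖ / s ^ i) (fun i _ => hnn i)
      (Finset.mem_range.2 (not_le.1 hn))
    linarith [le_max_right B 0]

/-- The constant `B` does not affect the rate: any exponent `z > c` absorbs it, and then `z`
decreases to `c`. -/
lemma expRate_le {u : ℝ → X} {l : Filter ℝ} (hl : Tendsto (fun τ : ℝ => |τ|) l atTop) {B c : ℝ}
    (h : ∀ᶠ τ in l, ‖u τ‖ ≤ B * Real.exp (c * |τ|)) : expRate u l ≤ (c : EReal) := by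
  refine (EReal.le_of_forall_lt_iff_le).1 fun z hz => ?_
  have hz' : c < z := by exact_mod_cast hz
  have h1 : Tendsto (fun τ : ℝ => Real.exp ((z - c) * |τ|)) l atTop :=
    Real.tendsto_exp_atTop.comp (hl.const_mul_atTop (sub_pos.2 hz'))
  refine limsup_le_of_le (by isBoundedDefault) ?_
  filter_upwards [h, h1.eventually_ge_atTop B, hl.eventually_gt_atTop 0] with τ hτ hB hpos
  rw [← norm_le_exp_iff hpos]
  calc ‖u τ‖ ≤ B * Real.exp (c * |τ|) := hτ
    _ ≤ Real.exp ((z - c) * |τ|) * Real.exp (c * |τ|) := by gcongr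
    _ = _ := by rw [← Real.exp_add]; ring_nf

/-- A rate gives an exponential bound without constant only for a strictly larger exponent. This
loss is why room between the exponents is kept throughout. -/
lemma eventually_norm_le_of_expRate_le {u : ℝ → X} {l : Filter ℝ}
    (hl : Tendsto (fun τ : ℝ => |τ|) l atTop) {c c' : ℝ} (hc : c < c')
    (h : expRate u l ≤ (c : EReal)) : ∀ᶠ τ in l, ‖u τ‖ ≤ Real.exp (c' * |τ|) := by
  have h1 : expRate u l < (c' : EReal) := h.trans_lt (by exact_mod_cast hc)
  filter_upwards [eventually_lt_of_limsup_lt h1 (by isBoundedDefault),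
    hl.eventually_gt_atTop 0] with τ hτ hpos
  exact (norm_le_exp_iff hpos).2 hτ.le

end Rates

/-! ### Semiflows -/

section Semiflow

variable {X : Type*} [NormedAddCommGroup X]

/-- A continuous semiflow fixing the origin, with time-`t` maps that are Lipschitz uniformly
for `t ∈ [0, 1]`. -/
structure LipSemiflow (Φ : ℝ → X → X) : Prop where
  zero : ∀ x, Φ 0 x = x
  add : ∀ s t, 0 ≤ s → 0 ≤ t → ∀ x, Φ (s + t) x = Φ s (Φ t x)
  continuousOn : ContinuousOn (fun p : ℝ × X => Φ p.1 p.2) (Ici 0 ×ˢ univ)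
  lip : ∃ L, ∀ t ∈ Icc (0 : ℝ) 1, ∀ x y, ‖Φ t x - Φ t y‖ ≤ L * ‖x - y‖
  map_zero : ∀ t, 0 ≤ t → Φ t 0 = 0

namespace LipSemiflow

variable {Φ : ℝ → X → X}

lemma exists_lip (h : LipSemiflow Φ) (T : ℝ) :
    ∃ L : ℝ≥0, ∀ t ∈ Icc 0 T, ∀ x y, ‖Φ t x - Φ t y‖ ≤ L * ‖x - y‖ := by
  obtain ⟨L, hL⟩ := h.lip
  have key : ∀ n : ℕ, ∃ K : ℝ≥0, ∀ t ∈ Icc (0 : ℝ) n, ∀ x y, ‖Φ t x - Φ t y‖ ≤ K * ‖x - y‖ := by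
    intro n
    induction n with
    | zero =>
      refine ⟨1, fun t ht x y => ?_⟩
      have : t = 0 := le_antisymm (by simpa using ht.2) ht.1
      simp [this, h.zero]
    | succ n ih =>
      obtain ⟨K, hK⟩ := ih
      refine ⟨max K (L.toNNReal * K), fun t ht x y => ?_⟩
      by_cases htn : t ≤ n
      · refine (hK t ⟨ht.1, htn⟩ x y).trans ?_
        gcongr
        exact le_max_left _ _
      · push Not at htn
        have ht1 : t - n ∈ Icc (0 : ℝ) 1 :=
          ⟨sub_nonneg.2 htn.le, by have := ht.2; push_cast at this; linarith⟩
        have hn : (n : ℝ) ∈ Icc (0 : ℝ) n := ⟨n.cast_nonneg, le_rfl⟩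
        have hadd : ∀ x, Φ t x = Φ (t - n) (Φ n x) := fun x => by
          rw [← h.add _ _ ht1.1 n.cast_nonneg, sub_add_cancel]
        rw [hadd, hadd]
        calc _ ≤ L * ‖Φ n x - Φ n y‖ := hL _ ht1 _ _
          _ ≤ L.toNNReal * ‖Φ n x - Φ n y‖ := by gcongr; exact Real.le_coe_toNNReal L
          _ ≤ L.toNNReal * (K * ‖x - y‖) := by gcongr; exact hK n hn x y
          _ = ((L.toNNReal * K : ℝ≥0) : ℝ) * ‖x - y‖ := by push_cast; ring
          _ ≤ _ := by gcongr; exact le_max_right _ _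
  obtain ⟨K, hK⟩ := key ⌈T⌉₊
  exact ⟨K, fun t ht => hK t ⟨ht.1, ht.2.trans (Nat.le_ceil T)⟩⟩

lemma comm (h : LipSemiflow Φ) {s t : ℝ} (hs : 0 ≤ s) (ht : 0 ≤ t) (x : X) :
    Φ s (Φ t x) = Φ t (Φ s x) := by
  rw [← h.add s t hs ht, add_comm, h.add t s ht hs]

lemma nat_succ (h : LipSemiflow Φ) (n : ℕ) (x : X) : Φ (n + 1 : ℕ) x = Φ 1 (Φ n x) := by
  rw [← h.add _ _ zero_le_one n.cast_nonneg]
  push_cast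
  rw [add_comm]

lemma continuous_apply (h : LipSemiflow Φ) {t : ℝ} (ht : 0 ≤ t) : Continuous (Φ t) := by
  rw [← continuousOn_univ]
  exact h.continuousOn.comp (f := fun x => (t, x)) (by fun_prop) fun x _ => ⟨ht, mem_univ _⟩

/-- The semiflow extends to a flow on an invariant set on which the time-one map has a Lipschitz
inverse `G`. -/
theorem exists_flow (h : LipSemiflow Φ) {W : Set X} (hW : ∀ t, 0 ≤ t → ∀ x ∈ W, Φ t x ∈ W)
    {G : X → X} (hG : ∀ x ∈ W, G x ∈ W) (hFG : ∀ x ∈ W, Φ 1 (G x) = x)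
    (hGF : ∀ x ∈ W, G (Φ 1 x) = x) {K : ℝ≥0}
    (hGlip : ∀ x ∈ W, ∀ y ∈ W, ‖G x - G y‖ ≤ K * ‖x - y‖) :
    ∃ Ψ : ℝ → W → W, (∀ w, Ψ 0 w = w) ∧ (∀ s t w, Ψ (s + t) w = Ψ s (Ψ t w)) ∧
      Continuous (fun p : ℝ × W => Ψ p.1 p.2) ∧
      (∀ T : ℝ, ∃ K : ℝ≥0, ∀ τ, |τ| ≤ T → LipschitzWith K (Ψ τ)) ∧
      ∀ τ, 0 ≤ τ → ∀ w, (Ψ τ w : X) = Φ τ w := by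
  let Gw : W → W := fun x => ⟨G x, hG x x.2⟩
  let Φw : ℝ → W → W := fun t x => ⟨Φ (max t 0) x, hW _ (le_max_right _ _) x x.2⟩
  have hΦw : ∀ {t}, 0 ≤ t → ∀ x, (Φw t x : X) = Φ t x := fun ht x => by
    change Φ (max _ 0) _ = _
    rw [max_eq_left ht]
  have hadd : ∀ {s t}, 0 ≤ s → 0 ≤ t → ∀ x, Φw (s + t) x = Φw s (Φw t x) := fun hs ht x => by
    ext
    rw [hΦw (add_nonneg hs ht), hΦw hs, hΦw ht, h.add _ _ hs ht]
  have hleft : ∀ x, Gw (Φw 1 x) = x := fun x => by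
    ext
    change G (Φw 1 x) = x
    rw [hΦw zero_le_one, hGF x x.2]
  have hright : ∀ x, Φw 1 (Gw x) = x := fun x => by
    ext
    rw [hΦw zero_le_one]
    exact hFG x x.2
  have hcomm : ∀ {t}, 0 ≤ t → ∀ x, Φw t (Gw x) = Gw (Φw t x) := fun {t} ht x => by
    conv_rhs => rw [← hright x, ← hadd ht zero_le_one, add_comm, hadd zero_le_one ht, hleft]
  have hcommn : ∀ {t}, 0 ≤ t → ∀ (n : ℕ) x, Φw t (Gw^[n] x) = Gw^[n] (Φw t x) := by
    intro t ht n x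
    induction n with
    | zero => rfl
    | succ n ih => rw [Function.iterate_succ_apply', hcomm ht, ih, Function.iterate_succ_apply']
  -- For negative `τ`, flow forward for the nonnegative time `τ + n` and undo `n` unit steps with
  -- the inverse; the next statement shows that the choice of `n` is immaterial.
  let Ψ : ℝ → W → W := fun τ x => Gw^[⌈-τ⌉₊] (Φw (τ + ⌈-τ⌉₊) x)
  have hΨ : ∀ {τ : ℝ} {n : ℕ}, 0 ≤ τ + n → ∀ x, Ψ τ x = Gw^[n] (Φw (τ + n) x) := by
    intro τ n hn x
    have h1 : ⌈-τ⌉₊ ≤ n := Nat.ceil_le.2 (by linarith)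
    obtain ⟨i, rfl⟩ := Nat.exists_eq_add_of_le h1
    have h0 : 0 ≤ τ + ⌈-τ⌉₊ := by linarith [Nat.le_ceil (-τ)]
    clear hn h1
    induction i with
    | zero => rfl
    | succ i ih =>
      rw [ih, ← add_assoc, Function.iterate_succ_apply]
      have h2 : τ + ((⌈-τ⌉₊ + i + 1 : ℕ) : ℝ) = 1 + (τ + ((⌈-τ⌉₊ + i : ℕ) : ℝ)) := by
        push_cast; ring
      have h3 : 0 ≤ τ + ((⌈-τ⌉₊ + i : ℕ) : ℝ) := by
        push_cast
        have : (0 : ℝ) ≤ i := i.cast_nonneg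
        linarith
      rw [h2, hadd zero_le_one h3, hleft]
  have hΨpos : ∀ τ, 0 ≤ τ → ∀ w, (Ψ τ w : X) = Φ τ w := fun τ hτ w => by
    rw [hΨ (n := 0) (by simpa using hτ)]
    simpa using hΦw hτ w
  have hGwlip : LipschitzWith K Gw := LipschitzWith.of_dist_le_mul fun x y => by
    rw [Subtype.dist_eq, Subtype.dist_eq, dist_eq_norm, dist_eq_norm]
    exact hGlip x x.2 y y.2
  refine ⟨Ψ, fun w => ?_, fun s t w => ?_, ?_, fun T => ?_, hΨpos⟩
  · ext
    rw [hΨpos 0 le_rfl, h.zero]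
  · have hs : 0 ≤ s + ⌈-s⌉₊ := by linarith [Nat.le_ceil (-s)]
    have ht : 0 ≤ t + ⌈-t⌉₊ := by linarith [Nat.le_ceil (-t)]
    have hst : 0 ≤ s + t + (⌈-s⌉₊ + ⌈-t⌉₊ : ℕ) := by push_cast; linarith
    have h1 : s + t + (⌈-s⌉₊ + ⌈-t⌉₊ : ℕ) = (s + ⌈-s⌉₊) + (t + ⌈-t⌉₊) := by push_cast; ring
    rw [hΨ hst, h1, hadd hs ht, Function.iterate_add_apply]
    change _ = Gw^[⌈-s⌉₊] (Φw (s + ⌈-s⌉₊) (Gw^[⌈-t⌉₊] (Φw (t + ⌈-t⌉₊) w)))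
    rw [hcommn hs]
  · rw [continuous_iff_continuousAt]
    rintro ⟨τ₀, x₀⟩
    -- One `n` serves all times near `τ₀`, so continuity reduces to that of the semiflow and of
    -- `Gw`.
    obtain ⟨n, hn⟩ := exists_nat_gt (-τ₀)
    have hcont : Continuous fun p : ℝ × W => Gw^[n] (Φw (p.1 + n) p.2) := by
      refine (hGwlip.continuous.iterate n).comp (Continuous.subtype_mk ?_ _)
      exact h.continuousOn.comp_continuous (f := fun p : ℝ × W => (max (p.1 + n) 0, (p.2 : X)))
        (by fun_prop) fun p => ⟨le_max_right (p.1 + n) 0, mem_univ _⟩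
    refine hcont.continuousAt.congr ?_
    have : ∀ᶠ p : ℝ × W in 𝓝 (τ₀, x₀), -n < p.1 :=
      continuous_fst.continuousAt.eventually (lt_mem_nhds (by simpa using neg_lt.1 hn))
    filter_upwards [this] with p hp
    exact (hΨ (by linarith) p.2).symm
  · obtain ⟨L, hL⟩ := h.exists_lip (T + ⌈T⌉₊)
    refine ⟨K ^ ⌈T⌉₊ * L, fun τ hτ => ?_⟩
    have h1 := abs_le.1 hτ
    have h2 : 0 ≤ τ + ⌈T⌉₊ := by linarith [Nat.le_ceil T]
    have h3 : Ψ τ = Gw^[⌈T⌉₊] ∘ Φw (τ + ⌈T⌉₊) := funext fun x => hΨ h2 x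
    rw [h3]
    refine (hGwlip.iterate _).comp (LipschitzWith.of_dist_le_mul fun x y => ?_)
    rw [Subtype.dist_eq, Subtype.dist_eq, dist_eq_norm, dist_eq_norm, hΦw h2, hΦw h2]
    exact hL _ ⟨h2, by linarith⟩ _ _

end LipSemiflow

end Semiflow

end

end Vorticity

namespace Vorticity

noncomputable section

/-! ### Invariant manifold and foliation -/

section Manifold

variable {X : Type*} [NormedAddCommGroup X]

/-- Every time `τ ≤ 0` is reached within time `1` from the integer time `-⌈-τ⌉₊`, and the semiflow
is Lipschitz over that time, so bounds at integer times suffice. -/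
lemma LipSemiflow.norm_le_of_backward {Φ : ℝ → X → X} (h : LipSemiflow Φ) {w : ℝ → X}
    (hw : IsNegSemiorbit Φ w) {B μ : ℝ} (hμ : 0 ≤ μ)
    (hB : ∀ n : ℕ, ‖w (-n)‖ ≤ B * Real.exp μ ^ n) :
    expRate w atBot ≤ (μ : EReal) := by
  obtain ⟨L, hL⟩ := h.exists_lip 1
  have hB0 : 0 ≤ B := by simpa using (norm_nonneg _).trans (hB 0)
  refine expRate_le tendsto_abs_atBot_atTop (B := L * B * Real.exp μ) ?_
  filter_upwards [eventually_le_atBot 0] with τ hτ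
  have hn : τ + ⌈-τ⌉₊ ∈ Icc (0 : ℝ) 1 :=
    ⟨by linarith [Nat.le_ceil (-τ)], by linarith [Nat.ceil_lt_add_one (neg_nonneg.2 hτ)]⟩
  have h1 : w τ = Φ (τ + ⌈-τ⌉₊) (w (-⌈-τ⌉₊)) := by
    rw [← hw _ _ hn.1 (by linarith)]
    congr 1; ring
  have h2 := hL _ hn (w (-⌈-τ⌉₊)) 0
  rw [h.map_zero _ hn.1, sub_zero, sub_zero, ← h1] at h2
  calc ‖w τ‖ ≤ L * (B * Real.exp μ ^ ⌈-τ⌉₊) := h2.trans (by gcongr; exact hB _)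
    _ ≤ L * (B * (Real.exp μ * Real.exp (μ * |τ|))) := by
      gcongr
      rw [← Real.exp_nat_mul, ← Real.exp_add, abs_of_nonpos hτ]
      apply Real.exp_le_exp.2
      nlinarith [Nat.ceil_lt_add_one (neg_nonneg.2 hτ)]
    _ = _ := by ring

variable [NormedSpace ℝ X]

/-- The projection onto the range of `P`. -/
def toRange (P : X →L[ℝ] X) : X →L[ℝ] LinearMap.range P.toLinearMap :=
  P.codRestrict _ fun x => LinearMap.mem_range_self _ x

/-- The complementary projection onto the kernel of `P`. -/
def toKer (P : X →L[ℝ] X) (hP : ∀ x, P (P x) = P x) : X →L[ℝ] LinearMap.ker P.toLinearMap :=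
  (ContinuousLinearMap.id ℝ X - P).codRestrict _ fun x => by
    change P (x - P x) = 0
    rw [map_sub, hP, sub_self]

/-- The invariant manifold theorem for an abstract semiflow whose time-one map is a small `C¹`
perturbation of a linear map with a spectral gap. The manifold collects the endpoints of slowly
growing backward orbits, the leaf of `w` the points whose orbits approach that of `w` fast. Both are
found for the time-one map alone. -/
theorem exists_graph_and_foliation [CompleteSpace X] {Λ P J : X →L[ℝ] X} {C κ q μ₁ μ₂ : ℝ}
    [FiniteDimensional ℝ (LinearMap.range P.toLinearMap)]
    (h : ExpSplitting Λ P J C κ q) (hC : 0 ≤ C) (hμ₁ : 0 ≤ μ₁) (hμ : μ₁ < μ₂)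
    (hκ : κ < Real.exp μ₁) (hq : q * Real.exp μ₂ < 1) :
    ∃ δ, 0 < δ ∧ ∀ Φ : ℝ → X → X, LipSemiflow Φ → ContDiff ℝ 1 (Φ 1) →
      (∀ x y, ‖(Φ 1 x - Λ x) - (Φ 1 y - Λ y)‖ ≤ δ * ‖x - y‖) →
      fderiv ℝ (fun x => Φ 1 x - Λ x) 0 = 0 →
      ∃ g : LinearMap.range P.toLinearMap → LinearMap.ker P.toLinearMap,
        ContDiff ℝ 1 g ∧ (∃ K : ℝ≥0, LipschitzWith K g) ∧ g 0 = 0 ∧ fderiv ℝ g 0 = 0 ∧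
        (∃ Ψ : ℝ → graphManifold g → graphManifold g,
          (∀ w, Ψ 0 w = w) ∧ (∀ s t w, Ψ (s + t) w = Ψ s (Ψ t w)) ∧
          Continuous (fun p : ℝ × graphManifold g => Ψ p.1 p.2) ∧
          (∀ T : ℝ, ∃ K : ℝ≥0, ∀ τ, |τ| ≤ T → LipschitzWith K (Ψ τ)) ∧
          ∀ τ, 0 ≤ τ → ∀ w, (Ψ τ w : X) = Φ τ w) ∧
        (∀ τ, 0 ≤ τ → Φ τ '' graphManifold g = graphManifold g) ∧
        (∀ w₀ ∈ graphManifold g, ∃ w : ℝ → X,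
          (IsNegSemiorbit Φ w ∧ (∀ τ ≤ 0, w τ ∈ graphManifold g) ∧ w 0 = w₀) ∧
          ∀ w' : ℝ → X, IsNegSemiorbit Φ w' → (∀ τ ≤ 0, w' τ ∈ graphManifold g) →
            w' 0 = w₀ → ∀ τ ≤ 0, w' τ = w τ) ∧
        (∀ w : ℝ → X, IsNegSemiorbit Φ w → (∀ τ ≤ 0, w τ ∈ graphManifold g) →
          expRate w atBot ≤ (μ₁ : EReal)) ∧
        (∀ w : ℝ → X, IsNegSemiorbit Φ w → expRate w atBot ≤ (μ₂ : EReal) →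
          ∀ τ ≤ 0, w τ ∈ graphManifold g) ∧
        ∃ h : X × LinearMap.ker P.toLinearMap → LinearMap.range P.toLinearMap,
          Continuous h ∧
          (∀ w, ContDiff ℝ 1 fun ws => h (w, ws)) ∧
          (∀ w, ∀ ws : LinearMap.ker P.toLinearMap, (ws : X) = w - P w →
            (h (w, ws) : X) = P w) ∧
          (∀ τ, 0 ≤ τ → ∀ w, Φ τ '' leaf h w ⊆ leaf h (Φ τ w)) ∧
          (∀ w, leaf h w =
            {w' | expRate (fun τ => Φ τ w' - Φ τ w) atTop ≤ ((-μ₂ : ℝ) : EReal)}) ∧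
          (∀ w, ∃! x, x ∈ leaf h w ∩ graphManifold g) ∧
          (∀ x, ∃! w, w ∈ graphManifold g ∧ x ∈ leaf h w) := by
  -- The rate `μ₂` enters through a limsup and gives bounds only for exponents above it; `ν`
  -- provides that room while staying inside the gap.
  obtain ⟨ν, hν, hqν⟩ : ∃ ν, μ₂ < ν ∧ q * Real.exp ν < 1 := by
    have hc : Continuous fun ν => q * Real.exp ν := by fun_prop
    have h1 : ∀ᶠ ν in 𝓝 μ₂, q * Real.exp ν < 1 := hc.continuousAt.eventually (gt_mem_nhds hq)
    have h2 : ∀ᶠ ν in 𝓝[>] μ₂, q * Real.exp ν < 1 := nhdsWithin_le_nhds h1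
    obtain ⟨ν, h3, h4⟩ := (h2.and self_mem_nhdsWithin).exists
    exact ⟨ν, h4, h3⟩
  set s₁ := Real.exp μ₁ with hs₁
  set s₂ := Real.exp ν with hs₂
  have hs1 : 0 < s₁ := Real.exp_pos _
  have hs2 : 0 < s₂ := Real.exp_pos _
  have hs12 : s₁ < s₂ := Real.exp_lt_exp.2 (hμ.trans hν)
  have hpow12 : ∀ n : ℕ, s₁ ^ n ≤ s₂ ^ n := fun n => pow_le_pow_left₀ hs1.le hs12.le n
  obtain ⟨Mb, hMb, hback⟩ := h.exists_backward hC hκ hs12 hqν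
  -- Forward weights are reciprocals: leaf points are constructed with decay `e^{-νn}` and
  -- recognised from the weaker decay `e^{-μ₁n}`, so that `-μ₂` lies strictly between.
  obtain ⟨Mf, hMf, hforw⟩ := h.exists_forward hC (t₁ := s₂⁻¹) (t₂ := s₁⁻¹)
    (by rwa [← one_div, lt_div_iff₀ hs2]) ((inv_lt_inv₀ hs2 hs1).2 hs12)
    (by rwa [← div_eq_mul_inv, div_lt_one hs1])
  -- The first two conditions make the fixed point maps contract; the last two bound by `1/2` the
  -- slopes of the manifold and of the leaves.
  obtain ⟨δ, hδ, hδb, hδf, hδb', hδf'⟩ : ∃ δ : ℝ, 0 < δ ∧ δ * Mb ≤ 1 / 2 ∧ δ * Mf ≤ 1 / 2 ∧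
      δ * Mb * (2 * C) ≤ 1 / 2 ∧ δ * Mf * (2 * C) ≤ 1 / 2 := by
    have hD : 0 < 2 * (1 + 2 * C) * (Mb + Mf) := by positivity
    refine ⟨1 / (2 * (1 + 2 * C) * (Mb + Mf)), by positivity, ?_, ?_, ?_, ?_⟩ <;>
    · field_simp
      nlinarith [mul_nonneg hC hMb.le, mul_nonneg hC hMf.le]
  refine ⟨δ, hδ, fun Φ hΦ hΦd hΦlip hΦ0 => ?_⟩
  set R : X → X := fun x => Φ 1 x - Λ x with hR
  have hRd : ContDiff ℝ 1 R := hΦd.sub Λ.contDiff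
  have hR0 : R 0 = 0 := by simp [hR, hΦ.map_zero]
  have hFR : ∀ x, Φ 1 x = Λ x + R x := fun x => by simp [hR]
  set Ec := LinearMap.range P.toLinearMap
  set Es := LinearMap.ker P.toLinearMap
  set pc := toRange P
  set qs := toKer P h.idem
  have hpc : ∀ x, (pc x : X) = P x := fun _ => rfl
  have hqs : ∀ x, (qs x : X) = x - P x := fun _ => rfl
  have hPEc : ∀ ζ : Ec, P ζ = ζ := by
    rintro ⟨_, x, rfl⟩
    exact h.idem x
  have hPEs : ∀ η : Es, P η = 0 := fun η => η.2
  obtain ⟨u, hu, hPu, hub, hulip, hulip0, huniq, hud, hud0⟩ := hback δ hδ.le hδb R hRd hΦlip hR0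
  have hu' : ∀ ζ n, u ζ n = Φ 1 (u ζ (n + 1)) := fun ζ n => by rw [hFR]; exact hu ζ n
  let g : Ec → Es := fun ζ => qs (u ζ 0)
  have hg : ∀ ζ, (g ζ : X) = u ζ 0 - ζ := fun ζ => by
    rw [← hPu ζ]; rfl
  have hg' : ∀ ζ : Ec, (ζ : X) + g ζ = u ζ 0 := fun ζ => by rw [hg]; abel
  have huniq' : ∀ v : ℕ → X, (∀ n, v n = Φ 1 (v (n + 1))) → (∃ B, ∀ n, ‖v n‖ ≤ B * s₂ ^ n) →
      v = u (pc (v 0)) := fun v hv hvb =>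
    huniq v (fun n => by rw [← hFR]; exact hv n) hvb _ rfl
  have hWmem : ∀ v : ℕ → X, (∀ n, v n = Φ 1 (v (n + 1))) → (∃ B, ∀ n, ‖v n‖ ≤ B * s₂ ^ n) →
      v 0 ∈ graphManifold g := fun v hv hvb =>
    ⟨pc (v 0), by rw [hg', ← huniq' v hv hvb]⟩
  have hWu : ∀ x ∈ graphManifold g, u (pc x) 0 = x := by
    rintro x ⟨ζ, rfl⟩
    rw [hg']
    have : pc (u ζ 0) = ζ := Subtype.ext (hPu ζ)
    rw [this]
  have hglip : ∀ ζ ζ', ‖g ζ - g ζ'‖ ≤ 1 / 2 * ‖ζ - ζ'‖ := fun ζ ζ' => by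
    change ‖(g ζ : X) - g ζ'‖ ≤ _
    rw [hg, hg]
    exact (hulip0 ζ ζ').trans (by gcongr)
  -- `Φ t` commutes with `Φ 1` and is Lipschitz, so it maps the backward orbit through `x` to a
  -- backward orbit of the same growth.
  have hW : ∀ t, 0 ≤ t → ∀ x ∈ graphManifold g, Φ t x ∈ graphManifold g := by
    intro t ht x hx
    obtain ⟨L, hL⟩ := hΦ.exists_lip t
    rw [← hWu x hx]
    refine hWmem (fun n => Φ t (u (pc x) n)) (fun n => ?_) ⟨L * (2 * C * ‖pc x‖), fun n => ?_⟩
    · rw [hΦ.comm zero_le_one ht, ← hu']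
    · have := hL t ⟨ht, le_rfl⟩ (u (pc x) n) 0
      rw [hΦ.map_zero t ht, sub_zero, sub_zero] at this
      refine this.trans ?_
      rw [mul_assoc]
      gcongr
      exact (hub _ n).trans (by gcongr)
  -- One step back along the constructed orbit inverts the time-one map on the manifold.
  let G : X → X := fun x => u (pc x) 1
  have hG : ∀ x ∈ graphManifold g, G x ∈ graphManifold g := fun x _ =>
    hWmem (fun n => u (pc x) (n + 1)) (fun n => hu' _ _) ⟨2 * C * ‖pc x‖ * s₂, fun n => by
      calc _ ≤ 2 * C * ‖pc x‖ * s₁ ^ (n + 1) := hub _ _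
        _ ≤ 2 * C * ‖pc x‖ * s₂ ^ (n + 1) := by gcongr
        _ = _ := by ring⟩
  have hFG : ∀ x ∈ graphManifold g, Φ 1 (G x) = x := fun x hx => by
    rw [← hu' (pc x) 0, hWu x hx]
  have hGF : ∀ x ∈ graphManifold g, G (Φ 1 x) = x := fun x hx => by
    -- Prepending `Φ 1 x` to the backward orbit of `x` gives a backward orbit of admissible growth,
    -- which by uniqueness is the constructed one.
    have := huniq' (fun n => Nat.casesOn n (Φ 1 x) fun n => u (pc x) n) (fun n => ?_)
      (exists_forall_norm_le_of_eventually (B := 2 * C * ‖pc x‖ * s₂⁻¹) hs2 ?_)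
    · have h1 := congr_fun this 1
      exact h1.symm.trans (hWu x hx)
    · cases n with
      | zero => exact congrArg (Φ 1) (hWu x hx).symm
      | succ n => exact hu' _ n
    · filter_upwards [eventually_ge_atTop 1] with n hn
      obtain ⟨n, rfl⟩ := Nat.exists_eq_add_of_le' hn
      calc ‖u (pc x) n‖ ≤ 2 * C * ‖pc x‖ * s₁ ^ n := hub _ _
        _ ≤ 2 * C * ‖pc x‖ * s₂ ^ n := by gcongr
        _ = _ := by rw [pow_succ]; field_simp
  have hGlip : ∀ x ∈ graphManifold g, ∀ y ∈ graphManifold g,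
      ‖G x - G y‖ ≤ (2 * C * ‖P‖ * s₁).toNNReal * ‖x - y‖ := fun x _ y _ => by
    rw [Real.coe_toNNReal _ (by positivity)]
    refine (hulip _ _ 1).trans ?_
    have h1 : ‖pc x - pc y‖ ≤ ‖P‖ * ‖x - y‖ := by
      rw [← map_sub]
      exact P.le_opNorm _
    calc _ ≤ 2 * C * (‖P‖ * ‖x - y‖) * s₁ ^ 1 := by gcongr
      _ = _ := by ring
  obtain ⟨Ψ, hΨ0, hΨadd, hΨc, hΨlip, hΨΦ⟩ := hΦ.exists_flow hW hG hFG hGF hGlip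
  have hback_eq : ∀ w' : ℝ → X, IsNegSemiorbit Φ w' → (hw' : ∀ τ ≤ 0, w' τ ∈ graphManifold g) →
      ∀ τ (hτ : τ ≤ 0), w' τ = Ψ τ ⟨w' 0, hw' 0 le_rfl⟩ := fun w' hw hw' τ hτ => by
    have h1 : (⟨w' 0, hw' 0 le_rfl⟩ : graphManifold g) = Ψ (-τ) ⟨w' τ, hw' τ hτ⟩ := by
      ext
      rw [hΨΦ _ (neg_nonneg.2 hτ), ← hw _ _ (neg_nonneg.2 hτ) (by simp)]
      simp
    rw [h1, ← hΨadd, add_neg_cancel, hΨ0]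
  refine ⟨g, qs.contDiff.comp hud, ⟨1 / 2, LipschitzWith.of_dist_le_mul fun ζ ζ' => ?_⟩, ?_, ?_,
    ⟨Ψ, hΨ0, hΨadd, hΨc, hΨlip, hΨΦ⟩, fun τ hτ => ?_, fun w₀ hw₀ => ?_, fun w hw hwW => ?_,
    fun w hw hrate τ₀ hτ₀ => ?_, ?_⟩
  · rw [dist_eq_norm, dist_eq_norm]
    simpa using hglip ζ ζ'
  · have : u 0 0 = 0 := by simpa using hub 0 0
    simp [g, this]
  · have := (qs.hasFDerivAt.comp (0 : Ec) (hud0 hΦ0)).fderiv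
    have h0 : qs.comp Ec.subtypeL = 0 := by
      ext ζ
      change (ζ : X) - P ζ = 0
      rw [hPEc, sub_self]
    rw [h0] at this
    exact this
  · refine Subset.antisymm (image_subset_iff.2 fun x hx => hW τ hτ x hx) fun y hy => ?_
    refine ⟨Ψ (-τ) ⟨y, hy⟩, Subtype.coe_prop _, ?_⟩
    rw [← hΨΦ τ hτ, ← hΨadd, add_neg_cancel, hΨ0]
  · refine ⟨fun τ => Ψ τ ⟨w₀, hw₀⟩, ⟨fun s t ht hst => ?_, fun τ _ => Subtype.coe_prop _,
      congrArg Subtype.val (hΨ0 _)⟩, fun w' hw hw' hw0 τ hτ => ?_⟩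
    · change (Ψ (s + t) _ : X) = Φ t (Ψ s _)
      rw [add_comm, hΨadd, hΨΦ t ht]
    · rw [hback_eq w' hw hw' τ hτ]
      subst hw0
      rfl
  -- The time-one map is injective on the manifold, so a negative semi-orbit in it coincides at
  -- integer times with the constructed orbit and inherits its growth `e^{μ₁n}`.
  · have hwn : ∀ n : ℕ, w (-n) = u (pc (w 0)) n := by
      intro n
      induction n with
      | zero => simpa using (hWu _ (hwW 0 le_rfl)).symm
      | succ n ih =>
        have h1 : Φ 1 (w (-(n + 1 : ℕ))) = w (-n) := by
          rw [← hw _ _ zero_le_one (by push_cast; linarith [(n.cast_nonneg : (0 : ℝ) ≤ n)])]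
          push_cast
          congr 1; ring
        have h2 : u (pc (w 0)) (0 + (n + 1)) ∈ graphManifold g :=
          hWmem (fun i => u (pc (w 0)) (i + (n + 1)))
            (fun i => by rw [hu' _ (i + (n + 1))]; congr 2; ring)
            ⟨2 * C * ‖pc (w 0)‖ * s₂ ^ (n + 1), fun i => by
              calc _ ≤ 2 * C * ‖pc (w 0)‖ * s₁ ^ (i + (n + 1)) := hub _ _
                _ ≤ 2 * C * ‖pc (w 0)‖ * s₂ ^ (i + (n + 1)) := by gcongr
                _ = _ := by ring⟩
        rw [zero_add] at h2
        have h3 := hwW (-(n + 1 : ℕ)) (by simp; linarith [(n.cast_nonneg : (0 : ℝ) ≤ n)])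
        rw [← hGF _ h3, ← hGF _ h2, ← hu', h1, ih]
    exact hΦ.norm_le_of_backward hw hμ₁ fun n => by rw [hwn]; exact hub _ n
  · have h1 : w τ₀ = w (τ₀ - (0 : ℕ)) := by simp
    rw [h1]
    -- Sampling the semi-orbit at unit steps back from `τ₀` gives a backward orbit of the time-one
    -- map, of growth at most `e^{νn}`.
    refine hWmem (fun n => w (τ₀ - n)) (fun n => ?_) ?_
    · rw [← hw _ _ zero_le_one]
      · push_cast; congr 1; ring
      · push_cast; linarith [(n.cast_nonneg : (0 : ℝ) ≤ n)]
    · have h2 := eventually_norm_le_of_expRate_le tendsto_abs_atBot_atTop hν hrate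
      have h3 : Tendsto (fun n : ℕ => τ₀ - n) atTop atBot :=
        tendsto_atBot_add_const_left _ _ (tendsto_neg_atTop_atBot.comp tendsto_natCast_atTop_atTop)
      refine exists_forall_norm_le_of_eventually (B := Real.exp (-ν * τ₀)) hs2 ?_
      filter_upwards [h3.eventually h2] with n hn
      refine hn.trans (le_of_eq ?_)
      rw [hs₂, ← Real.exp_nat_mul, ← Real.exp_add, abs_of_nonpos
        (by linarith [(n.cast_nonneg : (0 : ℝ) ≤ n)])]
      congr 1; ring
  have hxc : ∀ n : ℕ, Continuous fun w => Φ n w := fun n => hΦ.continuous_apply n.cast_nonneg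
  obtain ⟨y, hy, hQy, hyb, hylip0, hyuniq, hyd, hyc⟩ :=
    hforw δ hδ.le hδf R hRd hΦlip (fun w n => Φ n w) hxc
  -- A point of the leaf is `w` plus the decaying perturbation whose component in `ker P` is the
  -- difference between `η` and that of `w`.
  let hh : X × Es → Ec := fun p => pc (p.1 + y p.1 (p.2 - qs p.1) 0)
  have hhP : ∀ w η, ((hh (w, η) : Ec) : X) + η = w + y w (η - qs w) 0 := fun w η => by
    change P (w + y w (η - qs w) 0) + η = _
    have := hQy w (η - qs w)
    rw [AddSubgroupClass.coe_sub, hqs] at this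
    have h2 : (η : X) = y w (η - qs w) 0 - P (y w (η - qs w) 0) + (w - P w) := by
      rw [this]; abel
    calc _ = P w + P (y w (η - qs w) 0) + (y w (η - qs w) 0 - P (y w (η - qs w) 0) + (w - P w)) := by
          rw [← h2, map_add]
      _ = _ := by abel
  have hleaf1 : ∀ w η, ∃ B, ∀ n : ℕ, ‖Φ n (w + y w η 0) - Φ n w‖ ≤ B * s₂⁻¹ ^ n := fun w η => by
    have h1 : ∀ n : ℕ, Φ n (w + y w η 0) = Φ n w + y w η n := by
      intro n
      induction n with
      | zero => simp [hΦ.zero]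
      | succ n ih =>
        rw [hΦ.nat_succ, ih, hΦ.nat_succ, hFR, hFR, hy, map_add]
        abel
    exact ⟨_, fun n => by rw [h1, add_sub_cancel_left]; exact hyb w η n⟩
  have hleaf2 : ∀ w w', (∃ B, ∀ n : ℕ, ‖Φ n w' - Φ n w‖ ≤ B * s₁⁻¹ ^ n) → w' ∈ leaf hh w := by
    intro w w' hB
    have h1 := hyuniq w (fun n => Φ n w' - Φ n w) (fun n => by
      rw [add_sub_cancel (Φ n w), hΦ.nat_succ, hΦ.nat_succ, hFR (Φ n w'), hFR (Φ n w), map_sub]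
      abel) hB (qs (w' - w)) (by simp [hΦ.zero, hqs]; abel)
    refine ⟨qs w', ?_⟩
    rw [hhP, ← map_sub, ← h1]
    simp [hΦ.zero]
  have hleaf : ∀ w w', w' ∈ leaf hh w → ∃ B, ∀ n : ℕ, ‖Φ n w' - Φ n w‖ ≤ B * s₂⁻¹ ^ n := by
    rintro w _ ⟨ws, rfl⟩
    rw [hhP]
    exact hleaf1 w _
  have hinv : ∀ n : ℕ, s₂⁻¹ ^ n ≤ s₁⁻¹ ^ n := fun n => by gcongr
  have hleaf2' : ∀ w w', (∃ B, ∀ n : ℕ, ‖Φ n w' - Φ n w‖ ≤ B * s₂⁻¹ ^ n) → w' ∈ leaf hh w :=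
    fun w w' ⟨B, hB⟩ => hleaf2 w w' ⟨B, fun n => (hB n).trans (by
      have hB0 : 0 ≤ B := by simpa using (norm_nonneg _).trans (hB 0)
      gcongr)⟩
  have hsymm : ∀ w w', w' ∈ leaf hh w → w ∈ leaf hh w' := fun w w' hw => by
    obtain ⟨B, hB⟩ := hleaf w w' hw
    exact hleaf2' _ _ ⟨B, fun n => by rw [norm_sub_rev]; exact hB n⟩
  have hpoint : ∀ w, ∃! x, x ∈ leaf hh w ∩ graphManifold g := by
    intro w
    have hhlip : ∀ η η', ‖hh (w, η) - hh (w, η')‖ ≤ 1 / 2 * ‖η - η'‖ := fun η η' => by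
      change ‖(hh (w, η) : X) - hh (w, η')‖ ≤ _
      rw [eq_sub_of_add_eq (hhP w η), eq_sub_of_add_eq (hhP w η')]
      have h1 := hylip0 w (η - qs w) (η' - qs w)
      rw [sub_sub_sub_cancel_right] at h1
      have h2 : w + y w (η - qs w) 0 - η - (w + y w (η' - qs w) 0 - η') =
          (y w (η - qs w) 0 - (η - qs w : Es)) - (y w (η' - qs w) 0 - (η' - qs w : Es)) := by
        push_cast; abel
      rw [h2]
      exact h1.trans (by gcongr)
    -- A point common to leaf and manifold is `ζ + g ζ` with `ζ = hh (w, g ζ)`. Both slopes are at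
    -- most `1/2`, so this is a fixed point problem for a contraction.
    have hc : ContractingWith (1 / 2) fun ζ => hh (w, g ζ) := by
      refine ⟨by rw [← NNReal.coe_lt_coe]; norm_num, LipschitzWith.of_dist_le_mul fun ζ ζ' => ?_⟩
      rw [dist_eq_norm, dist_eq_norm]
      have h3 : ((1 / 2 : ℝ≥0) : ℝ) = 1 / 2 := by norm_num
      rw [h3]
      refine (hhlip _ _).trans ?_
      gcongr
      refine (hglip _ _).trans ?_
      linarith [norm_nonneg (ζ - ζ')]
    have : CompleteSpace Ec := FiniteDimensional.complete ℝ Ec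
    have hfix := hc.fixedPoint_isFixedPt
    refine ⟨(hc.fixedPoint _ : X) + g (hc.fixedPoint _), ⟨⟨g (hc.fixedPoint _), ?_⟩, ⟨_, rfl⟩⟩, ?_⟩
    · exact congrArg (fun ζ : Ec => (ζ : X) + g (hc.fixedPoint _)) hfix.symm
    · rintro x ⟨⟨ws, hx⟩, ⟨ζ, hx'⟩⟩
      have h1 : ζ = hh (w, ws) := by
        have := congrArg P (hx'.symm.trans hx)
        rw [map_add, map_add, hPEs, hPEs, hPEc, hPEc, add_zero, add_zero] at this
        exact Subtype.ext this
      have h2 : g ζ = ws := by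
        rw [h1] at hx'
        rw [h1]
        exact Subtype.ext (add_left_cancel (hx'.symm.trans hx))
      have h3 : Function.IsFixedPt (fun ζ => hh (w, g ζ)) ζ := by
        change hh (w, g ζ) = ζ
        rw [h2, ← h1]
      rw [hx', hc.fixedPoint_unique h3]
  refine ⟨hh, ?_, fun w => ?_, fun w ws hws => ?_, fun τ hτ w => ?_, fun w => ?_, hpoint,
    fun x => ?_⟩
  · refine pc.continuous.comp (continuous_fst.add ?_)
    exact hyc.comp (f := fun p : X × Es => (p.1, p.2 - qs p.1)) (by fun_prop)
  · exact pc.contDiff.comp (contDiff_const.add ((hyd w).comp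
      (f := fun ws : Es => ws - qs w) (contDiff_id.sub contDiff_const)))
  · have h1 : ws - qs w = 0 := by
      rw [sub_eq_zero]
      exact Subtype.ext hws
    have h2 : y w 0 0 = 0 := by simpa using hyb w 0 0
    change P (w + y w (ws - qs w) 0) = _
    rw [h1, h2, add_zero]
  · rintro _ ⟨w', hw', rfl⟩
    obtain ⟨B, hB⟩ := hleaf w w' hw'
    obtain ⟨L, hL⟩ := hΦ.exists_lip τ
    refine hleaf2' _ _ ⟨L * B, fun n => ?_⟩
    rw [hΦ.comm n.cast_nonneg hτ, hΦ.comm n.cast_nonneg hτ]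
    refine (hL τ ⟨hτ, le_rfl⟩ _ _).trans ?_
    rw [mul_assoc]
    gcongr
    exact hB n
  · ext w'
    constructor
    · intro hw'
      obtain ⟨B, hB⟩ := hleaf w w' hw'
      obtain ⟨L, hL⟩ := hΦ.exists_lip 1
      have hB0 : 0 ≤ B := by simpa using (norm_nonneg _).trans (hB 0)
      have hν0 : 0 < ν := (hμ₁.trans_lt hμ).trans hν
      have h1 : expRate (fun τ => Φ τ w' - Φ τ w) atTop ≤ ((-ν : ℝ) : EReal) := by
        refine expRate_le tendsto_abs_atTop_atTop (B := L * B * Real.exp ν) ?_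
        filter_upwards [eventually_ge_atTop 0] with τ hτ
        have hf := Nat.floor_le hτ
        have hf' := Nat.lt_floor_add_one τ
        have hn : τ - ⌊τ⌋₊ ∈ Icc (0 : ℝ) 1 := ⟨by linarith, by linarith⟩
        have hsplit : ∀ x, Φ τ x = Φ (τ - ⌊τ⌋₊) (Φ ⌊τ⌋₊ x) := fun x => by
          rw [← hΦ.add _ _ hn.1 (Nat.cast_nonneg _), sub_add_cancel]
        rw [hsplit, hsplit]
        calc _ ≤ L * (B * s₂⁻¹ ^ ⌊τ⌋₊) := (hL _ hn _ _).trans (by gcongr; exact hB _)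
          _ ≤ L * (B * (Real.exp ν * Real.exp (-ν * |τ|))) := by
            gcongr
            rw [hs₂, ← Real.exp_neg, ← Real.exp_nat_mul, ← Real.exp_add, abs_of_nonneg hτ]
            apply Real.exp_le_exp.2
            nlinarith
          _ = _ := by ring
      exact h1.trans (by exact_mod_cast (neg_lt_neg hν).le)
    · intro hw'
      refine hleaf2 w w' (exists_forall_norm_le_of_eventually (B := 1) (by positivity) ?_)
      have h2 := eventually_norm_le_of_expRate_le tendsto_abs_atTop_atTop (neg_lt_neg hμ) hw'
      filter_upwards [tendsto_natCast_atTop_atTop.eventually h2] with n hn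
      refine hn.trans (le_of_eq ?_)
      rw [hs₁, ← Real.exp_neg, ← Real.exp_nat_mul, one_mul, abs_of_nonneg n.cast_nonneg, mul_comm]
  -- Lying on a leaf is a symmetric relation, so the base points on the manifold whose leaf contains
  -- `x` are the points of the manifold on the leaf of `x`.
  · obtain ⟨w, ⟨hw1, hw2⟩, hw3⟩ := hpoint x
    exact ⟨w, ⟨hw2, hsymm _ _ hw1⟩, fun w' ⟨h1, h2⟩ => hw3 w' ⟨hsymm _ _ h2, h1⟩⟩

end Manifold

end

end Vorticity

namespace Vorticity

noncomputable section

/-! ### The Duhamel operator -/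

section Superposition

variable {I X Y : Type*} [TopologicalSpace I] [CompactSpace I] [NormedAddCommGroup X]
  [NormedSpace ℝ X] [NormedAddCommGroup Y] [NormedSpace ℝ Y]

/-- The pointwise application of a continuous family of operators, as an operator on spaces of
continuous functions. -/
def pointwiseOp (A : C(I, X →L[ℝ] Y)) : C(I, X) →L[ℝ] C(I, Y) :=
  LinearMap.mkContinuous
    { toFun := fun v => ⟨fun t => A t (v t), by fun_prop⟩
      map_add' := fun v w => by ext t; simp
      map_smul' := fun a v => by ext t; simp } ‖A‖ fun v => by
    refine (ContinuousMap.norm_le _ (by positivity)).2 fun t => ?_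
    calc ‖A t (v t)‖ ≤ ‖A t‖ * ‖v t‖ := (A t).le_opNorm _
      _ ≤ ‖A‖ * ‖v‖ := by gcongr; exacts [A.norm_coe_le_norm t, v.norm_coe_le_norm t]

lemma pointwiseOp_apply (A : C(I, X →L[ℝ] Y)) (v : C(I, X)) (t : I) :
    pointwiseOp A v t = A t (v t) := rfl

lemma norm_pointwiseOp_le {A : C(I, X →L[ℝ] Y)} {δ : ℝ} (hδ : 0 ≤ δ) (hA : ∀ t, ‖A t‖ ≤ δ) :
    ‖pointwiseOp A‖ ≤ δ := by
  refine ContinuousLinearMap.opNorm_le_bound _ hδ fun v => ?_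
  refine (ContinuousMap.norm_le (pointwiseOp A v) (by positivity)).2 fun t => ?_
  exact ((A t).le_of_opNorm_le (hA t) _).trans (by gcongr; exact v.norm_coe_le_norm t)

lemma norm_pointwiseOp_sub_le (A B : C(I, X →L[ℝ] Y)) :
    ‖pointwiseOp A - pointwiseOp B‖ ≤ ‖A - B‖ := by
  have : pointwiseOp A - pointwiseOp B = pointwiseOp (A - B) := by
    ext v t
    simp [pointwiseOp_apply]
  rw [this]
  exact norm_pointwiseOp_le (norm_nonneg (A - B)) fun t => (A - B).norm_coe_le_norm t

/-- The superposition operator `u ↦ N ∘ u`. -/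
def superposition (N : C(X, Y)) (u : C(I, X)) : C(I, Y) := N.comp u

/-- The range of `u` is compact, so `fderiv ℝ N` is uniformly continuous near it, and the mean value
inequality gives a remainder uniform in `t`. -/
lemma hasFDerivAt_superposition {N : C(X, Y)} (hN : ContDiff ℝ 1 N) (u : C(I, X)) :
    HasFDerivAt (superposition N)
      (pointwiseOp ((⟨fderiv ℝ N, hN.continuous_fderiv (by norm_num)⟩ :
        C(X, X →L[ℝ] Y)).comp u)) u := by
  rw [hasFDerivAt_iff_isLittleO, Asymptotics.isLittleO_iff]
  intro ε hε
  have hc : Continuous (fderiv ℝ N) := hN.continuous_fderiv (by norm_num)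
  have hK : IsCompact (range u) := isCompact_range u.continuous
  have h1 := hK.uniformContinuousAt_of_continuousAt (fderiv ℝ N) (fun a _ => hc.continuousAt)
    (Metric.dist_mem_uniformity hε)
  obtain ⟨η, hη, hη'⟩ := Metric.mem_uniformity_dist.1 h1
  filter_upwards [Metric.ball_mem_nhds u hη] with v hv
  refine (ContinuousMap.norm_le _ (by positivity)).2 fun t => ?_
  have hvt : v t ∈ Metric.ball (u t) η :=
    (ContinuousMap.dist_apply_le_dist (f := v) (g := u) t).trans_lt hv
  have h2 := (convex_ball (u t) η).norm_image_sub_le_of_norm_fderiv_le' (𝕜 := ℝ) (f := N)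
    (φ := fderiv ℝ N (u t)) (C := ε)
    (fun x _ => hN.differentiable (by norm_num) x) (fun x hx => by
      have := hη' (a := u t) (b := x) (by rw [dist_comm]; exact hx) ⟨t, rfl⟩
      rw [← dist_eq_norm, dist_comm]
      exact le_of_lt this) (Metric.mem_ball_self hη) hvt
  refine h2.trans ?_
  gcongr
  exact (v - u).norm_coe_le_norm t

lemma continuous_pointwiseOp :
    Continuous (pointwiseOp : C(I, X →L[ℝ] Y) → C(I, X) →L[ℝ] C(I, Y)) := by
  have h : LipschitzWith 1 (pointwiseOp : C(I, X →L[ℝ] Y) → C(I, X) →L[ℝ] C(I, Y)) :=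
    LipschitzWith.of_dist_le_mul fun A B => by
      rw [NNReal.coe_one, one_mul, dist_eq_norm (pointwiseOp A), dist_eq_norm A]
      exact norm_pointwiseOp_sub_le A B
  exact h.continuous

lemma contDiff_superposition {N : C(X, Y)} (hN : ContDiff ℝ 1 N) :
    ContDiff ℝ 1 (superposition N : C(I, X) → C(I, Y)) := by
  rw [contDiff_one_iff_fderiv]
  refine ⟨fun u => (hasFDerivAt_superposition hN u).differentiableAt, ?_⟩
  rw [funext fun u => (hasFDerivAt_superposition hN u).fderiv]
  exact continuous_pointwiseOp.comp (ContinuousMap.continuous_postcomp (X := I) _)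

end Superposition

/-- A perturbation of the identity by a `C¹` contraction is invertible, with a `C¹` inverse. -/
lemma exists_contDiff_inverse {E : Type*} [NormedAddCommGroup E] [NormedSpace ℝ E]
    [CompleteSpace E] {T : E → E} (hTd : ContDiff ℝ 1 T)
    (hT : ∀ u v, ‖T u - T v‖ ≤ 1 / 2 * ‖u - v‖) :
    ∃ G : E → E, (∀ u v, u + T u = v ↔ u = G v) ∧ ContDiff ℝ 1 G := by
  have happ : ApproximatesLinearOn (fun u => u + T u)
      ((ContinuousLinearEquiv.refl ℝ E : E ≃L[ℝ] E) : E →L[ℝ] E) univ (1 / 2) := by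
    intro u _ v _
    have : u + T u - (v + T v) - (u - v) = T u - T v := by abel
    change ‖u + T u - (v + T v) - (u - v)‖ ≤ _
    rw [this]
    simpa using hT u v
  have hcond : Subsingleton E ∨ (1 / 2 : ℝ≥0) <
      ‖((ContinuousLinearEquiv.refl ℝ E).symm : E →L[ℝ] E)‖₊⁻¹ := by
    rcases subsingleton_or_nontrivial E with hE | hE
    · exact Or.inl hE
    · right
      have : ‖((ContinuousLinearEquiv.refl ℝ E).symm : E →L[ℝ] E)‖₊ = 1 := by
        ext
        exact ContinuousLinearMap.norm_id
      rw [this, inv_one, ← NNReal.coe_lt_coe]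
      norm_num
  set H : E ≃ₜ E := happ.toHomeomorph _ hcond
  have hH : ∀ u, H u = u + T u := fun _ => rfl
  have hTn : ∀ u, ‖fderiv ℝ T u‖ ≤ 1 / 2 := fun u =>
    norm_fderiv_le_of_lip' ℝ (by norm_num) (Eventually.of_forall fun v => hT v u)
  refine ⟨H.symm, fun u v => by rw [H.eq_symm_apply, hH], ?_⟩
  have hunit : ∀ u, ∃ L : E ≃L[ℝ] E, (L : E →L[ℝ] E) = ContinuousLinearMap.id ℝ E +
      fderiv ℝ T u := fun u => by
    have hlt : ‖-fderiv ℝ T u‖ < 1 := by rw [norm_neg]; linarith [hTn u]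
    obtain ⟨U, hU⟩ := isUnit_one_sub_of_norm_lt_one hlt
    refine ⟨ContinuousLinearEquiv.ofUnit U, ?_⟩
    ext1 v
    change (U : E →L[ℝ] E) v = _
    rw [hU, sub_neg_eq_add]
    rfl
  choose L hL using hunit
  refine H.contDiff_symm (f₀' := L) (fun u => ?_) (contDiff_id.add hTd)
  rw [hL]
  exact (hasFDerivAt_id u).add (hTd.differentiable (by norm_num) u).hasFDerivAt

lemma hasFDerivAt_neg_comp_of_zero {D E F : Type*} [NormedAddCommGroup D] [NormedSpace ℝ D]
    [NormedAddCommGroup E] [NormedSpace ℝ E] [NormedAddCommGroup F] [NormedSpace ℝ F] {T : E → F}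
    {φ : D → E} {x : D} (hT : HasFDerivAt T (0 : E →L[ℝ] F) (φ x)) (hφ : DifferentiableAt ℝ φ x) :
    HasFDerivAt (fun y => -T (φ y)) (0 : D →L[ℝ] F) x := by
  have h2 := (hT.comp x hφ.hasFDerivAt).neg
  rw [ContinuousLinearMap.zero_comp, neg_zero] at h2
  exact h2

lemma norm_extend_le {Y : Type*} [NormedAddCommGroup Y] (f : C(unitInterval, Y)) (s : ℝ) : ‖IccExtend zero_le_one f s‖ ≤ ‖f‖ :=
  f.norm_coe_le_norm _

section Duhamel

variable {X Y : Type*} [NormedAddCommGroup X] [NormedSpace ℝ X] [NormedAddCommGroup Y]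
  [NormedSpace ℝ Y]

/-- A strongly continuous semigroup `S` and a family of smoothing operators `K`, of singularity
`t ^ (-3/4)` at the origin, which is compatible with `S`. -/
structure SmoothingPair (S : ℝ → X →L[ℝ] X) (K : ℝ → Y →L[ℝ] X) (c C : ℝ) : Prop where
  S_zero : ∀ x, S 0 x = x
  S_add : ∀ s t, 0 ≤ s → 0 ≤ t → ∀ x, S (s + t) x = S s (S t x)
  S_cont : ∀ x, ContinuousOn (fun t => S t x) (Ici 0)
  S_bdd : ∀ T, ∃ B, ∀ t ∈ Icc 0 T, ‖S t‖ ≤ B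
  S_le : ∀ t ∈ Icc (0 : ℝ) 1, ‖S t‖ ≤ C
  K_le : ∀ t ∈ Ioc (0 : ℝ) 1, ‖K t‖ ≤ c * t ^ (-(3 / 4) : ℝ)
  S_K : ∀ s t, 0 ≤ s → 0 < t → ∀ y, S s (K t y) = K (s + t) y

variable {S : ℝ → X →L[ℝ] X} {K : ℝ → Y →L[ℝ] X} {c C : ℝ}

namespace SmoothingPair

lemma c_nonneg (h : SmoothingPair S K c C) : 0 ≤ c := by
  simpa using (norm_nonneg _).trans (h.K_le 1 ⟨one_pos, le_rfl⟩)

lemma C_nonneg (h : SmoothingPair S K c C) : 0 ≤ C :=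
  (norm_nonneg _).trans (h.S_le 0 ⟨le_rfl, zero_le_one⟩)

/-- Strong continuity together with local boundedness of the norms gives joint continuity. -/
lemma continuousOn_S (h : SmoothingPair S K c C) :
    ContinuousOn (fun p : ℝ × X => S p.1 p.2) (Ici 0 ×ˢ univ) := by
  rintro ⟨t₀, x₀⟩ ⟨ht₀, -⟩
  obtain ⟨B, hB⟩ := h.S_bdd (t₀ + 1)
  rw [ContinuousWithinAt, tendsto_iff_norm_sub_tendsto_zero]
  have h1 : Tendsto (fun p : ℝ × X => B * ‖p.2 - x₀‖ + ‖S p.1 x₀ - S t₀ x₀‖)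
      (𝓝[Ici 0 ×ˢ univ] (t₀, x₀)) (𝓝 0) := by
    have h2 : ContinuousWithinAt (fun p : ℝ × X => B * ‖p.2 - x₀‖ + ‖S p.1 x₀ - S t₀ x₀‖)
        (Ici 0 ×ˢ univ) (t₀, x₀) := by
      refine ContinuousWithinAt.add (by fun_prop) (ContinuousWithinAt.norm
        (ContinuousWithinAt.sub ?_ continuousWithinAt_const))
      exact ContinuousWithinAt.comp (x := (t₀, x₀)) (f := Prod.fst) (g := fun t => S t x₀)
        (h.S_cont x₀ t₀ ht₀) (by fun_prop) fun p hp => hp.1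
    simpa using h2.tendsto
  refine squeeze_zero' (Eventually.of_forall fun _ => norm_nonneg _) ?_ h1
  have h3 : ∀ᶠ p : ℝ × X in 𝓝[Ici 0 ×ˢ univ] (t₀, x₀), p.1 < t₀ + 1 :=
    nhdsWithin_le_nhds (continuous_fst.continuousAt.eventually (gt_mem_nhds (lt_add_one t₀)))
  filter_upwards [h3, self_mem_nhdsWithin] with p hp hp'
  have h4 : S p.1 p.2 - S t₀ x₀ = S p.1 (p.2 - x₀) + (S p.1 x₀ - S t₀ x₀) := by
    rw [map_sub]; abel
  rw [h4]
  exact (norm_add_le _ _).trans (by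
    gcongr
    exact (S p.1).le_of_opNorm_le (hB _ ⟨hp'.1, hp.le⟩) _)

/-- Near `t₀ > 0` one has `K t = S (t - t₀ / 2) (K (t₀ / 2))`, so the continuity comes from that of
the semigroup. -/
lemma continuousOn_K (h : SmoothingPair S K c C) :
    ContinuousOn (fun p : ℝ × Y => K p.1 p.2) (Ioi 0 ×ˢ univ) := by
  rintro ⟨t₀, y₀⟩ ⟨ht₀, -⟩
  have ht0 : 0 < t₀ := ht₀
  refine ContinuousAt.continuousWithinAt ?_
  have hev : ∀ᶠ p : ℝ × Y in 𝓝 (t₀, y₀), t₀ / 2 < p.1 :=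
    continuous_fst.continuousAt.eventually (lt_mem_nhds (by change t₀ / 2 < t₀; linarith))
  have h1 : ContinuousAt (fun p : ℝ × Y => S (p.1 - t₀ / 2) (K (t₀ / 2) p.2)) (t₀, y₀) := by
    have h2 : Ici (0 : ℝ) ×ˢ (univ : Set X) ∈ 𝓝 (t₀ - t₀ / 2, K (t₀ / 2) y₀) :=
      prod_mem_nhds (Ici_mem_nhds (by linarith)) univ_mem
    exact ContinuousAt.comp (x := (t₀, y₀)) (g := fun p : ℝ × X => S p.1 p.2)
      (f := fun p : ℝ × Y => (p.1 - t₀ / 2, K (t₀ / 2) p.2)) (h.continuousOn_S.continuousAt h2)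
      (by fun_prop)
  refine h1.congr ?_
  filter_upwards [hev] with p hp
  rw [h.S_K _ _ (by linarith) (by linarith), sub_add_cancel]

/-- For `t > 1` the operator is `S (t - 1)` after `K 1`; the resulting bound is dominated by a
multiple of the singular function on `(0, T]`. -/
lemma exists_K_le (h : SmoothingPair S K c C) (T : ℝ) :
    ∃ c', 0 ≤ c' ∧ ∀ t ∈ Ioc 0 T, ‖K t‖ ≤ c' * t ^ (-(3 / 4) : ℝ) := by
  obtain ⟨B, hB⟩ := h.S_bdd T
  have hc := h.c_nonneg
  refine ⟨c + |B| * ‖K 1‖ * |T| ^ (3 / 4 : ℝ), by positivity, fun t ht => ?_⟩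
  have hpos : 0 < t ^ (-(3 / 4) : ℝ) := Real.rpow_pos_of_pos ht.1 _
  rw [add_mul]
  by_cases ht1 : t ≤ 1
  · have := h.K_le t ⟨ht.1, ht1⟩
    have h2 : 0 ≤ |B| * ‖K 1‖ * |T| ^ (3 / 4 : ℝ) * t ^ (-(3 / 4) : ℝ) := by positivity
    linarith
  · push Not at ht1
    have h1 : ‖K t‖ ≤ |B| * ‖K 1‖ := by
      refine ContinuousLinearMap.opNorm_le_bound _ (by positivity) fun y => ?_
      have h2 : K t y = S (t - 1) (K 1 y) := by
        rw [h.S_K _ _ (by linarith) one_pos, sub_add_cancel]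
      rw [h2, mul_assoc]
      refine ((S (t - 1)).le_of_opNorm_le (hB _ ⟨by linarith, by linarith [ht.2]⟩) _).trans ?_
      gcongr
      exacts [le_abs_self B, (K 1).le_opNorm y]
    have h3 : 1 ≤ |T| ^ (3 / 4 : ℝ) * t ^ (-(3 / 4) : ℝ) := by
      rw [Real.rpow_neg ht.1.le, ← div_eq_mul_inv, one_le_div (by positivity)]
      exact Real.rpow_le_rpow ht.1.le (ht.2.trans (le_abs_self T)) (by norm_num)
    calc ‖K t‖ ≤ |B| * ‖K 1‖ * 1 := by rw [mul_one]; exact h1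
      _ ≤ |B| * ‖K 1‖ * (|T| ^ (3 / 4 : ℝ) * t ^ (-(3 / 4) : ℝ)) := by gcongr
      _ ≤ _ := by
        have : 0 ≤ c * t ^ (-(3 / 4) : ℝ) := by positivity
        linarith

lemma intervalIntegrable_singular (τ : ℝ) :
    IntervalIntegrable (fun t : ℝ => t ^ (-(3 / 4) : ℝ)) volume 0 τ :=
  intervalIntegral.intervalIntegrable_rpow' (by norm_num)

lemma integral_singular : ∫ t in (0 : ℝ)..1, t ^ (-(3 / 4) : ℝ) = 4 := by
  rw [integral_rpow (Or.inl (by norm_num))]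
  norm_num

lemma intervalIntegrable (h : SmoothingPair S K c C) {τ : ℝ} (hτ : 0 ≤ τ) {f : ℝ → Y}
    (hf : ContinuousOn f (Icc 0 τ)) :
    IntervalIntegrable (fun s => K (τ - s) (f s)) volume 0 τ := by
  obtain ⟨c', hc', hK⟩ := h.exists_K_le τ
  obtain ⟨D, hD⟩ := isCompact_Icc.exists_bound_of_continuousOn hf
  have hb : IntervalIntegrable (fun s => c' * (τ - s) ^ (-(3 / 4) : ℝ) * D) volume 0 τ := by
    have := (intervalIntegrable_singular τ).comp_sub_left τ
    rw [sub_zero, sub_self] at this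
    exact ((this.symm.const_mul c').mul_const D)
  rw [intervalIntegrable_iff_integrableOn_Ioo_of_le hτ] at hb ⊢
  refine Integrable.mono' hb ?_ ?_
  · refine ContinuousOn.aestronglyMeasurable (fun s hs => ?_) measurableSet_Ioo
    refine (h.continuousOn_K (τ - s, f s) ⟨sub_pos.2 hs.2, mem_univ _⟩).comp
      (f := fun s => (τ - s, f s)) (s := Ioo 0 τ) ?_ fun s hs => ⟨sub_pos.2 hs.2, mem_univ _⟩
    exact ContinuousWithinAt.prodMk (by fun_prop)
      ((hf s ⟨hs.1.le, hs.2.le⟩).mono Ioo_subset_Icc_self)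
  · refine (ae_restrict_iff' measurableSet_Ioo).2 (Eventually.of_forall fun s hs => ?_)
    refine (K (τ - s)).le_opNorm _ |>.trans ?_
    have h1 := hK (τ - s) ⟨sub_pos.2 hs.2, by linarith [hs.1]⟩
    have h2 := hD s ⟨hs.1.le, hs.2.le⟩
    exact mul_le_mul h1 h2 (norm_nonneg _) ((norm_nonneg _).trans h1)

/-- `∫ K (t - s) f(s) ds` over `0 ≤ s ≤ t`. -/
def duhamelFun (K : ℝ → Y →L[ℝ] X) (f : C(unitInterval, Y)) (t : ℝ) : X :=
  ∫ s in (0 : ℝ)..t, K (t - s) (IccExtend zero_le_one f s)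

/-- The reflection `s ↦ t - s` fixes the singularity at `s = 0` and moves the dependence on `t` into
the argument of `f` and an indicator, as dominated convergence requires. -/
lemma duhamelFun_eq (K : ℝ → Y →L[ℝ] X) (f : C(unitInterval, Y)) {t : ℝ} (ht : t ∈ Icc (0 : ℝ) 1) :
    duhamelFun K f t = ∫ s in (0 : ℝ)..1,
      indicator {s | s ≤ t} (fun s => K s (IccExtend zero_le_one f (t - s))) s := by
  rw [intervalIntegral.integral_indicator ht, duhamelFun]
  have := intervalIntegral.integral_comp_sub_left (a := 0) (b := t)
    (fun s => K s (IccExtend zero_le_one f (t - s))) t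
  simpa using this

lemma norm_indicator_le (h : SmoothingPair S K c C) (f : C(unitInterval, Y)) (t : ℝ) {s : ℝ}
    (hs : s ∈ Ioc (0 : ℝ) 1) :
    ‖indicator {s | s ≤ t} (fun s => K s (IccExtend zero_le_one f (t - s))) s‖ ≤
      c * s ^ (-(3 / 4) : ℝ) * ‖f‖ := by
  refine (norm_indicator_le_norm_self _ _).trans ((K s).le_opNorm _ |>.trans ?_)
  have h1 := h.K_le s hs
  exact mul_le_mul h1 (norm_extend_le f _) (norm_nonneg _) ((norm_nonneg _).trans h1)

lemma continuousOn_duhamelFun (h : SmoothingPair S K c C) (f : C(unitInterval, Y)) :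
    ContinuousOn (duhamelFun K f) (Icc 0 1) := by
  have hext : Continuous (IccExtend (zero_le_one' ℝ) f) := f.continuous.Icc_extend'
  intro t₀ ht₀
  have h1 : ContinuousAt (fun t => ∫ s in (0 : ℝ)..1,
      indicator {s | s ≤ t} (fun s => K s (IccExtend zero_le_one f (t - s))) s) t₀ := by
    refine intervalIntegral.continuousAt_of_dominated_interval
      (bound := fun s => c * s ^ (-(3 / 4) : ℝ) * ‖f‖) (Eventually.of_forall fun t => ?_)
      (Eventually.of_forall fun t => Eventually.of_forall fun s hs => ?_)
      (((intervalIntegrable_singular 1).const_mul c).mul_const _) ?_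
    · refine AEStronglyMeasurable.indicator ?_ measurableSet_Iic
      rw [uIoc_of_le zero_le_one]
      refine ContinuousOn.aestronglyMeasurable ?_ measurableSet_Ioc
      exact h.continuousOn_K.comp (f := fun s => (s, IccExtend zero_le_one f (t - s)))
        (by fun_prop) fun s hs => ⟨hs.1, mem_univ _⟩
    · rw [uIoc_of_le zero_le_one] at hs
      exact h.norm_indicator_le f t hs
    · have hne : ∀ᵐ s : ℝ, s ≠ t₀ := by simp [ae_iff, measure_singleton]
      filter_upwards [hne] with s hs hs1
      rw [uIoc_of_le zero_le_one] at hs1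
      rcases lt_or_gt_of_ne hs with hlt | hgt
      · have h2 : ContinuousAt (fun t => K s (IccExtend zero_le_one f (t - s))) t₀ := by
          fun_prop
        refine h2.congr ?_
        filter_upwards [lt_mem_nhds hlt] with t ht
        exact (indicator_of_mem (s := {s | s ≤ t}) ht.le
          (fun s => K s (IccExtend zero_le_one f (t - s)))).symm
      · refine (continuousAt_const : ContinuousAt (fun _ : ℝ => (0 : X)) t₀).congr ?_
        filter_upwards [gt_mem_nhds hgt] with t ht
        exact (indicator_of_notMem (s := {s | s ≤ t}) (by simpa using ht)
          (fun s => K s (IccExtend zero_le_one f (t - s)))).symm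
  exact h1.continuousWithinAt.congr (fun t ht => duhamelFun_eq K f ht) (duhamelFun_eq K f ht₀)

/-- The factor `4` is the integral of `s^{-3/4}` over `[0, 1]`. -/
lemma norm_duhamelFun_le (h : SmoothingPair S K c C) (f : C(unitInterval, Y)) {t : ℝ}
    (ht : t ∈ Icc (0 : ℝ) 1) : ‖duhamelFun K f t‖ ≤ 4 * c * ‖f‖ := by
  rw [duhamelFun_eq K f ht]
  have := intervalIntegral.norm_integral_le_of_norm_le (zero_le_one' ℝ)
    (f := indicator {s | s ≤ t} (fun s => K s (IccExtend zero_le_one f (t - s))))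
    (g := fun s => c * s ^ (-(3 / 4) : ℝ) * ‖f‖)
    (Eventually.of_forall fun s hs => h.norm_indicator_le f t hs)
    (((intervalIntegrable_singular 1).const_mul c).mul_const _)
  refine this.trans (le_of_eq ?_)
  rw [intervalIntegral.integral_mul_const, intervalIntegral.integral_const_mul, integral_singular]
  ring

lemma intervalIntegrable_extend (h : SmoothingPair S K c C) (f : C(unitInterval, Y)) {t : ℝ}
    (ht : 0 ≤ t) :
    IntervalIntegrable (fun s => K (t - s) (IccExtend zero_le_one f s)) volume 0 t :=
  h.intervalIntegrable ht (f.continuous.Icc_extend' (h := zero_le_one)).continuousOn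

/-- The Duhamel operator on `C([0, 1])`. -/
def duhamel (h : SmoothingPair S K c C) : C(unitInterval, Y) →L[ℝ] C(unitInterval, X) :=
  LinearMap.mkContinuous
    { toFun := fun f => ⟨fun t => duhamelFun K f t,
        continuousOn_iff_continuous_domRestrict.1 (h.continuousOn_duhamelFun f)⟩
      map_add' := fun f g => by
        ext t
        change duhamelFun K (f + g) t = duhamelFun K f t + duhamelFun K g t
        rw [duhamelFun, duhamelFun, duhamelFun, ← intervalIntegral.integral_add
          (h.intervalIntegrable_extend f t.2.1) (h.intervalIntegrable_extend g t.2.1)]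
        congr 1
        ext s
        rw [← map_add]; rfl
      map_smul' := fun a f => by
        ext t
        change duhamelFun K (a • f) t = a • duhamelFun K f t
        rw [duhamelFun, duhamelFun, ← intervalIntegral.integral_smul]
        congr 1
        ext s
        rw [← map_smul]; rfl } (4 * c) fun f => by
    have hc := h.c_nonneg
    exact (ContinuousMap.norm_le _ (by positivity)).2 fun t => h.norm_duhamelFun_le f t.2

lemma norm_duhamel_le (h : SmoothingPair S K c C) : ‖h.duhamel‖ ≤ 4 * c :=
  LinearMap.mkContinuous_norm_le _ (by have := h.c_nonneg; positivity) _

/-- The orbits of the semigroup as elements of `C([0, 1])`. -/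
def orbit (h : SmoothingPair S K c C) : X →L[ℝ] C(unitInterval, X) :=
  LinearMap.mkContinuous
    { toFun := fun x => ⟨fun t => S t x,
        ((h.S_cont x).comp_continuous continuous_subtype_val fun t => t.2.1)⟩
      map_add' := fun x y => by ext t; simp
      map_smul' := fun a x => by ext t; simp } C fun x => by
    have hC := h.C_nonneg
    exact (ContinuousMap.norm_le _ (by positivity)).2 fun t =>
      (S t).le_of_opNorm_le (h.S_le t t.2) x

lemma norm_orbit_le (h : SmoothingPair S K c C) (x : X) : ‖h.orbit x‖ ≤ C * ‖x‖ :=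
  h.orbit.le_of_opNorm_le (LinearMap.mkContinuous_norm_le _ h.C_nonneg _) x

/-- Solutions on `[0, 1]` of the integral equation depend continuously differentiably on the
initial value. -/
theorem exists_local [CompleteSpace X] (h : SmoothingPair S K c C) {N : X → Y} {δ : ℝ}
    (hδ : 0 ≤ δ) (hcδ : 4 * c * δ ≤ 1 / 2) (hNd : ContDiff ℝ 1 N)
    (hN : ∀ x y, ‖N x - N y‖ ≤ δ * ‖x - y‖) (hN0 : N 0 = 0) (hN' : fderiv ℝ N 0 = 0) :
    ∃ φ : X → C(unitInterval, X),
      (∀ ζ u, u + h.duhamel (superposition ⟨N, hNd.continuous⟩ u) = h.orbit ζ ↔ u = φ ζ) ∧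
      (∀ ζ ζ', ‖φ ζ - φ ζ'‖ ≤ 2 * C * ‖ζ - ζ'‖) ∧ φ 0 = 0 ∧ ContDiff ℝ 1 φ ∧
      (∀ ζ ζ', ‖(φ ζ - h.orbit ζ) - (φ ζ' - h.orbit ζ')‖ ≤ 8 * c * C * δ * ‖ζ - ζ'‖) ∧
      HasFDerivAt (fun ζ => φ ζ - h.orbit ζ) (0 : X →L[ℝ] C(unitInterval, X)) 0 := by
  have hc := h.c_nonneg
  have hC := h.C_nonneg
  set Nc : C(X, Y) := ⟨N, hNd.continuous⟩
  set T : C(unitInterval, X) → C(unitInterval, X) := fun u => h.duhamel (superposition Nc u)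
  have hsup : ∀ u v : C(unitInterval, X), ‖superposition Nc u - superposition Nc v‖ ≤
      δ * ‖u - v‖ := fun u v => (ContinuousMap.norm_le _ (by positivity)).2 fun t =>
    (hN (u t) (v t)).trans (by gcongr; exact (u - v).norm_coe_le_norm t)
  have hT : ∀ u v, ‖T u - T v‖ ≤ 4 * c * δ * ‖u - v‖ := fun u v => by
    change ‖h.duhamel _ - h.duhamel _‖ ≤ _
    rw [← map_sub, mul_assoc]
    exact (h.duhamel.le_of_opNorm_le h.norm_duhamel_le _).trans (by gcongr; exact hsup u v)
  have hT2 : ∀ u v, ‖T u - T v‖ ≤ 1 / 2 * ‖u - v‖ := fun u v => (hT u v).trans (by gcongr)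
  have hTd : ContDiff ℝ 1 T := h.duhamel.contDiff.comp (contDiff_superposition hNd)
  -- The integral equation reads `u + T u = h.orbit ζ` with a `C¹` contraction `T`, so the solution
  -- is the inverse of `1 + T` applied to the linear orbit.
  obtain ⟨G, hG, hGd⟩ := exists_contDiff_inverse hTd hT2
  have hφeq : ∀ ζ, G (h.orbit ζ) + T (G (h.orbit ζ)) = h.orbit ζ := fun ζ => (hG _ _).2 rfl
  have hsub : ∀ ζ, G (h.orbit ζ) - h.orbit ζ = -T (G (h.orbit ζ)) := fun ζ => by
    rw [sub_eq_iff_eq_add, ← sub_eq_neg_add, eq_sub_iff_add_eq, hφeq]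
  have hlip : ∀ ζ ζ', ‖G (h.orbit ζ) - G (h.orbit ζ')‖ ≤ 2 * C * ‖ζ - ζ'‖ := by
    intro ζ ζ'
    have h1 : G (h.orbit ζ) - G (h.orbit ζ') = h.orbit (ζ - ζ') -
        (T (G (h.orbit ζ)) - T (G (h.orbit ζ'))) := by
      rw [map_sub, ← sub_eq_zero]
      have e1 := hφeq ζ
      have e2 := hφeq ζ'
      generalize G (h.orbit ζ) = a at e1 ⊢
      generalize G (h.orbit ζ') = b at e2 ⊢
      rw [← e1, ← e2]
      abel
    have h2 := (norm_sub_le (h.orbit (ζ - ζ')) (T (G (h.orbit ζ)) - T (G (h.orbit ζ')))).trans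
      (add_le_add (h.norm_orbit_le (ζ - ζ')) (hT2 (G (h.orbit ζ)) (G (h.orbit ζ'))))
    rw [← h1] at h2
    linarith
  have hsup0 : superposition Nc (0 : C(unitInterval, X)) = 0 := by ext t; exact hN0
  have hφ0 : G (h.orbit 0) = 0 := by
    rw [map_zero, eq_comm, ← hG]
    simp [T, hsup0]
  have hφd : ContDiff ℝ 1 fun ζ => G (h.orbit ζ) := hGd.comp h.orbit.contDiff
  refine ⟨fun ζ => G (h.orbit ζ), fun ζ u => hG _ _, hlip, hφ0, hφd, fun ζ ζ' => ?_, ?_⟩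
  · rw [hsub, hsub, neg_sub_neg]
    refine (hT _ _).trans ?_
    rw [norm_sub_rev]
    calc _ ≤ 4 * c * δ * (2 * C * ‖ζ - ζ'‖) := by gcongr; exact hlip _ _
      _ = _ := by ring
  · simp only [hsub]
    have h1 : HasFDerivAt T (0 : C(unitInterval, X) →L[ℝ] C(unitInterval, X))
        (G (h.orbit 0)) := by
      rw [hφ0]
      have h2 := h.duhamel.hasFDerivAt.comp (0 : C(unitInterval, X))
        (hasFDerivAt_superposition (N := Nc) hNd 0)
      have h3 : pointwiseOp ((⟨fderiv ℝ Nc, hNd.continuous_fderiv (by norm_num)⟩ :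
          C(X, X →L[ℝ] Y)).comp (0 : C(unitInterval, X))) = 0 := by
        ext v t
        change fderiv ℝ N 0 (v t) = 0
        rw [hN']
        rfl
      rw [h3, ContinuousLinearMap.comp_zero] at h2
      exact h2
    exact hasFDerivAt_neg_comp_of_zero h1 (hφd.differentiable (by norm_num) 0)

end SmoothingPair

end Duhamel

end

end Vorticity

namespace Vorticity

noncomputable section

/-! ### Global mild solutions and their semiflow -/

section MildSolutions

variable {X Y : Type*} [NormedAddCommGroup X] [NormedSpace ℝ X] [NormedAddCommGroup Y]
  [NormedSpace ℝ Y]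

/-- The integral equation at time `τ`. -/
def MildAt (S : ℝ → X →L[ℝ] X) (K : ℝ → Y →L[ℝ] X) (N : X → Y) (ζ : X) (w : ℝ → X) (τ : ℝ) :
    Prop :=
  w τ + ∫ s in (0 : ℝ)..τ, K (τ - s) (N (w s)) = S τ ζ

variable {S : ℝ → X →L[ℝ] X} {K : ℝ → Y →L[ℝ] X} {c C : ℝ} {N : X → Y}

lemma MildAt.congr {ζ : X} {w w' : ℝ → X} {τ : ℝ} (h : MildAt S K N ζ w τ) (hτ : 0 ≤ τ)
    (hw : ∀ s ∈ Icc 0 τ, w' s = w s) : MildAt S K N ζ w' τ := by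
  rw [MildAt, hw τ ⟨hτ, le_rfl⟩, ← h]
  congr 1
  refine intervalIntegral.integral_congr fun s hs => ?_
  rw [uIcc_of_le hτ] at hs
  simp only [hw s hs]

/-- Restarting at time `a`: on `[0, a]` compatibility lets `S σ` be pulled out of the integral, and
the equation at `a` turns this part into `S (a + σ) ζ - S σ (w a)`. -/
lemma SmoothingPair.mildAt_add [CompleteSpace X] (h : SmoothingPair S K c C) (hN : Continuous N) {ζ : X}
    {w : ℝ → X} {a σ : ℝ} (ha : 0 ≤ a) (hσ : 0 ≤ σ) (hw : ContinuousOn w (Icc 0 (a + σ)))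
    (hwa : MildAt S K N ζ w a) :
    MildAt S K N ζ w (a + σ) ↔ MildAt S K N (w a) (fun s => w (a + s)) σ := by
  have hNw : ContinuousOn (fun s => N (w s)) (Icc 0 (a + σ)) := hN.comp_continuousOn hw
  have hI := h.intervalIntegrable (by positivity) hNw
  have h1 : IntervalIntegrable (fun s => K (a + σ - s) (N (w s))) volume 0 a :=
    hI.mono_set (by
      rw [uIcc_of_le ha, uIcc_of_le (by positivity)]
      exact Icc_subset_Icc_right (by linarith))
  have h2 : IntervalIntegrable (fun s => K (a + σ - s) (N (w s))) volume a (a + σ) :=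
    hI.mono_set (by
      rw [uIcc_of_le (by linarith), uIcc_of_le (by positivity)]
      exact Icc_subset_Icc_left ha)
  have h3 : ∫ s in (0 : ℝ)..a, K (a + σ - s) (N (w s)) = S (a + σ) ζ - S σ (w a) := by
    have h4 : ∫ s in (0 : ℝ)..a, K (a + σ - s) (N (w s)) =
        ∫ s in (0 : ℝ)..a, S σ (K (a - s) (N (w s))) := by
      rw [intervalIntegral.integral_of_le ha, intervalIntegral.integral_of_le ha,
        integral_Ioc_eq_integral_Ioo, integral_Ioc_eq_integral_Ioo]
      refine setIntegral_congr_fun measurableSet_Ioo fun s hs => ?_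
      rw [h.S_K σ (a - s) hσ (sub_pos.2 hs.2)]
      congr 2
      ring
    rw [h4, ContinuousLinearMap.intervalIntegral_comp_comm _ (h.intervalIntegrable ha
      (hNw.mono (Icc_subset_Icc_right (by linarith)))), add_comm a, h.S_add σ a hσ ha, ← map_sub,
      ← hwa, add_sub_cancel_left]
  have h5 : ∫ s in a..(a + σ), K (a + σ - s) (N (w s)) =
      ∫ s in (0 : ℝ)..σ, K (σ - s) (N (w (a + s))) := by
    have := intervalIntegral.integral_comp_add_left (a := 0) (b := σ)
      (fun s => K (a + σ - s) (N (w s))) a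
    rw [add_zero] at this
    rw [← this]
    refine intervalIntegral.integral_congr fun s _ => ?_
    simp only [add_sub_add_left_eq_sub]
  rw [MildAt, MildAt, ← intervalIntegral.integral_add_adjacent_intervals h1 h2, h3, h5,
    ← sub_eq_zero, ← sub_eq_zero (b := S σ (w a))]
  refine Eq.congr ?_ rfl
  abel

/-- The integral equation for a globally Lipschitz nonlinearity generates a semiflow, whose time-one
map is a small perturbation of the linear one. -/
theorem SmoothingPair.exists_semiflow [CompleteSpace X] (h : SmoothingPair S K c C) {δ : ℝ}
    (hδ : 0 ≤ δ) (hcδ : 4 * c * δ ≤ 1 / 2) (hNd : ContDiff ℝ 1 N)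
    (hN : ∀ x y, ‖N x - N y‖ ≤ δ * ‖x - y‖) (hN0 : N 0 = 0) (hN' : fderiv ℝ N 0 = 0) :
    ∃ Φ : ℝ → X → X, LipSemiflow Φ ∧ (∀ ζ τ, 0 ≤ τ → MildAt S K N ζ (fun t => Φ t ζ) τ) ∧
      (∀ ζ w, ContinuousOn w (Ici 0) → (∀ τ, 0 ≤ τ → MildAt S K N ζ w τ) →
        EqOn w (fun t => Φ t ζ) (Ici 0)) ∧
      ContDiff ℝ 1 (Φ 1) ∧
      (∀ x y, ‖(Φ 1 x - S 1 x) - (Φ 1 y - S 1 y)‖ ≤ 8 * c * C * δ * ‖x - y‖) ∧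
      fderiv ℝ (fun x => Φ 1 x - S 1 x) 0 = 0 := by
  obtain ⟨φ, hφ, hlip, hφ0, hφd, hφS, hφ'⟩ := h.exists_local hδ hcδ hNd hN hN0 hN'
  have hφc : Continuous fun p : X × unitInterval => φ p.1 p.2 :=
    ContinuousEval.continuous_eval.comp ((hφd.continuous.comp continuous_fst).prodMk continuous_snd)
  have hmild : ∀ (ζ : X) (u : C(unitInterval, X)), u = φ ζ ↔ ∀ t : unitInterval,
      u t + ∫ s in (0 : ℝ)..t, K (t - s) (N (IccExtend zero_le_one u s)) = S t ζ := by
    intro ζ u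
    rw [← hφ, ContinuousMap.ext_iff]
    rfl
  set F : X → X := fun ζ => φ ζ 1
  -- The time-one map is iterated over the integer part of `τ` and the local solution used on the
  -- fractional part. At integers both descriptions agree because `φ ζ 0 = ζ`.
  set Φ : ℝ → X → X := fun τ ζ =>
    φ (F^[⌊τ⌋₊] ζ) (projIcc 0 1 zero_le_one (τ - ⌊τ⌋₊)) with hΦdef
  have hφzero : ∀ ζ, φ ζ 0 = ζ := fun ζ => by
    have := (hmild ζ (φ ζ)).1 rfl 0
    simpa [h.S_zero] using this
  have hΦ1 : ∀ ζ τ (hτ : τ ∈ Icc (0 : ℝ) 1), Φ τ ζ = φ ζ ⟨τ, hτ⟩ := by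
    intro ζ τ hτ
    rcases eq_or_lt_of_le hτ.2 with rfl | hlt
    · simp only [hΦdef, Nat.floor_one, Function.iterate_one, Nat.cast_one, sub_self]
      rw [projIcc_left]
      exact hφzero _
    · have : ⌊τ⌋₊ = 0 := Nat.floor_eq_zero.2 hlt
      simp only [hΦdef, this, Function.iterate_zero, id, Nat.cast_zero, sub_zero]
      rw [projIcc_of_mem _ hτ]
  have hF : ∀ ζ, Φ 1 ζ = F ζ := fun ζ => hΦ1 ζ 1 ⟨zero_le_one, le_rfl⟩
  have hΦadd : ∀ ζ τ, 0 ≤ τ → Φ (1 + τ) ζ = Φ τ (F ζ) := by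
    intro ζ τ hτ
    simp only [hΦdef, add_comm (1 : ℝ) τ, Nat.floor_add_one hτ, Function.iterate_succ,
      Function.comp_apply, Nat.cast_add, Nat.cast_one, add_sub_add_right_eq_sub]
  have hFc : Continuous F := hφc.comp (continuous_id.prodMk continuous_const)
  have hcont1 : ContinuousOn (fun p : ℝ × X => Φ p.1 p.2) (Icc 0 1 ×ˢ univ) := by
    have : Continuous fun p : ℝ × X => φ p.2 (projIcc 0 1 (zero_le_one' ℝ) p.1) :=
      hφc.comp (continuous_snd.prodMk ((continuous_projIcc (h := zero_le_one' ℝ)).comp continuous_fst))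
    refine this.continuousOn.congr fun p hp => ?_
    simp only [hΦ1 p.2 p.1 hp.1, projIcc_of_mem _ hp.1]
  have hcontn : ∀ n : ℕ, ContinuousOn (fun p : ℝ × X => Φ p.1 p.2) (Icc 0 (n + 1 : ℝ) ×ˢ univ) := by
    intro n
    induction n with
    | zero => simpa using hcont1
    | succ n ih =>
      have hset : Icc (0 : ℝ) ((n + 1 : ℕ) + 1 : ℝ) ×ˢ (univ : Set X) =
          Icc 0 1 ×ˢ univ ∪ Icc 1 ((n + 1 : ℕ) + 1 : ℝ) ×ˢ univ := by
        rw [← union_prod, Icc_union_Icc_eq_Icc zero_le_one (by push_cast; linarith [Nat.cast_nonneg (α := ℝ) n])]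
      rw [hset]
      refine ContinuousOn.union_of_isClosed hcont1 ?_ (isClosed_Icc.prod isClosed_univ)
        (isClosed_Icc.prod isClosed_univ)
      have h1 : ContinuousOn (fun p : ℝ × X => Φ (p.1 - 1) (F p.2))
          (Icc 1 ((n + 1 : ℕ) + 1 : ℝ) ×ˢ univ) := by
        refine ih.comp (f := fun p : ℝ × X => (p.1 - 1, F p.2)) (by fun_prop) fun p hp => ?_
        have := hp.1
        push_cast at this
        exact ⟨⟨by linarith [this.1], by linarith [this.2]⟩, mem_univ _⟩
      refine h1.congr fun p hp => ?_
      change Φ p.1 p.2 = Φ (p.1 - 1) (F p.2)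
      rw [← hΦadd _ _ (by linarith [hp.1.1]), add_sub_cancel]
  have hcont : ContinuousOn (fun p : ℝ × X => Φ p.1 p.2) (Ici 0 ×ˢ univ) := by
    refine continuousOn_of_locally_continuousOn fun p hp => ?_
    obtain ⟨n, hn⟩ := exists_nat_gt p.1
    refine ⟨Iio (n : ℝ) ×ˢ univ, isOpen_Iio.prod isOpen_univ, ⟨hn, mem_univ _⟩, ?_⟩
    refine (hcontn n).mono fun q hq => ?_
    have h1 : q.1 < n := hq.2.1
    exact ⟨⟨hq.1.1, by linarith⟩, mem_univ _⟩
  have hcontζ : ∀ ζ, ContinuousOn (fun t => Φ t ζ) (Ici 0) := fun ζ =>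
    hcont.comp (f := fun t => (t, ζ)) (by fun_prop) fun t ht => ⟨ht, mem_univ _⟩
  have hloc : ∀ ζ w, ContinuousOn w (Icc 0 1) → ((∀ τ ∈ Icc (0 : ℝ) 1, MildAt S K N ζ w τ) ↔
      ∀ τ ∈ Icc (0 : ℝ) 1, w τ = Φ τ ζ) := by
    intro ζ w hw
    set u : C(unitInterval, X) := ⟨fun t => w t, continuousOn_iff_continuous_domRestrict.1 hw⟩
    have hu : ∀ t : unitInterval, (∫ s in (0 : ℝ)..t, K (t - s) (N (IccExtend zero_le_one u s))) =
        ∫ s in (0 : ℝ)..t, K (t - s) (N (w s)) := fun t => by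
      refine intervalIntegral.integral_congr fun s hs => ?_
      rw [uIcc_of_le t.2.1] at hs
      have hs1 : s ∈ Icc (0 : ℝ) 1 := ⟨hs.1, hs.2.trans t.2.2⟩
      simp only [IccExtend_of_mem zero_le_one u hs1]
      rfl
    have h1 := hmild ζ u
    simp only [hu] at h1
    constructor
    · intro h2 τ hτ
      rw [hΦ1 ζ τ hτ, ← h1.2 fun t => h2 t t.2]
      rfl
    · intro h2 τ hτ
      refine h1.1 ?_ ⟨τ, hτ⟩
      ext t
      change w t = _
      rw [h2 t t.2, hΦ1 ζ t t.2]
  have hex : ∀ (n : ℕ) ζ, ∀ τ ∈ Icc 0 (n + 1 : ℝ), MildAt S K N ζ (fun t => Φ t ζ) τ := by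
    intro n
    induction n with
    | zero =>
      intro ζ
      simpa using (hloc ζ _ ((hcontζ ζ).mono Icc_subset_Ici_self)).2 fun _ _ => rfl
    | succ n ih =>
      intro ζ τ hτ
      rcases le_total τ 1 with h1 | h1
      · exact ih ζ τ ⟨hτ.1, h1.trans (by linarith [Nat.cast_nonneg (α := ℝ) n])⟩
      · obtain ⟨σ, rfl⟩ : ∃ σ, τ = 1 + σ := ⟨τ - 1, by ring⟩
        have hσ : 0 ≤ σ := by linarith
        have h2 := hτ.2
        push_cast at h2
        refine (h.mildAt_add hNd.continuous zero_le_one hσ ((hcontζ ζ).mono Icc_subset_Ici_self)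
          (ih ζ 1 ⟨zero_le_one, by linarith [Nat.cast_nonneg (α := ℝ) n]⟩)).2 ?_
        rw [hF]
        exact (ih (F ζ) σ ⟨hσ, by linarith⟩).congr hσ fun s hs => hΦadd ζ s hs.1
  have hex' : ∀ ζ τ, 0 ≤ τ → MildAt S K N ζ (fun t => Φ t ζ) τ := fun ζ τ hτ => by
    obtain ⟨n, hn⟩ := exists_nat_gt τ
    exact hex n ζ τ ⟨hτ, by linarith⟩
  have huniq : ∀ (n : ℕ) ζ w, ContinuousOn w (Ici 0) → (∀ τ, 0 ≤ τ → MildAt S K N ζ w τ) →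
      ∀ τ ∈ Icc 0 (n + 1 : ℝ), w τ = Φ τ ζ := by
    intro n
    induction n with
    | zero =>
      intro ζ w hw hm
      simpa using (hloc ζ w (hw.mono Icc_subset_Ici_self)).1 fun τ hτ => hm τ hτ.1
    | succ n ih =>
      intro ζ w hw hm τ hτ
      rcases le_total τ 1 with h1 | h1
      · exact ih ζ w hw hm τ ⟨hτ.1, h1.trans (by linarith [Nat.cast_nonneg (α := ℝ) n])⟩
      · obtain ⟨σ, rfl⟩ : ∃ σ, τ = 1 + σ := ⟨τ - 1, by ring⟩
        have hσ : 0 ≤ σ := by linarith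
        have h2 := hτ.2
        push_cast at h2
        have hw1 : w 1 = F ζ := by
          rw [← hF]
          exact ih ζ w hw hm 1 ⟨zero_le_one, by linarith [Nat.cast_nonneg (α := ℝ) n]⟩
        rw [hΦadd ζ σ hσ, ← hw1]
        refine ih (w 1) (fun s => w (1 + s)) (hw.comp (by fun_prop) fun s hs => ?_)
          (fun s hs => ?_) σ ⟨hσ, by linarith⟩
        · exact add_nonneg zero_le_one (mem_Ici.1 hs)
        · exact (h.mildAt_add hNd.continuous zero_le_one hs (hw.mono Icc_subset_Ici_self)
            (hm 1 zero_le_one)).1 (hm _ (by positivity))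
  have huniq' : ∀ ζ w, ContinuousOn w (Ici 0) → (∀ τ, 0 ≤ τ → MildAt S K N ζ w τ) →
      EqOn w (fun t => Φ t ζ) (Ici 0) := fun ζ w hw hm τ hτ => by
    obtain ⟨n, hn⟩ := exists_nat_gt τ
    exact huniq n ζ w hw hm τ ⟨hτ, by linarith⟩
  have hΦS : ∀ x, Φ 1 x - S 1 x = ContinuousMap.evalCLM ℝ (1 : unitInterval)
      (φ x - h.orbit x) := fun x => by rw [hF]; rfl
  refine ⟨Φ, ⟨fun x => ?_, fun s t hs ht x => ?_, hcont, ⟨2 * C, fun t ht x y => ?_⟩,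
    fun t ht => ?_⟩, hex', huniq', ?_, fun x y => ?_, ?_⟩
  · rw [hΦ1 x 0 ⟨le_rfl, zero_le_one⟩]
    exact hφzero x
  -- The semigroup law is uniqueness applied to the shifted orbit, which solves the restarted
  -- equation.
  · have := huniq' (Φ t x) (fun σ => Φ (t + σ) x) ((hcontζ x).comp (by fun_prop)
      fun σ hσ => add_nonneg ht hσ) fun σ hσ =>
      (h.mildAt_add hNd.continuous ht hσ ((hcontζ x).mono Icc_subset_Ici_self) (hex' x t ht)).1
        (hex' x _ (add_nonneg ht hσ))
    rw [add_comm s t]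
    exact this hs
  · rw [hΦ1 x t ht, hΦ1 y t ht]
    exact ((φ x - φ y).norm_coe_le_norm ⟨t, ht⟩).trans (hlip x y)
  · have hFn : ∀ n : ℕ, F^[n] 0 = 0 := fun n =>
      Function.iterate_fixed (by simp only [F, hφ0]; rfl) n
    simp only [hΦdef, hFn, hφ0]
    rfl
  · have : Φ 1 = fun x => ContinuousMap.evalCLM ℝ (1 : unitInterval) (φ x) := funext hF
    rw [this]
    exact (ContinuousLinearMap.contDiff _).comp hφd
  · rw [hΦS, hΦS, ← map_sub]
    exact (((φ x - h.orbit x) - (φ y - h.orbit y)).norm_coe_le_norm 1).trans (hφS x y)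
  · rw [funext hΦS]
    have := (ContinuousMap.evalCLM ℝ (1 : unitInterval)).hasFDerivAt.comp (0 : X) hφ'
    rw [ContinuousLinearMap.comp_zero] at this
    exact this.fderiv

end MildSolutions

end

end Vorticity

namespace Vorticity

noncomputable section

/-! ### The truncated quadratic nonlinearity -/

section CutoffNonlinearity

variable {X : Type*} [NormedAddCommGroup X] [NormedSpace ℝ X]

/-- A strongly continuous semigroup `S` and a family of smoothing bilinear operators `B`, of
singularity `t ^ (-3/4)` at the origin, which is compatible with `S`. -/
structure SmoothingBilinear (S : ℝ → X →L[ℝ] X) (B : ℝ → X →L[ℝ] X →L[ℝ] X) (c C : ℝ) : Prop where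
  S_zero : ∀ x, S 0 x = x
  S_add : ∀ s t, 0 ≤ s → 0 ≤ t → ∀ x, S (s + t) x = S s (S t x)
  S_cont : ∀ x, ContinuousOn (fun t => S t x) (Ici 0)
  S_bdd : ∀ T, ∃ D, ∀ t ∈ Icc 0 T, ‖S t‖ ≤ D
  S_le : ∀ t ∈ Icc (0 : ℝ) 1, ‖S t‖ ≤ C
  B_le : ∀ t ∈ Ioc (0 : ℝ) 1, ‖B t‖ ≤ c * t ^ (-(3 / 4) : ℝ)
  S_B : ∀ s t, 0 ≤ s → 0 < t → ∀ x y, S s (B t x y) = B (s + t) x y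

variable {S : ℝ → X →L[ℝ] X} {B : ℝ → X →L[ℝ] X →L[ℝ] X} {c C : ℝ}

section CompatibleVectors

variable {W : Type*} [NormedAddCommGroup W] [NormedSpace ℝ W]

/-- The vectors on which the operators `k t` are compatible with the semigroup `S`. -/
def compatibleVectors (S : ℝ → X →L[ℝ] X) (k : ℝ → W →L[ℝ] X) : Submodule ℝ W where
  carrier := {y | ∀ s t, 0 ≤ s → 0 < t → S s (k t y) = k (s + t) y}
  add_mem' := fun hx hy s t hs ht => by simp [hx s t hs ht, hy s t hs ht]
  zero_mem' := fun s t _ _ => by simp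
  smul_mem' := fun a x hx s t hs ht => by simp [hx s t hs ht]

lemma exists_codRestrict_bilinear {V : Submodule ℝ W} (T : X →L[ℝ] X →L[ℝ] W)
    (hT : ∀ x y, ‖T x y‖ ≤ ‖x‖ * ‖y‖) (hV : ∀ x y, T x y ∈ V) :
    ∃ T' : X →L[ℝ] X →L[ℝ] V, (∀ x y, ‖T' x y‖ ≤ ‖x‖ * ‖y‖) ∧ ∀ x y, (T' x y : W) = T x y := by
  refine ⟨LinearMap.mkContinuous₂ (LinearMap.mk₂ ℝ (fun x y => ⟨T x y, hV x y⟩)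
    (fun x x' y => Subtype.ext (by simp)) (fun a x y => Subtype.ext (by simp))
    (fun x y y' => Subtype.ext (by simp)) (fun a x y => Subtype.ext (by simp))) 1
    fun x y => ?_, hT, fun x y => rfl⟩
  rw [one_mul]
  exact hT x y

end CompatibleVectors

namespace SmoothingBilinear

lemma hasFDerivAt_cutoff {Y : Type*} [NormedAddCommGroup Y] [NormedSpace ℝ Y]
    (T : X →L[ℝ] X →L[ℝ] Y) {χ : X → ℝ} (hχ : ContDiff ℝ 1 χ) (r : ℝ) (w : X) :
    HasFDerivAt (fun w => χ (r⁻¹ • w) • T w w)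
      (χ (r⁻¹ • w) • (T w + T.flip w) +
        (r⁻¹ • fderiv ℝ χ (r⁻¹ • w)).smulRight (T w w)) w := by
  have h1 : HasFDerivAt (fun w => T w w) (T w + T.flip w) w := by
    have := T.hasFDerivAt_of_bilinear (hasFDerivAt_id w) (hasFDerivAt_id w)
    exact this
  have h2 : HasFDerivAt (fun w => χ (r⁻¹ • w)) (r⁻¹ • fderiv ℝ χ (r⁻¹ • w)) w := by
    have h3 : HasFDerivAt (fun w : X => r⁻¹ • w) (r⁻¹ • ContinuousLinearMap.id ℝ X) w :=
      (hasFDerivAt_id w).const_smul _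
    have h4 := (hχ.differentiable (by norm_num) (r⁻¹ • w)).hasFDerivAt.comp w h3
    rw [ContinuousLinearMap.comp_smul, ContinuousLinearMap.comp_id] at h4
    exact h4
  exact h2.smul h1

/-- The truncated quadratic nonlinearity has a small Lipschitz constant. -/
lemma cutoff_lipschitz {Y : Type*} [NormedAddCommGroup Y] [NormedSpace ℝ Y]
    {T : X →L[ℝ] X →L[ℝ] Y} (hT : ∀ x y, ‖T x y‖ ≤ ‖x‖ * ‖y‖) {χ : X → ℝ}
    (hχ : ContDiff ℝ 1 χ) {D : ℝ} (hD : 0 ≤ D) (hχD : ∀ w, |χ w| ≤ D ∧ ‖fderiv ℝ χ w‖ ≤ D)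
    (hχ0 : ∀ w, 2 ≤ ‖w‖ → χ w = 0) {r : ℝ} (hr : 0 < r) :
    (∀ x y, ‖χ (r⁻¹ • x) • T x x - χ (r⁻¹ • y) • T y y‖ ≤ 8 * D * r * ‖x - y‖) ∧
      fderiv ℝ (fun w => χ (r⁻¹ • w) • T w w) 0 = 0 := by
  have hd := hasFDerivAt_cutoff T hχ r
  have hbound : ∀ w, ‖fderiv ℝ (fun w => χ (r⁻¹ • w) • T w w) w‖ ≤ 8 * D * r := by
    intro w
    -- For `‖w‖ ≤ 2r` the quadratic term contributes `4Dr` and the derivative of the cut-off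
    -- `r⁻¹D(2r)² = 4Dr`. Elsewhere the function vanishes identically near `w`.
    by_cases hw : ‖w‖ ≤ 2 * r
    · rw [(hd w).fderiv]
      refine ContinuousLinearMap.opNorm_le_bound _ (by positivity) fun v => ?_
      have h1 : ‖χ (r⁻¹ • w) • (T w v + T v w)‖ ≤ D * (2 * (2 * r) * ‖v‖) := by
        rw [norm_smul, Real.norm_eq_abs]
        refine mul_le_mul (hχD _).1 ?_ (norm_nonneg _) hD
        calc ‖T w v + T v w‖ ≤ ‖w‖ * ‖v‖ + ‖v‖ * ‖w‖ :=
              (norm_add_le _ _).trans (add_le_add (hT _ _) (hT _ _))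
          _ = 2 * ‖w‖ * ‖v‖ := by ring
          _ ≤ _ := by gcongr
      have h2 : ‖(r⁻¹ * fderiv ℝ χ (r⁻¹ • w) v) • T w w‖ ≤ (r⁻¹ * (D * ‖v‖)) * ((2 * r) * (2 * r)) := by
        rw [norm_smul, norm_mul, norm_inv, Real.norm_of_nonneg hr.le]
        have h3 := (fderiv ℝ χ (r⁻¹ • w)).le_of_opNorm_le (hχD _).2 v
        have h4 : ‖T w w‖ ≤ (2 * r) * (2 * r) := (hT w w).trans (by gcongr)
        gcongr
      calc _ ≤ ‖χ (r⁻¹ • w) • (T w v + T v w)‖ + ‖(r⁻¹ * fderiv ℝ χ (r⁻¹ • w) v) • T w w‖ :=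
            norm_add_le _ _
        _ ≤ D * (2 * (2 * r) * ‖v‖) + (r⁻¹ * (D * ‖v‖)) * ((2 * r) * (2 * r)) := add_le_add h1 h2
        _ = 8 * D * r * ‖v‖ := by field_simp; ring
    · push Not at hw
      have h0 : (fun w => χ (r⁻¹ • w) • T w w) =ᶠ[𝓝 w] fun _ => 0 := by
        filter_upwards [continuous_norm.continuousAt.eventually (lt_mem_nhds hw)] with v hv
        rw [hχ0, zero_smul]
        rw [norm_smul, norm_inv, Real.norm_of_nonneg hr.le, inv_mul_eq_div, le_div_iff₀ hr]
        exact hv.le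
      rw [h0.fderiv_eq, fderiv_const_apply, norm_zero]
      positivity
  refine ⟨fun x y => ?_, ?_⟩
  · exact convex_univ.norm_image_sub_le_of_norm_fderiv_le (𝕜 := ℝ)
      (f := fun w => χ (r⁻¹ • w) • T w w)
      (fun w _ => (hd w).differentiableAt) (fun w _ => hbound w) (mem_univ y) (mem_univ x)
  · rw [(hd 0).fderiv]
    ext v
    simp

/-- The integral equation was solved for a fixed nonlinearity followed by linear smoothing
operators, whereas `B t` is bilinear and depends on time. Factoring `B t x y = k t (T₀ x y)` through
an auxiliary space separates the two. Compatibility with the semigroup is known only on the vectors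
`T₀ x y`, whence the restriction to `compatibleVectors S k`. -/
theorem exists_cutoff_semiflow_of_pairing [CompleteSpace X] {W : Type*} [NormedAddCommGroup W]
    [NormedSpace ℝ W] {k : ℝ → W →L[ℝ] X} {T₀ : X →L[ℝ] X →L[ℝ] W}
    (hT₀ : ∀ x y, ‖T₀ x y‖ ≤ ‖x‖ * ‖y‖) (h : SmoothingBilinear S B c C)
    (hk : ∀ t, ‖k t‖ ≤ ‖B t‖) (hkB : ∀ t x y, k t (T₀ x y) = B t x y) {χ : X → ℝ}
    (hχ : ContDiff ℝ 1 χ) (hχb : ∃ D : ℝ, ∀ w, |χ w| ≤ D ∧ ‖fderiv ℝ χ w‖ ≤ D)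
    (hχ0 : ∀ w, 2 ≤ ‖w‖ → χ w = 0) {δ : ℝ} (hδ : 0 < δ) :
    ∃ rbar : ℝ, 0 < rbar ∧ ∀ r : ℝ, 0 < r → r ≤ rbar → ∃ Φ : ℝ → X → X, LipSemiflow Φ ∧
      (∀ ζ τ, 0 ≤ τ → Φ τ ζ + ∫ s in (0 : ℝ)..τ,
        χ (r⁻¹ • Φ s ζ) • B (τ - s) (Φ s ζ) (Φ s ζ) = S τ ζ) ∧
      (∀ ζ w, ContinuousOn w (Ici 0) → (∀ τ, 0 ≤ τ → w τ + ∫ s in (0 : ℝ)..τ,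
        χ (r⁻¹ • w s) • B (τ - s) (w s) (w s) = S τ ζ) → EqOn w (fun t => Φ t ζ) (Ici 0)) ∧
      (∀ w, ContinuousOn w (Ici 0) → ∀ τ, 0 ≤ τ → IntervalIntegrable
        (fun s => χ (r⁻¹ • w s) • B (τ - s) (w s) (w s)) volume 0 τ) ∧
      ContDiff ℝ 1 (Φ 1) ∧
      (∀ x y, ‖(Φ 1 x - S 1 x) - (Φ 1 y - S 1 y)‖ ≤ δ * ‖x - y‖) ∧
      fderiv ℝ (fun x => Φ 1 x - S 1 x) 0 = 0 := by
  obtain ⟨D, hD⟩ := hχb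
  have hD0 : 0 ≤ D := (abs_nonneg _).trans (hD 0).1
  have hp : SmoothingPair S (fun t => (k t).comp (compatibleVectors S k).subtypeL) c C :=
    ⟨h.S_zero, h.S_add, h.S_cont, h.S_bdd, h.S_le, fun t ht =>
      (ContinuousLinearMap.opNorm_le_bound _ ((norm_nonneg (B t)).trans (h.B_le t ht)) fun y =>
        (k t).le_of_opNorm_le ((hk t).trans (h.B_le t ht)) (y : W)),
      fun s t hs ht y => y.2 s t hs ht⟩
  obtain ⟨T, hT, hTT⟩ := exists_codRestrict_bilinear (V := compatibleVectors S k) T₀ hT₀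
    fun x y s t hs ht => by rw [hkB, hkB, h.S_B s t hs ht]
  have hTB : ∀ t x y, (k t).comp (compatibleVectors S k).subtypeL (T x y) = B t x y :=
    fun t x y => by
      change k t (T x y : W) = _
      rw [hTT, hkB]
  have hc := hp.c_nonneg
  have hC := hp.C_nonneg
  -- The nonlinearity has Lipschitz constant `8Dr`. The first condition makes the integral equation
  -- contract, the second makes the time-one map `δ`-close to its linear part.
  obtain ⟨r₁, hr₁, hr₁'⟩ : ∃ r₁ : ℝ, 0 < r₁ ∧ 4 * c * (8 * D * r₁) ≤ 1 / 2 ∧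
      8 * c * C * (8 * D * r₁) ≤ δ := by
    have hA : 0 ≤ 32 * c * D := by positivity
    have hE : 0 ≤ 64 * c * C * D := by positivity
    refine ⟨min (1 / (2 * (32 * c * D + 1))) (δ / (64 * c * C * D + 1)), by positivity, ?_, ?_⟩
    · calc 4 * c * (8 * D * min (1 / (2 * (32 * c * D + 1))) (δ / (64 * c * C * D + 1)))
          = (32 * c * D) * min (1 / (2 * (32 * c * D + 1))) (δ / (64 * c * C * D + 1)) := by ring
        _ ≤ (32 * c * D + 1) * (1 / (2 * (32 * c * D + 1))) := by
            gcongr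
            · linarith
            · exact min_le_left _ _
        _ = 1 / 2 := by field_simp
    · calc 8 * c * C * (8 * D * min (1 / (2 * (32 * c * D + 1))) (δ / (64 * c * C * D + 1)))
          = (64 * c * C * D) * min (1 / (2 * (32 * c * D + 1))) (δ / (64 * c * C * D + 1)) := by ring
        _ ≤ (64 * c * C * D + 1) * (δ / (64 * c * C * D + 1)) := by
            gcongr
            · linarith
            · exact min_le_right _ _
        _ = δ := by field_simp
  refine ⟨r₁, hr₁, fun r hr hrr => ?_⟩
  obtain ⟨hlip, hder⟩ := cutoff_lipschitz hT hχ hD0 hD hχ0 hr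
  set N : X → compatibleVectors S k := fun w => χ (r⁻¹ • w) • T w w
  have hNd : ContDiff ℝ 1 N := by
    refine ContDiff.smul (hχ.comp (contDiff_const_smul _)) ?_
    exact T.isBoundedBilinearMap.contDiff.comp (contDiff_id.prodMk contDiff_id)
  have hδr : 4 * c * (8 * D * r) ≤ 1 / 2 := le_trans (by gcongr) hr₁'.1
  obtain ⟨Φ, h1, h2, h3, h4, h5, h6⟩ := hp.exists_semiflow (N := N) (by positivity) hδr hNd hlip
    (by simp [N]) hder
  have hK : ∀ (w : ℝ → X) (τ s : ℝ), (k (τ - s)).comp (compatibleVectors S k).subtypeL (N (w s)) =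
      χ (r⁻¹ • w s) • B (τ - s) (w s) (w s) := fun w τ s => by
    rw [map_smul, hTB]
  replace h2 : ∀ ζ τ, 0 ≤ τ → Φ τ ζ + ∫ s in (0 : ℝ)..τ,
      χ (r⁻¹ • Φ s ζ) • B (τ - s) (Φ s ζ) (Φ s ζ) = S τ ζ := fun ζ τ hτ => by
    rw [← h2 ζ τ hτ]
    congr 1
    exact intervalIntegral.integral_congr fun s _ => (hK (fun s => Φ s ζ) τ s).symm
  refine ⟨Φ, h1, h2, fun ζ w hw hm => h3 ζ w hw fun τ hτ => ?_, fun w hw τ hτ => ?_, h4,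
    fun x y => (h5 x y).trans ?_, h6⟩
  · rw [MildAt]
    simp only [hK]
    exact hm τ hτ
  · simp only [← hK]
    exact hp.intervalIntegrable hτ
      (hNd.continuous.comp_continuousOn (hw.mono Icc_subset_Ici_self))
  · gcongr
    exact le_trans (by gcongr) hr₁'.2

/-- A factorisation that always exists: `T₀ x y` is the map `e ↦ f e x y`, and `k t` evaluates it at
the element `b t` that represents `B t`. -/
theorem exists_cutoff_semiflow_of_embedding [CompleteSpace X] {E : Type*} [NormedAddCommGroup E]
    [NormedSpace ℝ E] {b : ℝ → E} {f : E →L[ℝ] X →L[ℝ] X →L[ℝ] X}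
    (hf : ∀ e x y, ‖f e x y‖ ≤ ‖e‖ * ‖x‖ * ‖y‖) (hb : ∀ t, ‖b t‖ ≤ ‖B t‖)
    (hfb : ∀ t x y, f (b t) x y = B t x y) (h : SmoothingBilinear S B c C) {χ : X → ℝ}
    (hχ : ContDiff ℝ 1 χ) (hχb : ∃ D : ℝ, ∀ w, |χ w| ≤ D ∧ ‖fderiv ℝ χ w‖ ≤ D)
    (hχ0 : ∀ w, 2 ≤ ‖w‖ → χ w = 0) {δ : ℝ} (hδ : 0 < δ) :
    ∃ rbar : ℝ, 0 < rbar ∧ ∀ r : ℝ, 0 < r → r ≤ rbar → ∃ Φ : ℝ → X → X, LipSemiflow Φ ∧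
      (∀ ζ τ, 0 ≤ τ → Φ τ ζ + ∫ s in (0 : ℝ)..τ,
        χ (r⁻¹ • Φ s ζ) • B (τ - s) (Φ s ζ) (Φ s ζ) = S τ ζ) ∧
      (∀ ζ w, ContinuousOn w (Ici 0) → (∀ τ, 0 ≤ τ → w τ + ∫ s in (0 : ℝ)..τ,
        χ (r⁻¹ • w s) • B (τ - s) (w s) (w s) = S τ ζ) → EqOn w (fun t => Φ t ζ) (Ici 0)) ∧
      (∀ w, ContinuousOn w (Ici 0) → ∀ τ, 0 ≤ τ → IntervalIntegrable
        (fun s => χ (r⁻¹ • w s) • B (τ - s) (w s) (w s)) volume 0 τ) ∧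
      ContDiff ℝ 1 (Φ 1) ∧
      (∀ x y, ‖(Φ 1 x - S 1 x) - (Φ 1 y - S 1 y)‖ ≤ δ * ‖x - y‖) ∧
      fderiv ℝ (fun x => Φ 1 x - S 1 x) 0 = 0 := by
  refine exists_cutoff_semiflow_of_pairing (W := E →L[ℝ] X)
    (k := fun t => ContinuousLinearMap.apply ℝ X (b t))
    (T₀ := (ContinuousLinearMap.flipₗᵢ ℝ E X X).toContinuousLinearEquiv.toContinuousLinearMap.comp
      f.flip) (fun x y => ?_) h (fun t => ?_) hfb hχ hχb hχ0 hδ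
  · refine ContinuousLinearMap.opNorm_le_bound _ (by positivity) fun e => ?_
    exact (hf e x y).trans (le_of_eq (by ring))
  · refine (ContinuousLinearMap.opNorm_le_bound _ (norm_nonneg _) fun y => ?_).trans (hb t)
    rw [mul_comm]
    exact y.le_opNorm (b t)

theorem exists_cutoff_semiflow [CompleteSpace X] (h : SmoothingBilinear S B c C) {χ : X → ℝ}
    (hχ : ContDiff ℝ 1 χ) (hχb : ∃ D : ℝ, ∀ w, |χ w| ≤ D ∧ ‖fderiv ℝ χ w‖ ≤ D)
    (hχ0 : ∀ w, 2 ≤ ‖w‖ → χ w = 0) {δ : ℝ} (hδ : 0 < δ) :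
    ∃ rbar : ℝ, 0 < rbar ∧ ∀ r : ℝ, 0 < r → r ≤ rbar → ∃ Φ : ℝ → X → X, LipSemiflow Φ ∧
      (∀ ζ τ, 0 ≤ τ → Φ τ ζ + ∫ s in (0 : ℝ)..τ,
        χ (r⁻¹ • Φ s ζ) • B (τ - s) (Φ s ζ) (Φ s ζ) = S τ ζ) ∧
      (∀ ζ w, ContinuousOn w (Ici 0) → (∀ τ, 0 ≤ τ → w τ + ∫ s in (0 : ℝ)..τ,
        χ (r⁻¹ • w s) • B (τ - s) (w s) (w s) = S τ ζ) → EqOn w (fun t => Φ t ζ) (Ici 0)) ∧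
      (∀ w, ContinuousOn w (Ici 0) → ∀ τ, 0 ≤ τ → IntervalIntegrable
        (fun s => χ (r⁻¹ • w s) • B (τ - s) (w s) (w s)) volume 0 τ) ∧
      ContDiff ℝ 1 (Φ 1) ∧
      (∀ x y, ‖(Φ 1 x - S 1 x) - (Φ 1 y - S 1 y)‖ ≤ δ * ‖x - y‖) ∧
      fderiv ℝ (fun x => Φ 1 x - S 1 x) 0 = 0 :=
  exists_cutoff_semiflow_of_embedding (E := X →L[ℝ] X →L[ℝ] X) (b := B)
    (f := ContinuousLinearMap.id ℝ _) (fun e x y => e.le_opNorm₂ x y) (fun _ => le_rfl)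
    (fun _ _ _ => rfl) h hχ hχb hχ0 hδ

end SmoothingBilinear

end CutoffNonlinearity

end

end Vorticity

namespace Vorticity

noncomputable section

/-! ### Spectral projection by polynomial calculus -/

section SpectralProjection

variable {X : Type*} [NormedAddCommGroup X] [NormedSpace ℝ X]

open Polynomial in
/-- The monic polynomial with simple roots in `σ`. -/
def nodalPoly (σ : Finset ℝ) : ℝ[X] := ∏ l ∈ σ, (Polynomial.X - Polynomial.C l)

open Polynomial in
lemma nodalPoly_dvd {σ : Finset ℝ} {p : ℝ[X]} (h : ∀ l ∈ σ, p.eval l = 0) : nodalPoly σ ∣ p := by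
  refine Finset.prod_dvd_of_coprime (fun a _ b _ hab => ?_) fun l hl =>
    Polynomial.dvd_iff_isRoot.2 (h l hl)
  exact Polynomial.pairwise_coprime_X_sub_C Function.injective_id hab

-- The difference of the polynomials vanishes on `σ`, so the nodal polynomial divides it. Inverses
-- and powers of `Λ` can thus be computed by interpolation.
open Polynomial in
lemma aeval_eq_of_eval_eq {Λ : X →L[ℝ] X} {σ : Finset ℝ} {p p' : ℝ[X]}
    (h : ∀ l ∈ σ, p.eval l = p'.eval l) {x : X} (hx : aeval Λ (nodalPoly σ) x = 0) :
    aeval Λ p x = aeval Λ p' x := by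
  obtain ⟨s, hs⟩ := nodalPoly_dvd (σ := σ) (p := p - p') fun l hl => by
    rw [Polynomial.eval_sub, h l hl, sub_self]
  rw [← sub_eq_zero, ← sub_apply, ← map_sub, hs, mul_comm, map_mul]
  change aeval Λ s (aeval Λ (nodalPoly σ) x) = 0
  rw [hx, map_zero]

/-- The inverse is the Neumann series `-∑ l^{-n-1} Λ^n`, convergent on `V` because `r < l`.
Injectivity: an eigenvector for `l` would grow like `l ^ n`, against the bound `C * r ^ n`. -/
lemma bijOn_sub_smul [CompleteSpace X] {Λ : X →L[ℝ] X} {V : Submodule ℝ X}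
    (hVc : IsClosed (V : Set X)) (hV : ∀ x ∈ V, Λ x ∈ V) {C r l : ℝ} (hr : 0 ≤ r) (hl : r < l)
    (hdecay : ∀ (n : ℕ), ∀ x ∈ V, ‖(Λ ^ n) x‖ ≤ C * r ^ n * ‖x‖) :
    BijOn (fun x => Λ x - l • x) V V := by
  have hl0 : 0 < l := hr.trans_lt hl
  have hpow : ∀ (n : ℕ), ∀ x ∈ V, (Λ ^ n) x ∈ V := fun n x hx => by
    induction n with
    | zero => simpa using hx
    | succ n ih => rw [clm_pow_succ_apply]; exact hV _ ih
  refine ⟨fun x hx => V.sub_mem (hV x hx) (V.smul_mem l hx), fun x hx y hy hxy => ?_, fun y hy => ?_⟩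
  · have hz : x - y ∈ V := V.sub_mem hx hy
    have hΛ : Λ (x - y) = l • (x - y) := by
      simp only at hxy
      rw [map_sub, smul_sub, ← sub_eq_zero]
      rw [← sub_eq_zero] at hxy
      rw [← hxy]
      abel
    have hΛn : ∀ n : ℕ, (Λ ^ n) (x - y) = l ^ n • (x - y) := fun n => by
      induction n with
      | zero => simp
      | succ n ih => rw [clm_pow_succ_apply, ih, map_smul, hΛ, smul_smul, pow_succ]
    have h1 : ∀ n : ℕ, ‖x - y‖ ≤ C * (r / l) ^ n * ‖x - y‖ := fun n => by
      have := hdecay n _ hz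
      rw [hΛn, norm_smul, norm_pow, Real.norm_of_nonneg hl0.le] at this
      rw [div_pow, mul_div_assoc', div_mul_eq_mul_div, le_div_iff₀ (by positivity)]
      linarith
    have h2 : Tendsto (fun n : ℕ => C * (r / l) ^ n * ‖x - y‖) atTop (𝓝 (C * 0 * ‖x - y‖)) :=
      ((tendsto_pow_atTop_nhds_zero_of_lt_one (by positivity)
        ((div_lt_one hl0).2 hl)).const_mul _).mul_const _
    rw [mul_zero, zero_mul] at h2
    have h3 := ge_of_tendsto' h2 h1
    exact sub_eq_zero.1 (norm_le_zero_iff.1 h3)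
  · set u : ℕ → X := fun n => (l ^ n)⁻¹ • (Λ ^ n) y
    have hu : Summable u := by
      refine Summable.of_norm_bounded (g := fun n => C * (r / l) ^ n * ‖y‖)
        (((summable_geometric_of_lt_one (by positivity) ((div_lt_one hl0).2 hl)).mul_left _).mul_right
          _) fun n => ?_
      rw [norm_smul, norm_inv, norm_pow, Real.norm_of_nonneg hl0.le, inv_mul_le_iff₀ (by positivity)]
      refine (hdecay n y hy).trans (le_of_eq ?_)
      rw [div_pow]
      field_simp
    have hmem : ∑' n, u n ∈ V := by
      refine hVc.mem_of_tendsto hu.hasSum (Eventually.of_forall fun s => ?_)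
      exact V.sum_mem fun n _ => V.smul_mem _ (hpow n y hy)
    have hΛu : ∀ n, Λ (u n) = l • u (n + 1) := fun n => by
      simp only [u, map_smul, clm_pow_succ_apply, smul_smul]
      congr 1
      rw [pow_succ]
      field_simp
    refine ⟨-(l⁻¹ • ∑' n, u n), V.neg_mem (V.smul_mem _ hmem), ?_⟩
    have h1 : Λ (∑' n, u n) = l • ∑' n, u (n + 1) := by
      rw [Λ.map_tsum hu, ← tsum_const_smul'' (γ := ℝ)]
      exact tsum_congr hΛu
    have h2 : ∑' n, u n = y + ∑' n, u (n + 1) := by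
      rw [hu.tsum_eq_zero_add]
      simp [u]
    simp only [map_neg, map_smul, h1]
    rw [smul_smul, inv_mul_cancel₀ hl0.ne', one_smul, smul_neg, smul_smul, mul_inv_cancel₀ hl0.ne',
      one_smul, h2]
    abel

open Polynomial in
lemma bijOn_nodalPoly {Λ : X →L[ℝ] X} {V : Submodule ℝ X} (σ : Finset ℝ)
    (h : ∀ l ∈ σ, BijOn (fun x => Λ x - l • x) (V : Set X) V) :
    BijOn (aeval Λ (nodalPoly σ)) (V : Set X) V := by
  induction σ using Finset.induction_on with
  | empty =>
    simp only [nodalPoly, Finset.prod_empty, map_one]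
    exact bijOn_id _
  | insert a s ha ih =>
    have h1 : ⇑(aeval Λ (nodalPoly (insert a s))) =
        (fun x => Λ x - a • x) ∘ ⇑(aeval Λ (nodalPoly s)) := by
      ext x
      simp only [nodalPoly, Finset.prod_insert ha, map_mul, map_sub, aeval_X, aeval_C]
      rfl
    rw [h1]
    exact (h a (Finset.mem_insert_self _ _)).comp (ih fun l hl => h l (Finset.mem_insert_of_mem hl))

open Polynomial in
/-- Construction of the spectral projection from an invariant subspace of finite codimension, on
which `Λ` decays. -/
theorem exists_spectralProjection [CompleteSpace X] {F : Type*} [NormedAddCommGroup F]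
    [NormedSpace ℝ F] [FiniteDimensional ℝ F] {Λ : X →L[ℝ] X} (M : X →L[ℝ] F) {σ : Finset ℝ}
    {C r κ : ℝ} (hr : 0 ≤ r) (hσ : ∀ l ∈ σ, r < l) (hκ : 0 ≤ κ) (hσκ : ∀ l ∈ σ, l⁻¹ ≤ κ)
    (hM : ∀ x, M x = 0 → M (Λ x) = 0)
    (hdecay : ∀ (n : ℕ) x, M x = 0 → ‖(Λ ^ n) x‖ ≤ C * r ^ n * ‖x‖)
    (hMA : ∀ x, M (aeval Λ (nodalPoly σ) x) = 0) :
    ∃ (P J : X →L[ℝ] X) (C' : ℝ), 0 ≤ C' ∧ IsSpectralProjection Λ σ P ∧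
      FiniteDimensional ℝ (LinearMap.range P.toLinearMap) ∧ ExpSplitting Λ P J C' κ r := by
  set V : Submodule ℝ X := LinearMap.ker M.toLinearMap
  have hVc : IsClosed (V : Set X) := M.isClosed_ker
  have hbij : ∀ l ∈ σ, BijOn (fun x => Λ x - l • x) (V : Set X) V := fun l hl =>
    bijOn_sub_smul hVc hM hr (hσ l hl) hdecay
  have hpos : ∀ l ∈ σ, 0 < l := fun l hl => hr.trans_lt (hσ l hl)
  set A : X →L[ℝ] X := aeval Λ (nodalPoly σ)
  have hA : BijOn A (V : Set X) V := bijOn_nodalPoly σ hbij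
  have hcommp : ∀ (p p' : ℝ[X]) x, aeval Λ p (aeval Λ p' x) = aeval Λ p' (aeval Λ p x) :=
    fun p p' x => by
      have := congrArg (fun f : X →L[ℝ] X => f x) (map_mul (aeval Λ) p p')
      have h2 := congrArg (fun f : X →L[ℝ] X => f x) (map_mul (aeval Λ) p' p)
      rw [mul_comm] at this
      exact this.symm.trans h2
  have hΛp : ∀ x, aeval Λ (Polynomial.X : ℝ[X]) x = Λ x := fun x => by rw [aeval_X]
  have hAΛ : ∀ x, A (Λ x) = Λ (A x) := fun x => by
    simpa only [hΛp] using hcommp (nodalPoly σ) Polynomial.X x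
  have : CompleteSpace V := hVc.completeSpace_coe
  set AV : V →L[ℝ] V := (A.comp V.subtypeL).codRestrict V fun x => hA.1 x.2
  have hAV : ∀ x : V, (AV x : X) = A x := fun _ => rfl
  set e : V ≃L[ℝ] V := ContinuousLinearEquiv.ofBijective AV
    (LinearMap.ker_eq_bot.2 fun x y hxy => Subtype.ext (hA.2.1 x.2 y.2 (congrArg Subtype.val hxy)))
    (LinearMap.range_eq_top.2 fun y => by
      obtain ⟨x, hx, hxy⟩ := hA.2.2 y.2
      exact ⟨⟨x, hx⟩, Subtype.ext hxy⟩)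
  have he : ∀ x : V, (e x : X) = A x := fun _ => rfl
  -- `A` maps everything into `V` and is invertible there; inverting it on `V` after applying it is
  -- the projection onto `V` along the kernel of `A`.
  set R : X →L[ℝ] X := V.subtypeL.comp ((e.symm : V →L[ℝ] V).comp (A.codRestrict V hMA))
  have hRV : ∀ x, R x ∈ V := fun x => (e.symm (A.codRestrict V hMA x)).2
  have hAR : ∀ x, A (R x) = A x := fun x => by
    change A (e.symm (A.codRestrict V hMA x)) = _
    rw [← he, e.apply_symm_apply]
    rfl
  have hR1 : ∀ x ∈ V, R x = x := fun x hx => hA.2.1 (hRV x) hx (hAR x)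
  have hRΛ : ∀ x, R (Λ x) = Λ (R x) := fun x =>
    hA.2.1 (hRV _) (hM _ (hRV x)) (by rw [hAR, hAΛ, hAΛ, hAR])
  set P : X →L[ℝ] X := ContinuousLinearMap.id ℝ X - R
  have hPx : ∀ x, P x = x - R x := fun _ => rfl
  have hAP : ∀ x, A (P x) = 0 := fun x => by rw [hPx, map_sub, hAR, sub_self]
  have hPid : ∀ x, A x = 0 → P x = x := fun x hx => by
    have : R x = 0 := hA.2.1 (hRV x) V.zero_mem (by rw [hAR, hx, map_zero])
    rw [hPx, this, sub_zero]
  have hPΛ : ∀ x, P (Λ x) = Λ (P x) := fun x => by rw [hPx, hPx, map_sub, hRΛ]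
  have hPp : ∀ (p : ℝ[X]) x, P (aeval Λ p (P x)) = aeval Λ p (P x) := fun p x =>
    hPid _ (by
      change aeval Λ (nodalPoly σ) (aeval Λ p (P x)) = 0
      rw [hcommp, show aeval Λ (nodalPoly σ) (P x) = 0 from hAP x, map_zero])
  have hker : (LinearMap.ker P.toLinearMap : Submodule ℝ X) = V := by
    ext x
    refine ⟨fun hx => ?_, fun hx => ?_⟩
    · have : P x = 0 := hx
      rw [hPx, sub_eq_zero] at this
      rw [this]
      exact hRV x
    · change P x = 0
      rw [hPx, hR1 x hx, sub_self]
  have hmemrange : ∀ x, x ∈ LinearMap.range P.toLinearMap ↔ A x = 0 := fun x =>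
    ⟨by rintro ⟨y, rfl⟩; exact hAP y, fun hx => ⟨x, hPid x hx⟩⟩
  have hspec : IsSpectralProjection Λ σ P := by
    refine ⟨fun x => hPid _ (hAP x), hPΛ, le_antisymm (fun x hx => ?_) ?_, fun l hl => ?_⟩
    · have hAx := (hmemrange x).1 hx
      rcases σ.eq_empty_or_nonempty with hσe | hσn
      · have : x = 0 := by
          have h1 : A x = x := by simp [A, nodalPoly, hσe]
          rw [← h1, hAx]
        rw [this]
        exact Submodule.zero_mem _
      -- A vector killed by the nodal polynomial is the sum of its images under the Lagrange basis
      -- polynomials, and these images are eigenvectors.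
      have hsum : x = ∑ l ∈ σ, aeval Λ (Lagrange.basis σ id l) x := by
        have h1 := congrArg (fun p : ℝ[X] => aeval Λ p x)
          (Lagrange.sum_basis (s := σ) (v := id) Function.injective_id.injOn hσn)
        simp only [map_sum, map_one, sum_apply] at h1
        exact h1.symm
      rw [hsum]
      refine Submodule.sum_mem _ fun l hl => Submodule.mem_iSup_of_mem l
        (Submodule.mem_iSup_of_mem hl ?_)
      rw [Module.End.mem_eigenspace_iff]
      change Λ (aeval Λ (Lagrange.basis σ id l) x) = l • aeval Λ (Lagrange.basis σ id l) x
      have h2 := aeval_eq_of_eval_eq (Λ := Λ) (σ := σ)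
        (p := Polynomial.X * Lagrange.basis σ id l) (p' := Polynomial.C l * Lagrange.basis σ id l)
        (fun l' hl' => by
          rw [eval_mul, eval_mul, eval_X, eval_C]
          by_cases h : l' = l
          · rw [h]
          · have := Lagrange.eval_basis_of_ne (s := σ) (v := id) (Ne.symm h) hl'
            simp only [id] at this
            rw [this, mul_zero, mul_zero]) hAx
      rw [map_mul, map_mul, aeval_X, aeval_C] at h2
      exact h2
    · refine iSup₂_le fun l hl x hx => ?_
      rw [Module.End.mem_eigenspace_iff] at hx
      have hx' : Λ x = l • x := hx
      rw [hmemrange]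
      have h1 : nodalPoly σ = (nodalPoly (σ.erase l)) * (Polynomial.X - Polynomial.C l) := by
        rw [nodalPoly, nodalPoly, mul_comm, Finset.mul_prod_erase σ
          (fun l => (Polynomial.X - Polynomial.C l : ℝ[X])) hl]
      change aeval Λ (nodalPoly σ) x = 0
      rw [h1, map_mul, map_sub, aeval_X, aeval_C]
      change aeval Λ (nodalPoly (σ.erase l)) (Λ x - l • x) = 0
      rw [hx', sub_self, map_zero]
    · rw [hker]
      exact hbij l hl
  -- `M` is injective on the range of `P`: `A` vanishes on that range and is injective on `V`, the
  -- kernel of `M`.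
  have hfin : FiniteDimensional ℝ (LinearMap.range P.toLinearMap) := by
    refine FiniteDimensional.of_injective
      (M.toLinearMap.comp (LinearMap.range P.toLinearMap).subtype) ?_
    refine (injective_iff_map_eq_zero _).2 fun x hx => Subtype.ext ?_
    have h1 : (x : X) ∈ V := hx
    have h2 := (hmemrange x).1 x.2
    exact hA.2.1 h1 V.zero_mem (h2.trans (map_zero A).symm)
  -- Interpolating `l ↦ l⁻¹` on `σ` inverts `Λ` on the range of `P`. Powers of `p(Λ)` are again
  -- found by interpolation, so their growth is at most a constant times `κ ^ n` rather than a power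
  -- of the norm.
  set p : ℝ[X] := Lagrange.interpolate σ id fun l => l⁻¹
  have hp : ∀ l ∈ σ, p.eval l = l⁻¹ := fun l hl =>
    Lagrange.eval_interpolate_at_node (s := σ) (v := id) (fun l => l⁻¹)
      Function.injective_id.injOn hl
  set J : X →L[ℝ] X := (aeval Λ p).comp P
  have hJ : ∀ x, J x = aeval Λ p (P x) := fun _ => rfl
  have hΛJ : ∀ x, Λ (aeval Λ p (P x)) = P x := fun x => by
    have h2 := aeval_eq_of_eval_eq (Λ := Λ) (σ := σ) (p := Polynomial.X * p) (p' := 1)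
      (fun l hl => by
        rw [eval_mul, eval_X, hp l hl, mul_inv_cancel₀ (hpos l hl).ne', eval_one]) (hAP x)
    rw [map_mul, aeval_X, map_one] at h2
    exact h2
  have hJpow : ∀ (n : ℕ) x, (J ^ (n + 1)) x =
      ∑ l ∈ σ, (l⁻¹) ^ (n + 1) • aeval Λ (Lagrange.basis σ id l) (P x) := by
    intro n x
    have h1 : (J ^ (n + 1)) x = aeval Λ (p ^ (n + 1)) (P x) := by
      induction n with
      | zero => simp [hJ]
      | succ n ih =>
        rw [clm_pow_succ_apply, ih, hJ, hPp, pow_succ' p (n + 1), map_mul]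
        rfl
    rw [h1, aeval_eq_of_eval_eq (p' := ∑ l ∈ σ, Polynomial.C ((l⁻¹) ^ (n + 1)) *
      Lagrange.basis σ id l) (fun l hl => ?_) (hAP x)]
    · simp only [map_sum, map_mul, aeval_C, sum_apply]
      rfl
    · have h3 := Lagrange.eval_interpolate_at_node (s := σ) (v := id) (fun l => (l⁻¹) ^ (n + 1))
        Function.injective_id.injOn hl
      rw [eval_pow, hp l hl]
      rw [Lagrange.interpolate_apply] at h3
      exact h3.symm
  set D : ℝ := ∑ l ∈ σ, ‖(aeval Λ (Lagrange.basis σ id l)).comp P‖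
  have hD : 0 ≤ D := Finset.sum_nonneg fun _ _ => norm_nonneg _
  refine ⟨P, J, 1 + D + |C| * ‖R‖, by positivity, hspec, hfin, ?_⟩
  refine ⟨hspec.idem, hPΛ, fun x => ?_, fun x => ?_, fun x => ?_, fun x => ?_, hκ, hr,
    fun n x => ?_, fun n x => ?_⟩
  · rw [hJ, hspec.idem, hJ]
  · rw [hJ, hPp]
  · rw [hJ, hΛJ]
  · rw [hJ, hPΛ]
    have := hcommp p Polynomial.X (P x)
    rw [hΛp, hΛp] at this
    rw [this, hΛJ]
  · rcases n with _ | n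
    · simp only [pow_zero, one_apply_eq_self, mul_one]
      have : 0 ≤ (D + |C| * ‖R‖) * ‖x‖ := by positivity
      linarith
    · rw [hJpow]
      calc ‖∑ l ∈ σ, (l⁻¹) ^ (n + 1) • aeval Λ (Lagrange.basis σ id l) (P x)‖
          ≤ ∑ l ∈ σ, ‖(aeval Λ (Lagrange.basis σ id l)).comp P‖ * (κ ^ (n + 1) * ‖x‖) := by
            refine norm_sum_le_of_le _ fun l hl => ?_
            rw [norm_smul, norm_pow, norm_inv, Real.norm_of_nonneg (hpos l hl).le]
            have h1 := ((aeval Λ (Lagrange.basis σ id l)).comp P).le_opNorm x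
            have h2 : (l⁻¹) ^ (n + 1) ≤ κ ^ (n + 1) :=
              pow_le_pow_left₀ (inv_nonneg.2 (hpos l hl).le) (hσκ l hl) _
            calc _ ≤ κ ^ (n + 1) * (‖(aeval Λ (Lagrange.basis σ id l)).comp P‖ * ‖x‖) :=
                  mul_le_mul h2 h1 (norm_nonneg _) (by positivity)
              _ = _ := by ring
        _ = D * (κ ^ (n + 1) * ‖x‖) := by rw [Finset.sum_mul]
        _ ≤ _ := by
          have : 0 ≤ (1 + |C| * ‖R‖) * (κ ^ (n + 1) * ‖x‖) := by positivity
          linarith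
  · have h1 : x - P x = R x := by rw [hPx, sub_sub_cancel]
    rw [h1]
    calc ‖(Λ ^ n) (R x)‖ ≤ C * r ^ n * ‖R x‖ := hdecay n _ (hRV x)
      _ ≤ |C| * r ^ n * (‖R‖ * ‖x‖) := by
        gcongr
        exacts [le_abs_self C, R.le_opNorm x]
      _ ≤ _ := by
        have : 0 ≤ (1 + D) * (r ^ n * ‖x‖) := by positivity
        linarith

end SpectralProjection

end

end Vorticity

namespace Vorticity

noncomputable section

/-! ### Gaussian identities and weights on the plane -/

section HeatKernel

lemma norm_sq_plane (x : Plane) : ‖x‖ ^ 2 = x 0 ^ 2 + x 1 ^ 2 := by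
  rw [EuclideanSpace.real_norm_sq_eq, Fin.sum_univ_two]

lemma abs_coord_le (x : Plane) (i : Fin 2) : |x i| ≤ ‖x‖ := by
  simpa using PiLp.norm_apply_le x i

lemma finrank_plane : Module.finrank ℝ Plane = 2 := by simp

/-- The heat kernel of the plane at time `a`. -/
def heatKernel (a : ℝ) (x : Plane) : ℝ := Real.exp (-‖x‖ ^ 2 / (4 * a)) / (4 * Real.pi * a)

/-- The partial derivatives of the heat kernel. -/
def gradKernel (a : ℝ) (i : Fin 2) (x : Plane) : ℝ := -(x i) / (2 * a) * heatKernel a x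

lemma continuous_heatKernel (a : ℝ) : Continuous (heatKernel a) := by
  unfold heatKernel
  fun_prop

lemma continuous_gradKernel (a : ℝ) (i : Fin 2) : Continuous (gradKernel a i) := by
  unfold gradKernel
  exact (by fun_prop : Continuous fun x : Plane => -(x i) / (2 * a)).mul (continuous_heatKernel a)

lemma heatKernel_nonneg {a : ℝ} (ha : 0 ≤ a) (x : Plane) : 0 ≤ heatKernel a x := by
  unfold heatKernel
  have := Real.pi_pos
  positivity

lemma heatKernel_pos {a : ℝ} (ha : 0 < a) (x : Plane) : 0 < heatKernel a x := by
  unfold heatKernel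
  have := Real.pi_pos
  positivity

lemma heatKernel_neg (a : ℝ) (x : Plane) : heatKernel a (-x) = heatKernel a x := by
  rw [heatKernel, heatKernel, norm_neg]

lemma gradKernel_neg (a : ℝ) (i : Fin 2) (x : Plane) : gradKernel a i (-x) = -gradKernel a i x := by
  rw [gradKernel, gradKernel, heatKernel_neg, PiLp.neg_apply]
  ring

lemma heatKernel_le {a : ℝ} (ha : 0 < a) (x : Plane) : heatKernel a x ≤ (4 * Real.pi * a)⁻¹ := by
  have := Real.pi_pos
  rw [heatKernel, div_eq_mul_inv]
  refine mul_le_of_le_one_left (by positivity) (Real.exp_le_one_iff.2 ?_)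
  rw [neg_div]
  have : 0 ≤ ‖x‖ ^ 2 / (4 * a) := by positivity
  linarith

lemma heatKernel_eq (a : ℝ) (x : Plane) :
    heatKernel a x = (4 * Real.pi * a)⁻¹ * Real.exp (-(4 * a)⁻¹ * ‖x‖ ^ 2) := by
  rw [heatKernel, div_eq_inv_mul]
  congr 2
  ring

lemma integral_heatKernel {a : ℝ} (ha : 0 < a) : ∫ x, heatKernel a x = 1 := by
  simp only [heatKernel_eq]
  rw [integral_const_mul, GaussianFourier.integral_rexp_neg_mul_sq_norm (by positivity),
    finrank_plane]
  norm_num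
  have := Real.pi_pos
  field_simp

lemma integrable_heatKernel {a : ℝ} (ha : 0 < a) : Integrable (heatKernel a) := by
  by_contra h
  have := integral_heatKernel ha
  rw [integral_undef h] at this
  exact zero_ne_one this

/-- Half of the Gaussian exponent absorbs the linear factor, by `s ≤ 2 * exp (s ^ 2 / 8)` with `s =
‖x‖ / √a`. The normalising constant at time `2 * a` supplies the remaining factor `2`. -/
lemma norm_mul_heatKernel_le {a : ℝ} (ha : 0 < a) (x : Plane) :
    ‖x‖ * heatKernel a x ≤ 4 * Real.sqrt a * heatKernel (2 * a) x := by
  have hpi := Real.pi_pos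
  set s := ‖x‖ / Real.sqrt a with hs
  have hsa : 0 < Real.sqrt a := Real.sqrt_pos.2 ha
  have hx : ‖x‖ = s * Real.sqrt a := by rw [hs]; field_simp
  have hx2 : ‖x‖ ^ 2 = s ^ 2 * a := by rw [hx, mul_pow, Real.sq_sqrt ha.le]
  have h1 : s ≤ 2 * Real.exp (s ^ 2 / 8) := by
    have := Real.add_one_le_exp (s ^ 2 / 8)
    nlinarith [sq_nonneg (s - 2)]
  have h2 : Real.exp (-‖x‖ ^ 2 / (4 * a)) * Real.exp (s ^ 2 / 8) =
      Real.exp (-‖x‖ ^ 2 / (4 * (2 * a))) := by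
    rw [← Real.exp_add, hx2]
    congr 1
    field_simp
    ring
  rw [heatKernel, heatKernel, ← h2, hx]
  have h3 : 0 < Real.exp (-(s * Real.sqrt a) ^ 2 / (4 * a)) := Real.exp_pos _
  calc s * Real.sqrt a * (Real.exp (-(s * Real.sqrt a) ^ 2 / (4 * a)) / (4 * Real.pi * a))
      ≤ 2 * Real.exp (s ^ 2 / 8) * Real.sqrt a *
        (Real.exp (-(s * Real.sqrt a) ^ 2 / (4 * a)) / (4 * Real.pi * a)) := by gcongr
    _ = _ := by field_simp; norm_num

/-- One derivative costs `a^{-1/2}` and a doubling of the time in the Gaussian. -/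
lemma abs_gradKernel_le {a : ℝ} (ha : 0 < a) (i : Fin 2) (x : Plane) :
    |gradKernel a i x| ≤ 2 * (Real.sqrt a)⁻¹ * heatKernel (2 * a) x := by
  have hsa : 0 < Real.sqrt a := Real.sqrt_pos.2 ha
  have h0 := heatKernel_nonneg ha.le x
  rw [gradKernel, abs_mul, abs_div, abs_neg, abs_of_pos (by positivity : 0 < 2 * a), abs_of_nonneg h0]
  have h1 := norm_mul_heatKernel_le ha x
  have h2 := abs_coord_le x i
  calc |x i| / (2 * a) * heatKernel a x ≤ ‖x‖ / (2 * a) * heatKernel a x := by gcongr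
    _ = (2 * a)⁻¹ * (‖x‖ * heatKernel a x) := by ring
    _ ≤ (2 * a)⁻¹ * (4 * Real.sqrt a * heatKernel (2 * a) x) := by gcongr
    _ = _ := by
      nth_rw 1 [← Real.sq_sqrt ha.le]
      field_simp
      norm_num

lemma integrable_gradKernel {a : ℝ} (ha : 0 < a) (i : Fin 2) : Integrable (gradKernel a i) :=
  ((integrable_heatKernel (by positivity : 0 < 2 * a)).const_mul (2 * (Real.sqrt a)⁻¹)).mono'
    (continuous_gradKernel a i).aestronglyMeasurable
    (Eventually.of_forall fun x => abs_gradKernel_le ha i x)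

lemma integral_gradKernel (a : ℝ) (i : Fin 2) : ∫ x, gradKernel a i x = 0 := by
  have h := integral_neg_eq_self (gradKernel a i) volume
  simp only [gradKernel_neg, integral_neg] at h
  linarith

/-- Completion of squares for a product of two Gaussians. -/
lemma heatKernel_mul_heatKernel {A a : ℝ} (hA : 0 < A) (ha : 0 < a) (c : ℝ) (ξ y z : Plane) :
    heatKernel A (ξ - c • z) * heatKernel a (z - y) =
      heatKernel (A + c ^ 2 * a) (ξ - c • y) *
        heatKernel (A * a / (A + c ^ 2 * a))
          (z - (y + (c * a / (A + c ^ 2 * a)) • (ξ - c • y))) := by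
  have hpi := Real.pi_pos
  have hA' : 0 < A + c ^ 2 * a := by positivity
  rw [heatKernel, heatKernel, heatKernel, heatKernel, div_mul_div_comm, div_mul_div_comm,
    ← Real.exp_add, ← Real.exp_add]
  congr 1
  · congr 1
    simp only [norm_sq_plane, PiLp.sub_apply, PiLp.add_apply, PiLp.smul_apply, smul_eq_mul]
    field_simp
    ring
  · field_simp

/-- Completing the square recentres `z`. The linear factor `z - y` splits into the new centre, which
gives the gradient of the outer kernel, and a centred remainder, which is odd and later integrates
to zero. -/
lemma gradKernel_apply_add {A a : ℝ} (hA : 0 < A) (ha : 0 < a) (c : ℝ) (i : Fin 2)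
    (ξ y z : Plane) :
    heatKernel A (ξ - c • z) * gradKernel a i (z - y) =
      c * gradKernel (A + c ^ 2 * a) i (ξ - c • y) *
        heatKernel (A * a / (A + c ^ 2 * a))
          (z - (y + (c * a / (A + c ^ 2 * a)) • (ξ - c • y))) +
      A / (A + c ^ 2 * a) * heatKernel (A + c ^ 2 * a) (ξ - c • y) *
        gradKernel (A * a / (A + c ^ 2 * a)) i
          (z - (y + (c * a / (A + c ^ 2 * a)) • (ξ - c • y))) := by
  have hA' : 0 < A + c ^ 2 * a := by positivity
  have h := heatKernel_mul_heatKernel hA ha c ξ y z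
  rw [gradKernel, mul_left_comm, h, gradKernel, gradKernel]
  simp only [PiLp.sub_apply, PiLp.add_apply, PiLp.smul_apply, smul_eq_mul]
  field_simp
  ring

lemma integrable_heatKernel_mul {A a : ℝ} (hA : 0 < A) (ha : 0 < a) (c : ℝ) (ξ y : Plane) :
    Integrable fun z => heatKernel A (ξ - c • z) * heatKernel a (z - y) := by
  have hA' : 0 < A + c ^ 2 * a := by positivity
  simp only [heatKernel_mul_heatKernel hA ha]
  exact ((integrable_heatKernel (by positivity)).comp_sub_right _).const_mul _

lemma integral_heatKernel_mul {A a : ℝ} (hA : 0 < A) (ha : 0 < a) (c : ℝ) (ξ y : Plane) :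
    ∫ z, heatKernel A (ξ - c • z) * heatKernel a (z - y) =
      heatKernel (A + c ^ 2 * a) (ξ - c • y) := by
  have hA' : 0 < A + c ^ 2 * a := by positivity
  simp only [heatKernel_mul_heatKernel hA ha]
  rw [integral_const_mul, integral_sub_right_eq_self, integral_heatKernel (by positivity), mul_one]

lemma integral_heatKernel_mul_gradKernel {A a : ℝ} (hA : 0 < A) (ha : 0 < a) (c : ℝ) (i : Fin 2)
    (ξ y : Plane) :
    ∫ z, heatKernel A (ξ - c • z) * gradKernel a i (z - y) =
      c * gradKernel (A + c ^ 2 * a) i (ξ - c • y) := by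
  have hA' : 0 < A + c ^ 2 * a := by positivity
  have hB : 0 < A * a / (A + c ^ 2 * a) := by positivity
  simp only [gradKernel_apply_add hA ha]
  rw [integral_add (((integrable_heatKernel hB).comp_sub_right _).const_mul _)
    (((integrable_gradKernel hB i).comp_sub_right _).const_mul _), integral_const_mul,
    integral_const_mul, integral_sub_right_eq_self, integral_sub_right_eq_self,
    integral_heatKernel hB, integral_gradKernel]
  ring

lemma hasFDerivAt_heatKernel {a : ℝ} (ha : a ≠ 0) (x : Plane) :
    HasFDerivAt (heatKernel a) ((-(2 * a)⁻¹ * heatKernel a x) • innerSL ℝ x) x := by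
  have h1 : HasFDerivAt (fun x : Plane => ‖x‖ ^ 2) ((2 : ℝ) • innerSL ℝ x) x :=
    (hasStrictFDerivAt_norm_sq x).hasFDerivAt.congr_fderiv (by rw [two_smul, two_smul])
  have h2 := (((h1.const_mul (-(4 * a)⁻¹)).exp).const_mul ((4 * Real.pi * a)⁻¹))
  rw [funext (heatKernel_eq a)]
  refine h2.congr_fderiv ?_
  ext v
  simp only [FunLike.coe_smul, Pi.smul_apply, smul_eq_mul, innerSL_apply_apply]
  field_simp
  ring

/-- The weight of the space `L²(m)`. -/
def weight (m : ℝ) (x : Plane) : ℝ := (1 + ‖x‖ ^ 2) ^ m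

lemma one_le_base (x : Plane) : 1 ≤ 1 + ‖x‖ ^ 2 := by
  have := sq_nonneg ‖x‖
  linarith

lemma base_pos (x : Plane) : 0 < 1 + ‖x‖ ^ 2 := by positivity

lemma weight_pos (m : ℝ) (x : Plane) : 0 < weight m x := Real.rpow_pos_of_pos (base_pos x) _

lemma continuous_weight (m : ℝ) : Continuous (weight m) :=
  (by fun_prop : Continuous fun x : Plane => 1 + ‖x‖ ^ 2).rpow_const fun x => Or.inl (base_pos x).ne'

lemma one_add_norm_add_sq_le (x y : Plane) :
    1 + ‖x + y‖ ^ 2 ≤ 2 * (1 + ‖x‖ ^ 2) * (1 + ‖y‖ ^ 2) := by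
  have h := norm_add_le x y
  have h2 : ‖x + y‖ ^ 2 ≤ (‖x‖ + ‖y‖) ^ 2 := by gcongr
  nlinarith [sq_nonneg (‖x‖ - ‖y‖), sq_nonneg (‖x‖ * ‖y‖)]

lemma weight_add_le {m : ℝ} (hm : 0 ≤ m) (x y : Plane) :
    weight m (x + y) ≤ 2 ^ m * weight m x * weight m y := by
  rw [weight, weight, weight, ← Real.mul_rpow (by norm_num) (base_pos x).le,
    ← Real.mul_rpow (by positivity) (base_pos y).le]
  exact Real.rpow_le_rpow (base_pos _).le (one_add_norm_add_sq_le x y) hm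

/-- The inequality `1 + s ≤ m / b * exp (b * s / m)` raised to the power `m`. -/
lemma rpow_le_mul_exp {m : ℝ} (hm : 1 ≤ m) {b : ℝ} (hb : 0 < b) (hb1 : b ≤ 1) {s : ℝ} (hs : 0 ≤ s) :
    (1 + s) ^ m ≤ (m / b) ^ m * Real.exp (b * s) := by
  have hM : 1 ≤ m / b := (one_le_div hb).2 (hb1.trans hm)
  have h1 : 1 + s ≤ m / b * Real.exp (b * s / m) := by
    have := Real.add_one_le_exp (b * s / m)
    calc 1 + s ≤ m / b * 1 + m / b * (b * s / m) := by
          have : m / b * (b * s / m) = s := by field_simp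
          linarith
      _ = m / b * (b * s / m + 1) := by ring
      _ ≤ _ := by gcongr
  calc (1 + s) ^ m ≤ (m / b * Real.exp (b * s / m)) ^ m := by gcongr
    _ = _ := by
      rw [Real.mul_rpow (by positivity) (Real.exp_pos _).le, ← Real.exp_mul]
      congr 2
      field_simp

/-- Half of the Gaussian exponent, at least `‖x‖ ^ 2 / 16` when `a ≤ 2`, absorbs the weight, with a
constant uniform in `a`. -/
lemma exists_heatKernel_mul_weight_le {m : ℝ} (hm : 1 ≤ m) :
    ∃ C, 0 ≤ C ∧ ∀ a ∈ Ioc (0 : ℝ) 2, ∀ x : Plane,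
      heatKernel a x * weight m x ≤ C * heatKernel (2 * a) x := by
  refine ⟨2 * (m / 16⁻¹) ^ m, by positivity, fun a ha x => ?_⟩
  have ha0 := ha.1
  have hpi := Real.pi_pos
  have h1 := rpow_le_mul_exp hm (b := 16⁻¹) (by norm_num) (by norm_num) (sq_nonneg ‖x‖)
  have h2 : Real.exp (-‖x‖ ^ 2 / (4 * a)) * Real.exp (16⁻¹ * ‖x‖ ^ 2) ≤
      Real.exp (-‖x‖ ^ 2 / (4 * (2 * a))) := by
    rw [← Real.exp_add, Real.exp_le_exp]
    have h3 : 16⁻¹ * ‖x‖ ^ 2 ≤ ‖x‖ ^ 2 / (8 * a) := by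
      rw [inv_mul_eq_div]
      gcongr
      linarith [ha.2]
    have h4 : -‖x‖ ^ 2 / (4 * a) = -‖x‖ ^ 2 / (4 * (2 * a)) - ‖x‖ ^ 2 / (8 * a) := by
      field_simp
      ring
    linarith
  rw [heatKernel, heatKernel, weight]
  calc Real.exp (-‖x‖ ^ 2 / (4 * a)) / (4 * Real.pi * a) * (1 + ‖x‖ ^ 2) ^ m
      ≤ Real.exp (-‖x‖ ^ 2 / (4 * a)) / (4 * Real.pi * a) *
        ((m / 16⁻¹) ^ m * Real.exp (16⁻¹ * ‖x‖ ^ 2)) := by gcongr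
    _ = (m / 16⁻¹) ^ m * (Real.exp (-‖x‖ ^ 2 / (4 * a)) * Real.exp (16⁻¹ * ‖x‖ ^ 2)) /
        (4 * Real.pi * a) := by ring
    _ ≤ (m / 16⁻¹) ^ m * Real.exp (-‖x‖ ^ 2 / (4 * (2 * a))) / (4 * Real.pi * a) := by gcongr
    _ = _ := by field_simp

end HeatKernel

end

end Vorticity

namespace Vorticity

noncomputable section

/-! ### Operators on the weighted space given by pointwise formulas -/

section WeightedSpace

lemma measurable_weight (m : ℝ) : Measurable fun ξ : Plane => ENNReal.ofReal (weight m ξ) :=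
  (continuous_weight m).measurable.ennreal_ofReal

lemma weightedMeasure_eq (m : ℝ) :
    weightedMeasure m = volume.withDensity fun ξ => ENNReal.ofReal (weight m ξ) := rfl

lemma weightedMeasure_absolutelyContinuous (m : ℝ) : weightedMeasure m ≪ volume :=
  withDensity_absolutelyContinuous _ _

lemma absolutelyContinuous_weightedMeasure (m : ℝ) : volume ≪ weightedMeasure m :=
  withDensity_absolutelyContinuous' (measurable_weight m).aemeasurable
    (Eventually.of_forall fun ξ => (ENNReal.ofReal_pos.2 (weight_pos m ξ)).ne')

/-- The density is positive, so the null sets are those of Lebesgue measure, to which all pointwise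
statements refer. -/
lemma ae_weightedMeasure_iff {m : ℝ} {p : Plane → Prop} :
    (∀ᵐ ξ ∂weightedMeasure m, p ξ) ↔ ∀ᵐ ξ, p ξ :=
  ⟨fun h => (absolutelyContinuous_weightedMeasure m).ae_le h,
    fun h => (weightedMeasure_absolutelyContinuous m).ae_le h⟩

lemma lintegral_weightedMeasure (m : ℝ) (f : Plane → ℝ≥0∞) :
    ∫⁻ ξ, f ξ ∂weightedMeasure m = ∫⁻ ξ, ENNReal.ofReal (weight m ξ) * f ξ := by
  rw [weightedMeasure_eq, lintegral_withDensity_eq_lintegral_mul_non_measurable₀ _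
    (measurable_weight m).aemeasurable (Eventually.of_forall fun _ => ENNReal.ofReal_lt_top)]
  rfl

lemma eLpNorm_sq (m : ℝ) (u : Plane → ℝ) :
    eLpNorm u 2 (weightedMeasure m) ^ 2 = ∫⁻ ξ, ENNReal.ofReal (weight m ξ) * ‖u ξ‖ₑ ^ 2 := by
  have h := eLpNorm_nnreal_pow_eq_lintegral (f := u) (μ := weightedMeasure m) (p := 2) two_ne_zero
  rw [lintegral_weightedMeasure] at h
  simpa using h

lemma enorm_sq_L2m {m : ℝ} (f : L2m m) :
    ‖f‖ₑ ^ 2 = ∫⁻ ξ, ENNReal.ofReal (weight m ξ) * ‖f ξ‖ₑ ^ 2 := by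
  rw [← eLpNorm_sq, Lp.enorm_def]

lemma eLpNorm_le_of_lintegral_le {m : ℝ} {u : Plane → ℝ} {D : ℝ≥0∞}
    (h : ∫⁻ ξ, ENNReal.ofReal (weight m ξ) * ‖u ξ‖ₑ ^ 2 ≤ D ^ 2) :
    eLpNorm u 2 (weightedMeasure m) ≤ D := by
  rw [← eLpNorm_sq] at h
  exact (ENNReal.pow_le_pow_left_iff two_ne_zero).1 h

lemma memLp_of_lintegral_le {m : ℝ} {u : Plane → ℝ} (hu : AEStronglyMeasurable u volume) {D : ℝ≥0∞}
    (hD : D ≠ ⊤) (h : ∫⁻ ξ, ENNReal.ofReal (weight m ξ) * ‖u ξ‖ₑ ^ 2 ≤ D ^ 2) :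
    MemLp u 2 (weightedMeasure m) :=
  ⟨hu.mono_ac (weightedMeasure_absolutelyContinuous m),
    (eLpNorm_le_of_lintegral_le h).trans_lt hD.lt_top⟩

lemma ext_L2m {m : ℝ} {f g : L2m m} (h : ∀ᵐ ξ, f ξ = g ξ) : f = g :=
  Lp.ext (ae_weightedMeasure_iff.2 h)

lemma coeFn_add_L2m {m : ℝ} (f g : L2m m) : ∀ᵐ ξ, (f + g : L2m m) ξ = f ξ + g ξ :=
  ae_weightedMeasure_iff.1 (Lp.coeFn_add f g)

lemma coeFn_smul_L2m {m : ℝ} (c : ℝ) (f : L2m m) : ∀ᵐ ξ, (c • f : L2m m) ξ = c * f ξ :=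
  ae_weightedMeasure_iff.1 (Lp.coeFn_smul c f)

lemma coeFn_sub_L2m {m : ℝ} (f g : L2m m) : ∀ᵐ ξ, (f - g : L2m m) ξ = f ξ - g ξ :=
  ae_weightedMeasure_iff.1 (Lp.coeFn_sub f g)

lemma coeFn_toLp_L2m {m : ℝ} {u : Plane → ℝ} (hu : MemLp u 2 (weightedMeasure m)) :
    ∀ᵐ ξ, hu.toLp u ξ = u ξ :=
  ae_weightedMeasure_iff.1 hu.coeFn_toLp

lemma measurable_L2m {m : ℝ} (f : L2m m) : Measurable f := (Lp.stronglyMeasurable f).measurable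

lemma norm_toLp_le {m : ℝ} {u : Plane → ℝ} (hu : MemLp u 2 (weightedMeasure m)) {D : ℝ}
    (hD : 0 ≤ D) (h : ∫⁻ ξ, ENNReal.ofReal (weight m ξ) * ‖u ξ‖ₑ ^ 2 ≤ ENNReal.ofReal D ^ 2) :
    ‖hu.toLp u‖ ≤ D := by
  rw [Lp.norm_toLp]
  exact ENNReal.toReal_le_of_le_ofReal hD (eLpNorm_le_of_lintegral_le h)

lemma norm_le_of_ae_eq {m : ℝ} {f : L2m m} {u : Plane → ℝ} (hfu : ∀ᵐ ξ, f ξ = u ξ) {D : ℝ}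
    (hD : 0 ≤ D) (h : ∫⁻ ξ, ENNReal.ofReal (weight m ξ) * ‖u ξ‖ₑ ^ 2 ≤ ENNReal.ofReal D ^ 2) :
    ‖f‖ ≤ D := by
  rw [Lp.norm_def]
  refine ENNReal.toReal_le_of_le_ofReal hD (eLpNorm_le_of_lintegral_le ?_)
  refine le_trans (le_of_eq (lintegral_congr_ae ?_)) h
  filter_upwards [hfu] with ξ hξ
  rw [hξ]

lemma ofReal_mul_enorm {m : ℝ} {D : ℝ} (hD : 0 ≤ D) (f : L2m m) :
    ENNReal.ofReal D * ‖f‖ₑ = ENNReal.ofReal (D * ‖f‖) := by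
  rw [ENNReal.ofReal_mul hD, ofReal_norm]

/-- A bounded operator on `L²(m)` from a pointwise formula. -/
lemma exists_clm_of_pointwise {m D : ℝ} (hD : 0 ≤ D) {U : L2m m → Plane → ℝ}
    (hU : ∀ f, AEStronglyMeasurable (U f) volume)
    (hadd : ∀ f g, ∀ᵐ ξ, U (f + g) ξ = U f ξ + U g ξ)
    (hsmul : ∀ (c : ℝ) f, ∀ᵐ ξ, U (c • f) ξ = c * U f ξ)
    (hb : ∀ f, ∫⁻ ξ, ENNReal.ofReal (weight m ξ) * ‖U f ξ‖ₑ ^ 2 ≤ (ENNReal.ofReal D * ‖f‖ₑ) ^ 2) :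
    ∃ T : L2m m →L[ℝ] L2m m, (∀ f, ∀ᵐ ξ, T f ξ = U f ξ) ∧ ‖T‖ ≤ D := by
  have hmem : ∀ f, MemLp (U f) 2 (weightedMeasure m) := fun f =>
    memLp_of_lintegral_le (hU f) (ENNReal.mul_ne_top ENNReal.ofReal_ne_top enorm_ne_top) (hb f)
  have hT : ∀ f, ∀ᵐ ξ, (hmem f).toLp (U f) ξ = U f ξ := fun f => coeFn_toLp_L2m (hmem f)
  let T : L2m m →L[ℝ] L2m m := LinearMap.mkContinuous
    { toFun := fun f => (hmem f).toLp (U f)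
      map_add' := fun f g => ext_L2m (by
        filter_upwards [hT (f + g), hT f, hT g, hadd f g,
          coeFn_add_L2m ((hmem f).toLp (U f)) ((hmem g).toLp (U g))] with ξ h1 h2 h3 h4 h5
        rw [h1, h4, h5, h2, h3])
      map_smul' := fun c f => ext_L2m (by
        filter_upwards [hT (c • f), hT f, hsmul c f,
          coeFn_smul_L2m c ((hmem f).toLp (U f))] with ξ h1 h2 h3 h4
        rw [h1, h3, RingHom.id_apply, h4, h2]) } D fun f => by
    refine norm_toLp_le (hmem f) (by positivity) ?_
    rw [← ofReal_mul_enorm hD]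
    exact hb f
  exact ⟨T, hT, LinearMap.mkContinuous_norm_le _ hD _⟩

/-- A bounded bilinear map on `L²(m)` from a pointwise formula. -/
lemma exists_bilinear_of_pointwise {m D : ℝ} (hD : 0 ≤ D) {U : L2m m → L2m m → Plane → ℝ}
    (hU : ∀ f g, AEStronglyMeasurable (U f g) volume)
    (hadd : ∀ f f' g, ∀ᵐ ξ, U (f + f') g ξ = U f g ξ + U f' g ξ)
    (hsmul : ∀ (c : ℝ) f g, ∀ᵐ ξ, U (c • f) g ξ = c * U f g ξ)
    (hadd' : ∀ f g g', ∀ᵐ ξ, U f (g + g') ξ = U f g ξ + U f g' ξ)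
    (hsmul' : ∀ (c : ℝ) f g, ∀ᵐ ξ, U f (c • g) ξ = c * U f g ξ)
    (hb : ∀ f g, ∫⁻ ξ, ENNReal.ofReal (weight m ξ) * ‖U f g ξ‖ₑ ^ 2 ≤
      (ENNReal.ofReal D * ‖f‖ₑ * ‖g‖ₑ) ^ 2) :
    ∃ T : L2m m →L[ℝ] L2m m →L[ℝ] L2m m, (∀ f g, ∀ᵐ ξ, T f g ξ = U f g ξ) ∧ ‖T‖ ≤ D := by
  have hmem : ∀ f g, MemLp (U f g) 2 (weightedMeasure m) := fun f g =>
    memLp_of_lintegral_le (hU f g)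
      (ENNReal.mul_ne_top (ENNReal.mul_ne_top ENNReal.ofReal_ne_top enorm_ne_top) enorm_ne_top) (hb f g)
  have hT : ∀ f g, ∀ᵐ ξ, (hmem f g).toLp (U f g) ξ = U f g ξ := fun f g => coeFn_toLp_L2m (hmem f g)
  let T₀ : L2m m →ₗ[ℝ] L2m m →ₗ[ℝ] L2m m := LinearMap.mk₂ ℝ (fun f g => (hmem f g).toLp (U f g))
    (fun f f' g => ext_L2m (by
      filter_upwards [hT (f + f') g, hT f g, hT f' g, hadd f f' g,
        coeFn_add_L2m ((hmem f g).toLp (U f g)) ((hmem f' g).toLp (U f' g))] with ξ h1 h2 h3 h4 h5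
      rw [h1, h4, h5, h2, h3]))
    (fun c f g => ext_L2m (by
      filter_upwards [hT (c • f) g, hT f g, hsmul c f g,
        coeFn_smul_L2m c ((hmem f g).toLp (U f g))] with ξ h1 h2 h3 h4
      rw [h1, h3, h4, h2]))
    (fun f g g' => ext_L2m (by
      filter_upwards [hT f (g + g'), hT f g, hT f g', hadd' f g g',
        coeFn_add_L2m ((hmem f g).toLp (U f g)) ((hmem f g').toLp (U f g'))] with ξ h1 h2 h3 h4 h5
      rw [h1, h4, h5, h2, h3]))
    (fun c f g => ext_L2m (by
      filter_upwards [hT f (c • g), hT f g, hsmul' c f g,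
        coeFn_smul_L2m c ((hmem f g).toLp (U f g))] with ξ h1 h2 h3 h4
      rw [h1, h3, h4, h2]))
  have hT₀ : ∀ f g, ‖T₀ f g‖ ≤ D * ‖f‖ * ‖g‖ := fun f g => by
    refine norm_toLp_le (hmem f g) (by positivity) ?_
    rw [ENNReal.ofReal_mul (by positivity), ENNReal.ofReal_mul hD, ofReal_norm, ofReal_norm]
    exact hb f g
  exact ⟨T₀.mkContinuous₂ D hT₀, hT, LinearMap.mkContinuous₂_norm_le _ hD _⟩

/-- The Cauchy-Schwarz inequality. -/
lemma lintegral_mul_sq_le {α : Type*} [MeasurableSpace α] {μ : Measure α} {f g : α → ℝ≥0∞}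
    (hf : AEMeasurable f μ) (hg : AEMeasurable g μ) :
    (∫⁻ x, f x * g x ∂μ) ^ 2 ≤ (∫⁻ x, f x ^ 2 ∂μ) * ∫⁻ x, g x ^ 2 ∂μ := by
  have h := ENNReal.lintegral_mul_le_Lp_mul_Lq μ Real.HolderConjugate.two_two hf hg
  have h2 : ∀ x : ℝ≥0∞, (x ^ (1 / 2 : ℝ)) ^ 2 = x := fun x => by
    rw [← ENNReal.rpow_natCast, ← ENNReal.rpow_mul]
    norm_num
  simp only [ENNReal.rpow_two] at h
  calc _ ≤ ((∫⁻ x, f x ^ 2 ∂μ) ^ (1 / 2 : ℝ) * (∫⁻ x, g x ^ 2 ∂μ) ^ (1 / 2 : ℝ)) ^ 2 := by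
        gcongr
        exact h
    _ = _ := by rw [mul_pow, h2, h2]

/-- The Cauchy-Schwarz inequality for a weighted measure. -/
lemma lintegral_mul_mul_sq_le {α : Type*} [MeasurableSpace α] {μ : Measure α} {k f g : α → ℝ≥0∞}
    (hk : AEMeasurable k μ) (hf : AEMeasurable f μ) (hg : AEMeasurable g μ) :
    (∫⁻ x, k x * (f x * g x) ∂μ) ^ 2 ≤ (∫⁻ x, k x * f x ^ 2 ∂μ) * ∫⁻ x, k x * g x ^ 2 ∂μ := by
  have h2 : ∀ x : ℝ≥0∞, (x ^ (1 / 2 : ℝ)) ^ 2 = x := fun x => by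
    rw [← ENNReal.rpow_natCast, ← ENNReal.rpow_mul]
    norm_num
  have h := lintegral_mul_sq_le (μ := μ) (f := fun x => k x ^ (1 / 2 : ℝ) * f x)
    (g := fun x => k x ^ (1 / 2 : ℝ) * g x) ((hk.pow_const _).mul hf) ((hk.pow_const _).mul hg)
  simp only [mul_pow, h2] at h
  refine le_trans (le_of_eq ?_) h
  congr 1
  refine lintegral_congr fun x => ?_
  nth_rw 1 [← h2 (k x)]
  ring

lemma lintegral_mul_sq_le' {α : Type*} [MeasurableSpace α] {μ : Measure α} {k f : α → ℝ≥0∞}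
    (hk : AEMeasurable k μ) (hf : AEMeasurable f μ) :
    (∫⁻ x, k x * f x ∂μ) ^ 2 ≤ (∫⁻ x, k x ∂μ) * ∫⁻ x, k x * f x ^ 2 ∂μ := by
  simpa using lintegral_mul_mul_sq_le (μ := μ) hk (aemeasurable_const (b := (1 : ℝ≥0∞))) hf

/-- Integration of a kernel in its first variable against a weight. -/
lemma lintegral_kernel_le {k : Plane → Plane → ℝ≥0∞} (hk : Measurable (Function.uncurry k))
    {f w w' : Plane → ℝ≥0∞} (hf : Measurable f) (hw : Measurable w) (hw' : Measurable w')
    {B : ℝ≥0∞}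
    (hB : ∀ η, f η ≠ 0 → ∫⁻ ξ, w ξ * k ξ η ≤ B * w' η) :
    ∫⁻ ξ, w ξ * ∫⁻ η, k ξ η * f η ≤ B * ∫⁻ η, w' η * f η := by
  have hm1 : Measurable (Function.uncurry fun ξ η => w ξ * (k ξ η * f η)) :=
    (hw.comp measurable_fst).mul (hk.mul (hf.comp measurable_snd))
  calc ∫⁻ ξ, w ξ * ∫⁻ η, k ξ η * f η = ∫⁻ ξ, ∫⁻ η, w ξ * (k ξ η * f η) := by
        refine lintegral_congr fun ξ => (lintegral_const_mul _ ?_).symm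
        exact (hk.comp (measurable_const.prodMk measurable_id)).mul hf
    _ = ∫⁻ η, ∫⁻ ξ, w ξ * (k ξ η * f η) := lintegral_lintegral_swap hm1.aemeasurable
    _ = ∫⁻ η, (∫⁻ ξ, w ξ * k ξ η) * f η := by
        refine lintegral_congr fun η => ?_
        rw [← lintegral_mul_const]
        · refine lintegral_congr fun ξ => by ring
        · exact hw.mul (hk.comp (measurable_id.prodMk measurable_const))
    _ ≤ ∫⁻ η, B * (w' η * f η) := by
        refine lintegral_mono fun η => ?_
        by_cases h : f η = 0
        · simp [h]
        · rw [← mul_assoc]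
          exact mul_le_mul_left (hB η h) _
    _ = _ := lintegral_const_mul _ (hw'.mul hf)

end WeightedSpace

end

end Vorticity

namespace Vorticity

noncomputable section

/-! ### Integral estimates for weights and kernels -/

section Estimates

lemma integrable_weight {s : ℝ} (hs : s < -1) : Integrable (weight s) := by
  have h := integrable_rpow_neg_one_add_norm_sq (E := Plane) (μ := volume) (r := -2 * s)
    (by rw [finrank_plane]; push_cast; linarith)
  have e : -(-2 * s) / 2 = s := by ring
  rw [e] at h
  exact h

lemma lintegral_ofReal_weight {s : ℝ} (hs : s < -1) :
    ∫⁻ ξ, ENNReal.ofReal (weight s ξ) = ENNReal.ofReal (∫ ξ, weight s ξ) :=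
  (ofReal_integral_eq_lintegral_ofReal (integrable_weight hs)
    (Eventually.of_forall fun ξ => (weight_pos s ξ).le)).symm

lemma weight_mul_weight (s t : ℝ) (x : Plane) : weight s x * weight t x = weight (s + t) x :=
  (Real.rpow_add (base_pos x) s t).symm

lemma weight_sq (s : ℝ) (x : Plane) : weight s x ^ 2 = weight (2 * s) x := by
  rw [sq, weight_mul_weight, two_mul]

lemma weight_zero (x : Plane) : weight 0 x = 1 := Real.rpow_zero _

lemma weight_le_one {s : ℝ} (hs : s ≤ 0) (x : Plane) : weight s x ≤ 1 :=
  Real.rpow_le_one_of_one_le_of_nonpos (one_le_base x) hs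

lemma weight_mono {s t : ℝ} (h : s ≤ t) (x : Plane) : weight s x ≤ weight t x :=
  Real.rpow_le_rpow_of_exponent_le (one_le_base x) h

lemma weight_smul_le {m : ℝ} (hm : 0 ≤ m) {c : ℝ} (hc : c ∈ Ioc (0 : ℝ) 1) (x : Plane) :
    weight m (c • x) ≤ weight m x := by
  refine Real.rpow_le_rpow (base_pos _).le ?_ hm
  rw [norm_smul, Real.norm_of_nonneg hc.1.le, mul_pow]
  have := mul_le_of_le_one_left (sq_nonneg ‖x‖) (pow_le_one₀ hc.1.le hc.2 (n := 2))
  linarith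

/-- Splitting of the weight in the Cauchy-Schwarz inequality. -/
lemma lintegral_mul_enorm_sq_le {m : ℝ} (f : L2m m) {k u : Plane → ℝ≥0∞} (hk : Measurable k)
    (hu : Measurable u) :
    (∫⁻ ξ, k ξ * (u ξ * ‖f ξ‖ₑ)) ^ 2 ≤ (∫⁻ ξ, k ξ * (ENNReal.ofReal (weight (-m) ξ) * u ξ ^ 2)) *
      ∫⁻ ξ, k ξ * (ENNReal.ofReal (weight m ξ) * ‖f ξ‖ₑ ^ 2) := by
  have h := lintegral_mul_mul_sq_le (μ := volume) (k := k)
    (f := fun ξ => ENNReal.ofReal (weight (-m / 2) ξ) * u ξ)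
    (g := fun ξ => ENNReal.ofReal (weight (m / 2) ξ) * ‖f ξ‖ₑ) hk.aemeasurable
    ((measurable_weight _).mul hu).aemeasurable
    ((measurable_weight _).mul (measurable_L2m f).enorm).aemeasurable
  simp only [mul_pow, ← ENNReal.ofReal_pow (weight_pos _ _).le, weight_sq] at h
  rw [show 2 * (-m / 2) = -m by ring, show 2 * (m / 2) = m by ring] at h
  refine le_trans (le_of_eq ?_) h
  congr 1
  refine lintegral_congr fun ξ => ?_
  have h1 : ENNReal.ofReal (weight (-m / 2) ξ) * ENNReal.ofReal (weight (m / 2) ξ) = 1 := by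
    rw [← ENNReal.ofReal_mul (weight_pos _ _).le, weight_mul_weight, show -m / 2 + m / 2 = 0 by ring,
      weight_zero, ENNReal.ofReal_one]
  calc k ξ * (u ξ * ‖f ξ‖ₑ) = k ξ * (ENNReal.ofReal (weight (-m / 2) ξ) *
        ENNReal.ofReal (weight (m / 2) ξ) * (u ξ * ‖f ξ‖ₑ)) := by rw [h1, one_mul]
    _ = _ := by ring

lemma le_ofReal_sqrt_mul {x y : ℝ≥0∞} {I : ℝ} (hI : 0 ≤ I) (h : x ^ 2 ≤ ENNReal.ofReal I * y ^ 2) :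
    x ≤ ENNReal.ofReal (Real.sqrt I) * y := by
  rw [← ENNReal.pow_le_pow_left_iff two_ne_zero, mul_pow, ← ENNReal.ofReal_pow (Real.sqrt_nonneg _),
    Real.sq_sqrt hI]
  exact h

/-- Cauchy–Schwarz against the weight of exponent `2 * s - m`, which is integrable over the plane
when this is below `-1`. -/
lemma exists_lintegral_weight_mul_le {m s : ℝ} (h : 2 * s + 1 < m) :
    ∃ C, 0 ≤ C ∧ ∀ f : L2m m, ∫⁻ ξ, ENNReal.ofReal (weight s ξ) * ‖f ξ‖ₑ ≤
      ENNReal.ofReal C * ‖f‖ₑ := by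
  have hs : -m + 2 * s < -1 := by linarith
  refine ⟨Real.sqrt (∫ ξ, weight (-m + 2 * s) ξ), Real.sqrt_nonneg _, fun f => ?_⟩
  refine le_ofReal_sqrt_mul (integral_nonneg fun ξ => (weight_pos _ ξ).le) ?_
  have h1 := lintegral_mul_enorm_sq_le f (k := fun _ => 1) measurable_const (measurable_weight s)
  simp only [one_mul, ← ENNReal.ofReal_pow (weight_pos _ _).le, weight_sq,
    ← ENNReal.ofReal_mul (weight_pos _ _).le, weight_mul_weight] at h1
  rwa [lintegral_ofReal_weight hs, ← enorm_sq_L2m] at h1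

lemma integrable_weight_mul {m s : ℝ} (h : 2 * s + 1 < m) (f : L2m m) :
    Integrable fun ξ => weight s ξ * f ξ := by
  obtain ⟨C, hC, hb⟩ := exists_lintegral_weight_mul_le h
  refine ⟨((continuous_weight s).measurable.mul (measurable_L2m f)).aestronglyMeasurable, ?_⟩
  rw [hasFiniteIntegral_iff_enorm]
  refine lt_of_le_of_lt (le_trans (le_of_eq ?_) (hb f))
    (ENNReal.mul_ne_top ENNReal.ofReal_ne_top enorm_ne_top).lt_top
  refine lintegral_congr fun ξ => ?_
  rw [enorm_mul, Real.enorm_of_nonneg (weight_pos s ξ).le]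

lemma integrable_L2m {m : ℝ} (hm : 1 < m) (f : L2m m) : Integrable f := by
  simpa [weight_zero] using integrable_weight_mul (s := 0) (by linarith) f

lemma integral_heatKernel_smul {a : ℝ} (ha : 0 < a) {c : ℝ} (hc : 0 < c) (ξ : Plane) :
    ∫ η, heatKernel a (ξ - c • η) = (c ^ 2)⁻¹ := by
  have h := Measure.integral_comp_smul (volume : Measure Plane) (fun η => heatKernel a (ξ - η)) c
  rw [h, finrank_plane, integral_sub_left_eq_self, integral_heatKernel ha,
    abs_of_pos (by positivity), smul_eq_mul, mul_one]

lemma integrable_heatKernel_smul {a : ℝ} (ha : 0 < a) {c : ℝ} (hc : 0 < c) (ξ : Plane) :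
    Integrable fun η => heatKernel a (ξ - c • η) := by
  by_contra h
  have := integral_heatKernel_smul ha hc ξ
  rw [integral_undef h] at this
  have : 0 < (c ^ 2)⁻¹ := by positivity
  linarith

lemma lintegral_heatKernel_smul {a : ℝ} (ha : 0 < a) {c : ℝ} (hc : 0 < c) (ξ : Plane) :
    ∫⁻ η, ENNReal.ofReal (heatKernel a (ξ - c • η)) = ENNReal.ofReal (c ^ 2)⁻¹ := by
  rw [← integral_heatKernel_smul ha hc ξ, ofReal_integral_eq_lintegral_ofReal
    (integrable_heatKernel_smul ha hc ξ) (Eventually.of_forall fun η => heatKernel_nonneg ha.le _)]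

lemma measurable_heatKernel_smul (a c : ℝ) :
    Measurable (Function.uncurry fun ξ η : Plane => ENNReal.ofReal (heatKernel a (ξ - c • η))) :=
  ((continuous_heatKernel a).comp
    (by fun_prop : Continuous fun p : Plane × Plane => p.1 - c • p.2)).measurable.ennreal_ofReal

/-- The weight at `ξ` is at most a product of the weights at `ξ - y` and at `y`; the Gaussian
absorbs the first. -/
lemma exists_lintegral_weight_mul_heatKernel_le {m : ℝ} (hm : 1 ≤ m) :
    ∃ C, 0 ≤ C ∧ ∀ a ∈ Ioc (0 : ℝ) 2, ∀ y : Plane,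
      ∫⁻ ξ, ENNReal.ofReal (weight m ξ) * ENNReal.ofReal (heatKernel a (ξ - y)) ≤
        ENNReal.ofReal C * ENNReal.ofReal (weight m y) := by
  obtain ⟨C, hC, hb⟩ := exists_heatKernel_mul_weight_le hm
  refine ⟨2 ^ m * C, by positivity, fun a ha y => ?_⟩
  have ha2 : 0 < 2 * a := by have := ha.1; positivity
  have h1 : ∀ ξ, ENNReal.ofReal (weight m ξ) * ENNReal.ofReal (heatKernel a (ξ - y)) ≤
      ENNReal.ofReal (2 ^ m * C * weight m y) * ENNReal.ofReal (heatKernel (2 * a) (ξ - y)) := by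
    intro ξ
    have hw := weight_pos m y
    have hk := heatKernel_nonneg ha.1.le (ξ - y)
    rw [← ENNReal.ofReal_mul (weight_pos m ξ).le, ← ENNReal.ofReal_mul (by positivity)]
    refine ENNReal.ofReal_le_ofReal ?_
    have h2 := weight_add_le (by linarith : 0 ≤ m) (ξ - y) y
    rw [sub_add_cancel] at h2
    calc weight m ξ * heatKernel a (ξ - y)
        ≤ 2 ^ m * weight m (ξ - y) * weight m y * heatKernel a (ξ - y) := by gcongr
      _ = 2 ^ m * weight m y * (heatKernel a (ξ - y) * weight m (ξ - y)) := by ring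
      _ ≤ 2 ^ m * weight m y * (C * heatKernel (2 * a) (ξ - y)) :=
        mul_le_mul_of_nonneg_left (hb a ha _) (by positivity)
      _ = _ := by ring
  refine (lintegral_mono h1).trans ?_
  rw [lintegral_const_mul' _ _ ENNReal.ofReal_ne_top, ← ofReal_integral_eq_lintegral_ofReal
    ((integrable_heatKernel ha2).comp_sub_right y)
    (Eventually.of_forall fun η => heatKernel_nonneg ha2.le _), integral_sub_right_eq_self,
    integral_heatKernel ha2, ENNReal.ofReal_one, mul_one, ENNReal.ofReal_mul (by positivity)]

/-- Schur's test. -/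
lemma lintegral_kernel_sq_le {k : Plane → Plane → ℝ≥0∞} (hk : Measurable (Function.uncurry k))
    {f w w' : Plane → ℝ≥0∞} (hf : Measurable f) (hw : Measurable w) (hw' : Measurable w')
    {A B : ℝ≥0∞} (hA : ∀ ξ, ∫⁻ η, k ξ η ≤ A)
    (hB : ∀ η, f η ≠ 0 → ∫⁻ ξ, w ξ * k ξ η ≤ B * w' η) :
    ∫⁻ ξ, w ξ * (∫⁻ η, k ξ η * f η) ^ 2 ≤ A * (B * ∫⁻ η, w' η * f η ^ 2) := by
  have hk1 : ∀ ξ, Measurable (k ξ) := fun ξ => hk.comp (measurable_const.prodMk measurable_id)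
  calc ∫⁻ ξ, w ξ * (∫⁻ η, k ξ η * f η) ^ 2
      ≤ ∫⁻ ξ, A * (w ξ * ∫⁻ η, k ξ η * f η ^ 2) := by
        refine lintegral_mono fun ξ => ?_
        calc w ξ * (∫⁻ η, k ξ η * f η) ^ 2
            ≤ w ξ * ((∫⁻ η, k ξ η) * ∫⁻ η, k ξ η * f η ^ 2) := by
              gcongr
              exact lintegral_mul_sq_le' (hk1 ξ).aemeasurable hf.aemeasurable
          _ ≤ w ξ * (A * ∫⁻ η, k ξ η * f η ^ 2) := by gcongr; exact hA ξ
          _ = _ := by ring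
    _ = A * ∫⁻ ξ, w ξ * ∫⁻ η, k ξ η * f η ^ 2 := by
        refine lintegral_const_mul _ (hw.mul ?_)
        exact Measurable.lintegral_prod_right' (f := fun p : Plane × Plane => k p.1 p.2 * f p.2 ^ 2)
          (hk.mul ((hf.comp measurable_snd).pow_const 2))
    _ ≤ _ := by
        gcongr
        exact lintegral_kernel_le hk (hf.pow_const 2) hw hw'
          (fun η hη => hB η fun h => hη (by rw [h]; simp))

/-- The Riesz kernel `|x|⁻¹`. -/
def rieszKernel (x : Plane) : ℝ≥0∞ := ENNReal.ofReal ‖x‖⁻¹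

lemma measurable_rieszKernel : Measurable rieszKernel := by
  unfold rieszKernel
  fun_prop

/-- Split at distance `r` from `z`. Outside, the kernel is at most `1 / r`; inside, `φ ≤ M` and the
kernel integrates to a multiple of the radius. The radius stays free, to be optimised in each
application. -/
lemma exists_lintegral_mul_rieszKernel_le :
    ∃ κ : ℝ, 0 ≤ κ ∧ ∀ (φ : Plane → ℝ≥0∞) (M : ℝ≥0∞) (z : Plane) (r : ℝ), 0 < r → Measurable φ →
      (∀ y, φ y ≤ M) → ∫⁻ y, φ y * rieszKernel (y - z) ≤
        ENNReal.ofReal r⁻¹ * (∫⁻ y, φ y) + ENNReal.ofReal (κ * r) * M := by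
  set κ : ℝ := 2 * volume.real (Metric.ball (0 : Plane) 1)
  refine ⟨κ, by positivity, fun φ M z r hr hφ hM => ?_⟩
  set g : ℝ → ℝ := (Iio r).indicator fun y => y⁻¹
  have hg0 : ∀ y, 0 ≤ y → 0 ≤ g y := fun y hy => by
    simp only [g, indicator]
    split_ifs
    exacts [inv_nonneg.2 hy, le_rfl]
  -- In polar coordinates the Jacobian factor `y` cancels the singularity `y⁻¹`.
  have hgi : ∀ y ∈ Ioi (0 : ℝ), y ^ (Module.finrank ℝ Plane - 1) • g y =
      (Iio r).indicator (fun _ => (1 : ℝ)) y := fun y hy => by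
    rw [finrank_plane]
    by_cases h : y < r
    · simp only [g, indicator_of_mem (mem_Iio.2 h), smul_eq_mul]
      rw [show 2 - 1 = 1 by norm_num, pow_one, mul_inv_cancel₀ (ne_of_gt hy)]
    · simp only [g, indicator_of_notMem (fun h' => h (mem_Iio.1 h')), smul_zero]
  have hint : Integrable fun x : Plane => g ‖x‖ := by
    rw [integrable_fun_norm_addHaar (volume : Measure Plane),
      integrableOn_congr_fun hgi measurableSet_Ioi]
    rw [IntegrableOn, integrable_indicator_iff measurableSet_Iio, IntegrableOn,
      Measure.restrict_restrict measurableSet_Iio, Iio_inter_Ioi]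
    exact integrableOn_const (by simp)
  have hval : ∫ x : Plane, g ‖x‖ = κ * r := by
    rw [integral_fun_norm_addHaar (volume : Measure Plane) g,
      setIntegral_congr_fun measurableSet_Ioi hgi, integral_indicator measurableSet_Iio,
      Measure.restrict_restrict measurableSet_Iio, Iio_inter_Ioi, setIntegral_const, finrank_plane]
    simp [κ, hr.le]
    ring
  have hlin : ∫⁻ y : Plane, ENNReal.ofReal (g ‖y - z‖) = ENNReal.ofReal (κ * r) := by
    rw [lintegral_sub_right_eq_self (fun x : Plane => ENNReal.ofReal (g ‖x‖)) z, ← hval,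
      ofReal_integral_eq_lintegral_ofReal hint (Eventually.of_forall fun x => hg0 _ (norm_nonneg _))]
  have hgm : Measurable g := measurable_inv.indicator measurableSet_Iio
  have hpt : ∀ y, φ y * rieszKernel (y - z) ≤
      ENNReal.ofReal r⁻¹ * φ y + ENNReal.ofReal (g ‖y - z‖) * M := fun y => by
    by_cases h : ‖y - z‖ < r
    · have : g ‖y - z‖ = ‖y - z‖⁻¹ := indicator_of_mem (mem_Iio.2 h) _
      rw [this, mul_comm]
      exact le_trans (by gcongr; exacts [le_rfl, hM y]) le_add_self
    · rw [mul_comm]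
      refine le_trans ?_ le_self_add
      gcongr
      rw [rieszKernel]
      exact ENNReal.ofReal_le_ofReal (inv_anti₀ hr (not_lt.1 h))
  calc _ ≤ ∫⁻ y, (ENNReal.ofReal r⁻¹ * φ y + ENNReal.ofReal (g ‖y - z‖) * M) := lintegral_mono hpt
    _ = _ := by
      rw [lintegral_add_left (hφ.const_mul _), lintegral_const_mul _ hφ, lintegral_mul_const, hlin]
      exact (hgm.comp (by fun_prop)).ennreal_ofReal

end Estimates

end

end Vorticity

namespace Vorticity

noncomputable section

/-! ### The linear semigroup as bounded operators -/

section LinearSemigroup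

lemma enorm_integral_mul_le {k f : Plane → ℝ} {k' : Plane → ℝ≥0∞} (hk : ∀ η, ‖k η‖ₑ ≤ k' η) :
    ‖∫ η, k η * f η‖ₑ ≤ ∫⁻ η, k' η * ‖f η‖ₑ := by
  refine (enorm_integral_le_lintegral_enorm _).trans (lintegral_mono fun η => ?_)
  rw [enorm_mul]
  exact mul_le_mul_left (hk η) _

lemma aestronglyMeasurable_integral_kernel {k : Plane → Plane → ℝ}
    (hk : Continuous (Function.uncurry k)) {f : Plane → ℝ} (hf : Measurable f) :
    AEStronglyMeasurable (fun ξ => ∫ η, k ξ η * f η) volume :=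
  (StronglyMeasurable.integral_prod_right (f := fun ξ η => k ξ η * f η)
    (hk.measurable.mul (hf.comp measurable_snd)).stronglyMeasurable).aestronglyMeasurable

lemma continuous_heatKernel_smul (a c : ℝ) :
    Continuous (Function.uncurry fun ξ η : Plane => heatKernel a (ξ - c • η)) :=
  (continuous_heatKernel a).comp (by fun_prop : Continuous fun p : Plane × Plane => p.1 - c • p.2)

lemma integrable_heatKernel_smul_mul {a : ℝ} (ha : 0 < a) (c : ℝ) (ξ : Plane) {f : Plane → ℝ}
    (hf : Integrable f) : Integrable fun η => heatKernel a (ξ - c • η) * f η := by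
  refine hf.bdd_mul (c := (4 * Real.pi * a)⁻¹)
    ((continuous_heatKernel a).comp (by fun_prop)).aestronglyMeasurable
    (Eventually.of_forall fun η => ?_)
  rw [Real.norm_of_nonneg (heatKernel_nonneg ha.le _)]
  exact heatKernel_le ha _

/-- The operators `f ↦ ∫ G_a(ξ - cη) f(η) dη` on `L²(m)`. -/
lemma exists_heatOperator {m : ℝ} (hm : 1 < m) :
    ∃ C, 0 ≤ C ∧ ∀ a ∈ Ioc (0 : ℝ) 2, ∀ c ∈ Ioc (0 : ℝ) 1, ∃ T : L2m m →L[ℝ] L2m m,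
      (∀ f, ∀ᵐ ξ, T f ξ = ∫ η, heatKernel a (ξ - c • η) * f η) ∧ ‖T‖ ≤ C * c⁻¹ := by
  obtain ⟨C, hC, hb⟩ := exists_lintegral_weight_mul_heatKernel_le hm.le
  refine ⟨Real.sqrt C, Real.sqrt_nonneg _, fun a ha c hc => ?_⟩
  have hc0 := hc.1
  refine exists_clm_of_pointwise (by positivity)
    (fun f => aestronglyMeasurable_integral_kernel (continuous_heatKernel_smul a c)
      (measurable_L2m f)) (fun f g => Eventually.of_forall fun ξ => ?_)
    (fun b f => Eventually.of_forall fun ξ => ?_) fun f => ?_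
  · rw [← integral_add (integrable_heatKernel_smul_mul ha.1 c ξ (integrable_L2m hm f))
      (integrable_heatKernel_smul_mul ha.1 c ξ (integrable_L2m hm g))]
    refine integral_congr_ae ?_
    filter_upwards [coeFn_add_L2m f g] with η hη
    rw [hη, mul_add]
  · rw [← integral_const_mul]
    refine integral_congr_ae ?_
    filter_upwards [coeFn_smul_L2m b f] with η hη
    rw [hη]
    ring
  -- Schur's test: the kernel integrates in `η` to `c⁻²`, and in `ξ` against the weight to a
  -- multiple of the weight at `c • η`, which is at most the weight at `η`. The square root gives
  -- the norm bound of order `c⁻¹`.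
  · calc ∫⁻ ξ, ENNReal.ofReal (weight m ξ) * ‖∫ η, heatKernel a (ξ - c • η) * f η‖ₑ ^ 2
        ≤ ∫⁻ ξ, ENNReal.ofReal (weight m ξ) *
          (∫⁻ η, ENNReal.ofReal (heatKernel a (ξ - c • η)) * ‖f η‖ₑ) ^ 2 := by
          refine lintegral_mono fun ξ => ?_
          gcongr
          exact enorm_integral_mul_le fun η =>
            (Real.enorm_of_nonneg (heatKernel_nonneg ha.1.le _)).le
      _ ≤ ENNReal.ofReal (c ^ 2)⁻¹ * (ENNReal.ofReal C *
          ∫⁻ η, ENNReal.ofReal (weight m η) * ‖f η‖ₑ ^ 2) := by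
          refine lintegral_kernel_sq_le (measurable_heatKernel_smul a c) (measurable_L2m f).enorm
            (measurable_weight m) (measurable_weight m)
            (fun ξ => (lintegral_heatKernel_smul ha.1 hc.1 ξ).le) fun η _ => ?_
          refine (hb a ha (c • η)).trans ?_
          gcongr
          exact weight_smul_le (by linarith) hc η
      _ = _ := by
          rw [← enorm_sq_L2m, mul_pow, ← ENNReal.ofReal_pow (by positivity), mul_pow,
            Real.sq_sqrt hC, ← mul_assoc, ← ENNReal.ofReal_mul (by positivity), inv_pow, mul_comm C]

/-- The integral formula of the semigroup after a change of variables. -/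
lemma semigroup_eq {τ : ℝ} (hτ : 0 < τ) (f : Plane → ℝ) (ξ : Plane) :
    semigroup τ f ξ =
      ∫ η, heatKernel (1 - Real.exp (-τ)) (ξ - Real.exp (-τ / 2) • η) * f η := by
  have h := Measure.integral_comp_smul (volume : Measure Plane)
    (fun η => heatKernel (1 - Real.exp (-τ)) (ξ - Real.exp (-τ / 2) • η) * f η) (Real.exp (τ / 2))
  have h1 : ∀ x : Plane, Real.exp (-τ / 2) • Real.exp (τ / 2) • x = x := fun x => by
    rw [smul_smul, ← Real.exp_add, show -τ / 2 + τ / 2 = 0 by ring, Real.exp_zero, one_smul]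
  simp only [h1] at h
  rw [finrank_plane, abs_of_pos (by positivity), ← Real.exp_nat_mul, Nat.cast_ofNat,
    show 2 * (τ / 2) = τ by ring, smul_eq_mul, eq_inv_mul_iff_mul_eq₀ (Real.exp_pos τ).ne'] at h
  rw [← h, semigroup, if_neg hτ.ne', ← integral_const_mul, ← integral_const_mul]
  refine integral_congr_ae (Eventually.of_forall fun x => ?_)
  simp only [heatKernel]
  ring

lemma one_sub_exp_pos {τ : ℝ} (hτ : 0 < τ) : 0 < 1 - Real.exp (-τ) := by
  simpa using hτ

lemma one_sub_exp_mem {τ : ℝ} (hτ : 0 < τ) : 1 - Real.exp (-τ) ∈ Ioc (0 : ℝ) 1 :=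
  ⟨one_sub_exp_pos hτ, by linarith [Real.exp_pos (-τ)]⟩

lemma exp_half_mem {τ : ℝ} (hτ : 0 ≤ τ) : Real.exp (-τ / 2) ∈ Ioc (0 : ℝ) 1 :=
  ⟨Real.exp_pos _, Real.exp_le_one_iff.2 (by linarith)⟩

lemma exp_half_sq (τ : ℝ) : Real.exp (-τ / 2) ^ 2 = Real.exp (-τ) := by
  rw [← Real.exp_nat_mul]
  congr 1
  push_cast
  ring

/-- The semigroup `e^{τL}` as a family of bounded operators on `L²(m)`. -/
structure IsHeatSemigroup {m : ℝ} (S : ℝ → L2m m →L[ℝ] L2m m) (C : ℝ) : Prop where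
  zero : ∀ f, S 0 f = f
  apply : ∀ τ, 0 < τ → ∀ f, ∀ᵐ ξ, S τ f ξ =
    ∫ η, heatKernel (1 - Real.exp (-τ)) (ξ - Real.exp (-τ / 2) • η) * f η
  norm_le : ∀ τ, 0 ≤ τ → ‖S τ‖ ≤ C * Real.exp (τ / 2)

lemma exists_isHeatSemigroup {m : ℝ} (hm : 1 < m) :
    ∃ (S : ℝ → L2m m →L[ℝ] L2m m) (C : ℝ), 0 ≤ C ∧ IsHeatSemigroup S C := by
  obtain ⟨C, hC, hT⟩ := exists_heatOperator hm
  have h : ∀ τ : ℝ, ∃ T : L2m m →L[ℝ] L2m m, (τ = 0 → ∀ f, T f = f) ∧ (0 < τ → ∀ f, ∀ᵐ ξ, T f ξ =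
      ∫ η, heatKernel (1 - Real.exp (-τ)) (ξ - Real.exp (-τ / 2) • η) * f η) ∧
      (0 ≤ τ → ‖T‖ ≤ (C + 1) * Real.exp (τ / 2)) := fun τ => by
    rcases lt_trichotomy τ 0 with hτ | rfl | hτ
    -- Negative times carry the zero operator as a default value.
    · exact ⟨0, fun h => by linarith, fun h => by linarith, fun h => by linarith⟩
    · refine ⟨ContinuousLinearMap.id ℝ _, fun _ _ => rfl, fun h => by linarith, fun _ => ?_⟩
      refine ContinuousLinearMap.norm_id_le.trans ?_
      simp [hC]
    · obtain ⟨T, h1, h2⟩ := hT _ ⟨one_sub_exp_pos hτ, by linarith [(one_sub_exp_mem hτ).2]⟩ _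
        (exp_half_mem hτ.le)
      refine ⟨T, fun h => by linarith, fun _ => h1, fun _ => h2.trans ?_⟩
      rw [← Real.exp_neg, show -(-τ / 2) = τ / 2 by ring]
      gcongr
      linarith
  choose S hS using h
  exact ⟨S, C + 1, by positivity, fun f => (hS 0).1 rfl f, fun τ hτ => (hS τ).2.1 hτ,
    fun τ hτ => (hS τ).2.2 hτ⟩

/-- Composition of the heat operators with another convolution operator. -/
lemma integral_heatKernel_comp {A a c c' D : ℝ} (hA : 0 < A) (ha : 0 < a) {φ : Plane → ℝ}
    (hφ : Continuous φ) (hφD : ∀ x, |φ x| ≤ D * heatKernel a x) {h : Plane → ℝ} (hh : Integrable h)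
    (ξ : Plane) :
    ∫ z, heatKernel A (ξ - c • z) * ∫ η, φ (z - c' • η) * h η =
      ∫ η, (∫ z, heatKernel A (ξ - c • z) * φ (z - c' • η)) * h η := by
  have hmaj : Integrable (fun p : Plane × Plane =>
      heatKernel A (ξ - c • p.1) * heatKernel a (p.1 - c' • p.2) * ‖h p.2‖) (volume.prod volume) := by
    have hmeas : AEStronglyMeasurable (fun p : Plane × Plane =>
        heatKernel A (ξ - c • p.1) * heatKernel a (p.1 - c' • p.2) * ‖h p.2‖)
        (volume.prod volume) := by
      refine AEStronglyMeasurable.mul (Continuous.aestronglyMeasurable ?_)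
        hh.aestronglyMeasurable.norm.comp_snd
      exact ((continuous_heatKernel A).comp (by fun_prop)).mul
        ((continuous_heatKernel a).comp (by fun_prop))
    rw [integrable_prod_iff' hmeas]
    refine ⟨Eventually.of_forall fun η => ?_, ?_⟩
    · exact (integrable_heatKernel_mul hA ha c ξ (c' • η)).mul_const ‖h η‖
    · have : ∀ η, ∫ z, ‖heatKernel A (ξ - c • z) * heatKernel a (z - c' • η) * ‖h η‖‖ =
          heatKernel (A + c ^ 2 * a) (ξ - (c * c') • η) * ‖h η‖ := fun η => by
        rw [← smul_smul, ← integral_heatKernel_mul hA ha, ← integral_mul_const]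
        refine integral_congr_ae (Eventually.of_forall fun z => ?_)
        have h1 := heatKernel_nonneg hA.le (ξ - c • z)
        have h2 := heatKernel_nonneg ha.le (z - c' • η)
        exact Real.norm_of_nonneg (by positivity)
      simp only [this]
      exact integrable_heatKernel_smul_mul (by positivity) _ ξ hh.norm
  have hint : Integrable (Function.uncurry fun z η =>
      heatKernel A (ξ - c • z) * (φ (z - c' • η) * h η)) (volume.prod volume) := by
    refine (hmaj.const_mul D).mono' ?_ (Eventually.of_forall fun p => ?_)
    · refine AEStronglyMeasurable.mul (Continuous.aestronglyMeasurable ?_)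
        (AEStronglyMeasurable.mul (Continuous.aestronglyMeasurable ?_)
          hh.aestronglyMeasurable.comp_snd)
      · exact (continuous_heatKernel A).comp (by fun_prop)
      · exact hφ.comp (by fun_prop)
    · have h1 := heatKernel_nonneg hA.le (ξ - c • p.1)
      simp only [Function.uncurry, norm_mul, Real.norm_of_nonneg h1, Real.norm_eq_abs]
      calc _ ≤ heatKernel A (ξ - c • p.1) * (D * heatKernel a (p.1 - c' • p.2) * |h p.2|) := by
            gcongr
            exact hφD _
        _ = _ := by ring
  calc _ = ∫ z, ∫ η, heatKernel A (ξ - c • z) * (φ (z - c' • η) * h η) := by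
        refine integral_congr_ae (Eventually.of_forall fun z => ?_)
        exact (integral_const_mul _ _).symm
    _ = ∫ η, ∫ z, heatKernel A (ξ - c • z) * (φ (z - c' • η) * h η) := integral_integral_swap hint
    _ = _ := by
        refine integral_congr_ae (Eventually.of_forall fun η => ?_)
        simp only [← integral_mul_const, mul_assoc]

lemma one_sub_exp_add (s t : ℝ) : 1 - Real.exp (-s) + Real.exp (-s / 2) ^ 2 * (1 - Real.exp (-t)) =
    1 - Real.exp (-(s + t)) := by
  rw [exp_half_sq, neg_add, Real.exp_add]
  ring

lemma exp_half_add (s t : ℝ) :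
    Real.exp (-s / 2) * Real.exp (-t / 2) = Real.exp (-(s + t) / 2) := by
  rw [← Real.exp_add]
  congr 1
  ring

namespace IsHeatSemigroup

variable {m : ℝ} {S : ℝ → L2m m →L[ℝ] L2m m} {C : ℝ}

/-- Gaussians compose: with `a(τ) = 1 - e^{-τ}` and `c(τ) = e^{-τ/2}` one has `a(s) + c(s)² a(t) =
a(s + t)`, and the dilations multiply. -/
lemma add (h : IsHeatSemigroup S C) (hm : 1 < m) {s t : ℝ} (hs : 0 ≤ s) (ht : 0 ≤ t) (f : L2m m) :
    S (s + t) f = S s (S t f) := by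
  rcases hs.eq_or_lt with rfl | hs
  · rw [zero_add, h.zero]
  rcases ht.eq_or_lt with rfl | ht
  · rw [add_zero, h.zero]
  refine ext_L2m ?_
  filter_upwards [h.apply (s + t) (by positivity) f, h.apply s hs (S t f)] with ξ h1 h2
  rw [h1, h2]
  have h3 : ∫ z, heatKernel (1 - Real.exp (-s)) (ξ - Real.exp (-s / 2) • z) * S t f z =
      ∫ z, heatKernel (1 - Real.exp (-s)) (ξ - Real.exp (-s / 2) • z) *
        ∫ η, heatKernel (1 - Real.exp (-t)) (z - Real.exp (-t / 2) • η) * f η := by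
    refine integral_congr_ae ?_
    filter_upwards [h.apply t ht f] with z hz
    rw [hz]
  rw [h3, integral_heatKernel_comp (D := 1) (one_sub_exp_pos hs) (one_sub_exp_pos ht)
    (continuous_heatKernel _) (fun x => by
      rw [one_mul, abs_of_nonneg (heatKernel_nonneg (one_sub_exp_pos ht).le x)])
    (integrable_L2m hm f)]
  refine integral_congr_ae (Eventually.of_forall fun η => ?_)
  simp only
  rw [integral_heatKernel_mul (one_sub_exp_pos hs) (one_sub_exp_pos ht), one_sub_exp_add, smul_smul,
    exp_half_add]

end IsHeatSemigroup

end LinearSemigroup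

end

end Vorticity

namespace Vorticity

noncomputable section

/-! ### Strong continuity of the linear semigroup -/

section StrongContinuity

lemma isLocallyFinite_weightedMeasure (m : ℝ) : IsLocallyFiniteMeasure (weightedMeasure m) :=
  IsLocallyFiniteMeasure.withDensity_ofReal (continuous_weight m)

lemma exists_compactSupport_approx {m : ℝ} (f : L2m m) {ε : ℝ} (hε : 0 < ε) :
    ∃ (g : Plane → ℝ) (hg : MemLp g 2 (weightedMeasure m)), Continuous g ∧ HasCompactSupport g ∧
      ‖f - hg.toLp g‖ ≤ ε := by
  have := isLocallyFinite_weightedMeasure m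
  obtain ⟨g, h1, h2, h3, h4⟩ := (Lp.memLp f).exists_hasCompactSupport_eLpNorm_sub_le
    (by norm_num) (ENNReal.ofReal_pos.2 hε).ne'
  refine ⟨g, h4, h3, h1, ?_⟩
  rw [Lp.norm_def]
  refine ENNReal.toReal_le_of_le_ofReal hε.le (le_trans (le_of_eq (eLpNorm_congr_ae ?_)) h2)
  filter_upwards [Lp.coeFn_sub f (h4.toLp g), h4.coeFn_toLp] with ξ hξ hξ'
  rw [hξ, Pi.sub_apply, Pi.sub_apply, hξ']

/-- The Gaussian at time `1` is invariant under the semigroup, so this domination yields a majorant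
for the whole orbit, uniform in `τ`. -/
lemma abs_le_mul_heatKernel {g : Plane → ℝ} (hg : Continuous g) (hgc : HasCompactSupport g) :
    ∃ D, 0 ≤ D ∧ ∀ x, |g x| ≤ D * heatKernel 1 x := by
  have h1 : HasCompactSupport fun x => (heatKernel 1 x)⁻¹ * g x := hgc.mul_left
  obtain ⟨D, hD⟩ := h1.exists_bound_of_continuous
    (((continuous_heatKernel 1).inv₀ fun x => (heatKernel_pos one_pos x).ne').mul hg)
  refine ⟨D, (norm_nonneg _).trans (hD 0), fun x => ?_⟩
  have h2 := hD x
  have h3 := heatKernel_pos one_pos x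
  rw [norm_mul, norm_inv, Real.norm_of_nonneg h3.le, inv_mul_le_iff₀ h3, Real.norm_eq_abs] at h2
  linarith

lemma heatKernel_scale {a : ℝ} (ha : 0 < a) (u : Plane) :
    a * heatKernel a (Real.sqrt a • u) = heatKernel 1 u := by
  have hpi := Real.pi_pos
  rw [heatKernel, heatKernel, norm_smul, Real.norm_of_nonneg (Real.sqrt_nonneg a), mul_pow,
    Real.sq_sqrt ha.le]
  have : -(a * ‖u‖ ^ 2) / (4 * a) = -‖u‖ ^ 2 / (4 * 1) := by field_simp
  rw [this]
  field_simp

/-- The substitution `η = c⁻¹ (ξ + √a u)` freezes the kernel and moves the dependence on `a` and `c`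
into the argument of `g`. -/
lemma integral_heatKernel_rescale {a c : ℝ} (ha : 0 < a) (hc : 0 < c) (g : Plane → ℝ) (ξ : Plane) :
    ∫ η, heatKernel a (ξ - c • η) * g η =
      (c ^ 2)⁻¹ * ∫ u, heatKernel 1 u * g (c⁻¹ • (ξ + Real.sqrt a • u)) := by
  have hsa : 0 < Real.sqrt a := Real.sqrt_pos.2 ha
  have h := Measure.integral_comp_smul (volume : Measure Plane)
    (fun x => heatKernel a (ξ - c • (c⁻¹ • ξ + x)) * g (c⁻¹ • ξ + x)) (c⁻¹ * Real.sqrt a)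
  rw [integral_add_left_eq_self (fun x => heatKernel a (ξ - c • x) * g x) (c⁻¹ • ξ), finrank_plane,
    abs_of_pos (by positivity), mul_pow, Real.sq_sqrt ha.le, smul_eq_mul] at h
  have h1 : ∀ u : Plane, heatKernel a (ξ - c • (c⁻¹ • ξ + (c⁻¹ * Real.sqrt a) • u)) *
      g (c⁻¹ • ξ + (c⁻¹ * Real.sqrt a) • u) =
      a⁻¹ * (heatKernel 1 u * g (c⁻¹ • (ξ + Real.sqrt a • u))) := fun u => by
    rw [mul_smul c⁻¹, ← smul_add, smul_inv_smul₀ hc.ne', sub_add_cancel_left, heatKernel_neg,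
      ← heatKernel_scale ha]
    field_simp
  simp only [h1, integral_const_mul] at h
  have h2 : ∫ η, heatKernel a (ξ - c • η) * g η =
      ((c⁻¹) ^ 2 * a) * (((c⁻¹) ^ 2 * a)⁻¹ * ∫ η, heatKernel a (ξ - c • η) * g η) := by
    field_simp
  rw [h2, ← h]
  field_simp

lemma tendsto_heatKernel_integral {g : Plane → ℝ} (hg : Continuous g) {D : ℝ}
    (hD : ∀ x, |g x| ≤ D) (ξ : Plane) :
    Tendsto (fun τ : ℝ => ∫ η, heatKernel (1 - Real.exp (-τ)) (ξ - Real.exp (-τ / 2) • η) * g η)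
      (𝓝[>] 0) (𝓝 (g ξ)) := by
  have h1 : Tendsto (fun τ : ℝ => (Real.exp (-τ / 2) ^ 2)⁻¹ * ∫ u, heatKernel 1 u *
      g ((Real.exp (-τ / 2))⁻¹ • (ξ + Real.sqrt (1 - Real.exp (-τ)) • u))) (𝓝[>] 0)
      (𝓝 (1 * ∫ u, heatKernel 1 u * g ξ)) := by
    have hcont : ∀ u : Plane, Continuous fun τ : ℝ => heatKernel 1 u *
        g ((Real.exp (-τ / 2))⁻¹ • (ξ + Real.sqrt (1 - Real.exp (-τ)) • u)) := fun u => by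
      have hinv : Continuous fun τ : ℝ => (Real.exp (-τ / 2))⁻¹ :=
        (by fun_prop : Continuous fun τ : ℝ => Real.exp (-τ / 2)).inv₀ fun τ => (Real.exp_pos _).ne'
      exact continuous_const.mul (hg.comp (hinv.smul (by fun_prop)))
    refine Tendsto.mul ?_ ?_
    · have : Continuous fun τ : ℝ => (Real.exp (-τ / 2) ^ 2)⁻¹ :=
        (by fun_prop : Continuous fun τ : ℝ => Real.exp (-τ / 2) ^ 2).inv₀ fun τ => by positivity
      have h2 := this.tendsto 0
      simp only [neg_zero, zero_div, Real.exp_zero, one_pow, inv_one] at h2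
      exact h2.mono_left nhdsWithin_le_nhds
    · refine tendsto_integral_filter_of_dominated_convergence (fun u => heatKernel 1 u * D)
        (Eventually.of_forall fun τ => ?_) (Eventually.of_forall fun τ =>
          Eventually.of_forall fun u => ?_) ((integrable_heatKernel one_pos).mul_const D)
        (Eventually.of_forall fun u => ?_)
      · exact ((continuous_heatKernel 1).mul (hg.comp (by fun_prop))).aestronglyMeasurable
      · have h3 := heatKernel_nonneg one_pos.le u
        rw [norm_mul, Real.norm_of_nonneg h3]
        gcongr
        exact hD _
      · have h2 := (hcont u).tendsto 0
        simp only [neg_zero, zero_div, Real.exp_zero, inv_one, sub_self, Real.sqrt_zero, zero_smul,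
          add_zero, one_smul] at h2
        exact h2.mono_left nhdsWithin_le_nhds
  rw [integral_mul_const, integral_heatKernel one_pos, one_mul, one_mul] at h1
  refine h1.congr' ?_
  filter_upwards [self_mem_nhdsWithin] with τ hτ
  exact (integral_heatKernel_rescale (one_sub_exp_pos hτ) (Real.exp_pos _) g ξ).symm

lemma lintegral_weight_heatKernel_sq_ne_top {m : ℝ} (hm : 1 ≤ m) :
    ∫⁻ ξ, ENNReal.ofReal (weight m ξ) * ENNReal.ofReal (heatKernel 1 ξ) ^ 2 ≠ ⊤ := by
  obtain ⟨C, hC, hb⟩ := exists_lintegral_weight_mul_heatKernel_le hm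
  have h1 := hb 1 ⟨one_pos, by norm_num⟩ 0
  simp only [sub_zero] at h1
  refine ne_top_of_le_ne_top ?_ (b := ENNReal.ofReal (4 * Real.pi * 1)⁻¹ *
    ∫⁻ ξ, ENNReal.ofReal (weight m ξ) * ENNReal.ofReal (heatKernel 1 ξ)) ?_
  · exact ENNReal.mul_ne_top ENNReal.ofReal_ne_top (ne_top_of_le_ne_top
      (ENNReal.mul_ne_top ENNReal.ofReal_ne_top ENNReal.ofReal_ne_top) h1)
  · rw [← lintegral_const_mul' _ _ ENNReal.ofReal_ne_top]
    refine lintegral_mono fun ξ => ?_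
    rw [sq, mul_left_comm]
    gcongr
    exact heatKernel_le one_pos ξ

namespace IsHeatSemigroup

variable {m : ℝ} {S : ℝ → L2m m →L[ℝ] L2m m} {C : ℝ}

lemma tendsto_of_compactSupport (h : IsHeatSemigroup S C) (hm : 1 < m) {g : Plane → ℝ}
    (hg : MemLp g 2 (weightedMeasure m)) (hgc : Continuous g) (hgs : HasCompactSupport g) :
    Tendsto (fun τ => S τ (hg.toLp g)) (𝓝[>] 0) (𝓝 (hg.toLp g)) := by
  obtain ⟨D, hD0, hD⟩ := abs_le_mul_heatKernel hgc hgs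
  have hgb : ∀ x, |g x| ≤ D * (4 * Real.pi * 1)⁻¹ := fun x =>
    (hD x).trans (by gcongr; exact heatKernel_le one_pos x)
  have hgt := coeFn_toLp_L2m hg
  have hgi : Integrable g := (integrable_congr hgt).1 (integrable_L2m hm _)
  set U : ℝ → Plane → ℝ := fun τ ξ =>
    ∫ η, heatKernel (1 - Real.exp (-τ)) (ξ - Real.exp (-τ / 2) • η) * g η
  have hU : ∀ τ, 0 < τ → ∀ᵐ ξ, (S τ (hg.toLp g) - hg.toLp g : L2m m) ξ = U τ ξ - g ξ := by
    intro τ hτ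
    filter_upwards [h.apply τ hτ (hg.toLp g), hgt,
      coeFn_sub_L2m (S τ (hg.toLp g)) (hg.toLp g)] with ξ h1 h2 h3
    rw [h3, h1, h2]
    congr 1
    refine integral_congr_ae ?_
    filter_upwards [hgt] with η hη
    rw [hη]
  -- Invariance of the Gaussian at time `1`: the times combine to `(1 - e^{-τ}) + e^{-τ} = 1`.
  have hUb : ∀ τ, 0 < τ → ∀ ξ, |U τ ξ| ≤ D * heatKernel 1 ξ := by
    intro τ hτ ξ
    have hA := one_sub_exp_pos hτ
    have h1 := integral_heatKernel_mul hA one_pos (Real.exp (-τ / 2)) ξ 0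
    rw [exp_half_sq, mul_one, sub_add_cancel, smul_zero, sub_zero] at h1
    rw [← h1, ← integral_const_mul, ← Real.norm_eq_abs]
    refine norm_integral_le_of_norm_le
      ((integrable_heatKernel_mul hA one_pos _ ξ 0).const_mul D) (Eventually.of_forall fun η => ?_)
    have h2 := heatKernel_nonneg hA.le (ξ - Real.exp (-τ / 2) • η)
    rw [norm_mul, Real.norm_of_nonneg h2, Real.norm_eq_abs, sub_zero, mul_left_comm]
    gcongr
    exact hD η
  rw [tendsto_iff_norm_sub_tendsto_zero]
  have hlim : Tendsto (fun τ => ∫⁻ ξ, ENNReal.ofReal (weight m ξ) * ‖U τ ξ - g ξ‖ₑ ^ 2) (𝓝[>] 0)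
      (𝓝 (∫⁻ _ : Plane, (0 : ℝ≥0∞))) := by
    refine tendsto_lintegral_filter_of_dominated_convergence
      (fun ξ => ENNReal.ofReal (2 * D) ^ 2 *
        (ENNReal.ofReal (weight m ξ) * ENNReal.ofReal (heatKernel 1 ξ) ^ 2))
      (Eventually.of_forall fun τ => ?_) ?_ ?_ (Eventually.of_forall fun ξ => ?_)
    · have hUm : Measurable (U τ) :=
        (StronglyMeasurable.integral_prod_right (f := fun ξ η =>
          heatKernel (1 - Real.exp (-τ)) (ξ - Real.exp (-τ / 2) • η) * g η)
          ((continuous_heatKernel_smul _ _).mul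
            (hgc.comp continuous_snd)).stronglyMeasurable).measurable
      exact (measurable_weight m).mul ((hUm.sub hgc.measurable).enorm.pow_const 2)
    · filter_upwards [self_mem_nhdsWithin] with τ hτ
      refine Eventually.of_forall fun ξ => ?_
      have h3 : ‖U τ ξ - g ξ‖ₑ ≤ ENNReal.ofReal (2 * D) * ENNReal.ofReal (heatKernel 1 ξ) := by
        rw [← ENNReal.ofReal_mul (by positivity), ← ofReal_norm]
        refine ENNReal.ofReal_le_ofReal ((norm_sub_le _ _).trans ?_)
        have := add_le_add (hUb τ hτ ξ) (hD ξ)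
        rw [Real.norm_eq_abs, Real.norm_eq_abs]
        linarith
      calc _ ≤ ENNReal.ofReal (weight m ξ) *
            (ENNReal.ofReal (2 * D) * ENNReal.ofReal (heatKernel 1 ξ)) ^ 2 := by gcongr
        _ = _ := by ring
    · rw [lintegral_const_mul' _ _ (by finiteness)]
      exact ENNReal.mul_ne_top (by finiteness) (lintegral_weight_heatKernel_sq_ne_top hm.le)
    · have h4 : Tendsto (fun τ => U τ ξ - g ξ) (𝓝[>] 0) (𝓝 (g ξ - g ξ)) :=
        (tendsto_heatKernel_integral hgc hgb ξ).sub_const _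
      rw [sub_self] at h4
      have h5 : Tendsto (fun τ => ‖U τ ξ - g ξ‖ₑ ^ 2) (𝓝[>] 0) (𝓝 (‖(0 : ℝ)‖ₑ ^ 2)) :=
        ((ENNReal.continuous_pow 2).tendsto _).comp ((continuous_enorm.tendsto _).comp h4)
      have h6 := ENNReal.Tendsto.const_mul (a := ENNReal.ofReal (weight m ξ)) h5
        (Or.inr ENNReal.ofReal_ne_top)
      simpa using h6
  rw [lintegral_zero] at hlim
  have hsq : Tendsto (fun τ => ‖S τ (hg.toLp g) - hg.toLp g‖ₑ ^ 2) (𝓝[>] 0) (𝓝 0) := by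
    refine hlim.congr' ?_
    filter_upwards [self_mem_nhdsWithin] with τ hτ
    rw [enorm_sq_L2m]
    refine lintegral_congr_ae ?_
    filter_upwards [hU τ hτ] with ξ hξ
    rw [hξ]
  have hsq' : Tendsto (fun τ => ‖S τ (hg.toLp g) - hg.toLp g‖ ^ 2) (𝓝[>] 0) (𝓝 0) := by
    have := (ENNReal.tendsto_toReal ENNReal.zero_ne_top).comp hsq
    simpa [Function.comp_def] using this
  have := hsq'.sqrt
  simpa [Real.sqrt_sq] using this

/-- Compactly supported continuous functions are dense, and `‖S τ‖` is bounded near `τ = 0`. -/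
lemma tendsto_zero (h : IsHeatSemigroup S C) (hm : 1 < m) (f : L2m m) :
    Tendsto (fun τ => S τ f) (𝓝[≥] 0) (𝓝 f) := by
  have hC : 0 ≤ C := by
    have := (norm_nonneg _).trans (h.norm_le 0 le_rfl)
    simpa using this
  have key : ContinuousWithinAt (fun τ => S τ f) (Ioi 0) 0 := by
    rw [ContinuousWithinAt, h.zero, Metric.tendsto_nhds]
    intro ε hε
    set M := C * Real.exp (1 / 2)
    have hM : 0 ≤ M := by positivity
    obtain ⟨g, hg, hgc, hgs, hgf⟩ := exists_compactSupport_approx f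
      (ε := ε / (2 * (M + 2))) (by positivity)
    have h1 := (Metric.tendsto_nhds.1 (h.tendsto_of_compactSupport hm hg hgc hgs)) (ε / 2)
      (by positivity)
    have hlt : ∀ᶠ τ : ℝ in 𝓝[>] 0, τ < 1 := nhdsWithin_le_nhds (gt_mem_nhds one_pos)
    filter_upwards [h1, hlt, self_mem_nhdsWithin] with τ h2 h3 h4
    have h4' : (0 : ℝ) < τ := h4
    rw [dist_eq_norm] at h2 ⊢
    have e : S τ f - f = S τ (f - hg.toLp g) + (S τ (hg.toLp g) - hg.toLp g) - (f - hg.toLp g) := by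
      rw [map_sub]; abel
    have hSM : ‖S τ‖ ≤ M := (h.norm_le τ h4'.le).trans
      (mul_le_mul_of_nonneg_left (Real.exp_le_exp.2 (by linarith)) hC)
    have h5 := (S τ).le_of_opNorm_le hSM (f - hg.toLp g)
    have h6 : ‖S τ f - f‖ ≤ M * ‖f - hg.toLp g‖ + ‖S τ (hg.toLp g) - hg.toLp g‖ +
        ‖f - hg.toLp g‖ := by
      rw [e]
      exact (norm_sub_le _ _).trans (add_le_add_left ((norm_add_le _ _).trans
        (add_le_add_left h5 _)) _)
    have h7 : (M + 1) * ‖f - hg.toLp g‖ ≤ (M + 1) * (ε / (2 * (M + 2))) := by gcongr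
    have h8 : (M + 1) * (ε / (2 * (M + 2))) < ε / 2 := by
      rw [mul_div_assoc', div_lt_div_iff₀ (by positivity) (by positivity)]
      nlinarith
    linarith
  have h2 := (continuousWithinAt_insert_self.2 key).tendsto
  rwa [Ioi_insert, h.zero] at h2

lemma continuousOn (h : IsHeatSemigroup S C) (hm : 1 < m) (f : L2m m) :
    ContinuousOn (fun τ => S τ f) (Ici 0) := by
  have hC : 0 ≤ C := by
    have := (norm_nonneg _).trans (h.norm_le 0 le_rfl)
    simpa using this
  intro t₀ ht₀
  have ht0 : 0 ≤ t₀ := ht₀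
  rw [ContinuousWithinAt, tendsto_iff_norm_sub_tendsto_zero]
  set M := C * Real.exp ((t₀ + 1) / 2)
  have h1 : Tendsto (fun t : ℝ => M * ‖S |t - t₀| f - f‖) (𝓝[Ici 0] t₀) (𝓝 0) := by
    have h2 : Tendsto (fun t : ℝ => |t - t₀|) (𝓝[Ici 0] t₀) (𝓝[≥] 0) := by
      refine tendsto_nhdsWithin_iff.2 ⟨?_, Eventually.of_forall fun t => mem_Ici.2 (abs_nonneg _)⟩
      have : Continuous fun t : ℝ => |t - t₀| := by fun_prop
      have h3 := this.tendsto t₀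
      rw [sub_self, abs_zero] at h3
      exact h3.mono_left nhdsWithin_le_nhds
    have h3 := (tendsto_iff_norm_sub_tendsto_zero.1 ((h.tendsto_zero hm f).comp h2)).const_mul M
    simpa using h3
  refine squeeze_zero' (Eventually.of_forall fun _ => norm_nonneg _) ?_ h1
  have hlt : ∀ᶠ t in 𝓝[Ici 0] t₀, t < t₀ + 1 := nhdsWithin_le_nhds (gt_mem_nhds (lt_add_one t₀))
  have hM : ∀ t, 0 ≤ t → t ≤ t₀ + 1 → ‖S t‖ ≤ M := fun t ht0' ht => (h.norm_le t ht0').trans (by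
    simp only [M]
    gcongr)
  filter_upwards [hlt, self_mem_nhdsWithin] with t ht ht'
  have ht'0 : 0 ≤ t := ht'
  -- On either side of `t₀` the earlier time is factored out, so the difference is an increment at
  -- time `|t - t₀|` from the start followed by a bounded operator.
  rcases le_total t₀ t with hle | hle
  · have e : S t f - S t₀ f = S t₀ (S (t - t₀) f - f) := by
      rw [map_sub, ← h.add hm ht0 (sub_nonneg.2 hle), add_sub_cancel]
    rw [e, abs_of_nonneg (sub_nonneg.2 hle)]
    exact (S t₀).le_of_opNorm_le (hM _ ht0 (by linarith)) _
  · have e : S t f - S t₀ f = -S t (S (t₀ - t) f - f) := by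
      rw [map_sub, ← h.add hm ht'0 (sub_nonneg.2 hle), add_sub_cancel]
      abel
    rw [e, norm_neg, abs_sub_comm, abs_of_nonneg (sub_nonneg.2 hle)]
    exact (S t).le_of_opNorm_le (hM _ ht'0 (by linarith)) _

end IsHeatSemigroup

end StrongContinuity

end

end Vorticity

namespace Vorticity

noncomputable section

/-! ### The Biot–Savart velocity and the Riesz potential -/

section Velocity

lemma perp_apply_zero (x : Plane) : perp x 0 = -x 1 := rfl

lemma perp_apply_one (x : Plane) : perp x 1 = x 0 := rfl

lemma norm_perp (x : Plane) : ‖perp x‖ = ‖x‖ := by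
  rw [← sq_eq_sq₀ (norm_nonneg _) (norm_nonneg _), norm_sq_plane, norm_sq_plane, perp_apply_zero,
    perp_apply_one]
  ring

lemma continuous_perp : Continuous perp := by
  refine (PiLp.continuous_toLp 2 _).comp (continuous_pi fun i => ?_)
  fin_cases i
  · exact (by fun_prop : Continuous fun x : Plane => -x 1)
  · exact (by fun_prop : Continuous fun x : Plane => x 0)

/-- The Riesz potential of order one of `|w|`. -/
def rieszPotential (w : Plane → ℝ) (ξ : Plane) : ℝ≥0∞ := ∫⁻ η, rieszKernel (ξ - η) * ‖w η‖ₑ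

lemma rieszKernel_sub_comm (x y : Plane) : rieszKernel (x - y) = rieszKernel (y - x) := by
  rw [rieszKernel, rieszKernel, norm_sub_rev]

lemma enorm_biotSavart_integrand (w : Plane → ℝ) (ξ η : Plane) :
    ‖(w η / ‖ξ - η‖ ^ 2) • perp (ξ - η)‖ₑ = rieszKernel (ξ - η) * ‖w η‖ₑ := by
  rw [rieszKernel, ← ofReal_norm, ← ofReal_norm, norm_smul, norm_perp, norm_div, norm_pow, norm_norm,
    ← ENNReal.ofReal_mul (by positivity)]
  congr 1
  rcases eq_or_ne ‖ξ - η‖ 0 with h | h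
  · simp [h]
  · field_simp

lemma enorm_biotSavart_le (w : Plane → ℝ) (ξ : Plane) : ‖biotSavart w ξ‖ₑ ≤ rieszPotential w ξ := by
  rw [biotSavart, enorm_smul]
  have h1 : ‖(2 * Real.pi)⁻¹‖ₑ ≤ 1 := by
    have hpi := Real.pi_gt_three
    rw [Real.enorm_of_nonneg (by positivity), ← ENNReal.ofReal_one]
    exact ENNReal.ofReal_le_ofReal (inv_le_one_of_one_le₀ (by linarith))
  calc _ ≤ 1 * ∫⁻ η, ‖(w η / ‖ξ - η‖ ^ 2) • perp (ξ - η)‖ₑ := by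
        gcongr
        exact enorm_integral_le_lintegral_enorm _
    _ = _ := by
        rw [one_mul]
        exact lintegral_congr fun η => enorm_biotSavart_integrand w ξ η

lemma enorm_biotSavart_apply_le (w : Plane → ℝ) (ξ : Plane) (i : Fin 2) :
    ‖biotSavart w ξ i‖ₑ ≤ rieszPotential w ξ := by
  refine le_trans ?_ (enorm_biotSavart_le w ξ)
  rw [← ofReal_norm, ← ofReal_norm]
  exact ENNReal.ofReal_le_ofReal (PiLp.norm_apply_le _ i)

lemma measurable_biotSavart_integrand {w : Plane → ℝ} (hw : Measurable w) :
    Measurable (Function.uncurry fun ξ η : Plane => (w η / ‖ξ - η‖ ^ 2) • perp (ξ - η)) := by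
  have h1 : Measurable fun p : Plane × Plane => w p.2 / ‖p.1 - p.2‖ ^ 2 :=
    (hw.comp measurable_snd).div (by fun_prop)
  have h2 : Measurable fun p : Plane × Plane => perp (p.1 - p.2) :=
    continuous_perp.measurable.comp (measurable_fst.sub measurable_snd)
  exact h1.smul h2

lemma measurable_biotSavart {w : Plane → ℝ} (hw : Measurable w) : Measurable (biotSavart w) := by
  have h := StronglyMeasurable.integral_prod_right (ν := volume)
    (f := fun ξ η : Plane => (w η / ‖ξ - η‖ ^ 2) • perp (ξ - η))
    (measurable_biotSavart_integrand hw).stronglyMeasurable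
  exact (h.const_smul (2 * Real.pi)⁻¹).measurable

lemma measurable_rieszPotential {w : Plane → ℝ} (hw : Measurable w) :
    Measurable (rieszPotential w) := by
  refine Measurable.lintegral_prod_right'
    (f := fun p : Plane × Plane => rieszKernel (p.1 - p.2) * ‖w p.2‖ₑ) ?_
  exact (measurable_rieszKernel.comp (by fun_prop)).mul (hw.comp measurable_snd).enorm

lemma biotSavart_smul (c : ℝ) {w w' : Plane → ℝ} (h : ∀ᵐ η, w' η = c * w η) (ξ : Plane) :
    biotSavart w' ξ = c • biotSavart w ξ := by
  have h1 : ∫ η, (w' η / ‖ξ - η‖ ^ 2) • perp (ξ - η) =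
      c • ∫ η, (w η / ‖ξ - η‖ ^ 2) • perp (ξ - η) := by
    rw [← integral_smul]
    refine integral_congr_ae ?_
    filter_upwards [h] with η hη
    rw [hη, smul_smul, mul_div_assoc]
  rw [biotSavart, biotSavart, h1, smul_comm]

/-- Additivity of the integral needs both integrands to be integrable, which is finiteness of the
two Riesz potentials; for elements of `L²(m)` this holds almost everywhere. -/
lemma biotSavart_add {u v w : Plane → ℝ} (h : ∀ᵐ η, w η = u η + v η) (hu : Measurable u)
    (hv : Measurable v) {ξ : Plane} (hu' : rieszPotential u ξ ≠ ⊤) (hv' : rieszPotential v ξ ≠ ⊤) :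
    biotSavart w ξ = biotSavart u ξ + biotSavart v ξ := by
  have hint : ∀ {u : Plane → ℝ}, Measurable u → rieszPotential u ξ ≠ ⊤ →
      Integrable fun η => (u η / ‖ξ - η‖ ^ 2) • perp (ξ - η) := fun {u} hm hu => by
    refine ⟨((measurable_biotSavart_integrand hm).comp
      (measurable_const.prodMk measurable_id)).aestronglyMeasurable, ?_⟩
    rw [hasFiniteIntegral_iff_enorm]
    refine lt_of_le_of_lt (le_of_eq ?_) hu.lt_top
    exact lintegral_congr fun η => enorm_biotSavart_integrand u ξ η
  rw [biotSavart, biotSavart, biotSavart, ← smul_add, ← integral_add (hint hu hu') (hint hv hv')]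
  congr 1
  refine integral_congr_ae ?_
  filter_upwards [h] with η hη
  rw [hη, ← add_smul, add_div]

lemma exists_lintegral_weight_mul_rieszKernel_le {m : ℝ} (hm : 1 < m) :
    ∃ C, 0 ≤ C ∧ ∀ ζ : Plane,
      ∫⁻ η, ENNReal.ofReal (weight (-m) η) * rieszKernel (η - ζ) ≤ ENNReal.ofReal C := by
  obtain ⟨κ, hκ, h⟩ := exists_lintegral_mul_rieszKernel_le
  have hI : 0 ≤ ∫ ξ, weight (-m) ξ := integral_nonneg fun ξ => (weight_pos _ ξ).le
  refine ⟨(∫ ξ, weight (-m) ξ) + κ, by positivity, fun ζ => ?_⟩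
  have h1 := h (fun η => ENNReal.ofReal (weight (-m) η)) 1 ζ 1 one_pos (measurable_weight _)
    fun y => by
      rw [← ENNReal.ofReal_one]
      exact ENNReal.ofReal_le_ofReal (weight_le_one (by linarith) y)
  rw [lintegral_ofReal_weight (by linarith), inv_one, ENNReal.ofReal_one, one_mul, mul_one, mul_one,
    ← ENNReal.ofReal_add hI hκ] at h1
  exact h1

/-- Cauchy–Schwarz with the weights of exponents `m` and `-m` bounds the squared potential by a
potential of the weighted square of `f`. By Tonelli the Riesz kernel then falls on `φ`. -/
lemma exists_lintegral_mul_rieszPotential_sq_le {m : ℝ} (hm : 1 < m) :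
    ∃ C, 0 ≤ C ∧ ∀ (f : L2m m) (φ : Plane → ℝ≥0∞) (A : ℝ≥0∞), Measurable φ →
      (∀ ζ, ∫⁻ η, φ η * rieszKernel (η - ζ) ≤ A) →
      ∫⁻ η, φ η * rieszPotential f η ^ 2 ≤ ENNReal.ofReal C * (A * ‖f‖ₑ ^ 2) := by
  obtain ⟨C, hC, h⟩ := exists_lintegral_weight_mul_rieszKernel_le hm
  refine ⟨C, hC, fun f φ A hφ hA => ?_⟩
  have hf2 : Measurable fun ζ => ENNReal.ofReal (weight m ζ) * ‖f ζ‖ₑ ^ 2 :=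
    (measurable_weight m).mul ((measurable_L2m f).enorm.pow_const 2)
  have hR : Measurable (Function.uncurry fun η ζ : Plane => rieszKernel (η - ζ)) :=
    measurable_rieszKernel.comp (by fun_prop)
  have h1 : ∀ η, rieszPotential f η ^ 2 ≤ ENNReal.ofReal C *
      ∫⁻ ζ, rieszKernel (η - ζ) * (ENNReal.ofReal (weight m ζ) * ‖f ζ‖ₑ ^ 2) := fun η => by
    have h2 := lintegral_mul_enorm_sq_le f (k := fun ζ => rieszKernel (η - ζ)) (u := fun _ => 1)
      (measurable_rieszKernel.comp (by fun_prop)) measurable_const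
    simp only [one_mul, one_pow, mul_one] at h2
    refine h2.trans ?_
    gcongr
    refine le_trans (le_of_eq ?_) (h η)
    refine lintegral_congr fun ζ => ?_
    rw [rieszKernel_sub_comm, mul_comm]
  calc ∫⁻ η, φ η * rieszPotential f η ^ 2
      ≤ ∫⁻ η, ENNReal.ofReal C * (φ η *
        ∫⁻ ζ, rieszKernel (η - ζ) * (ENNReal.ofReal (weight m ζ) * ‖f ζ‖ₑ ^ 2)) := by
        refine lintegral_mono fun η => ?_
        rw [mul_left_comm]
        gcongr
        exact h1 η
    _ = ENNReal.ofReal C * ∫⁻ η, φ η *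
        ∫⁻ ζ, rieszKernel (η - ζ) * (ENNReal.ofReal (weight m ζ) * ‖f ζ‖ₑ ^ 2) :=
        lintegral_const_mul' _ _ ENNReal.ofReal_ne_top
    _ ≤ _ := by
        gcongr
        have h3 := lintegral_kernel_le hR hf2 hφ (measurable_const (a := (1 : ℝ≥0∞)))
          (B := A) fun ζ _ => by rw [mul_one]; exact hA ζ
        simpa [enorm_sq_L2m] using h3

lemma ae_rieszPotential_ne_top {m : ℝ} (hm : 1 < m) (f : L2m m) :
    ∀ᵐ η, rieszPotential f η ≠ ⊤ := by
  obtain ⟨C, hC, h⟩ := exists_lintegral_mul_rieszPotential_sq_le hm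
  obtain ⟨C', hC', h'⟩ := exists_lintegral_weight_mul_rieszKernel_le hm
  have h1 := h f _ _ (measurable_weight (-m)) h'
  have h2 : ∫⁻ η, ENNReal.ofReal (weight (-m) η) * rieszPotential f η ^ 2 ≠ ⊤ :=
    ne_top_of_le_ne_top (by finiteness) h1
  have h3 := ae_lt_top ((measurable_weight (-m)).mul
    ((measurable_rieszPotential (measurable_L2m f)).pow_const 2)) h2
  filter_upwards [h3] with η hη hinf
  rw [Pi.mul_apply, hinf] at hη
  have h4 : ENNReal.ofReal (weight (-m) η) ≠ 0 := (ENNReal.ofReal_pos.2 (weight_pos _ η)).ne'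
  simp [ENNReal.mul_top h4] at hη

/-- Cauchy–Schwarz: `f` is square integrable against the weight of exponent `m`, and the velocity
against that of exponent `-m`. -/
lemma integrable_mul_biotSavart {m : ℝ} (hm : 1 < m) (f g : L2m m) (i : Fin 2) :
    Integrable fun η => f η * biotSavart g η i := by
  obtain ⟨C, hC, h⟩ := exists_lintegral_mul_rieszPotential_sq_le hm
  obtain ⟨C', hC', h'⟩ := exists_lintegral_weight_mul_rieszKernel_le hm
  have h1 := h g _ _ (measurable_weight (-m)) h'
  have hmeas : Measurable fun η => biotSavart g η i :=
    (by fun_prop : Measurable fun x : Plane => x i).comp (measurable_biotSavart (measurable_L2m g))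
  refine ⟨((measurable_L2m f).mul hmeas).aestronglyMeasurable, ?_⟩
  rw [hasFiniteIntegral_iff_enorm]
  have h2 := lintegral_mul_enorm_sq_le f (k := fun _ => 1) (u := rieszPotential g) measurable_const
    (measurable_rieszPotential (measurable_L2m g))
  simp only [one_mul] at h2
  rw [← enorm_sq_L2m] at h2
  have h3 : (∫⁻ η, rieszPotential g η * ‖f η‖ₑ) ^ 2 ≠ ⊤ :=
    ne_top_of_le_ne_top (ENNReal.mul_ne_top (ne_top_of_le_ne_top (by finiteness) h1)
      (by finiteness)) h2
  have h4 : ∫⁻ η, rieszPotential g η * ‖f η‖ₑ ≠ ⊤ := fun hinf => h3 (by rw [hinf]; simp)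
  refine lt_of_le_of_lt (lintegral_mono fun η => ?_) h4.lt_top
  rw [enorm_mul, mul_comm]
  gcongr
  exact enorm_biotSavart_apply_le _ _ _

end Velocity

end

end Vorticity

namespace Vorticity

noncomputable section

/-! ### Smoothing bounds for the bilinear term -/

section BilinearOperator

lemma continuous_gradKernel_smul (a c : ℝ) (i : Fin 2) :
    Continuous (Function.uncurry fun ξ η : Plane => gradKernel a i (ξ - c • η)) :=
  (continuous_gradKernel a i).comp (by fun_prop : Continuous fun p : Plane × Plane => p.1 - c • p.2)

lemma integrable_gradKernel_smul_mul {a : ℝ} (ha : 0 < a) (c : ℝ) (i : Fin 2) (ξ : Plane)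
    {f : Plane → ℝ} (hf : Integrable f) : Integrable fun η => gradKernel a i (ξ - c • η) * f η := by
  refine hf.bdd_mul (c := 2 * (Real.sqrt a)⁻¹ * (4 * Real.pi * (2 * a))⁻¹)
    ((continuous_gradKernel a i).comp (by fun_prop)).aestronglyMeasurable
    (Eventually.of_forall fun η => ?_)
  refine (abs_gradKernel_le ha i _).trans ?_
  gcongr
  exact heatKernel_le (by positivity) _

lemma measurable_heatKernel_smul_right (a c : ℝ) (ξ : Plane) :
    Measurable fun η : Plane => ENNReal.ofReal (heatKernel a (ξ - c • η)) :=
  ((continuous_heatKernel a).comp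
    (by fun_prop : Continuous fun η : Plane => ξ - c • η)).measurable.ennreal_ofReal

/-- The splitting radius `√b` balances the two contributions: the mass `c⁻²` divided by the radius,
and the radius times the maximum of the Gaussian, of order `1 / b`. -/
lemma exists_lintegral_heatKernel_mul_rieszKernel_le :
    ∃ C, 0 ≤ C ∧ ∀ b : ℝ, 0 < b → ∀ c ∈ Ioc (0 : ℝ) 1, ∀ ξ ζ : Plane,
      ∫⁻ η, ENNReal.ofReal (heatKernel b (ξ - c • η)) * rieszKernel (η - ζ) ≤
        ENNReal.ofReal (C * (c ^ 2)⁻¹ * (Real.sqrt b)⁻¹) := by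
  obtain ⟨κ, hκ, h⟩ := exists_lintegral_mul_rieszKernel_le
  refine ⟨1 + κ, by positivity, fun b hb c hc ξ ζ => ?_⟩
  have hc0 := hc.1
  have hsb : 0 < Real.sqrt b := Real.sqrt_pos.2 hb
  have hpi := Real.pi_gt_three
  have hm := measurable_heatKernel_smul_right b c ξ
  refine (h _ (ENNReal.ofReal (4 * Real.pi * b)⁻¹) ζ (Real.sqrt b) hsb hm fun y =>
    ENNReal.ofReal_le_ofReal (heatKernel_le hb _)).trans ?_
  rw [lintegral_heatKernel_smul hb hc0, ← ENNReal.ofReal_mul (by positivity),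
    ← ENNReal.ofReal_mul (by positivity), ← ENNReal.ofReal_add (by positivity) (by positivity)]
  refine ENNReal.ofReal_le_ofReal ?_
  have h1 : κ * Real.sqrt b * (4 * Real.pi * b)⁻¹ = κ * (Real.sqrt b)⁻¹ * (4 * Real.pi)⁻¹ := by
    nth_rw 2 [← Real.sq_sqrt hb.le]
    field_simp
  have h2 : (4 * Real.pi)⁻¹ ≤ 1 := inv_le_one_of_one_le₀ (by linarith)
  have h3 : 1 ≤ (c ^ 2)⁻¹ := (one_le_inv₀ (by positivity)).2 (pow_le_one₀ hc0.le hc.2)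
  rw [h1]
  have h4 : κ * (Real.sqrt b)⁻¹ * (4 * Real.pi)⁻¹ ≤ κ * (Real.sqrt b)⁻¹ * (c ^ 2)⁻¹ :=
    mul_le_mul_of_nonneg_left (h2.trans h3) (by positivity)
  calc _ ≤ (Real.sqrt b)⁻¹ * (c ^ 2)⁻¹ + κ * (Real.sqrt b)⁻¹ * (c ^ 2)⁻¹ := by linarith
    _ = _ := by ring

/-- The weighted bound for the quadratic term. -/
lemma exists_lintegral_quadratic_le {m : ℝ} (hm : 1 < m) :
    ∃ D, 0 ≤ D ∧ ∀ b ∈ Ioc (0 : ℝ) 2, ∀ c ∈ Ioc (0 : ℝ) 1, ∀ f g : L2m m,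
      ∫⁻ ξ, ENNReal.ofReal (weight m ξ) * (∫⁻ η, ENNReal.ofReal (heatKernel b (ξ - c • η)) *
        (‖f η‖ₑ * rieszPotential g η)) ^ 2 ≤
          ENNReal.ofReal (D * (c ^ 2)⁻¹ * (Real.sqrt b)⁻¹) * (‖f‖ₑ ^ 2 * ‖g‖ₑ ^ 2) := by
  obtain ⟨C₁, hC₁, h₁⟩ := exists_lintegral_mul_rieszPotential_sq_le hm
  obtain ⟨C₂, hC₂, h₂⟩ := exists_lintegral_heatKernel_mul_rieszKernel_le
  obtain ⟨C₃, hC₃, h₃⟩ := exists_lintegral_weight_mul_heatKernel_le hm.le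
  refine ⟨C₁ * C₂ * C₃, by positivity, fun b hb c hc f g => ?_⟩
  have hc0 := hc.1
  have hk := measurable_heatKernel_smul b c
  have hk1 := measurable_heatKernel_smul_right b c
  have hf := (measurable_L2m f).enorm
  have hg := measurable_rieszPotential (measurable_L2m g)
  set A : ℝ≥0∞ := ENNReal.ofReal C₁ *
    (ENNReal.ofReal (C₂ * (c ^ 2)⁻¹ * (Real.sqrt b)⁻¹) * ‖g‖ₑ ^ 2)
  have hA : A ≠ ⊤ := by finiteness
  -- Cauchy–Schwarz in `η` isolates the velocity in a factor bounded uniformly in `ξ`, of order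
  -- `b^{-1/2}`, and leaves only `f` under the heat kernel.
  calc _ ≤ ∫⁻ ξ, A * (ENNReal.ofReal (weight m ξ) *
        ∫⁻ η, ENNReal.ofReal (heatKernel b (ξ - c • η)) * ‖f η‖ₑ ^ 2) := by
        refine lintegral_mono fun ξ => ?_
        rw [mul_left_comm]
        gcongr
        rw [mul_comm A]
        refine (lintegral_mul_mul_sq_le (hk1 ξ).aemeasurable hf.aemeasurable
          hg.aemeasurable).trans ?_
        gcongr
        exact h₁ g _ _ (hk1 ξ) fun ζ => h₂ b hb.1 c hc ξ ζ
    _ = A * ∫⁻ ξ, ENNReal.ofReal (weight m ξ) *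
        ∫⁻ η, ENNReal.ofReal (heatKernel b (ξ - c • η)) * ‖f η‖ₑ ^ 2 :=
        lintegral_const_mul' _ _ hA
    _ ≤ A * (ENNReal.ofReal C₃ * ∫⁻ η, ENNReal.ofReal (weight m η) * ‖f η‖ₑ ^ 2) := by
        gcongr
        refine lintegral_kernel_le hk (hf.pow_const 2) (measurable_weight m) (measurable_weight m)
          fun η _ => (h₃ b hb (c • η)).trans ?_
        gcongr
        exact weight_smul_le (by linarith) hc η
    _ = _ := by
        rw [← enorm_sq_L2m]
        have e : C₁ * C₂ * C₃ * (c ^ 2)⁻¹ * (Real.sqrt b)⁻¹ =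
            C₁ * (C₂ * (c ^ 2)⁻¹ * (Real.sqrt b)⁻¹) * C₃ := by ring
        rw [e, ENNReal.ofReal_mul (by positivity), ENNReal.ofReal_mul hC₁]
        simp only [A]
        ring

/-- The components of the smoothing bilinear operators. -/
lemma exists_bilinearOperator {m : ℝ} (hm : 1 < m) :
    ∃ D, 0 ≤ D ∧ ∀ a ∈ Ioc (0 : ℝ) 1, ∀ c ∈ Ioc (0 : ℝ) 1, ∀ i : Fin 2,
      ∃ T : L2m m →L[ℝ] L2m m →L[ℝ] L2m m, (∀ f g, ∀ᵐ ξ, T f g ξ =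
        c * ∫ η, gradKernel a i (ξ - c • η) * (f η * biotSavart g η i)) ∧
        ‖T‖ ≤ D * a ^ (-(3 / 4) : ℝ) := by
  obtain ⟨D, hD, hb⟩ := exists_lintegral_quadratic_le hm
  refine ⟨2 * Real.sqrt D, by positivity, fun a ha c hc i => ?_⟩
  have ha0 := ha.1
  have hc0 := hc.1
  have hsa : 0 < Real.sqrt a := Real.sqrt_pos.2 ha0
  have hint := fun (f g : L2m m) ξ =>
    integrable_gradKernel_smul_mul ha0 c i ξ (integrable_mul_biotSavart hm f g i)
  have hmeas : ∀ g : L2m m, Measurable fun η => biotSavart g η i := fun g =>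
    (by fun_prop : Measurable fun x : Plane => x i).comp (measurable_biotSavart (measurable_L2m g))
  refine exists_bilinear_of_pointwise (by positivity) (fun f g => ?_)
    (fun f f' g => Eventually.of_forall fun ξ => ?_) (fun b f g => Eventually.of_forall fun ξ => ?_)
    (fun f g g' => Eventually.of_forall fun ξ => ?_) (fun b f g => Eventually.of_forall fun ξ => ?_)
    fun f g => ?_
  · exact (aestronglyMeasurable_integral_kernel (continuous_gradKernel_smul a c i)
      ((measurable_L2m f).mul (hmeas g))).const_mul c
  · rw [← mul_add, ← integral_add (hint f g ξ) (hint f' g ξ)]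
    congr 1
    refine integral_congr_ae ?_
    filter_upwards [coeFn_add_L2m f f'] with η hη
    rw [hη]
    ring
  · rw [mul_left_comm b, ← integral_const_mul b]
    congr 1
    refine integral_congr_ae ?_
    filter_upwards [coeFn_smul_L2m b f] with η hη
    rw [hη]
    ring
  · rw [← mul_add, ← integral_add (hint f g ξ) (hint f g' ξ)]
    congr 1
    refine integral_congr_ae ?_
    filter_upwards [ae_rieszPotential_ne_top hm g, ae_rieszPotential_ne_top hm g'] with η h1 h2
    rw [biotSavart_add (coeFn_add_L2m g g') (measurable_L2m g) (measurable_L2m g') h1 h2,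
      PiLp.add_apply]
    ring
  · rw [mul_left_comm b, ← integral_const_mul b]
    congr 1
    refine integral_congr_ae (Eventually.of_forall fun η => ?_)
    simp only
    rw [biotSavart_smul b (coeFn_smul_L2m b g), PiLp.smul_apply, smul_eq_mul]
    ring
  · have hpt : ∀ ξ, ‖c * ∫ η, gradKernel a i (ξ - c • η) * (f η * biotSavart g η i)‖ₑ ≤
        ENNReal.ofReal (2 * c * (Real.sqrt a)⁻¹) *
          ∫⁻ η, ENNReal.ofReal (heatKernel (2 * a) (ξ - c • η)) *
            (‖f η‖ₑ * rieszPotential g η) := fun ξ => by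
      rw [enorm_mul, Real.enorm_of_nonneg hc0.le, mul_comm 2 c, mul_assoc c,
        ENNReal.ofReal_mul hc0.le, mul_assoc]
      gcongr
      rw [← lintegral_const_mul' _ _ ENNReal.ofReal_ne_top]
      refine (enorm_integral_le_lintegral_enorm _).trans (lintegral_mono fun η => ?_)
      rw [enorm_mul, enorm_mul, ← mul_assoc (ENNReal.ofReal _), ← ENNReal.ofReal_mul (by positivity)]
      gcongr
      · rw [← ofReal_norm]
        exact ENNReal.ofReal_le_ofReal (abs_gradKernel_le ha0 i _)
      · exact enorm_biotSavart_apply_le _ _ _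
    have hs2 : (Real.sqrt (2 * a))⁻¹ ≤ (Real.sqrt a)⁻¹ := by
      gcongr
      linarith
    calc _ ≤ ∫⁻ ξ, ENNReal.ofReal (2 * c * (Real.sqrt a)⁻¹) ^ 2 * (ENNReal.ofReal (weight m ξ) *
          (∫⁻ η, ENNReal.ofReal (heatKernel (2 * a) (ξ - c • η)) *
            (‖f η‖ₑ * rieszPotential g η)) ^ 2) := by
          refine lintegral_mono fun ξ => ?_
          rw [mul_left_comm, ← mul_pow]
          gcongr
          exact hpt ξ
      _ = ENNReal.ofReal (2 * c * (Real.sqrt a)⁻¹) ^ 2 * ∫⁻ ξ, ENNReal.ofReal (weight m ξ) *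
          (∫⁻ η, ENNReal.ofReal (heatKernel (2 * a) (ξ - c • η)) *
            (‖f η‖ₑ * rieszPotential g η)) ^ 2 := lintegral_const_mul' _ _ (by finiteness)
      _ ≤ ENNReal.ofReal (2 * c * (Real.sqrt a)⁻¹) ^ 2 *
          (ENNReal.ofReal (D * (c ^ 2)⁻¹ * (Real.sqrt (2 * a))⁻¹) * (‖f‖ₑ ^ 2 * ‖g‖ₑ ^ 2)) := by
          gcongr
          exact hb (2 * a) ⟨by positivity, by linarith [ha.2]⟩ c hc f g
      _ ≤ ENNReal.ofReal (2 * c * (Real.sqrt a)⁻¹) ^ 2 *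
          (ENNReal.ofReal (D * (c ^ 2)⁻¹ * (Real.sqrt a)⁻¹) * (‖f‖ₑ ^ 2 * ‖g‖ₑ ^ 2)) := by
          gcongr
      _ = _ := by
          rw [mul_pow (_ * _) ‖g‖ₑ, mul_pow _ ‖f‖ₑ, ← ENNReal.ofReal_pow (by positivity),
            ← ENNReal.ofReal_pow (by positivity), ← mul_assoc, ← ENNReal.ofReal_mul (by positivity),
            mul_assoc (ENNReal.ofReal _)]
          congr 2
          -- In the norm the gradient contributes `a^{-1/2}` and the product with the velocity
          -- `a^{-1/4}`; the powers of `c` cancel.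
          have e1 : (a ^ (-(3 / 4) : ℝ)) ^ 2 = (Real.sqrt a)⁻¹ ^ 2 * (Real.sqrt a)⁻¹ := by
            rw [Real.sqrt_eq_rpow, ← Real.rpow_neg ha0.le, ← Real.rpow_natCast, ← Real.rpow_natCast,
              ← Real.rpow_mul ha0.le, ← Real.rpow_mul ha0.le, ← Real.rpow_add ha0]
            norm_num
          rw [mul_pow _ (a ^ (-(3 / 4) : ℝ)), mul_pow 2 (Real.sqrt D), Real.sq_sqrt hD, e1]
          field_simp

end BilinearOperator

end

end Vorticity

namespace Vorticity

noncomputable section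

/-! ### The quadratic term of the vorticity equation -/

section QuadraticTerm

variable {m : ℝ} {S : ℝ → L2m m →L[ℝ] L2m m} {C : ℝ}

/-- The time `1 - exp (-t)` of the heat kernel is comparable to `t` on `(0, 1]`, which turns the
singularity in the former into one in `t`. -/
lemma mul_exp_neg_one_le {t : ℝ} (ht : t ∈ Ioc (0 : ℝ) 1) :
    t * Real.exp (-1) ≤ 1 - Real.exp (-t) := by
  have h1 : 1 - Real.exp (-t) = (Real.exp t - 1) * Real.exp (-t) := by
    rw [sub_mul, ← Real.exp_add, add_neg_cancel, Real.exp_zero, one_mul]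
  rw [h1]
  have h2 := Real.add_one_le_exp t
  exact mul_le_mul (by linarith) (Real.exp_le_exp.2 (by linarith [ht.2])) (Real.exp_pos _).le
    (by linarith [ht.1])

lemma IsHeatSemigroup.C_nonneg (h : IsHeatSemigroup S C) : 0 ≤ C := by
  have := (norm_nonneg _).trans (h.norm_le 0 le_rfl)
  simpa using this

/-- The semigroup acts on the gradient of the heat kernel. -/
lemma IsHeatSemigroup.apply_gradKernel (h : IsHeatSemigroup S C) {s t : ℝ} (hs : 0 < s)
    (ht : 0 < t) {u v : L2m m} {i : Fin 2} {p : Plane → ℝ} (hp : Integrable p)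
    (hu : ∀ᵐ ξ, u ξ = Real.exp (-t / 2) *
      ∫ η, gradKernel (1 - Real.exp (-t)) i (ξ - Real.exp (-t / 2) • η) * p η)
    (hv : ∀ᵐ ξ, v ξ = Real.exp (-(s + t) / 2) *
      ∫ η, gradKernel (1 - Real.exp (-(s + t))) i (ξ - Real.exp (-(s + t) / 2) • η) * p η) :
    S s u = v := by
  have ha := one_sub_exp_pos ht
  refine ext_L2m ?_
  filter_upwards [h.apply s hs u, hv] with ξ h1 h2
  have h3 : ∫ z, heatKernel (1 - Real.exp (-s)) (ξ - Real.exp (-s / 2) • z) * u z =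
      Real.exp (-t / 2) * ∫ z, heatKernel (1 - Real.exp (-s)) (ξ - Real.exp (-s / 2) • z) *
        ∫ η, gradKernel (1 - Real.exp (-t)) i (z - Real.exp (-t / 2) • η) * p η := by
    rw [← integral_const_mul]
    refine integral_congr_ae ?_
    filter_upwards [hu] with z hz
    rw [hz]
    ring
  rw [h1, h2, h3, integral_heatKernel_comp (one_sub_exp_pos hs) (by positivity)
    (continuous_gradKernel _ i) (abs_gradKernel_le ha i) hp]
  simp only [integral_heatKernel_mul_gradKernel (one_sub_exp_pos hs) ha, one_sub_exp_add, smul_smul,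
    exp_half_add, mul_assoc, integral_const_mul]
  -- Passing the gradient through the semigroup produces a factor `e^{-s/2}`, which completes the
  -- prefactor `e^{-t/2}` to `e^{-(s+t)/2}`.
  rw [← mul_assoc, mul_comm (Real.exp (-t / 2)), exp_half_add]

/-- The quadratic term of the vorticity equation as a smoothing bilinear map. -/
theorem IsHeatSemigroup.exists_smoothingBilinear (hm : 1 < m) (h : IsHeatSemigroup S C) :
    ∃ (B : ℝ → L2m m →L[ℝ] L2m m →L[ℝ] L2m m) (c C' : ℝ), SmoothingBilinear S B c C' ∧
      ∀ t, 0 < t → ∀ f g, ∀ᵐ ξ, B t f g ξ = Real.exp (-t / 2) * ∑ i,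
        ∫ η, gradKernel (1 - Real.exp (-t)) i (ξ - Real.exp (-t / 2) • η) *
          (f η * biotSavart g η i) := by
  obtain ⟨D, hD, hT⟩ := exists_bilinearOperator hm
  have hex : ∀ (i : Fin 2) (t : ℝ), ∃ T : L2m m →L[ℝ] L2m m →L[ℝ] L2m m, 0 < t →
      (∀ f g, ∀ᵐ ξ, T f g ξ = Real.exp (-t / 2) *
        ∫ η, gradKernel (1 - Real.exp (-t)) i (ξ - Real.exp (-t / 2) • η) *
          (f η * biotSavart g η i)) ∧
      ‖T‖ ≤ D * (1 - Real.exp (-t)) ^ (-(3 / 4) : ℝ) := fun i t => by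
    by_cases ht : 0 < t
    · obtain ⟨T, hT⟩ := hT _ (one_sub_exp_mem ht) _ (exp_half_mem ht.le) i
      exact ⟨T, fun _ => hT⟩
    · exact ⟨0, fun h => absurd h ht⟩
  choose T hT using hex
  have hC := h.C_nonneg
  have hS1 : ∀ t ∈ Icc (0 : ℝ) 1, ‖S t‖ ≤ C * Real.exp (1 / 2) := fun t ht =>
    (h.norm_le t ht.1).trans (by gcongr; exact ht.2)
  refine ⟨fun t => T 0 t + T 1 t, 2 * (D * Real.exp (-1) ^ (-(3 / 4) : ℝ)), C * Real.exp (1 / 2),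
    ⟨h.zero, fun s t hs ht f => h.add hm hs ht f, h.continuousOn hm, fun τ =>
      ⟨C * Real.exp (τ / 2), fun t ht => (h.norm_le t ht.1).trans (by gcongr; exact ht.2)⟩, hS1,
      fun t ht => ?_, fun s t hs ht f g => ?_⟩, fun t ht f g => ?_⟩
  · have h1 : (1 - Real.exp (-t)) ^ (-(3 / 4) : ℝ) ≤
        Real.exp (-1) ^ (-(3 / 4) : ℝ) * t ^ (-(3 / 4) : ℝ) := by
      rw [← Real.mul_rpow (Real.exp_pos _).le ht.1.le, mul_comm]
      exact Real.rpow_le_rpow_of_nonpos (mul_pos ht.1 (Real.exp_pos _)) (mul_exp_neg_one_le ht)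
        (by norm_num)
    have h2 : ∀ i, ‖T i t‖ ≤ D * (Real.exp (-1) ^ (-(3 / 4) : ℝ) * t ^ (-(3 / 4) : ℝ)) := fun i =>
      (hT i t ht.1).2.trans (by gcongr)
    calc ‖T 0 t + T 1 t‖ ≤ D * (Real.exp (-1) ^ (-(3 / 4) : ℝ) * t ^ (-(3 / 4) : ℝ)) +
        D * (Real.exp (-1) ^ (-(3 / 4) : ℝ) * t ^ (-(3 / 4) : ℝ)) :=
          (norm_add_le (T 0 t) (T 1 t)).trans (add_le_add (h2 0) (h2 1))
      _ = 2 * (D * Real.exp (-1) ^ (-(3 / 4) : ℝ)) * t ^ (-(3 / 4) : ℝ) := by ring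
  · change S s (T 0 t f g + T 1 t f g) = T 0 (s + t) f g + T 1 (s + t) f g
    rcases hs.eq_or_lt with rfl | hs
    · rw [h.zero, zero_add]
    rw [map_add]
    have key : ∀ i, S s (T i t f g) = T i (s + t) f g := fun i =>
      h.apply_gradKernel hs ht (integrable_mul_biotSavart hm f g i) ((hT i t ht).1 f g)
        ((hT i (s + t) (by positivity)).1 f g)
    rw [key, key]
  · change ∀ᵐ ξ, (T 0 t f g + T 1 t f g : L2m m) ξ = _
    filter_upwards [(hT 0 t ht).1 f g, (hT 1 t ht).1 f g, coeFn_add_L2m (T 0 t f g) (T 1 t f g)]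
      with ξ h1 h2 h3
    rw [h3, h1, h2, Fin.sum_univ_two, mul_add]

/-- The bound does not depend on `x`, so it dominates the derivative under the integral sign. -/
lemma norm_fderivKernel_le {a : ℝ} (ha : 0 < a) (p : ℝ) (x : Plane) :
    ‖(-(2 * a)⁻¹ * heatKernel a x * p) • innerSL ℝ x‖ ≤
      (2 * a)⁻¹ * (4 * Real.sqrt a * (4 * Real.pi * (2 * a))⁻¹) * ‖p‖ := by
  rw [norm_smul, innerSL_apply_norm, norm_mul, norm_mul, norm_neg,
    Real.norm_of_nonneg (by positivity : 0 ≤ (2 * a)⁻¹),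
    Real.norm_of_nonneg (heatKernel_nonneg ha.le _)]
  have h1 := norm_mul_heatKernel_le ha x
  have h2 := heatKernel_le (by positivity : 0 < 2 * a) x
  have h3 : ‖x‖ * heatKernel a x ≤ 4 * Real.sqrt a * (4 * Real.pi * (2 * a))⁻¹ :=
    h1.trans (mul_le_mul_of_nonneg_left h2 (by positivity))
  calc _ = (2 * a)⁻¹ * (‖x‖ * heatKernel a x) * ‖p‖ := by ring
    _ ≤ _ := mul_le_mul_of_nonneg_right (mul_le_mul_of_nonneg_left h3 (by positivity))
      (norm_nonneg _)

lemma integrable_fderivKernel {a : ℝ} (ha : 0 < a) (c : ℝ) {p : Plane → ℝ} (hp : Integrable p)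
    (ξ : Plane) : Integrable fun η =>
      (-(2 * a)⁻¹ * heatKernel a (ξ - c • η) * p η) • innerSL ℝ (ξ - c • η) :=
  (hp.norm.const_mul _).mono' (AEStronglyMeasurable.smul ((continuous_const.mul
    ((continuous_heatKernel a).comp (by fun_prop))).aestronglyMeasurable.mul
      hp.aestronglyMeasurable) (Continuous.aestronglyMeasurable (by fun_prop)))
    (Eventually.of_forall fun η => norm_fderivKernel_le ha (p η) (ξ - c • η))

/-- Differentiation under the integral sign. -/
lemma hasFDerivAt_integral_heatKernel {a : ℝ} (ha : 0 < a) (c : ℝ) {p : Plane → ℝ}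
    (hp : Integrable p) (ξ : Plane) :
    HasFDerivAt (fun ξ => ∫ η, heatKernel a (ξ - c • η) * p η)
      (∫ η, (-(2 * a)⁻¹ * heatKernel a (ξ - c • η) * p η) • innerSL ℝ (ξ - c • η)) ξ := by
  have hcont : ∀ x : Plane, Continuous fun η : Plane => heatKernel a (x - c • η) := fun x =>
    (continuous_heatKernel a).comp (by fun_prop)
  refine hasFDerivAt_integral_of_dominated_of_fderiv_le (s := univ)
    (F' := fun x η => (-(2 * a)⁻¹ * heatKernel a (x - c • η) * p η) • innerSL ℝ (x - c • η))
    (bound := fun η => (2 * a)⁻¹ * (4 * Real.sqrt a * (4 * Real.pi * (2 * a))⁻¹) * ‖p η‖)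
    univ_mem (Eventually.of_forall fun x => (hcont x).aestronglyMeasurable.mul
      hp.aestronglyMeasurable) (integrable_heatKernel_smul_mul ha c ξ hp)
    (integrable_fderivKernel ha c hp ξ).aestronglyMeasurable
    (Eventually.of_forall fun η x _ => norm_fderivKernel_le ha (p η) (x - c • η))
    (hp.norm.const_mul _) (Eventually.of_forall fun η x _ => ?_)
  have h1 : HasFDerivAt (fun x : Plane => x - c • η) (ContinuousLinearMap.id ℝ Plane) x :=
    (hasFDerivAt_id x).sub_const _
  have h2 := ((hasFDerivAt_heatKernel ha.ne' (x - c • η)).comp x h1).mul_const (p η)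
  refine h2.congr_fderiv ?_
  ext v
  simp only [FunLike.coe_smul, Pi.smul_apply, smul_eq_mul, ContinuousLinearMap.comp_id]
  ring

lemma divSemigroup_eq {t : ℝ} (ht : 0 < t) {F : Plane → Plane} (hF : ∀ i, Integrable fun η => F η i)
    (ξ : Plane) : divSemigroup t F ξ =
      ∑ i, ∫ η, gradKernel (1 - Real.exp (-t)) i (ξ - Real.exp (-t / 2) • η) * F η i := by
  have ha := one_sub_exp_pos ht
  refine Finset.sum_congr rfl fun i _ => ?_
  have h1 : semigroup t (fun η => F η i) = fun ξ =>
      ∫ η, heatKernel (1 - Real.exp (-t)) (ξ - Real.exp (-t / 2) • η) * F η i :=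
    funext fun ξ => semigroup_eq ht _ ξ
  rw [h1, (hasFDerivAt_integral_heatKernel ha _ (hF i) ξ).fderiv,
    ContinuousLinearMap.integral_apply]
  · refine integral_congr_ae (Eventually.of_forall fun η => ?_)
    simp only [FunLike.coe_smul, Pi.smul_apply, smul_eq_mul, innerSL_apply_apply, gradKernel]
    rw [EuclideanSpace.inner_single_right]
    simp only [one_mul, conj_trivial]
    rw [neg_div, div_eq_mul_inv]
    ring
  · exact integrable_fderivKernel ha _ (hF i) ξ

end QuadraticTerm

end

end Vorticity

namespace Vorticity

noncomputable section

/-! ### Moments and their triangular evolution -/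

section Moments

/-- The monomials on the plane. -/
def mono (p : ℕ × ℕ) (x : Plane) : ℝ := x 0 ^ p.1 * x 1 ^ p.2

lemma continuous_mono (p : ℕ × ℕ) : Continuous (mono p) := by
  unfold mono
  fun_prop

lemma norm_pow_le_weight (n : ℕ) (x : Plane) : ‖x‖ ^ n ≤ weight (n / 2) x := by
  rw [weight, show ‖x‖ ^ n = (‖x‖ ^ 2) ^ ((n : ℝ) / 2) by
    rw [← Real.rpow_natCast ‖x‖ 2, ← Real.rpow_mul (norm_nonneg _), Nat.cast_ofNat,
      mul_div_cancel₀ _ (two_ne_zero), Real.rpow_natCast]]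
  exact Real.rpow_le_rpow (by positivity) (by linarith) (by positivity)

lemma abs_mono_le_norm_pow (p : ℕ × ℕ) (x : Plane) : |mono p x| ≤ ‖x‖ ^ (p.1 + p.2) := by
  rw [mono, abs_mul, abs_pow, abs_pow, pow_add]
  exact mul_le_mul (pow_le_pow_left₀ (abs_nonneg _) (abs_coord_le x 0) _)
    (pow_le_pow_left₀ (abs_nonneg _) (abs_coord_le x 1) _) (by positivity) (by positivity)

lemma abs_mono_le_weight {p : ℕ × ℕ} {s : ℝ} (hs : ((p.1 + p.2 : ℕ) : ℝ) / 2 ≤ s) (x : Plane) :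
    |mono p x| ≤ weight s x :=
  (abs_mono_le_norm_pow p x).trans ((norm_pow_le_weight _ x).trans (weight_mono hs x))

/-- Binomial expansion of translated monomials. -/
lemma mono_add_smul (p : ℕ × ℕ) (c : ℝ) (x η : Plane) : mono p (x + c • η) =
    ∑ q ∈ Finset.range (p.1 + 1) ×ˢ Finset.range (p.2 + 1),
      (p.1.choose q.1 * p.2.choose q.2 * c ^ (q.1 + q.2)) *
        (mono (p.1 - q.1, p.2 - q.2) x * mono q η) := by
  simp only [mono, PiLp.add_apply, PiLp.smul_apply, smul_eq_mul]
  rw [add_comm (x 0), add_comm (x 1), add_pow, add_pow, Finset.sum_mul_sum, Finset.sum_product]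
  refine Finset.sum_congr rfl fun i _ => Finset.sum_congr rfl fun j _ => ?_
  rw [mul_pow, mul_pow, pow_add]
  ring

lemma integrable_mono_mul_heatKernel (p : ℕ × ℕ) {a : ℝ} (ha : a ∈ Ioc (0 : ℝ) 2) :
    Integrable fun x => mono p x * heatKernel a x := by
  have hs : (1 : ℝ) ≤ ((p.1 + p.2 : ℕ) : ℝ) / 2 + 1 := by
    have : (0 : ℝ) ≤ ((p.1 + p.2 : ℕ) : ℝ) := Nat.cast_nonneg _
    linarith
  obtain ⟨C, hC, hb⟩ := exists_heatKernel_mul_weight_le hs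
  have ha2 : 0 < 2 * a := by have := ha.1; positivity
  refine ((integrable_heatKernel ha2).const_mul C).mono'
    ((continuous_mono p).mul (continuous_heatKernel a)).aestronglyMeasurable
    (Eventually.of_forall fun x => ?_)
  have h0 := heatKernel_nonneg ha.1.le x
  rw [Real.norm_eq_abs, abs_mul, abs_of_nonneg h0, mul_comm]
  exact (mul_le_mul_of_nonneg_left (abs_mono_le_weight (by linarith) x) h0).trans (hb a ha x)

lemma integrable_mono_mul {m : ℝ} {p : ℕ × ℕ} (hp : ((p.1 + p.2 : ℕ) : ℝ) + 1 < m) (f : L2m m) :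
    Integrable fun η => mono p η * f η := by
  have h := integrable_weight_mul (m := m) (s := ((p.1 + p.2 : ℕ) : ℝ) / 2) (by linarith) f
  refine h.norm.mono' ((continuous_mono p).measurable.mul (measurable_L2m f)).aestronglyMeasurable
    (Eventually.of_forall fun η => ?_)
  rw [norm_mul, norm_mul, Real.norm_of_nonneg (weight_pos _ η).le]
  exact mul_le_mul_of_nonneg_right (abs_mono_le_weight le_rfl η) (norm_nonneg _)

lemma integrable_prod_heatKernel_mul {b : ℝ} (hb : 0 < b) (c : ℝ) {h : Plane → ℝ}
    (hh : Integrable h) : Integrable (fun p : Plane × Plane => heatKernel b (p.1 - c • p.2) * h p.2)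
      (volume.prod volume) := by
  have hmeas : AEStronglyMeasurable (fun p : Plane × Plane => heatKernel b (p.1 - c • p.2) * h p.2)
      (volume.prod volume) :=
    AEStronglyMeasurable.mul (Continuous.aestronglyMeasurable
      ((continuous_heatKernel b).comp (by fun_prop))) hh.aestronglyMeasurable.comp_snd
  rw [integrable_prod_iff' hmeas]
  refine ⟨Eventually.of_forall fun η =>
    ((integrable_heatKernel hb).comp_sub_right (c • η)).mul_const (h η), ?_⟩
  have : ∀ η, ∫ ξ, ‖heatKernel b (ξ - c • η) * h η‖ = ‖h η‖ := fun η => by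
    simp only [norm_mul, Real.norm_of_nonneg (heatKernel_nonneg hb.le _)]
    rw [integral_mul_const, integral_sub_right_eq_self (heatKernel b), integral_heatKernel hb,
      one_mul]
  simp only [this]
  exact hh.norm

/-- The moments of the image of a function under the heat operators. -/
lemma integral_mono_mul_heatOperator {m : ℝ} {p : ℕ × ℕ} (hp : ((p.1 + p.2 : ℕ) : ℝ) + 1 < m)
    {a c : ℝ} (ha : a ∈ Ioc (0 : ℝ) 2) (hc : c ∈ Ioc (0 : ℝ) 1) (f : L2m m) :
    ∫ ξ, mono p ξ * ∫ η, heatKernel a (ξ - c • η) * f η =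
      ∑ q ∈ Finset.range (p.1 + 1) ×ˢ Finset.range (p.2 + 1),
        (p.1.choose q.1 * p.2.choose q.2 * c ^ (q.1 + q.2) *
          ∫ x, mono (p.1 - q.1, p.2 - q.2) x * heatKernel a x) * ∫ η, mono q η * f η := by
  set s : ℝ := ((p.1 + p.2 : ℕ) : ℝ) / 2 with hs
  have hs0 : 0 ≤ s := by positivity
  obtain ⟨C, hC, hb⟩ := exists_heatKernel_mul_weight_le (m := s + 1) (by linarith)
  have ha2 : 0 < 2 * a := by have := ha.1; positivity
  -- Majorant for Fubini: the weight controlling the monomial splits into one part absorbed by the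
  -- Gaussian and one carried by `f`. The exponent is raised from `s` to `s + 1` only because the
  -- absorption lemma asks for an exponent at least `1`.
  have hint : Integrable (Function.uncurry fun ξ η => mono p ξ * (heatKernel a (ξ - c • η) * f η))
      (volume.prod volume) := by
    refine ((integrable_prod_heatKernel_mul ha2 c
      (integrable_weight_mul (m := m) (s := s) (by linarith) f).norm).const_mul (2 ^ s * C)).mono'
      ?_ (Eventually.of_forall fun z => ?_)
    · exact (((continuous_mono p).measurable.comp measurable_fst).mul
        (((continuous_heatKernel_smul a c).measurable).mul
          ((measurable_L2m f).comp measurable_snd))).aestronglyMeasurable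
    · obtain ⟨ξ, η⟩ := z
      have h0 := heatKernel_nonneg ha.1.le (ξ - c • η)
      have h1 : |mono p ξ| ≤ 2 ^ s * weight (s + 1) (ξ - c • η) * weight s η := by
        have h2 := weight_add_le hs0 (ξ - c • η) (c • η)
        rw [sub_add_cancel] at h2
        refine (abs_mono_le_weight le_rfl ξ).trans (h2.trans ?_)
        gcongr
        · exact (weight_pos _ _).le
        · exact mul_nonneg (by positivity) (weight_pos _ _).le
        · exact weight_mono (by linarith) _
        · exact weight_smul_le hs0 hc η
      simp only [Function.uncurry, norm_mul, Real.norm_of_nonneg h0,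
        Real.norm_of_nonneg (weight_pos s η).le, Real.norm_eq_abs]
      calc |mono p ξ| * (heatKernel a (ξ - c • η) * |f η|)
          ≤ (2 ^ s * weight (s + 1) (ξ - c • η) * weight s η) *
            (heatKernel a (ξ - c • η) * |f η|) :=
            mul_le_mul_of_nonneg_right h1 (by positivity)
        _ = 2 ^ s * (heatKernel a (ξ - c • η) * weight (s + 1) (ξ - c • η)) *
            (weight s η * |f η|) := by ring
        _ ≤ 2 ^ s * (C * heatKernel (2 * a) (ξ - c • η)) * (weight s η * |f η|) :=
            mul_le_mul_of_nonneg_right (mul_le_mul_of_nonneg_left (hb a ha _) (by positivity))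
              (mul_nonneg (weight_pos _ _).le (abs_nonneg _))
        _ = _ := by ring
  have hq : ∀ q ∈ Finset.range (p.1 + 1) ×ˢ Finset.range (p.2 + 1),
      ((q.1 + q.2 : ℕ) : ℝ) + 1 < m := fun q hq => by
    simp only [Finset.mem_product, Finset.mem_range] at hq
    have : ((q.1 + q.2 : ℕ) : ℝ) ≤ ((p.1 + p.2 : ℕ) : ℝ) := by
      exact_mod_cast (by omega : q.1 + q.2 ≤ p.1 + p.2)
    linarith
  have hinner : ∀ η, ∫ ξ, mono p ξ * (heatKernel a (ξ - c • η) * f η) =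
      ∑ q ∈ Finset.range (p.1 + 1) ×ˢ Finset.range (p.2 + 1),
        (p.1.choose q.1 * p.2.choose q.2 * c ^ (q.1 + q.2) *
          ∫ x, mono (p.1 - q.1, p.2 - q.2) x * heatKernel a x) * (mono q η * f η) := fun η => by
    have h1 : ∀ ξ, mono p ξ * (heatKernel a (ξ - c • η) * f η) =
        (fun x => mono p (x + c • η) * heatKernel a x * f η) (ξ - c • η) := fun ξ => by
      simp only [sub_add_cancel, mul_assoc]
    simp only [h1]
    rw [integral_sub_right_eq_self (fun x => mono p (x + c • η) * heatKernel a x * f η)]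
    simp only [mono_add_smul, Finset.sum_mul]
    rw [integral_finsetSum]
    · refine Finset.sum_congr rfl fun q _ => ?_
      rw [← integral_const_mul, ← integral_mul_const]
      refine integral_congr_ae (Eventually.of_forall fun x => ?_)
      simp only
      ring
    · intro q _
      refine (((integrable_mono_mul_heatKernel (p.1 - q.1, p.2 - q.2) ha).const_mul
        (p.1.choose q.1 * p.2.choose q.2 * c ^ (q.1 + q.2) * mono q η)).mul_const (f η)).congr
        (Eventually.of_forall fun x => ?_)
      simp only
      ring
  calc _ = ∫ ξ, ∫ η, mono p ξ * (heatKernel a (ξ - c • η) * f η) := by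
        simp only [integral_const_mul]
    _ = ∫ η, ∫ ξ, mono p ξ * (heatKernel a (ξ - c • η) * f η) := integral_integral_swap hint
    _ = _ := by
        simp only [hinner]
        rw [integral_finsetSum _ fun q h => (integrable_mono_mul (hq q h) f).const_mul _]
        simp only [integral_const_mul]

/-- On functions whose moments of lower order vanish, the heat operators act on the moments by
multiplication with a power of `c`. -/
lemma integral_mono_mul_heatOperator_of_eq_zero {m : ℝ} {p : ℕ × ℕ}
    (hp : ((p.1 + p.2 : ℕ) : ℝ) + 1 < m) {a c : ℝ} (ha : a ∈ Ioc (0 : ℝ) 2)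
    (hc : c ∈ Ioc (0 : ℝ) 1) {f : L2m m}
    (h0 : ∀ q : ℕ × ℕ, q.1 + q.2 < p.1 + p.2 → ∫ η, mono q η * f η = 0) :
    ∫ ξ, mono p ξ * ∫ η, heatKernel a (ξ - c • η) * f η =
      c ^ (p.1 + p.2) * ∫ η, mono p η * f η := by
  rw [integral_mono_mul_heatOperator hp ha hc f, Finset.sum_eq_single p]
  · simp [mono, integral_heatKernel ha.1]
  · intro q hq hqp
    simp only [Finset.mem_product, Finset.mem_range] at hq
    have : q.1 + q.2 < p.1 + p.2 := by
      rcases lt_or_ge (q.1 + q.2) (p.1 + p.2) with h | h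
      · exact h
      · exact absurd (Prod.ext (by omega) (by omega)) hqp
    rw [h0 q this, mul_zero]
  · intro h
    simp at h

/-- The multi-indices of degree at most `k`. -/
def multiIndices (k : ℕ) : Finset (ℕ × ℕ) :=
  (Finset.range (k + 1) ×ˢ Finset.range (k + 1)).filter fun p => p.1 + p.2 ≤ k

lemma mem_multiIndices {k : ℕ} {p : ℕ × ℕ} : p ∈ multiIndices k ↔ p.1 + p.2 ≤ k := by
  simp only [multiIndices, Finset.mem_filter, Finset.mem_product, Finset.mem_range]
  omega

lemma exists_momentMap {k : ℕ} {m : ℝ} (hm : (k : ℝ) + 1 < m) :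
    ∃ M : L2m m →L[ℝ] (multiIndices k → ℝ), ∀ f p, M f p = ∫ η, mono p.1 η * f η := by
  have hp : ∀ p : multiIndices k, ((p.1.1 + p.1.2 : ℕ) : ℝ) + 1 < m := fun p => by
    have : ((p.1.1 + p.1.2 : ℕ) : ℝ) ≤ k := by exact_mod_cast mem_multiIndices.1 p.2
    linarith
  have hex : ∀ p : multiIndices k, ∃ ℓ : L2m m →L[ℝ] ℝ, ∀ f, ℓ f = ∫ η, mono p.1 η * f η :=
      fun p => by
    obtain ⟨C, hC, hb⟩ := exists_lintegral_weight_mul_le (m := m)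
      (s := ((p.1.1 + p.1.2 : ℕ) : ℝ) / 2) (by linarith [hp p])
    refine ⟨LinearMap.mkContinuous
      { toFun := fun f => ∫ η, mono p.1 η * f η
        map_add' := fun f g => ?_
        map_smul' := fun b f => ?_ } C fun f => ?_, fun f => rfl⟩
    · rw [← integral_add (integrable_mono_mul (hp p) f) (integrable_mono_mul (hp p) g)]
      refine integral_congr_ae ?_
      filter_upwards [coeFn_add_L2m f g] with η hη
      rw [hη, mul_add]
    · rw [RingHom.id_apply, smul_eq_mul, ← integral_const_mul]
      refine integral_congr_ae ?_
      filter_upwards [coeFn_smul_L2m b f] with η hη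
      rw [hη]
      ring
    · have h1 : ‖∫ η, mono p.1 η * f η‖ₑ ≤ ENNReal.ofReal (C * ‖f‖) := by
        rw [← ofReal_mul_enorm hC]
        refine (enorm_integral_mul_le fun η => ?_).trans (hb f)
        rw [← ofReal_norm]
        exact ENNReal.ofReal_le_ofReal (abs_mono_le_weight le_rfl η)
      rw [← ofReal_norm] at h1
      exact (ENNReal.ofReal_le_ofReal_iff (by positivity)).1 h1
  choose ℓ hℓ using hex
  exact ⟨ContinuousLinearMap.pi ℓ, fun f p => hℓ p f⟩

/-- The product of the operators `Λ - c^j`, `j ≤ k`, annihilates the moments of order at most `k`,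
if `Λ` acts on the moments in a triangular way. -/
lemma moments_aeval_eq_zero {k : ℕ} {X : Type*} [NormedAddCommGroup X] [NormedSpace ℝ X]
    {M : X →L[ℝ] (multiIndices k → ℝ)} {Λ : X →L[ℝ] X} {c : ℝ}
    (hΛ : ∀ p x, (∀ q : multiIndices k, q.1.1 + q.1.2 < p.1.1 + p.1.2 → M x q = 0) →
      M (Λ x) p = c ^ (p.1.1 + p.1.2) * M x p) (x : X) :
    M (Polynomial.aeval Λ (∏ j ∈ Finset.range (k + 1), (Polynomial.X - Polynomial.C (c ^ j))) x)
      = 0 := by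
  -- The first `d` factors annihilate all moments of degree below `d`. On what is left `Λ` acts on
  -- moments of degree `d` by the scalar `c ^ d`, so the next factor kills these too.
  have key : ∀ d (p : multiIndices k), p.1.1 + p.1.2 < d → M (Polynomial.aeval Λ
      (∏ j ∈ Finset.range d, (Polynomial.X - Polynomial.C (c ^ j))) x) p = 0 := by
    intro d
    induction d with
    | zero => exact fun p hp => absurd hp (Nat.not_lt_zero _)
    | succ d ih =>
      intro p hp
      rw [Finset.prod_range_succ, mul_comm, map_mul]
      generalize Polynomial.aeval Λ
        (∏ j ∈ Finset.range d, (Polynomial.X - Polynomial.C (c ^ j))) = A at ih ⊢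
      have h1 : (Polynomial.aeval Λ (Polynomial.X - Polynomial.C (c ^ d)) * A) x =
          Λ (A x) - c ^ d • A x := by
        rw [map_sub, Polynomial.aeval_X, Polynomial.aeval_C, Algebra.algebraMap_eq_smul_one]
        rfl
      rw [h1, map_sub, map_smul, Pi.sub_apply, Pi.smul_apply,
        hΛ p (A x) fun q hq => ih q (by omega), smul_eq_mul]
      rcases Nat.lt_succ_iff_lt_or_eq.1 hp with h | h
      · rw [ih p h]
        ring
      · rw [h, sub_self]
  funext p
  exact key (k + 1) p (Nat.lt_succ_of_le (mem_multiIndices.1 p.2))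

end Moments

end

end Vorticity

namespace Vorticity

noncomputable section

/-! ### Taylor expansion of the heat kernel -/

section Expansion

lemma abs_exp_sub_sum_le (x : ℝ) (n : ℕ) :
    |Real.exp x - ∑ i ∈ Finset.range n, x ^ i / i.factorial| ≤ |x| ^ n * Real.exp |x| := by
  have h := Complex.norm_exp_sub_sum_le_norm_mul_exp (x : ℂ) n
  rw [Complex.norm_real, Real.norm_eq_abs] at h
  refine le_trans (le_of_eq ?_) h
  rw [← Real.norm_eq_abs, ← Complex.norm_real]
  push_cast
  rfl

/-- The terms of parabolic degree at most `k` in the Taylor expansion of `exp (α - β)`, where `α`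
has degree one and `β` degree two. -/
def expTrunc (k : ℕ) (α β : ℝ) : ℝ :=
  ∑ l ∈ Finset.range (k + 1), (-β) ^ l / l.factorial *
    ∑ i ∈ Finset.range (k + 1 - 2 * l), α ^ i / i.factorial

lemma abs_neg_pow_div_factorial_le {β b : ℝ} (hβ : 0 ≤ β) (h : β ≤ b) (l : ℕ) :
    |(-β) ^ l / l.factorial| ≤ b ^ l := by
  rw [abs_div, abs_pow, abs_neg, abs_of_nonneg hβ, Nat.abs_cast]
  have h1 : (1 : ℝ) ≤ l.factorial := by exact_mod_cast Nat.succ_le_of_lt (Nat.factorial_pos l)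
  exact (div_le_self (by positivity) h1).trans (pow_le_pow_left₀ hβ h l)

lemma pow_le_exp_mul {s : ℝ} (hs : 0 ≤ s) {n k : ℕ} (h : n ≤ k) : s ^ n ≤ Real.exp (k * s) := by
  have h1 : s ^ n ≤ Real.exp s ^ n :=
    pow_le_pow_left₀ hs (by linarith [Real.add_one_le_exp s]) n
  refine h1.trans ?_
  rw [Real.exp_nat_mul]
  exact pow_le_pow_right₀ (Real.one_le_exp hs) h

/-- For each power `l` of `β` the truncation leaves a remainder of `exp α` of order `r ^ (2 * l +
n)` with `2 * l + n ≥ k + 1`. The `k + 1` terms of this kind and the remainder of `exp (-β)`, which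
carries `exp β ≤ 3`, add up to the factor `k + 4`. -/
lemma abs_exp_sub_expTrunc_le (k : ℕ) {α β r s : ℝ} (hs : 0 ≤ s) (hr : 0 ≤ r) (hr1 : r ≤ 1)
    (hα : |α| ≤ s * r) (hβ : 0 ≤ β) (hβr : β ≤ r ^ 2) :
    |Real.exp α * Real.exp (-β) - expTrunc k α β| ≤
      (k + 4) * r ^ (k + 1) * Real.exp ((k + 2) * s) := by
  have hαs : |α| ≤ s := hα.trans (mul_le_of_le_one_right hs hr1)
  have hβ1 : β ≤ 1 := hβr.trans (pow_le_one₀ hr hr1)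
  have hexp : Real.exp ((k + 2) * s) = Real.exp ((k + 1 : ℕ) * s) * Real.exp s := by
    rw [← Real.exp_add]
    push_cast
    ring_nf
  have hdec : Real.exp α * Real.exp (-β) - expTrunc k α β =
      (∑ l ∈ Finset.range (k + 1), (-β) ^ l / l.factorial *
        (Real.exp α - ∑ i ∈ Finset.range (k + 1 - 2 * l), α ^ i / i.factorial)) +
      Real.exp α * (Real.exp (-β) - ∑ l ∈ Finset.range (k + 1), (-β) ^ l / l.factorial) := by
    simp only [mul_sub, Finset.sum_sub_distrib, expTrunc, ← Finset.sum_mul]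
    ring
  have hterm : ∀ l ∈ Finset.range (k + 1), |(-β) ^ l / l.factorial *
      (Real.exp α - ∑ i ∈ Finset.range (k + 1 - 2 * l), α ^ i / i.factorial)| ≤
      r ^ (k + 1) * Real.exp ((k + 2) * s) := fun l _ => by
    rw [abs_mul]
    set n := k + 1 - 2 * l with hn
    calc _ ≤ (r ^ 2) ^ l * (|α| ^ n * Real.exp |α|) :=
          mul_le_mul (abs_neg_pow_div_factorial_le hβ hβr l) (abs_exp_sub_sum_le α n)
            (abs_nonneg _) (by positivity)
      _ ≤ (r ^ 2) ^ l * ((s * r) ^ n * Real.exp s) := by gcongr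
      _ = r ^ (2 * l + n) * (s ^ n * Real.exp s) := by rw [mul_pow, ← pow_mul, pow_add]; ring
      _ ≤ r ^ (k + 1) * (Real.exp ((k + 1 : ℕ) * s) * Real.exp s) := by
          gcongr ?_ * (?_ * _)
          · exact pow_le_pow_of_le_one hr hr1 (by omega)
          · exact pow_le_exp_mul hs (by omega)
      _ = _ := by rw [hexp]
  have hlast : |Real.exp α * (Real.exp (-β) -
      ∑ l ∈ Finset.range (k + 1), (-β) ^ l / l.factorial)| ≤
      3 * (r ^ (k + 1) * Real.exp ((k + 2) * s)) := by
    rw [abs_mul, abs_of_pos (Real.exp_pos _)]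
    have h1 := abs_exp_sub_sum_le (-β) (k + 1)
    rw [abs_neg, abs_of_nonneg hβ] at h1
    have h2 : Real.exp β ≤ 3 := (Real.exp_le_exp.2 hβ1).trans (by
      have := Real.exp_one_lt_d9
      linarith)
    have h3 : β ≤ r := hβr.trans (by nlinarith)
    have h4 : Real.exp α ≤ Real.exp ((k + 2) * s) := by
      refine Real.exp_le_exp.2 ((le_abs_self α).trans (hαs.trans ?_))
      have : (0 : ℝ) ≤ (k + 1) * s := by positivity
      linarith
    calc _ ≤ Real.exp ((k + 2) * s) * (r ^ (k + 1) * 3) := by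
          refine mul_le_mul h4 (h1.trans ?_) (abs_nonneg _) (Real.exp_pos _).le
          gcongr
      _ = _ := by ring
  rw [hdec]
  refine (abs_add_le _ _).trans ((add_le_add ((Finset.abs_sum_le_sum_abs _ _).trans
    (Finset.sum_le_sum hterm)) hlast).trans (le_of_eq ?_))
  rw [Finset.sum_const, Finset.card_range, nsmul_eq_mul]
  push_cast
  ring

/-- For `r ≥ 1` each retained term has parabolic degree at most `k`, hence is of order at most `r ^
k`. -/
lemma abs_expTrunc_le (k : ℕ) {α β r s : ℝ} (hs : 0 ≤ s) (hr1 : 1 ≤ r)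
    (hα : |α| ≤ s * r) (hβ : 0 ≤ β) (hβr : β ≤ r ^ 2) :
    |expTrunc k α β| ≤ (k + 4) * r ^ k * Real.exp ((k + 2) * s) := by
  have hr : 0 ≤ r := by linarith
  have hterm : ∀ l ∈ Finset.range (k + 1), |(-β) ^ l / l.factorial *
      ∑ i ∈ Finset.range (k + 1 - 2 * l), α ^ i / i.factorial| ≤ r ^ k * Real.exp s := fun l _ => by
    rw [abs_mul]
    have h1 : |∑ i ∈ Finset.range (k + 1 - 2 * l), α ^ i / i.factorial| ≤
        ∑ i ∈ Finset.range (k + 1 - 2 * l), r ^ (k - 2 * l) * (s ^ i / i.factorial) := by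
      refine (Finset.abs_sum_le_sum_abs _ _).trans (Finset.sum_le_sum fun i hi => ?_)
      rw [abs_div, abs_pow, Nat.abs_cast, ← mul_div_assoc]
      rw [Finset.mem_range] at hi
      gcongr
      calc |α| ^ i ≤ (s * r) ^ i := by gcongr
        _ = r ^ i * s ^ i := by rw [mul_pow, mul_comm]
        _ ≤ _ := by
          gcongr
          omega
    rw [← Finset.mul_sum] at h1
    rcases lt_or_ge k (2 * l) with h | h
    · rw [show k + 1 - 2 * l = 0 by omega]
      simp only [Finset.range_zero, Finset.sum_empty, abs_zero, mul_zero]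
      positivity
    calc _ ≤ (r ^ 2) ^ l * (r ^ (k - 2 * l) * Real.exp s) := by
          refine mul_le_mul (abs_neg_pow_div_factorial_le hβ hβr l) (h1.trans ?_)
            (abs_nonneg _) (by positivity)
          gcongr
          exact Real.sum_le_exp_of_nonneg hs _
      _ = r ^ (2 * l + (k - 2 * l)) * Real.exp s := by rw [← pow_mul, pow_add]; ring
      _ = _ := by rw [show 2 * l + (k - 2 * l) = k by omega]
  refine (Finset.abs_sum_le_sum_abs _ _).trans ((Finset.sum_le_sum hterm).trans ?_)
  rw [Finset.sum_const, Finset.card_range, nsmul_eq_mul]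
  push_cast
  have h2 : s ≤ (k + 2) * s := by
    have : (0 : ℝ) ≤ (k + 1) * s := by positivity
    linarith
  calc ((k : ℝ) + 1) * (r ^ k * Real.exp s) ≤ (k + 4) * (r ^ k * Real.exp ((k + 2) * s)) := by
        gcongr
        norm_num
    _ = _ := by ring

/-- The Taylor polynomial of order `k` of the heat kernel `G_a(ξ - x)` in the variable `x`. -/
def heatTaylor (k : ℕ) (a : ℝ) (ξ x : Plane) : ℝ :=
  heatKernel a ξ * expTrunc k (inner ℝ ξ x / (2 * a)) (‖x‖ ^ 2 / (4 * a))

lemma heatKernel_sub {a : ℝ} (ξ x : Plane) : heatKernel a (ξ - x) = heatKernel a ξ *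
    (Real.exp (inner ℝ ξ x / (2 * a)) * Real.exp (-(‖x‖ ^ 2 / (4 * a)))) := by
  rw [heatKernel, heatKernel, div_mul_eq_mul_div, ← Real.exp_add, ← Real.exp_add,
    norm_sub_sq_real]
  congr 2
  ring

/-- A Gaussian majorant. -/
def gaussMajorant (k : ℕ) (ξ : Plane) : ℝ := Real.exp ((k + 2) * ‖ξ‖ - ‖ξ‖ ^ 2 / 4)

/-- The range of `a` contains the times `1 - e^{-n}` for integers `n ≥ 1`, and on it the Gaussians
have a common majorant. -/
lemma heatKernel_mul_exp_le (k : ℕ) {a : ℝ} (ha : a ∈ Icc (1 / 2 : ℝ) 1) (ξ : Plane) :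
    heatKernel a ξ * Real.exp ((k + 2) * ‖ξ‖) ≤ gaussMajorant k ξ := by
  have hpi := Real.pi_gt_three
  have ha0 : 0 < a := by linarith [ha.1]
  rw [heatKernel_eq, gaussMajorant, sub_eq_add_neg, Real.exp_add, mul_comm (Real.exp _) (Real.exp (-_))]
  refine mul_le_mul_of_nonneg_right ?_ (Real.exp_pos _).le
  have h1 : (4 * Real.pi * a)⁻¹ ≤ 1 := inv_le_one_of_one_le₀ (by nlinarith [ha.1])
  have h2 : (4⁻¹ : ℝ) ≤ (4 * a)⁻¹ := inv_anti₀ (by positivity) (by linarith [ha.2])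
  refine (mul_le_of_le_one_left (Real.exp_pos _).le h1).trans (Real.exp_le_exp.2 ?_)
  nlinarith [sq_nonneg ‖ξ‖]

/-- For `‖x‖ ≤ 1` the remainder is of order `‖x‖ ^ (k + 1)`; for `‖x‖ > 1` the Taylor polynomial is
of order `‖x‖ ^ k` and the kernel is kept apart. The exponent `k + θ` serves both regions, and for
`θ < 1` it is integrable against `L²(m)` when `m ≥ k + 2`. -/
lemma abs_heatKernel_sub_heatTaylor_le (k : ℕ) {θ : ℝ} (hθ : θ ∈ Icc (0 : ℝ) 1) {a : ℝ}
    (ha : a ∈ Icc (1 / 2 : ℝ) 1) (ξ x : Plane) :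
    |heatKernel a (ξ - x) - heatTaylor k a ξ x| ≤
      (k + 4) * gaussMajorant k ξ * ‖x‖ ^ (k + θ : ℝ) +
        {x : Plane | 1 < ‖x‖}.indicator (fun x => heatKernel a (ξ - x)) x := by
  have ha0 : 0 < a := by linarith [ha.1]
  have hG := heatKernel_nonneg ha0.le ξ
  have hα : |inner ℝ ξ x / (2 * a)| ≤ ‖ξ‖ * ‖x‖ := by
    rw [abs_div, abs_of_pos (by positivity : 0 < 2 * a)]
    exact (div_le_self (abs_nonneg _) (by linarith [ha.1])).trans (abs_real_inner_le_norm ξ x)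
  have hβ : 0 ≤ ‖x‖ ^ 2 / (4 * a) := by positivity
  have hβr : ‖x‖ ^ 2 / (4 * a) ≤ ‖x‖ ^ 2 := div_le_self (by positivity) (by linarith [ha.1])
  have hΓ := heatKernel_mul_exp_le k ha ξ
  have key : ∀ E n : ℝ, |E| ≤ (k + 4) * n * Real.exp ((k + 2) * ‖ξ‖) → 0 ≤ n →
      n ≤ ‖x‖ ^ (k + θ : ℝ) →
      |heatKernel a ξ * E| ≤ (k + 4) * gaussMajorant k ξ * ‖x‖ ^ (k + θ : ℝ) := by
    intro E n hE hn0 hn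
    rw [abs_mul, abs_of_nonneg hG]
    calc _ ≤ heatKernel a ξ * ((k + 4) * n * Real.exp ((k + 2) * ‖ξ‖)) := by gcongr
      _ = (k + 4) * (heatKernel a ξ * Real.exp ((k + 2) * ‖ξ‖)) * n := by ring
      _ ≤ _ := by
        have h1 : 0 ≤ gaussMajorant k ξ := (Real.exp_pos _).le
        gcongr
  by_cases hx : 1 < ‖x‖
  · rw [indicator_of_mem (by exact hx)]
    have h1 : |heatTaylor k a ξ x| ≤ (k + 4) * gaussMajorant k ξ * ‖x‖ ^ (k + θ : ℝ) := by
      refine key _ (‖x‖ ^ k) (abs_expTrunc_le k (norm_nonneg _) hx.le hα hβ hβr) (by positivity) ?_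
      rw [← Real.rpow_natCast]
      exact Real.rpow_le_rpow_of_exponent_le hx.le (by linarith [hθ.1])
    have h2 := heatKernel_nonneg ha0.le (ξ - x)
    refine (abs_sub _ _).trans ?_
    rw [abs_of_nonneg h2]
    linarith
  · rw [indicator_of_notMem (by exact hx), add_zero, heatKernel_sub, heatTaylor, ← mul_sub]
    rw [not_lt] at hx
    refine key _ (‖x‖ ^ (k + 1)) (abs_exp_sub_expTrunc_le k (norm_nonneg _) (norm_nonneg _) hx hα hβ
      hβr) (by positivity) ?_
    rcases (norm_nonneg x).eq_or_lt with h0 | h0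
    · rw [← h0, zero_pow (by omega)]
      positivity
    rw [← Real.rpow_natCast]
    refine Real.rpow_le_rpow_of_exponent_ge h0 hx ?_
    push_cast
    linarith [hθ.2]

end Expansion

/-! ### Functions with vanishing moments -/

section VanishingMoments

/-- Products with polynomials of a function whose moments of order at most `k` vanish. -/
def HasVanishingMoments (k : ℤ) (q : Plane → ℝ) : Prop :=
  ∀ p : ℕ × ℕ, ((p.1 + p.2 : ℕ) : ℤ) ≤ k →
    Integrable (fun η => mono p η * q η) ∧ ∫ η, mono p η * q η = 0

namespace HasVanishingMoments

variable {k : ℤ} {q q' : Plane → ℝ}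

lemma add (h : HasVanishingMoments k q) (h' : HasVanishingMoments k q') :
    HasVanishingMoments k fun η => q η + q' η := fun p hp => by
  simp only [mul_add]
  refine ⟨(h p hp).1.add (h' p hp).1, ?_⟩
  rw [integral_add (h p hp).1 (h' p hp).1, (h p hp).2, (h' p hp).2, add_zero]

lemma const_mul (h : HasVanishingMoments k q) (b : ℝ) :
    HasVanishingMoments k fun η => b * q η := fun p hp => by
  simp only [mul_left_comm _ b]
  refine ⟨(h p hp).1.const_mul b, ?_⟩
  rw [integral_const_mul, (h p hp).2, mul_zero]

/-- The order is an integer so that it may drop below zero, where the condition becomes empty. -/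
lemma coord_mul (h : HasVanishingMoments k q) (i : Fin 2) :
    HasVanishingMoments (k - 1) fun η => η i * q η := fun p hp => by
  fin_cases i
  · have h1 := h (p.1 + 1, p.2) (by push_cast at hp ⊢; linarith)
    have h2 : ∀ η, mono (p.1 + 1, p.2) η * q η = mono p η * (η 0 * q η) := fun η => by
      simp only [mono, pow_succ]
      ring
    simp only [h2] at h1
    exact h1
  · have h1 := h (p.1, p.2 + 1) (by push_cast at hp ⊢; linarith)
    have h2 : ∀ η, mono (p.1, p.2 + 1) η * q η = mono p η * (η 1 * q η) := fun η => by
      simp only [mono, pow_succ]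
      ring
    simp only [h2] at h1
    exact h1

lemma inner_mul (h : HasVanishingMoments k q) (ξ : Plane) :
    HasVanishingMoments (k - 1) fun η => inner ℝ ξ η * q η := by
  have h1 := ((h.coord_mul 0).const_mul (ξ 0)).add ((h.coord_mul 1).const_mul (ξ 1))
  have h2 : ∀ η : Plane, inner ℝ ξ η * q η = ξ 0 * (η 0 * q η) + ξ 1 * (η 1 * q η) := fun η => by
    rw [PiLp.inner_apply, Fin.sum_univ_two]
    simp only [RCLike.inner_apply, conj_trivial]
    ring
  simpa only [h2] using h1

lemma norm_sq_mul (h : HasVanishingMoments k q) :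
    HasVanishingMoments (k - 2) fun η => ‖η‖ ^ 2 * q η := by
  have h1 := ((h.coord_mul 0).coord_mul 0).add ((h.coord_mul 1).coord_mul 1)
  have h2 : ∀ η : Plane, ‖η‖ ^ 2 * q η = η 0 * (η 0 * q η) + η 1 * (η 1 * q η) := fun η => by
    rw [norm_sq_plane]
    ring
  rw [sub_sub, one_add_one_eq_two] at h1
  simpa only [h2] using h1

lemma inner_pow_mul (h : HasVanishingMoments k q) (ξ : Plane) (i : ℕ) :
    HasVanishingMoments (k - i) fun η => inner ℝ ξ η ^ i * q η := by
  induction i with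
  | zero => simpa using h
  | succ i ih =>
    have := ih.inner_mul ξ
    simp only [pow_succ', mul_assoc]
    convert this using 1
    push_cast
    ring

lemma norm_pow_mul (h : HasVanishingMoments k q) (l : ℕ) :
    HasVanishingMoments (k - 2 * l) fun η => (‖η‖ ^ 2) ^ l * q η := by
  induction l with
  | zero => simpa using h
  | succ l ih =>
    have := ih.norm_sq_mul
    simp only [pow_succ' _ l, mul_assoc]
    convert this using 1
    push_cast
    ring

lemma integral_eq_zero (h : HasVanishingMoments k q) (hk : 0 ≤ k) :
    Integrable q ∧ ∫ η, q η = 0 := by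
  simpa [mono] using h (0, 0) (by simpa using hk)

end HasVanishingMoments

/-- Each term of the Taylor polynomial has degree `i + 2 * l ≤ k` in `η`, so its integral is a
combination of vanishing moments. -/
lemma integral_heatTaylor_mul {k : ℕ} {q : Plane → ℝ} (h : HasVanishingMoments k q) (a c : ℝ)
    (ξ : Plane) : Integrable (fun η => heatTaylor k a ξ (c • η) * q η) ∧
      ∫ η, heatTaylor k a ξ (c • η) * q η = 0 := by
  have hterm : ∀ l ∈ Finset.range (k + 1), ∀ i ∈ Finset.range (k + 1 - 2 * l),
      Integrable (fun η : Plane => inner ℝ ξ η ^ i * ((‖η‖ ^ 2) ^ l * q η)) ∧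
        ∫ η, inner ℝ ξ η ^ i * ((‖η‖ ^ 2) ^ l * q η) = 0 := fun l _ i hi => by
    refine ((h.norm_pow_mul l).inner_pow_mul ξ i).integral_eq_zero ?_
    rw [Finset.mem_range] at hi
    omega
  have hexp : ∀ η : Plane, heatTaylor k a ξ (c • η) * q η = ∑ l ∈ Finset.range (k + 1),
      ∑ i ∈ Finset.range (k + 1 - 2 * l),
        (heatKernel a ξ * (-(c ^ 2 / (4 * a))) ^ l / l.factorial * (c / (2 * a)) ^ i /
          i.factorial) * (inner ℝ ξ η ^ i * ((‖η‖ ^ 2) ^ l * q η)) := fun η => by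
    rw [heatTaylor, expTrunc, Finset.mul_sum, Finset.sum_mul]
    refine Finset.sum_congr rfl fun l _ => ?_
    rw [Finset.mul_sum, Finset.mul_sum, Finset.sum_mul]
    refine Finset.sum_congr rfl fun i _ => ?_
    rw [inner_smul_right, norm_smul, mul_pow, Real.norm_eq_abs, sq_abs,
      show -(c ^ 2 * ‖η‖ ^ 2 / (4 * a)) = -(c ^ 2 / (4 * a)) * ‖η‖ ^ 2 by ring,
      show c * inner ℝ ξ η / (2 * a) = c / (2 * a) * inner ℝ ξ η by ring, mul_pow, mul_pow]
    ring
  have hint : ∀ l ∈ Finset.range (k + 1), ∀ i ∈ Finset.range (k + 1 - 2 * l),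
      Integrable fun η : Plane => (heatKernel a ξ * (-(c ^ 2 / (4 * a))) ^ l / l.factorial *
        (c / (2 * a)) ^ i / i.factorial) * (inner ℝ ξ η ^ i * ((‖η‖ ^ 2) ^ l * q η)) :=
    fun l hl i hi => (hterm l hl i hi).1.const_mul _
  simp only [hexp]
  refine ⟨integrable_finsetSum _ fun l hl => integrable_finsetSum _ (hint l hl), ?_⟩
  rw [integral_finsetSum _ fun l hl => integrable_finsetSum _ (hint l hl)]
  refine Finset.sum_eq_zero fun l hl => ?_
  rw [integral_finsetSum _ (hint l hl)]
  refine Finset.sum_eq_zero fun i hi => ?_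
  rw [integral_const_mul, (hterm l hl i hi).2, mul_zero]

end VanishingMoments

end

end Vorticity

namespace Vorticity

noncomputable section

/-! ### Decay on functions with vanishing moments -/

section Decay

lemma add_sq_le_four_mul (a b : ℝ≥0∞) : (a + b) ^ 2 ≤ 4 * (a ^ 2 + b ^ 2) := by
  have h1 : a + b ≤ 2 * max a b := by
    rw [two_mul]
    exact add_le_add (le_max_left _ _) (le_max_right _ _)
  calc (a + b) ^ 2 ≤ (2 * max a b) ^ 2 := pow_le_pow_left₀ zero_le h1 2
    _ = 4 * max a b ^ 2 := by rw [mul_pow]; norm_num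
    _ ≤ _ := by
      gcongr
      rcases max_cases a b with ⟨h, _⟩ | ⟨h, _⟩ <;> rw [h]
      · exact le_self_add
      · exact le_add_self

/-- The Gaussian beats both the weight and the linear exponential; completing the square costs the
constant `exp (8 * (k + 2) ^ 2)`. -/
lemma exists_lintegral_weight_mul_gaussMajorant_le (k : ℕ) {m : ℝ} (hm : 1 ≤ m) :
    ∃ K, 0 ≤ K ∧ ∫⁻ ξ, ENNReal.ofReal (weight m ξ) * ENNReal.ofReal (gaussMajorant k ξ) ^ 2 ≤
      ENNReal.ofReal K ^ 2 := by
  set D : ℝ := (m / 8⁻¹) ^ m * Real.exp (8 * (k + 2) ^ 2) with hD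
  have hD0 : 0 ≤ D := by positivity
  have hb : ∀ ξ : Plane, weight m ξ * gaussMajorant k ξ ^ 2 ≤ D * Real.exp (-4⁻¹ * ‖ξ‖ ^ 2) := by
    intro ξ
    have h1 := rpow_le_mul_exp hm (b := 8⁻¹) (by norm_num) (by norm_num) (sq_nonneg ‖ξ‖)
    rw [gaussMajorant, ← Real.exp_nat_mul]
    calc _ ≤ (m / 8⁻¹) ^ m * Real.exp (8⁻¹ * ‖ξ‖ ^ 2) *
          Real.exp ((2 : ℕ) * ((k + 2) * ‖ξ‖ - ‖ξ‖ ^ 2 / 4)) := by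
          gcongr
          exact h1
      _ = (m / 8⁻¹) ^ m * Real.exp (8⁻¹ * ‖ξ‖ ^ 2 +
          (2 : ℕ) * ((k + 2) * ‖ξ‖ - ‖ξ‖ ^ 2 / 4)) := by rw [mul_assoc, ← Real.exp_add]
      _ ≤ (m / 8⁻¹) ^ m * Real.exp (8 * (k + 2) ^ 2 + -4⁻¹ * ‖ξ‖ ^ 2) := by
          refine mul_le_mul_of_nonneg_left (Real.exp_le_exp.2 ?_) (by positivity)
          push_cast
          nlinarith [sq_nonneg (‖ξ‖ - 8 * (k + 2))]
      _ = _ := by rw [Real.exp_add, hD, mul_assoc]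
  have hint : Integrable fun ξ : Plane => D * Real.exp (-4⁻¹ * ‖ξ‖ ^ 2) := by
    have h1 := ((integrable_heatKernel (a := 1) one_pos).const_mul (4 * Real.pi)).const_mul D
    refine h1.congr (Eventually.of_forall fun ξ => ?_)
    simp only [heatKernel_eq, mul_one]
    rw [mul_inv_cancel_left₀ (by positivity)]
  have h0 : ∀ ξ : Plane, 0 ≤ D * Real.exp (-4⁻¹ * ‖ξ‖ ^ 2) := fun ξ => by positivity
  refine ⟨Real.sqrt (∫ ξ : Plane, D * Real.exp (-4⁻¹ * ‖ξ‖ ^ 2)), Real.sqrt_nonneg _, ?_⟩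
  rw [← ENNReal.ofReal_pow (Real.sqrt_nonneg _), Real.sq_sqrt (integral_nonneg h0),
    ofReal_integral_eq_lintegral_ofReal hint (Eventually.of_forall h0)]
  refine lintegral_mono fun ξ => ?_
  rw [← ENNReal.ofReal_pow (show 0 ≤ gaussMajorant k ξ from (Real.exp_pos _).le), ← ENNReal.ofReal_mul (weight_pos m ξ).le]
  exact ENNReal.ofReal_le_ofReal (hb ξ)

/-- Where `‖c • η‖ > 1` the base `1 + ‖c • η‖ ^ 2` is at most `2 * c ^ 2 * ‖η‖ ^ 2`, and the weight
gains the factor `c^{2m}`. -/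
lemma weight_smul_le_of_one_lt {m c : ℝ} (hm : 0 ≤ m) (hc : 0 < c) {η : Plane}
    (hη : 1 < ‖c • η‖) : weight m (c • η) ≤ 2 ^ m * (c ^ m) ^ 2 * weight m η := by
  have h2 : (c ^ m) ^ 2 = (c ^ 2) ^ m := by
    rw [← Real.rpow_natCast, ← Real.rpow_mul hc.le, mul_comm m, Real.rpow_mul hc.le,
      Real.rpow_natCast]
  rw [weight, weight, h2, ← Real.mul_rpow (by norm_num) (by positivity), ← Real.mul_rpow (by positivity) (base_pos η).le]
  refine Real.rpow_le_rpow (base_pos _).le ?_ hm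
  have h1 : ‖c • η‖ = c * ‖η‖ := by rw [norm_smul, Real.norm_of_nonneg hc.le]
  rw [h1] at hη ⊢
  nlinarith [sq_nonneg c]

/-- The contribution of the far region to the heat operator. -/
lemma lintegral_far_le {m : ℝ} (hm : 1 < m) : ∃ K, 0 ≤ K ∧ ∀ a ∈ Ioc (0 : ℝ) 2,
    ∀ c ∈ Ioc (0 : ℝ) 1, ∀ f : L2m m, ∫⁻ ξ, ENNReal.ofReal (weight m ξ) *
      (∫⁻ η, ENNReal.ofReal (heatKernel a (ξ - c • η)) *
        {η : Plane | 1 < ‖c • η‖}.indicator (fun η => ‖f η‖ₑ) η) ^ 2 ≤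
      (ENNReal.ofReal (K * c ^ (m - 1)) * ‖f‖ₑ) ^ 2 := by
  obtain ⟨C, hC, hb⟩ := exists_lintegral_weight_mul_heatKernel_le hm.le
  refine ⟨Real.sqrt (C * 2 ^ m), Real.sqrt_nonneg _, fun a ha c hc f => ?_⟩
  have hc0 := hc.1
  have hset : MeasurableSet {η : Plane | 1 < ‖c • η‖} :=
    measurableSet_lt measurable_const (by fun_prop)
  -- Schur's test needs the weighted bound only where the function is nonzero, that is in the far
  -- region. There the gain `c^{2m}` meets the loss `c⁻²` of the other bound, and the root is
  -- `c^{m-1}`.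
  refine (lintegral_kernel_sq_le (B := ENNReal.ofReal (C * (2 ^ m * (c ^ m) ^ 2)))
    (measurable_heatKernel_smul a c) ((measurable_L2m f).enorm.indicator hset)
    (measurable_weight m) (measurable_weight m)
    (fun ξ => (lintegral_heatKernel_smul ha.1 hc0 ξ).le) fun η hη => ?_).trans ?_
  · have hη' : 1 < ‖c • η‖ := by
      by_contra h
      exact hη (indicator_of_notMem (by exact h) _)
    refine (hb a ha (c • η)).trans ?_
    rw [← ENNReal.ofReal_mul hC, ← ENNReal.ofReal_mul (by positivity), mul_assoc]
    exact ENNReal.ofReal_le_ofReal (mul_le_mul_of_nonneg_left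
      (weight_smul_le_of_one_lt (by linarith) hc0 hη') hC)
  · calc _ ≤ ENNReal.ofReal (c ^ 2)⁻¹ * (ENNReal.ofReal (C * (2 ^ m * (c ^ m) ^ 2)) *
          ∫⁻ η, ENNReal.ofReal (weight m η) * ‖f η‖ₑ ^ 2) := by
          gcongr with η
          exact indicator_le_self _ _ η
      _ = _ := by
          rw [← enorm_sq_L2m, mul_pow, ← ENNReal.ofReal_pow (by positivity), mul_pow,
            Real.sq_sqrt (by positivity), ← mul_assoc, ← ENNReal.ofReal_mul (by positivity),
            Real.rpow_sub_one hc0.ne']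
          congr 2
          field_simp

/-- Decay of the heat operators on functions with vanishing moments. -/
theorem exists_decay {k : ℕ} {m θ : ℝ} (hm : (k : ℝ) + 2 ≤ m) (hθ : θ ∈ Ico (0 : ℝ) 1) :
    ∃ K, 0 ≤ K ∧ ∀ a ∈ Icc (1 / 2 : ℝ) 1, ∀ c ∈ Ioc (0 : ℝ) 1, ∀ f u : L2m m,
      (∀ p ∈ multiIndices k, ∫ η, mono p η * f η = 0) →
      (∀ᵐ ξ, u ξ = ∫ η, heatKernel a (ξ - c • η) * f η) → ‖u‖ ≤ K * c ^ (k + θ) * ‖f‖ := by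
  have hk0 : (0 : ℝ) ≤ k := Nat.cast_nonneg k
  have hm1 : 1 < m := by linarith
  have hkθ : 0 ≤ (k : ℝ) + θ := by linarith [hθ.1]
  obtain ⟨K₁, hK₁, h₁⟩ := exists_lintegral_weight_mul_gaussMajorant_le k hm1.le
  -- This needs `k + θ + 1 < m`, which is where `θ < 1` enters.
  obtain ⟨K₂, hK₂, h₂⟩ := exists_lintegral_weight_mul_le (m := m) (s := ((k : ℝ) + θ) / 2)
    (by linarith [hθ.2])
  obtain ⟨K₃, hK₃, h₃⟩ := lintegral_far_le hm1
  refine ⟨2 * ((k + 4) * K₁ * K₂ + K₃), by positivity, fun a ha c hc f u hf hu => ?_⟩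
  have hc0 := hc.1
  have ha0 : 0 < a := by linarith [ha.1]
  have hvan : HasVanishingMoments k f := fun p hp => by
    have hp' : p.1 + p.2 ≤ k := by exact_mod_cast hp
    refine ⟨integrable_mono_mul ?_ f, hf p (mem_multiIndices.2 hp')⟩
    have : ((p.1 + p.2 : ℕ) : ℝ) ≤ k := by exact_mod_cast hp'
    linarith
  set N : ℝ≥0∞ := ENNReal.ofReal ((k + 4) * c ^ (k + θ) * K₂) * ‖f‖ₑ with hN
  set far : Plane → ℝ≥0∞ := fun ξ => ∫⁻ η, ENNReal.ofReal (heatKernel a (ξ - c • η)) *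
    {η : Plane | 1 < ‖c • η‖}.indicator (fun η => ‖f η‖ₑ) η with hfar
  have hpt : ∀ ξ, ‖∫ η, heatKernel a (ξ - c • η) * f η‖ₑ ≤
      ENNReal.ofReal (gaussMajorant k ξ) * N + far ξ := by
    intro ξ
    have hT := integral_heatTaylor_mul hvan a c ξ
    -- The moments of `f` vanish, so the Taylor polynomial may be subtracted from the kernel.
    have e1 : ∫ η, heatKernel a (ξ - c • η) * f η =
        ∫ η, (heatKernel a (ξ - c • η) - heatTaylor k a ξ (c • η)) * f η := by
      simp only [sub_mul]
      rw [integral_sub (integrable_heatKernel_smul_mul ha0 c ξ (integrable_L2m hm1 f)) hT.1, hT.2,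
        sub_zero]
    rw [e1]
    have hΓ : 0 ≤ gaussMajorant k ξ := (Real.exp_pos _).le
    obtain ⟨Q, hQ⟩ : ∃ Q : ℝ, Q = (k + 4) * c ^ (k + θ) := ⟨_, rfl⟩
    have hQ0 : 0 ≤ Q := by rw [hQ]; positivity
    refine (enorm_integral_mul_le (k' := fun η =>
      ENNReal.ofReal (gaussMajorant k ξ * Q) *
        ENNReal.ofReal (weight ((k + θ) / 2) η) + {η : Plane | 1 < ‖c • η‖}.indicator
          (fun η => ENNReal.ofReal (heatKernel a (ξ - c • η))) η) fun η => ?_).trans ?_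
    · have h1 := abs_heatKernel_sub_heatTaylor_le k ⟨hθ.1, hθ.2.le⟩ ha ξ (c • η)
      rw [← ofReal_norm, Real.norm_eq_abs]
      refine (ENNReal.ofReal_le_ofReal h1).trans (ENNReal.ofReal_add_le.trans (add_le_add ?_ ?_))
      · rw [← ENNReal.ofReal_mul (by positivity)]
        refine ENNReal.ofReal_le_ofReal ?_
        have h2 : ‖c • η‖ ^ (k + θ : ℝ) ≤ c ^ (k + θ) * weight ((k + θ) / 2) η := by
          rw [norm_smul, Real.norm_of_nonneg hc0.le, Real.mul_rpow hc0.le (norm_nonneg _)]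
          refine mul_le_mul_of_nonneg_left ?_ (by positivity)
          rw [weight, show ‖η‖ ^ (k + θ : ℝ) = (‖η‖ ^ 2) ^ ((k + θ) / 2 : ℝ) by
            rw [← Real.rpow_natCast ‖η‖ 2, ← Real.rpow_mul (norm_nonneg _), Nat.cast_ofNat,
              mul_div_cancel₀ _ (two_ne_zero)]]
          exact Real.rpow_le_rpow (by positivity) (by linarith) (by positivity)
        calc _ ≤ (k + 4) * gaussMajorant k ξ * (c ^ (k + θ) * weight ((k + θ) / 2) η) := by gcongr
          _ = _ := by rw [hQ]; ring
      · by_cases hη : 1 < ‖c • η‖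
        · rw [indicator_of_mem (by exact hη), indicator_of_mem (by exact hη)]
        · rw [indicator_of_notMem (by exact hη), indicator_of_notMem (by exact hη),
            ENNReal.ofReal_zero]
    · simp only [add_mul]
      have hmeas : Measurable fun η : Plane => ENNReal.ofReal (gaussMajorant k ξ * Q) *
          ENNReal.ofReal (weight ((k + θ) / 2) η) * ‖f η‖ₑ :=
        (measurable_const.mul (measurable_weight _)).mul (measurable_L2m f).enorm
      rw [lintegral_add_left hmeas]
      refine add_le_add ?_ (le_of_eq (lintegral_congr fun η => ?_))
      · simp only [mul_assoc]
        rw [lintegral_const_mul' _ _ ENNReal.ofReal_ne_top]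
        refine (mul_le_mul_right (h₂ f) _).trans (le_of_eq ?_)
        rw [hN, ← mul_assoc, ← mul_assoc, ← ENNReal.ofReal_mul (by positivity),
          ← ENNReal.ofReal_mul hΓ, hQ]
        congr 2
        ring
      · simp only [indicator]
        split_ifs <;> simp
  have hfar2 : ∫⁻ ξ, ENNReal.ofReal (weight m ξ) * far ξ ^ 2 ≤
      (ENNReal.ofReal (K₃ * c ^ (k + θ)) * ‖f‖ₑ) ^ 2 := by
    refine (h₃ a ⟨ha0, by linarith [ha.2]⟩ c hc f).trans ?_
    gcongr ?_ ^ 2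
    refine mul_le_mul_left (ENNReal.ofReal_le_ofReal (mul_le_mul_of_nonneg_left ?_ hK₃)) _
    -- Since `m - 1 ≥ k + 1 > k + θ`, the far region decays faster than required.
    exact Real.rpow_le_rpow_of_exponent_ge hc0 hc.2 (by linarith [hθ.2])
  have hnear : ∫⁻ ξ, ENNReal.ofReal (weight m ξ) * (ENNReal.ofReal (gaussMajorant k ξ) * N) ^ 2 ≤
      (ENNReal.ofReal ((k + 4) * K₁ * K₂ * c ^ (k + θ)) * ‖f‖ₑ) ^ 2 := by
    have hmeas : Measurable fun ξ : Plane => ENNReal.ofReal (weight m ξ) *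
        ENNReal.ofReal (gaussMajorant k ξ) ^ 2 := by
      refine (measurable_weight m).mul (Measurable.pow_const ?_ 2)
      unfold gaussMajorant
      fun_prop
    simp only [mul_pow, ← mul_assoc]
    rw [lintegral_mul_const _ hmeas]
    refine (mul_le_mul_left h₁ _).trans (le_of_eq ?_)
    rw [← mul_pow, ← mul_pow, hN, ← mul_assoc, ← ENNReal.ofReal_mul hK₁]
    congr 3
    ring
  refine norm_le_of_ae_eq hu (by positivity) ?_
  have hadd : ∀ x y : ℝ, 0 ≤ x → 0 ≤ y → 4 * ((ENNReal.ofReal x * ‖f‖ₑ) ^ 2 +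
      (ENNReal.ofReal y * ‖f‖ₑ) ^ 2) ≤ ENNReal.ofReal (2 * (x + y) * ‖f‖) ^ 2 := fun x y hx hy => by
    rw [ofReal_mul_enorm hx, ofReal_mul_enorm hy, ← ENNReal.ofReal_pow (by positivity),
      ← ENNReal.ofReal_pow (by positivity), ← ENNReal.ofReal_pow (by positivity),
      ← ENNReal.ofReal_add (by positivity) (by positivity),
      show (4 : ℝ≥0∞) = ENNReal.ofReal 4 by norm_num, ← ENNReal.ofReal_mul (by norm_num)]
    refine ENNReal.ofReal_le_ofReal ?_
    have : 0 ≤ x * y * ‖f‖ ^ 2 := by positivity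
    nlinarith
  calc _ ≤ ∫⁻ ξ, 4 * (ENNReal.ofReal (weight m ξ) * (ENNReal.ofReal (gaussMajorant k ξ) * N) ^ 2 +
        ENNReal.ofReal (weight m ξ) * far ξ ^ 2) := by
        refine lintegral_mono fun ξ => ?_
        rw [← mul_add, mul_left_comm]
        exact mul_le_mul_right ((pow_le_pow_left₀ zero_le (hpt ξ) 2).trans
          (add_sq_le_four_mul _ _)) _
    _ = 4 * ((∫⁻ ξ, ENNReal.ofReal (weight m ξ) * (ENNReal.ofReal (gaussMajorant k ξ) * N) ^ 2) +
        ∫⁻ ξ, ENNReal.ofReal (weight m ξ) * far ξ ^ 2) := by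
        have hmeas : Measurable fun ξ : Plane => ENNReal.ofReal (weight m ξ) *
            (ENNReal.ofReal (gaussMajorant k ξ) * N) ^ 2 := by
          refine (measurable_weight m).mul (Measurable.pow_const (Measurable.mul_const ?_ _) 2)
          unfold gaussMajorant
          fun_prop
        rw [lintegral_const_mul' _ _ (by norm_num), lintegral_add_left hmeas]
    _ ≤ _ := (mul_le_mul_right (add_le_add hnear hfar2) _).trans
        (hadd _ _ (by positivity) (by positivity))
    _ = _ := by
        congr 2
        ring

end Decay

end

end Vorticity

namespace Vorticity

noncomputable section

/-! ### Spectral splitting of the time-one operator -/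

section Spectrum

variable {m : ℝ} {S : ℝ → L2m m →L[ℝ] L2m m} {C : ℝ}

lemma IsHeatSemigroup.pow_apply (h : IsHeatSemigroup S C) (hm : 1 < m) (n : ℕ) (f : L2m m) :
    (S 1 ^ n) f = S n f := by
  induction n with
  | zero => simp [h.zero]
  | succ n ih =>
    rw [clm_pow_succ_apply, ih, ← h.add hm zero_le_one (Nat.cast_nonneg n), add_comm]
    push_cast
    rfl

lemma exp_neg_div_two_pow (j : ℕ) : Real.exp (-1 / 2) ^ j = Real.exp (-(j : ℝ) / 2) := by
  rw [← Real.exp_nat_mul]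
  congr 1
  ring

lemma nodalPoly_exp (k : ℕ) :
    nodalPoly ((Finset.range (k + 1)).image fun j : ℕ => Real.exp (-(j : ℝ) / 2)) =
      ∏ j ∈ Finset.range (k + 1),
        (Polynomial.X - Polynomial.C (Real.exp (-1 / 2) ^ j)) := by
  rw [nodalPoly, Finset.prod_image]
  · simp only [exp_neg_div_two_pow]
  · intro i _ j _ hij
    have h1 := Real.exp_injective hij
    have h2 : (i : ℝ) = j := by linarith
    exact_mod_cast h2

/-- The spectral splitting of `e^L` on `L²(m)`. -/
theorem IsHeatSemigroup.exists_expSplitting (h : IsHeatSemigroup S C) {k : ℕ}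
    (hm : (k : ℝ) + 2 ≤ m) {ν : ℝ} (hν : ν ∈ Ioo ((k : ℝ) / 2) (((k : ℝ) + 1) / 2)) :
    ∃ (P J : L2m m →L[ℝ] L2m m) (C' : ℝ), 0 ≤ C' ∧ IsSpectralProjection (S 1)
        ((Finset.range (k + 1)).image fun j : ℕ => Real.exp (-(j : ℝ) / 2)) P ∧
      FiniteDimensional ℝ (LinearMap.range P.toLinearMap) ∧
      ExpSplitting (S 1) P J C' (Real.exp (k / 2)) (Real.exp (-ν)) := by
  have hk0 : (0 : ℝ) ≤ k := Nat.cast_nonneg k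
  have hm1 : 1 < m := by linarith
  obtain ⟨M, hM⟩ := exists_momentMap (k := k) (m := m) (by linarith)
  -- With `c = e^{-n/2}` the decay `c ^ (k + θ)` becomes `e^{-νn}` for `θ = 2ν - k`, which lies in
  -- `(0, 1)`.
  obtain ⟨K, hK, hdec⟩ := exists_decay (θ := 2 * ν - k) hm ⟨by linarith [hν.1], by linarith [hν.2]⟩
  -- This places the kernel time `1 - e^{-n}` in `[1/2, 1]` for `n ≥ 1`, as the decay estimate
  -- requires; `n = 0` is treated separately.
  have hexp1 : Real.exp (-1) ≤ 1 / 2 := by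
    rw [Real.exp_neg, one_div]
    exact inv_anti₀ two_pos (by linarith [Real.exp_one_gt_d9])
  have hΛ : ∀ (p : multiIndices k) x,
      (∀ q : multiIndices k, q.1.1 + q.1.2 < p.1.1 + p.1.2 → M x q = 0) →
      M (S 1 x) p = Real.exp (-1 / 2) ^ (p.1.1 + p.1.2) * M x p := fun p x hx => by
    have hp := mem_multiIndices.1 p.2
    have hp' : ((p.1.1 + p.1.2 : ℕ) : ℝ) ≤ k := by exact_mod_cast hp
    have h1 := one_sub_exp_mem one_pos
    rw [hM, hM, ← integral_mono_mul_heatOperator_of_eq_zero (a := 1 - Real.exp (-1)) (by linarith)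
      ⟨h1.1, by linarith [h1.2]⟩ (exp_half_mem zero_le_one) fun q hq => by
        rw [← hx ⟨q, mem_multiIndices.2 (hq.le.trans hp)⟩ hq, hM]]
    refine integral_congr_ae ?_
    filter_upwards [h.apply 1 one_pos x] with ξ hξ
    rw [hξ]
  refine exists_spectralProjection M (C := K + 1) (Real.exp_pos _).le (fun l hl => ?_)
    (Real.exp_pos _).le (fun l hl => ?_) (fun x hx => ?_) (fun n x hx => ?_) fun x => ?_
  · obtain ⟨j, hj, rfl⟩ := Finset.mem_image.1 hl
    have hj' : (j : ℝ) ≤ k := by exact_mod_cast Nat.lt_succ_iff.1 (Finset.mem_range.1 hj)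
    exact Real.exp_lt_exp.2 (by linarith [hν.1])
  · obtain ⟨j, hj, rfl⟩ := Finset.mem_image.1 hl
    have hj' : (j : ℝ) ≤ k := by exact_mod_cast Nat.lt_succ_iff.1 (Finset.mem_range.1 hj)
    rw [← Real.exp_neg]
    exact Real.exp_le_exp.2 (by linarith)
  · funext p
    rw [hΛ p x fun q _ => by rw [hx]; rfl, hx, Pi.zero_apply, mul_zero]
  · rcases Nat.eq_zero_or_pos n with rfl | hn
    · simp only [pow_zero, mul_one]
      exact le_mul_of_one_le_left (norm_nonneg _) (by linarith)
    have hn' : (1 : ℝ) ≤ n := by exact_mod_cast hn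
    have h2 : Real.exp (-(n : ℝ)) ≤ Real.exp (-1) := Real.exp_le_exp.2 (by linarith)
    rw [h.pow_apply hm1]
    have h1 := hdec (1 - Real.exp (-(n : ℝ))) ⟨by linarith, by linarith [Real.exp_pos (-(n : ℝ))]⟩
      (Real.exp (-(n : ℝ) / 2)) (exp_half_mem (by linarith)) x (S n x)
      (fun p hp => by rw [← hM x ⟨p, hp⟩, hx]; rfl) (h.apply n (by linarith) x)
    refine h1.trans (mul_le_mul_of_nonneg_right ?_ (norm_nonneg _))
    rw [← Real.exp_mul, ← Real.exp_nat_mul, show -(n : ℝ) / 2 * (k + (2 * ν - k)) = n * -ν by ring]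
    exact mul_le_mul_of_nonneg_right (by linarith) (Real.exp_pos _).le
  · rw [nodalPoly_exp]
    exact moments_aeval_eq_zero hΛ x

end Spectrum

/-! ### Identification of mild solutions with the abstract equation -/

section MildSolution

variable {m : ℝ} {S : ℝ → L2m m →L[ℝ] L2m m} {C : ℝ} {B : ℝ → L2m m →L[ℝ] L2m m →L[ℝ] L2m m}

lemma divSemigroup_cutoffFlux (hm : 1 < m)
    (hB : ∀ t, 0 < t → ∀ f g, ∀ᵐ ξ, B t f g ξ = Real.exp (-t / 2) * ∑ i,
        ∫ η, gradKernel (1 - Real.exp (-t)) i (ξ - Real.exp (-t / 2) • η) *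
          (f η * biotSavart g η i))
    (χ : L2m m → ℝ) (r : ℝ) {t : ℝ} (ht : 0 < t) (w : L2m m) :
    ∀ᵐ ξ, Real.exp (-t / 2) * divSemigroup t (cutoffFlux χ r w) ξ =
      (χ (r⁻¹ • w) • B t w w : L2m m) ξ := by
  have hflux : ∀ (i : Fin 2) (η : Plane),
      cutoffFlux χ r w η i = χ (r⁻¹ • w) * (w η * biotSavart w η i) := fun i η => by
    rw [cutoffFlux, PiLp.smul_apply, smul_eq_mul, mul_assoc]
  have hint : ∀ i : Fin 2, Integrable fun η => cutoffFlux χ r w η i := fun i => by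
    simp only [hflux]
    exact (integrable_mul_biotSavart hm w w i).const_mul _
  filter_upwards [hB t ht w w, coeFn_smul_L2m (χ (r⁻¹ • w)) (B t w w)] with ξ h1 h2
  rw [h2, h1, divSemigroup_eq ht hint, mul_left_comm, Finset.mul_sum (a := χ (r⁻¹ • w))]
  refine congrArg _ (Finset.sum_congr rfl fun i _ => ?_)
  rw [← integral_const_mul]
  refine integral_congr_ae (Eventually.of_forall fun η => ?_)
  simp only [hflux]
  ring

lemma IsHeatSemigroup.apply_eq_semigroup (h : IsHeatSemigroup S C) {τ : ℝ} (hτ : 0 ≤ τ)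
    (f : L2m m) : ∀ᵐ ξ, S τ f ξ = semigroup τ f ξ := by
  rcases hτ.eq_or_lt with rfl | hτ
  · refine Eventually.of_forall fun ξ => ?_
    rw [h.zero, semigroup, if_pos rfl]
  · filter_upwards [h.apply τ hτ f] with ξ hξ
    rw [hξ, semigroup_eq hτ]

/-- Mild solutions are the solutions of the integral equation in `L²(m)`. -/
lemma IsHeatSemigroup.isMildSolution_iff (h : IsHeatSemigroup S C) (hm : 1 < m)
    (hB : ∀ t, 0 < t → ∀ f g, ∀ᵐ ξ, B t f g ξ = Real.exp (-t / 2) * ∑ i,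
        ∫ η, gradKernel (1 - Real.exp (-t)) i (ξ - Real.exp (-t / 2) • η) *
          (f η * biotSavart g η i))
    {χ : L2m m → ℝ} {r : ℝ} (hint : ∀ w : ℝ → L2m m, ContinuousOn w (Ici 0) → ∀ τ, 0 ≤ τ →
      IntervalIntegrable (fun s => χ (r⁻¹ • w s) • B (τ - s) (w s) (w s)) volume 0 τ)
    {w₀ : L2m m} {w : ℝ → L2m m} :
    IsMildSolution χ r w₀ w ↔ ContinuousOn w (Ici 0) ∧ ∀ τ, 0 ≤ τ →
      w τ + ∫ s in 0..τ, χ (r⁻¹ • w s) • B (τ - s) (w s) (w s) = S τ w₀ := by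
  refine and_congr_right fun hw => forall₂_congr fun τ hτ => ⟨?_, fun heq => ?_⟩
  · rintro ⟨G, hG, -, heq⟩
    have hGe : ∀ s ∈ Ico 0 τ, G s = χ (r⁻¹ • w s) • B (τ - s) (w s) (w s) := fun s hs => by
      refine ext_L2m ?_
      filter_upwards [hG s hs, divSemigroup_cutoffFlux hm hB χ r (sub_pos.2 hs.2) (w s)]
        with ξ h1 h2
      rw [h1, h2]
    have hI : ∫ s in 0..τ, G s = ∫ s in 0..τ, χ (r⁻¹ • w s) • B (τ - s) (w s) (w s) := by
      refine intervalIntegral.integral_congr_ae ?_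
      -- The values of `G` are prescribed on `[0, τ)` while the integral runs over `(0, τ]`; the
      -- endpoint `τ` is a null set.
      filter_upwards [compl_mem_ae_iff.2 (measure_singleton (μ := volume) τ)] with s hs hs'
      rw [uIoc_of_le hτ] at hs'
      exact hGe s ⟨hs'.1.le, lt_of_le_of_ne hs'.2 hs⟩
    rw [← hI]
    refine ext_L2m ?_
    filter_upwards [heq, h.apply_eq_semigroup hτ w₀] with ξ h1 h2
    rw [h1, h2]
  · refine ⟨_, fun s hs => ?_, hint w hw τ hτ, ?_⟩
    · filter_upwards [divSemigroup_cutoffFlux hm hB χ r (sub_pos.2 hs.2) (w s)] with ξ h2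
      rw [h2]
    · rw [heq]
      exact h.apply_eq_semigroup hτ w₀

end MildSolution

end

end Vorticity

/-! ### Assembly of the theorem -/

theorem mainTheorem1 (k : ℕ) (m : ℝ) (hm : (k : ℝ) + 2 ≤ m)
    (μ₁ μ₂ : ℝ) (hμ₁ : (k : ℝ) / 2 < μ₁) (hμ : μ₁ < μ₂) (hμ₂ : μ₂ < ((k : ℝ) + 1) / 2)
    (χ : Vorticity.L2m m → ℝ) (hχ : ContDiff ℝ ∞ χ)
    (hχ_bdd : ∃ C : ℝ, ∀ w, |χ w| ≤ C ∧ ‖fderiv ℝ χ w‖ ≤ C)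
    (hχ_one : ∀ w, ‖w‖ ≤ 1 → χ w = 1) (hχ_zero : ∀ w, 2 ≤ ‖w‖ → χ w = 0) :
    ∃ Λ P : Vorticity.L2m m →L[ℝ] Vorticity.L2m m,
      -- `Λ = e^L`, and `P` is its spectral projection for the eigenvalues `1, …, e^{-k/2}`
      (∀ f : Vorticity.L2m m, ∀ᵐ ξ : Vorticity.Plane, Λ f ξ = Vorticity.semigroup 1 f ξ) ∧
      Vorticity.IsSpectralProjection Λ
        ((Finset.range (k + 1)).image fun j : ℕ => Real.exp (-(j : ℝ) / 2)) P ∧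
      FiniteDimensional ℝ (LinearMap.range P.toLinearMap) ∧
      ∃ rbar : ℝ, 0 < rbar ∧ ∀ r₀ : ℝ, 0 < r₀ → r₀ ≤ rbar →
        ∃ Φ : ℝ → Vorticity.L2m m → Vorticity.L2m m,
          Vorticity.IsSolutionSemiflow χ r₀ Φ ∧
          ∃ g : LinearMap.range P.toLinearMap → LinearMap.ker P.toLinearMap,
            ContDiff ℝ 1 g ∧ (∃ K : ℝ≥0, LipschitzWith K g) ∧ g 0 = 0 ∧ fderiv ℝ g 0 = 0 ∧
            -- invariance: the semiflow restricted to `W_c` extends to a Lipschitz flow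
            (∃ Ψ : ℝ → Vorticity.graphManifold g → Vorticity.graphManifold g,
              (∀ w, Ψ 0 w = w) ∧ (∀ s t w, Ψ (s + t) w = Ψ s (Ψ t w)) ∧
              Continuous (fun p : ℝ × Vorticity.graphManifold g => Ψ p.1 p.2) ∧
              (∀ T : ℝ, ∃ K : ℝ≥0, ∀ τ, |τ| ≤ T → LipschitzWith K (Ψ τ)) ∧
              ∀ τ, 0 ≤ τ → ∀ w, (Ψ τ w : Vorticity.L2m m) = Φ τ w) ∧
            (∀ τ, 0 ≤ τ → Φ τ '' Vorticity.graphManifold g = Vorticity.graphManifold g) ∧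
            (∀ w₀ ∈ Vorticity.graphManifold g, ∃ w : ℝ → Vorticity.L2m m,
              (Vorticity.IsNegSemiorbit Φ w ∧ (∀ τ ≤ 0, w τ ∈ Vorticity.graphManifold g) ∧
                w 0 = w₀) ∧
              ∀ w' : ℝ → Vorticity.L2m m, Vorticity.IsNegSemiorbit Φ w' →
                (∀ τ ≤ 0, w' τ ∈ Vorticity.graphManifold g) → w' 0 = w₀ →
                ∀ τ ≤ 0, w' τ = w τ) ∧
            -- characterization of `W_c` by backward growth rates
            (∀ w : ℝ → Vorticity.L2m m, Vorticity.IsNegSemiorbit Φ w →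
              (∀ τ ≤ 0, w τ ∈ Vorticity.graphManifold g) →
              Vorticity.expRate w atBot ≤ (μ₁ : EReal)) ∧
            (∀ w : ℝ → Vorticity.L2m m, Vorticity.IsNegSemiorbit Φ w →
              Vorticity.expRate w atBot ≤ (μ₂ : EReal) →
              ∀ τ ≤ 0, w τ ∈ Vorticity.graphManifold g) ∧
            -- invariant foliation
            ∃ h : Vorticity.L2m m × LinearMap.ker P.toLinearMap → LinearMap.range P.toLinearMap,
              Continuous h ∧
              (∀ w, ContDiff ℝ 1 fun ws => h (w, ws)) ∧
              (∀ w, ∀ ws : LinearMap.ker P.toLinearMap, (ws : Vorticity.L2m m) = w - P w →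
                (h (w, ws) : Vorticity.L2m m) = P w) ∧
              (∀ τ, 0 ≤ τ → ∀ w,
                Φ τ '' Vorticity.leaf h w ⊆ Vorticity.leaf h (Φ τ w)) ∧
              (∀ w, Vorticity.leaf h w =
                {w' | Vorticity.expRate (fun τ => Φ τ w' - Φ τ w) atTop ≤ ((-μ₂ : ℝ) : EReal)}) ∧
              -- completeness
              (∀ w, ∃! x, x ∈ Vorticity.leaf h w ∩ Vorticity.graphManifold g) ∧
              (∀ x, ∃! w, w ∈ Vorticity.graphManifold g ∧ x ∈ Vorticity.leaf h w) := by
  have hk0 : (0 : ℝ) ≤ k := Nat.cast_nonneg k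
  have hm1 : 1 < m := by linarith
  obtain ⟨S, C, -, hS⟩ := Vorticity.exists_isHeatSemigroup hm1
  -- `ν` is the decay rate on `ker P`; being above `μ₂` it gives `e^{-ν} e^{μ₂} < 1`. On the range
  -- of `P` the inverse grows at most like `e^{k/2}`, slower than `e^{μ₁}`.
  obtain ⟨ν, hν₁, hν₂⟩ := exists_between hμ₂
  obtain ⟨P, J, C', hC', hP, hfin, hsplit⟩ :=
    hS.exists_expSplitting hm (ν := ν) ⟨by linarith, hν₂⟩
  obtain ⟨δ, hδ, hmain⟩ := Vorticity.exists_graph_and_foliation (μ₁ := μ₁) (μ₂ := μ₂) hsplit hC'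
    (by linarith) hμ (Real.exp_lt_exp.2 hμ₁)
    (by rw [← Real.exp_add]; exact Real.exp_lt_one_iff.2 (by linarith))
  obtain ⟨B, c, c', hSB, hB⟩ := hS.exists_smoothingBilinear hm1
  obtain ⟨rbar, hrbar, hr⟩ := hSB.exists_cutoff_semiflow (hχ.of_le (by norm_num)) hχ_bdd hχ_zero hδ
  refine ⟨S 1, P, hS.apply_eq_semigroup zero_le_one, hP, hfin, rbar, hrbar, fun r₀ h0 h1 => ?_⟩
  obtain ⟨Φ, hΦ, hsol, huniq, hint, hsmooth, hsmall, hderiv⟩ := hr r₀ h0 h1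
  have hcont : ∀ w₀, ContinuousOn (fun τ => Φ τ w₀) (Ici 0) := fun w₀ =>
    hΦ.continuousOn.comp (f := fun τ => (τ, w₀)) (by fun_prop) fun τ hτ => ⟨hτ, mem_univ _⟩
  exact ⟨Φ, ⟨fun w₀ => (hS.isMildSolution_iff hm1 hB hint).2 ⟨hcont w₀, hsol w₀⟩,
    fun w₀ w hw => huniq w₀ w ((hS.isMildSolution_iff hm1 hB hint).1 hw).1
      ((hS.isMildSolution_iff hm1 hB hint).1 hw).2, hΦ.zero, hΦ.add, hΦ.continuousOn⟩,
    hmain Φ hΦ hsmooth hsmall hderiv⟩
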